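/- All trees are finite, rooted and ordered (plane); $|T|$ is the number of nodes of $T$, and for a node $v\in T$, $T_v$ is the subtree of $T$ consisting of $v$ and all its descendants. Let $\xi$ be a nonnegative integer-valued random variable with $\mathbb E\,\xi=1$ and $0<\sigma^2:=\operatorname{Var}\xi<\infty$. Let $\mathcal T$ be the Galton–Watson tree with offspring distribution $\xi$ (almost surely finite), and, for each $n$ with $\mathbb P(|\mathcal T|=n)>0$, let $\mathcal T_n$ be $\mathcal T$ conditioned on $|\mathcal T|=n$; all limits and sums over $n$ below are over such $n$. Let $f$ be a real-valued function on the set of finite rooted ordered trees with $\mathbb E|f(\mathcal T)|<\infty$, let $\mu:=\mathbb E f(\mathcal T)$, and let $F(T):=\sum_{v\in T} f(T_v)$. (i) If $\mathbb E f(\mathcal T_n)\to 0$ as $n\to\infty$, then $\mathbb E F(\mathcal T_n)=n\mu+o(\sqrt n)$. (ii) If $\mathbb E\big[f(\mathcal T_n)^2\big]\to0$ as $n\to\infty$ and $$\sum_{n}\frac{\sqrt{\mathbb E[f(\mathcal T_n)^2]}}{n}<\infty,$$ then $\mathbb E[f(\mathcal T)^2]<\infty$ and $\mathbb E\big|f(\mathcal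 T)\big(F(\mathcal T)-|\mathcal T|\mu\big)\big|<\infty$, so that $$\gamma^2:=2\,\mathbb E\Big[f(\mathcal T)\big(F(\mathcal T)-|\mathcal T|\mu\big)\Big]-\operatorname{Var} f(\mathcal T)-\frac{\mu^2}{\sigma^2}$$ is well defined and finite; moreover $\gamma^2\ge 0$, $$\operatorname{Var}F(\mathcal T_n)=n\gamma^2+o(n),\qquad \frac{F(\mathcal T_n)-n\mu}{\sqrt n}\ \xrightarrow{\ d\ }\ N(0,\gamma^2)\quad\text{as } n\to\infty,$$ where $N(0,0)$ denotes the point mass at $0$. -/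

import Mathlib

open MeasureTheory ProbabilityTheory Filter Asymptotics
open scoped ENNReal Topology

/-- Finite ordered (plane) rooted trees: a tree is the ordered list of the branches at its root. -/
inductive PlaneTree : Type
  | node : List PlaneTree → PlaneTree

namespace PlaneTree

/-- The family, over all vertices `v` of `T` in depth-first order, of the fringe subtrees `T_v`,
where `T_v` consists of `v` and all its descendants. -/
def fringe : PlaneTree → List PlaneTree
  | node ts => node ts :: (ts.map fringe).flatten

/-- The number `|T|` of vertices of `T`. -/
def size (T : PlaneTree) : ℕ := (fringe T).length

/-- The additive functional `F(T) = ∑_{v ∈ T} f(T_v)` with toll function `f`. -/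
def additive (f : PlaneTree → ℝ) (T : PlaneTree) : ℝ := ((fringe T).map f).sum

/-- The probability that the Galton–Watson tree with offspring distribution `p` equals a given
finite tree: the root has the prescribed number of children with probability `p ts.length`, and,
independently, the branches at the children are independent copies of the whole tree. Equivalently,
the product of `p d(v)` over all vertices `v`, where `d(v)` is the outdegree of `v`. -/
noncomputable def gwProb (p : PMF ℕ) : PlaneTree → ℝ≥0∞
  | node ts => p ts.length * (ts.map (gwProb p)).prod

/-- Every set of finite trees is an event. -/
instance : MeasurableSpace PlaneTree := ⊤

instance : DiscreteMeasurableSpace PlaneTree := ⟨fun _ => trivial⟩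

/-- The law of the Galton–Watson tree `𝒯` with offspring distribution `p`, on the set of finite
trees (for a critical `p` with positive variance, `𝒯` is almost surely finite). -/
noncomputable def gw (p : PMF ℕ) : Measure PlaneTree :=
  Measure.sum fun T => gwProb p T • Measure.dirac T

/-- The law of the conditioned Galton–Watson tree `𝒯_n`, i.e. of `𝒯` given `|𝒯| = n`. -/
noncomputable def gwCond (p : PMF ℕ) (n : ℕ) : Measure PlaneTree :=
  (gw p)[|{T | T.size = n}]

/-- The orders `n` with `ℙ(|𝒯| = n) > 0`, i.e. those for which `𝒯_n` is defined. -/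
abbrev AdmissibleSize (p : PMF ℕ) : Type := {n : ℕ // gw p {T | T.size = n} ≠ 0}

/-! The laws of `𝒯` and `𝒯_n` are probability measures. -/

theorem tsum_prod_fin (g : PlaneTree → ℝ≥0∞) (n : ℕ) :
    ∑' a : Fin n → PlaneTree, ∏ i, g (a i) = (∑' T, g T) ^ n := by
  induction n with
  | zero => simp
  | succ n ih =>
    rw [← (Fin.consEquiv fun _ : Fin (n + 1) => PlaneTree).tsum_eq]
    simp only [Fin.consEquiv, Equiv.coe_fn_mk, Fin.prod_univ_succ, Fin.cons_zero, Fin.cons_succ]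
    rw [ENNReal.tsum_prod (f := fun a (b : Fin n → PlaneTree) => g a * ∏ i, g (b i))]
    simp only [ENNReal.tsum_mul_left, ENNReal.tsum_mul_right, ih]
    rw [pow_succ, mul_comm]

theorem tsum_node (c : ℕ → ℝ≥0∞) (g : PlaneTree → ℝ≥0∞) :
    ∑' ts : List PlaneTree, c ts.length * (ts.map g).prod = ∑' n, c n * (∑' T, g T) ^ n := by
  rw [← List.equivSigmaTuple.symm.tsum_eq, ENNReal.tsum_sigma']
  refine tsum_congr fun n => ?_
  rw [← tsum_prod_fin, ← ENNReal.tsum_mul_left]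
  refine tsum_congr fun a => ?_
  simp [List.equivSigmaTuple, List.map_ofFn, List.prod_ofFn]

/-- The part of `gwProb` carried by trees with fewer than `h` generations. -/
noncomputable def gwProbTrunc (p : PMF ℕ) : ℕ → PlaneTree → ℝ≥0∞
  | 0, _ => 0
  | h + 1, node ts => p ts.length * (ts.map (gwProbTrunc p h)).prod

def nodeEquiv : List PlaneTree ≃ PlaneTree where
  toFun := node
  invFun | node ts => ts
  left_inv _ := rfl
  right_inv | node _ => rfl

theorem tsum_gwProbTrunc_le_one (p : PMF ℕ) (h : ℕ) : ∑' T, gwProbTrunc p h T ≤ 1 := by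
  induction h with
  | zero => simp [gwProbTrunc]
  | succ h ih =>
    rw [← nodeEquiv.tsum_eq]
    simp only [nodeEquiv, Equiv.coe_fn_mk, gwProbTrunc]
    rw [tsum_node (fun n => p n), ← p.tsum_coe]
    exact ENNReal.tsum_le_tsum fun n => mul_le_of_le_one_right' (pow_le_one' ih n)

theorem gwProbTrunc_eq (p : PMF ℕ) (h : ℕ) (T : PlaneTree) (hT : T.size ≤ h) :
    gwProbTrunc p h T = gwProb p T := by
  induction h generalizing T with
  | zero =>
    obtain ⟨ts⟩ := T
    simp [size, fringe] at hT
  | succ h ih =>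
    obtain ⟨ts⟩ := T
    rw [gwProbTrunc, gwProb]
    congr 2
    refine List.map_congr_left fun t ht => ih t ?_
    have h1 : t.size ≤ ((ts.map fringe).flatten).length := by
      rw [List.length_flatten]
      exact List.le_sum_of_mem (List.mem_map.2 ⟨_, List.mem_map.2 ⟨t, ht, rfl⟩, rfl⟩)
    simp only [size, fringe, List.length_cons] at hT h1 ⊢
    omega

theorem tsum_gwProb_le_one (p : PMF ℕ) : ∑' T, gwProb p T ≤ 1 := by
  rw [ENNReal.tsum_eq_iSup_sum]
  refine iSup_le fun s => ?_
  calc ∑ T ∈ s, gwProb p T = ∑ T ∈ s, gwProbTrunc p (s.sup size) T :=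
        Finset.sum_congr rfl fun T hT => (gwProbTrunc_eq p _ T (Finset.le_sup hT)).symm
    _ ≤ ∑' T, gwProbTrunc p (s.sup size) T := ENNReal.sum_le_tsum s
    _ ≤ 1 := tsum_gwProbTrunc_le_one p _

instance (p : PMF ℕ) : IsFiniteMeasure (gw p) := by
  constructor
  rw [gw, Measure.sum_apply _ MeasurableSet.univ]
  simpa using (tsum_gwProb_le_one p).trans_lt ENNReal.one_lt_top

instance (p : PMF ℕ) (n : AdmissibleSize p) : IsProbabilityMeasure (gwCond p n) :=
  cond_isProbabilityMeasure n.2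

/-- Under the standing assumptions the Galton–Watson tree is almost surely finite. -/
theorem isProbabilityMeasure_gw (p : PMF ℕ) (hmean : ∫ k : ℕ, (k : ℝ) ∂p.toMeasure = 1)
    (hvar : 0 < Var[fun k : ℕ => (k : ℝ); p.toMeasure]) : IsProbabilityMeasure (gw p) := by
  set q := ∑' T, gwProb p T with hq
  have hq1 : q ≤ 1 := tsum_gwProb_le_one p
  have hqfix : ∑' n, p n * q ^ n = q := by
    rw [hq, ← tsum_node (fun n => p n), ← nodeEquiv.tsum_eq]
    simp only [nodeEquiv, Equiv.coe_fn_mk, gwProb]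
  suffices h : q = 1 by
    constructor
    rw [gw, Measure.sum_apply _ MeasurableSet.univ]
    simpa using h
  by_contra hne
  have hlt : q < 1 := lt_of_le_of_ne hq1 hne
  have hqtop : q ≠ ∞ := hlt.ne_top
  set x := q.toReal with hx
  have hx0 : 0 ≤ x := ENNReal.toReal_nonneg
  have hx1 : x < 1 := by
    rw [hx, ← ENNReal.toReal_one]; exact (ENNReal.toReal_lt_toReal hqtop (by simp)).2 hlt
  have hk : Integrable (fun k : ℕ => (k : ℝ)) p.toMeasure := by
    by_contra h
    rw [integral_undef h] at hmean
    norm_num at hmean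
  have hpow : Integrable (fun k : ℕ => x ^ k) p.toMeasure := by
    refine Integrable.of_bound (C := 1) (measurable_of_countable _).aestronglyMeasurable ?_
    filter_upwards with k
    rw [Real.norm_eq_abs, abs_of_nonneg (by positivity)]
    exact pow_le_one₀ hx0 hx1.le
  have hgen : ∫ k : ℕ, x ^ k ∂p.toMeasure = x := by
    rw [integral_eq_lintegral_of_nonneg_ae (by filter_upwards with k; positivity)
      hpow.aestronglyMeasurable, lintegral_countable']
    rw [hx, ← hqfix]
    congr 1
    refine tsum_congr fun k => ?_
    rw [p.toMeasure_apply_singleton _ (MeasurableSet.singleton k), mul_comm]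
    congr 1
    rw [hqfix, ENNReal.ofReal_pow ENNReal.toReal_nonneg, ENNReal.ofReal_toReal hqtop]
  have hnn : ∀ k : ℕ, 0 ≤ x ^ k - (1 + (k : ℝ) * (x - 1)) := fun k => by
    have := one_add_mul_le_pow (a := x - 1) (by linarith) k
    simp only [add_sub_cancel] at this
    linarith
  have hi : Integrable (fun k : ℕ => x ^ k - (1 + (k : ℝ) * (x - 1))) p.toMeasure :=
    hpow.sub ((integrable_const _).add (hk.mul_const _))
  have hzero : ∫ k : ℕ, (x ^ k - (1 + (k : ℝ) * (x - 1))) ∂p.toMeasure = 0 := by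
    have hl : Integrable (fun k : ℕ => 1 + (k : ℝ) * (x - 1)) p.toMeasure :=
      (integrable_const _).add (hk.mul_const _)
    rw [integral_sub hpow hl,
      integral_add (integrable_const _) (hk.mul_const _), integral_mul_const, hmean, hgen]
    simp
  have hae := (integral_eq_zero_iff_of_nonneg hnn hi).1 hzero
  have hle : ∀ᵐ k : ℕ ∂p.toMeasure, (k : ℝ) ≤ 1 := by
    filter_upwards [hae] with k h
    by_contra hk1
    have hk2 : 1 < k := by exact_mod_cast not_le.1 hk1
    have := one_add_mul_self_lt_rpow_one_add (s := x - 1) (by linarith) (by linarith)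
      (p := (k : ℝ)) (by exact_mod_cast hk2)
    simp only [add_sub_cancel, Real.rpow_natCast] at this
    simp only [Pi.zero_apply] at h
    linarith
  have hone : (fun k : ℕ => 1 - (k : ℝ)) =ᵐ[p.toMeasure] 0 := by
    refine (integral_eq_zero_iff_of_nonneg_ae ?_ ((integrable_const _).sub hk)).1 ?_
    · filter_upwards [hle] with k h
      simpa using h
    · have := integral_sub (integrable_const (1 : ℝ)) hk
      simpa [hmean] using this
  have : Var[fun k : ℕ => (k : ℝ); p.toMeasure] = 0 := by
    rw [variance_congr (Y := fun _ => (1 : ℝ))]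
    · simp [variance, evariance]
    · filter_upwards [hone] with k h
      simp only [Pi.zero_apply] at h
      linarith
  linarith
end PlaneTree

/-!
A plane tree is coded by the list of its outdegrees in depth-first order. Subtracting `1` from each
letter turns this word into a walk which first reaches `-1` at its last step, fringe subtrees are
the factors of the word which are themselves words of trees, and the law of the Galton–Watson tree
is that of independent offspring variables. By the cycle lemma (`integral_ite_excess`), a uniformly
rotated word of the tree conditioned on having `n` vertices is a sequence of `n` independent
offspring variables conditioned on the walk being at `-1` at time `n`. Hence `𝔼 F(𝒯_n)` and its
higher analogues become expectations about a random walk bridge. Write `π_n = ℙ(|𝒯| = n)`; it is of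
order `n ^ (-3/2)` at the admissible sizes.

**The mean.** Summing over the size `k` of the fringe subtree gives
`π_n 𝔼 F(𝒯_n) = ∑ k, π_k 𝔼 f(𝒯_k) ℙ(S_{n-k} = 0)` (`levelSum_additive`), whereas
`n π_n = ℙ(S_n = -1)`. Fourier inversion shows that `ℙ(S_{n-k} = 0)` and `ℙ(S_n = -1)` differ by
`O(k n ^ (-3/2)) + o(1 / n)` for `k ≤ n / 2` (`exists_abs_walkProb_sub_le`); the `o(1 / n)` comes
from the oddness of the limiting integrand. With `𝔼 f(𝒯_k) → 0` this yields (i)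
(`eventually_abs_levelSum_additive_le`).

**A uniform variance bound.** Let `s` bound both `sup ‖f(𝒯_k)‖₂` and `∑ ‖f(𝒯_k)‖₂ / k`. Then
`𝔼 (F(𝒯_n) - n μ)² ≤ (A s)² n` with a constant `A` depending on the offspring law only
(`IsCritical.exists_levelSum_sub_sq_le`). The proof is by strong induction on `n`. Fringe subtrees
with more than half of the vertices form a chain, so the square of their contribution is again an
additive functional (`additive_sq_eq`), whose mean is known. The contribution of the smaller ones
is an average, over the rotations, of differences of sums over windows of the bridge; a window
leaving a fraction of the bridge free is comparable to a window of independent variables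
(`mul_levelSum_sub_pow_le`), and the variance over independent variables is explicit
(`variance_factorSum`) and involves `F` at smaller sizes only.

**Tolls carried by trees of bounded size.** If `f` vanishes on trees with more than `K` vertices,
then the sum of the tolls along a word is additive up to terms which depend on the `2 K` letters
around the cutting point. Cutting into long blocks gives a joint central limit theorem for this sum
and the endpoint of the walk (`IsCritical.tendsto_integral_exp_linear`). A Gaussian bound for the
joint characteristic function (`IsCritical.exists_norm_integral_exp_factorSum_le`), obtained by
integrating out one letter per block, allows the limit to be taken under the Fourier inversion
integral, which conditions on the endpoint (`IsCritical.tendsto_integral_exp_additive`). The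
covariance of the sum with the endpoint is `-n μ` to first order, so that the conditioning lowers
the variance by `n μ² / σ²`. Bounded fourth moments (`IsCritical.exists_levelSum_sub_pow_four_le`)
give convergence of the variance as well.

**General tolls.** By the summability assumption in (ii), the tail `f 1_{|T| > K}` satisfies the
hypothesis of the variance bound with `s → 0` as `K → ∞` (`TollBound.eventually_tail`). So
truncation changes the characteristic functions and the variances little, uniformly in `n`, and the
asymptotic variance depends continuously on the toll (`TollBound.abs_asympVar_sub_le`). Letting
`K → ∞` and applying Lévy's continuity theorem proves (ii).
-/

namespace PlaneTree

/-! ### Trees as words -/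

/-- The word of a tree: the outdegrees of its vertices in depth-first order. -/
def code : PlaneTree → List ℕ
  | node ts => ts.length :: (ts.map code).flatten

/-- Structural induction with the hypothesis for all branches at the root. -/
theorem induction_node {P : PlaneTree → Prop}
    (h : ∀ ts : List PlaneTree, (∀ t ∈ ts, P t) → P (node ts)) : ∀ T, P T
  | node ts => h ts fun t _ => induction_node h t

theorem length_code (T : PlaneTree) : (code T).length = T.size := by
  induction T using induction_node with
  | h ts ih =>
    simp only [code, size, fringe, List.length_cons, List.length_flatten, List.map_map]
    congr 2
    exact List.map_congr_left fun t ht => ih t ht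

theorem size_pos (T : PlaneTree) : 0 < T.size := by
  obtain ⟨ts⟩ := T
  simp [size, fringe]

/-- The increment over the word `l` of the walk with steps `k - 1`. -/
def excess (l : List ℕ) : ℤ := (l.map fun k : ℕ => (k : ℤ) - 1).sum

@[simp] theorem excess_nil : excess [] = 0 := rfl

@[simp] theorem excess_cons (k : ℕ) (l : List ℕ) : excess (k :: l) = (k : ℤ) - 1 + excess l := by
  simp [excess]

@[simp] theorem excess_append (l l' : List ℕ) : excess (l ++ l') = excess l + excess l' := by
  simp [excess]

theorem excess_eq (l : List ℕ) : excess l = (l.sum : ℤ) - l.length := by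
  induction l with
  | nil => simp
  | cons k l ih => simp [ih]; ring

theorem excess_flatten_code (ts : List PlaneTree) (h : ∀ t ∈ ts, excess (code t) = -1) :
    excess (ts.map code).flatten = -(ts.length : ℤ) := by
  induction ts with
  | nil => simp
  | cons t ts ih =>
    simp only [List.map_cons, List.flatten_cons, excess_append, List.length_cons]
    rw [ih fun t' ht' => h t' (List.mem_cons_of_mem _ ht'), h t List.mem_cons_self]
    push_cast; ring

theorem excess_code (T : PlaneTree) : excess (code T) = -1 := by
  induction T using induction_node with
  | h ts ih =>
    simp only [code, excess_cons]
    rw [excess_flatten_code ts ih]; ring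

theorem excess_take_flatten_code (ts : List PlaneTree)
    (h : ∀ t ∈ ts, ∀ i < (code t).length, 0 ≤ excess ((code t).take i)) (i : ℕ) :
    i < (ts.map code).flatten.length →
    -(ts.length : ℤ) < excess ((ts.map code).flatten.take i) := by
  induction ts generalizing i with
  | nil => simp
  | cons t ts ih =>
    intro hi
    simp only [List.map_cons, List.flatten_cons, List.length_append, List.length_cons] at hi ⊢
    rw [List.take_append, excess_append]
    rcases lt_or_ge i (code t).length with h1 | h1
    · have := h t List.mem_cons_self i h1
      rw [Nat.sub_eq_zero_of_le h1.le]
      simp; omega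
    · rw [List.take_of_length_le h1, excess_code]
      have := ih (fun t' ht' => h t' (List.mem_cons_of_mem _ ht')) (i - (code t).length) (by omega)
      push_cast; omega

/-- The walk coded by a tree stays nonnegative before its last step. -/
theorem excess_take_code (T : PlaneTree) :
    ∀ i < (code T).length, 0 ≤ excess ((code T).take i) := by
  induction T using induction_node with
  | h ts ih =>
    intro i hi
    rcases i with _ | i
    · simp
    · simp only [code, List.length_cons, List.take_succ_cons, excess_cons] at hi ⊢
      have := excess_take_flatten_code ts ih i (by omega)
      omega

theorem code_append_inj_flatten (ts : List PlaneTree)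
    (h : ∀ t ∈ ts, ∀ t' l l', code t ++ l = code t' ++ l' → t = t' ∧ l = l')
    (ts' : List PlaneTree) (l l' : List ℕ) (hlen : ts.length = ts'.length)
    (he : (ts.map code).flatten ++ l = (ts'.map code).flatten ++ l') : ts = ts' ∧ l = l' := by
  induction ts generalizing ts' with
  | nil =>
    obtain rfl : ts' = [] := List.eq_nil_of_length_eq_zero (by simpa using hlen.symm)
    simpa using he
  | cons t ts ih =>
    obtain _ | ⟨t', ts'⟩ := ts'
    · simp at hlen
    · simp only [List.map_cons, List.flatten_cons, List.append_assoc] at he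
      obtain ⟨rfl, he'⟩ := h t List.mem_cons_self t' _ _ he
      obtain ⟨rfl, rfl⟩ := ih (fun t' ht' => h t' (List.mem_cons_of_mem _ ht')) ts'
        (by simpa using hlen) he'
      exact ⟨rfl, rfl⟩

/-- Words of trees are uniquely decodable: no such word is a proper prefix of another one. -/
theorem code_append_inj (T : PlaneTree) :
    ∀ T' l l', code T ++ l = code T' ++ l' → T = T' ∧ l = l' := by
  induction T using induction_node with
  | h ts ih =>
    rintro ⟨ts'⟩ l l' he
    simp only [code, List.cons_append, List.cons.injEq] at he
    obtain ⟨rfl, rfl⟩ := code_append_inj_flatten ts ih ts' l l' he.1 he.2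
    exact ⟨rfl, rfl⟩

theorem code_injective : Function.Injective code := fun T T' h =>
  (code_append_inj T T' [] [] (by rw [h])).1

theorem eq_of_code_prefix {T T' : PlaneTree} {l : List ℕ} (h : code T <+: l)
    (h' : code T' <+: l) : T = T' := by
  obtain ⟨u, rfl⟩ := h
  obtain ⟨u', hu⟩ := h'
  exact ((code_append_inj T' T u' u hu).1).symm

/-- A word whose walk reaches level `-m` begins with the words of `m` trees. -/
theorem exists_forest_prefix (l : List ℕ) : ∀ m : ℕ, excess l ≤ -(m : ℤ) →
    ∃ ts : List PlaneTree, ts.length = m ∧ (ts.map code).flatten <+: l := by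
  induction l with
  | nil =>
    intro m hm
    obtain rfl : m = 0 := by simp at hm; omega
    exact ⟨[], rfl, by simp⟩
  | cons k l ih =>
    rintro (_ | m) hm
    · exact ⟨[], rfl, by simp⟩
    · obtain ⟨ts, hlen, hts⟩ := ih (m + k) (by simp at hm; push_cast; omega)
      refine ⟨node (ts.take k) :: ts.drop k, by simp; omega, ?_⟩
      have h1 : (ts.take k).length = k := by simp; omega
      simp only [List.map_cons, List.flatten_cons, code, h1, List.cons_append,
        List.cons_prefix_cons, true_and]
      rwa [← List.flatten_append, ← List.map_append, List.take_append_drop]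

theorem exists_code_prefix {l : List ℕ} (h : excess l < 0) : ∃ T, code T <+: l := by
  obtain ⟨ts, hlen, hts⟩ := exists_forest_prefix l 1 (by push_cast; omega)
  obtain ⟨t, rfl⟩ := List.length_eq_one_iff.1 hlen
  exact ⟨t, by simpa using hts⟩

/-! ### The cycle lemma -/

theorem exists_code_eq {l : List ℕ} (h : excess l = -1)
    (h' : ∀ i < l.length, 0 ≤ excess (l.take i)) : ∃ T, code T = l := by
  obtain ⟨T, u, rfl⟩ := exists_code_prefix (l := l) (by omega)
  by_cases hu : u = []
  · exact ⟨T, by simp [hu]⟩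
  · have h0 : 0 < u.length := List.length_pos_iff.2 hu
    have := h' (code T).length (by simp; omega)
    simp [excess_code] at this

/-- Existence in the cycle lemma: the rotation which starts at the first minimum of the walk is the
word of a tree. -/
theorem exists_rotate_code {l : List ℕ} (h : excess l = -1) :
    ∃ T, ∃ j < l.length, (code T).rotate j = l := by
  set s := l.length with hs
  -- the first index at which the walk is minimal
  have hfirst : ∃ i ≤ s, (∀ j ≤ s, excess (l.take i) ≤ excess (l.take j)) ∧
      ∀ j < i, excess (l.take i) < excess (l.take j) := by
    obtain ⟨i₀, hi₀, hmin⟩ := Finset.exists_min_image (Finset.range (s + 1))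
      (fun i => excess (l.take i)) ⟨0, by simp⟩
    have hex : ∃ i, i ≤ s ∧ excess (l.take i) = excess (l.take i₀) :=
      ⟨i₀, by simpa [Nat.lt_succ_iff] using hi₀, rfl⟩
    classical
    refine ⟨Nat.find hex, (Nat.find_spec hex).1, fun j hj => ?_, fun j hj => ?_⟩
    · rw [(Nat.find_spec hex).2]
      exact hmin j (by simp; omega)
    · rw [(Nat.find_spec hex).2]
      have h1 := hmin j (by simp; have := (Nat.find_spec hex).1; omega)
      have h2 := Nat.find_min hex hj
      have h3 := (Nat.find_spec hex).1
      rcases h1.lt_or_eq with h4 | h4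
      · exact h4
      · exact absurd ⟨by omega, h4.symm⟩ h2
  obtain ⟨i, his, hmin, hlt⟩ := hfirst
  have hsplit : excess (l.take i) + excess (l.drop i) = -1 := by
    rw [← excess_append, List.take_append_drop, h]
  obtain ⟨T, hT⟩ := exists_code_eq (l := l.drop i ++ l.take i)
    (by rw [excess_append]; omega) (by
      intro j hj
      rw [List.take_append, excess_append]
      rcases le_or_gt j (l.drop i).length with h1 | h1
      · rw [Nat.sub_eq_zero_of_le h1]
        have h2 : excess (l.take (i + j)) = excess (l.take i) + excess ((l.drop i).take j) := by
          rw [← excess_append, List.take_add]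
        have h3 := hmin (i + j) (by simp at h1; omega)
        simp; omega
      · rw [List.take_of_length_le h1.le]
        simp only [List.length_append, List.length_drop, List.length_take] at hj h1 ⊢
        rw [List.take_take, min_eq_left (by omega)]
        have := hlt (j - (s - i)) (by omega)
        rw [← hs]
        omega)
  have hs0 : 0 < s := by
    rcases Nat.eq_zero_or_pos s with h0 | h0
    · rw [List.eq_nil_of_length_eq_zero h0] at h; simp at h
    · exact h0
  have hT' : code T = l.rotate i := by rw [hT, List.rotate_eq_drop_append_take his]
  have hlen : (l.rotate i).length = s := by simp [hs]
  refine ⟨T, (s - i) % s, Nat.mod_lt _ hs0, ?_⟩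
  rw [hT', ← hlen, List.rotate_mod, hlen, List.rotate_rotate, Nat.add_sub_cancel' his, hs,
    List.rotate_length]

theorem eq_zero_of_code_eq_rotate {T T' : PlaneTree} {d : ℕ} (hd : d < (code T).length)
    (h : code T' = (code T).rotate d) : d = 0 := by
  by_contra hd0
  rw [List.rotate_eq_drop_append_take hd.le] at h
  have h1 := excess_take_code T d hd
  have h2 := excess_take_code T' ((code T).drop d).length (by rw [h]; simp; omega)
  rw [h, List.take_left] at h2
  have h3 : excess ((code T).take d) + excess ((code T).drop d) = -1 := by
    rw [← excess_append, List.take_append_drop, excess_code]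
  omega

/-- Uniqueness in the cycle lemma. -/
theorem rotate_code_inj {T T' : PlaneTree} {j j' : ℕ} (hj : j < T.size) (hj' : j' < T'.size)
    (h : (code T).rotate j = (code T').rotate j') : T = T' ∧ j = j' := by
  have hlen : T.size = T'.size := by
    have := congrArg List.length h
    simpa [length_code] using this
  have h1 : code T' = (code T).rotate (j + (T.size - j')) := by
    rw [← List.rotate_rotate, h, List.rotate_rotate, hlen, Nat.add_sub_cancel' hj'.le,
      ← length_code, List.rotate_length]
  have h2 : code T' = (code T).rotate ((j + (T.size - j')) % T.size) := by
    rw [← length_code, List.rotate_mod, length_code]; exact h1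
  have h3 := eq_zero_of_code_eq_rotate
    (by rw [length_code]; exact Nat.mod_lt _ (size_pos T)) h2
  rw [h3, List.rotate_zero] at h2
  refine ⟨(code_injective h2).symm, ?_⟩
  have h4 : T.size ∣ j + (T.size - j') := Nat.dvd_of_mod_eq_zero h3
  obtain ⟨c, hc⟩ := h4
  have : c = 1 := by
    rcases c with _ | _ | c
    · simp at hc; omega
    · rfl
    · exfalso
      have : T.size * (c + 1 + 1) = T.size * c + 2 * T.size := by ring
      have : 0 ≤ T.size * c := Nat.zero_le _
      omega
  subst this
  omega

/-! ### Additive functionals read off words -/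

open Classical in
/-- The toll of the tree whose word is a prefix of `l`; zero if there is no such tree. -/
noncomputable def headToll (f : PlaneTree → ℝ) (l : List ℕ) : ℝ :=
  if h : ∃ T, code T <+: l then f h.choose else 0

/-- The sum of the tolls of all trees whose words are factors of `l`. -/
noncomputable def factorSum (f : PlaneTree → ℝ) : List ℕ → ℝ
  | [] => 0
  | k :: l => headToll f (k :: l) + factorSum f l

theorem headToll_of_prefix (f : PlaneTree → ℝ) {T : PlaneTree} {l : List ℕ} (h : code T <+: l) :
    headToll f l = f T := by
  have h' : ∃ T, code T <+: l := ⟨T, h⟩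
  rw [headToll, dif_pos h', eq_of_code_prefix h'.choose_spec h]

theorem headToll_append (f : PlaneTree → ℝ) (T : PlaneTree) (l : List ℕ) :
    headToll f (code T ++ l) = f T := headToll_of_prefix f (List.prefix_append _ _)

theorem headToll_eq_zero (f : PlaneTree → ℝ) {l : List ℕ} (h : ¬ ∃ T, code T <+: l) :
    headToll f l = 0 := dif_neg h

theorem additive_node (f : PlaneTree → ℝ) (ts : List PlaneTree) :
    additive f (node ts) = f (node ts) + (ts.map (additive f)).sum := by
  simp only [additive, fringe, List.map_cons, List.sum_cons, List.map_flatten, List.sum_flatten,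
    List.map_map]
  rfl

theorem factorSum_flatten_append (f : PlaneTree → ℝ) (ts : List PlaneTree)
    (h : ∀ t ∈ ts, ∀ l, factorSum f (code t ++ l) = additive f t + factorSum f l) (l : List ℕ) :
    factorSum f ((ts.map code).flatten ++ l) = (ts.map (additive f)).sum + factorSum f l := by
  induction ts with
  | nil => simp
  | cons t ts ih =>
    simp only [List.map_cons, List.flatten_cons, List.append_assoc, List.sum_cons]
    rw [h t List.mem_cons_self, ih fun t' ht' => h t' (List.mem_cons_of_mem _ ht'), add_assoc]

theorem factorSum_code_append (f : PlaneTree → ℝ) (T : PlaneTree) :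
    ∀ l, factorSum f (code T ++ l) = additive f T + factorSum f l := by
  induction T using induction_node with
  | h ts ih =>
    intro l
    have h1 := headToll_append f (node ts) l
    simp only [code, List.cons_append, factorSum] at h1 ⊢
    rw [h1, factorSum_flatten_append f ts ih, additive_node, add_assoc]

theorem factorSum_code (f : PlaneTree → ℝ) (T : PlaneTree) : factorSum f (code T) = additive f T := by
  have := factorSum_code_append f T []
  simpa [factorSum] using this

theorem factorSum_eq_sum (f : PlaneTree → ℝ) (l : List ℕ) :
    factorSum f l = ∑ i ∈ Finset.range l.length, headToll f (l.drop i) := by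
  induction l with
  | nil => simp [factorSum]
  | cons k l ih => rw [factorSum, ih, List.length_cons, Finset.sum_range_succ']; simp [add_comm]

theorem exists_prefix_drop_code (T : PlaneTree) {i : ℕ} (hi : i < T.size) :
    ∃ t, code t <+: (code T).drop i := by
  refine exists_code_prefix ?_
  have h1 := excess_take_code T i (by rwa [length_code])
  have h2 : excess ((code T).take i) + excess ((code T).drop i) = -1 := by
    rw [← excess_append, List.take_append_drop, excess_code]
  omega

/-- Reading a tree off the word of `T` from the position `i` never reaches the end of the word, so
that cyclic reading makes no difference. -/
theorem headToll_rotate_code (f : PlaneTree → ℝ) (T : PlaneTree) {i : ℕ} (hi : i < T.size) :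
    headToll f ((code T).rotate i) = headToll f ((code T).drop i) := by
  obtain ⟨t, ht⟩ := exists_prefix_drop_code T hi
  rw [headToll_of_prefix f ht, List.rotate_eq_drop_append_take (by rw [length_code]; exact hi.le)]
  exact headToll_of_prefix f (ht.trans (List.prefix_append _ _))

/-- The additive functional is the sum of the tolls read cyclically along the word. -/
theorem sum_headToll_rotate (f : PlaneTree → ℝ) (T : PlaneTree) :
    ∑ i ∈ Finset.range T.size, headToll f ((code T).rotate i) = additive f T := by
  rw [← factorSum_code, factorSum_eq_sum, length_code]
  exact Finset.sum_congr rfl fun i hi => headToll_rotate_code f T (Finset.mem_range.1 hi)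

/-! ### Weights of words and sums over trees of a given size -/

/-- The probability that independent offspring variables spell the word `l`. -/
noncomputable def wordProb (p : PMF ℕ) (l : List ℕ) : ℝ := (l.map fun k => (p k).toReal).prod

@[simp] theorem wordProb_nil (p : PMF ℕ) : wordProb p [] = 1 := by simp [wordProb]

@[simp] theorem wordProb_cons (p : PMF ℕ) (k : ℕ) (l : List ℕ) :
    wordProb p (k :: l) = (p k).toReal * wordProb p l := by simp [wordProb]

@[simp] theorem wordProb_append (p : PMF ℕ) (l l' : List ℕ) :
    wordProb p (l ++ l') = wordProb p l * wordProb p l' := by simp [wordProb]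

theorem wordProb_rotate (p : PMF ℕ) (l : List ℕ) (j : ℕ) :
    wordProb p (l.rotate j) = wordProb p l := by
  rw [wordProb, wordProb]
  exact ((List.rotate_perm l j).map _).prod_eq

theorem wordProb_nonneg (p : PMF ℕ) (l : List ℕ) : 0 ≤ wordProb p l :=
  List.prod_nonneg (by simp)

theorem wordProb_flatten (p : PMF ℕ) (L : List (List ℕ)) :
    wordProb p L.flatten = (L.map (wordProb p)).prod := by
  induction L with
  | nil => simp
  | cons l L ih => simp [ih]

theorem toReal_gwProb (p : PMF ℕ) (T : PlaneTree) : (gwProb p T).toReal = wordProb p (code T) := by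
  induction T using induction_node with
  | h ts ih =>
    rw [gwProb, code, wordProb_cons, ENNReal.toReal_mul, wordProb_flatten, List.map_map]
    congr 1
    have h : ∀ ts : List PlaneTree, (∀ t ∈ ts, (gwProb p t).toReal = wordProb p (code t)) →
        (ts.map (gwProb p)).prod.toReal = (ts.map (wordProb p ∘ code)).prod := by
      intro ts
      induction ts with
      | nil => simp
      | cons t ts ih =>
        intro h
        simp only [List.map_cons, List.prod_cons, ENNReal.toReal_mul]
        rw [h t List.mem_cons_self, ih fun t' ht' => h t' (List.mem_cons_of_mem _ ht')]
        rfl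
    exact h ts ih

instance : Countable PlaneTree := code_injective.countable

theorem gw_real_singleton (p : PMF ℕ) (T : PlaneTree) :
    (gw p).real {T} = wordProb p (code T) := by
  rw [← toReal_gwProb, measureReal_def, gw, Measure.sum_apply _ (measurableSet_singleton _)]
  rw [tsum_eq_single T]
  · simp
  · intro T' hT'
    simp [hT']

/-- The words of length `n` with sum `s`. The words of the trees with `n` vertices are among those
with sum `n - 1`. -/
def words (n s : ℕ) : Finset (List ℕ) :=
  (Finset.Nat.antidiagonalTuple n s).image fun x => List.ofFn x

theorem mem_words {n s : ℕ} {l : List ℕ} : l ∈ words n s ↔ l.length = n ∧ l.sum = s := by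
  simp only [words, Finset.mem_image, Finset.Nat.mem_antidiagonalTuple]
  constructor
  · rintro ⟨x, hx, rfl⟩
    exact ⟨by simp, by rw [List.sum_ofFn, hx]⟩
  · rintro ⟨rfl, rfl⟩
    exact ⟨l.get, by rw [← List.sum_ofFn, List.ofFn_get], List.ofFn_get l⟩

/-- The trees with `n` vertices. -/
noncomputable def trees (n : ℕ) : Finset PlaneTree :=
  (words n (n - 1)).preimage code code_injective.injOn

@[simp] theorem mem_trees {n : ℕ} {T : PlaneTree} : T ∈ trees n ↔ T.size = n := by
  rw [trees, Finset.mem_preimage, mem_words, length_code, and_iff_left_iff_imp]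
  intro h
  have h1 := excess_code T
  have h2 := size_pos T
  rw [excess_eq, length_code, h] at h1
  omega

theorem trees_zero : trees 0 = ∅ := by
  ext T
  simpa using (size_pos T).ne'

/-- The sum of `g` over the trees with `n` vertices, weighted by the law of the Galton–Watson
tree, that is, `ℙ(|𝒯| = n) 𝔼 g(𝒯_n)`. -/
noncomputable def levelSum (p : PMF ℕ) (g : PlaneTree → ℝ) (n : ℕ) : ℝ :=
  ∑ T ∈ trees n, wordProb p (code T) * g T

/-- The probability `ℙ(|𝒯| = n)`. -/
noncomputable def sizeProb (p : PMF ℕ) (n : ℕ) : ℝ := levelSum p (fun _ => 1) n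

section levelSum
variable {p : PMF ℕ} {g h : PlaneTree → ℝ} {n : ℕ}

theorem sizeProb_eq_sum : sizeProb p n = ∑ T ∈ trees n, wordProb p (code T) := by
  simp [sizeProb, levelSum]

theorem levelSum_zero_right : levelSum p g 0 = 0 := by simp [levelSum, trees_zero]

theorem levelSum_add :
    levelSum p (fun T => g T + h T) n = levelSum p g n + levelSum p h n := by
  simp [levelSum, mul_add, Finset.sum_add_distrib]

theorem levelSum_sub :
    levelSum p (fun T => g T - h T) n = levelSum p g n - levelSum p h n := by
  simp [levelSum, mul_sub, Finset.sum_sub_distrib]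

theorem levelSum_const_mul (c : ℝ) :
    levelSum p (fun T => c * g T) n = c * levelSum p g n := by
  rw [levelSum, levelSum, Finset.mul_sum]
  exact Finset.sum_congr rfl fun T _ => by ring

theorem levelSum_const (c : ℝ) : levelSum p (fun _ => c) n = c * sizeProb p n := by
  rw [sizeProb, ← levelSum_const_mul]; simp

theorem levelSum_congr (H : ∀ T, T.size = n → g T = h T) : levelSum p g n = levelSum p h n :=
  Finset.sum_congr rfl fun T hT => by rw [H T (mem_trees.1 hT)]

theorem levelSum_mono (H : ∀ T, T.size = n → g T ≤ h T) : levelSum p g n ≤ levelSum p h n :=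
  Finset.sum_le_sum fun T hT =>
    mul_le_mul_of_nonneg_left (H T (mem_trees.1 hT)) (wordProb_nonneg _ _)

theorem levelSum_nonneg (H : ∀ T, T.size = n → 0 ≤ g T) : 0 ≤ levelSum p g n :=
  Finset.sum_nonneg fun T hT => mul_nonneg (wordProb_nonneg _ _) (H T (mem_trees.1 hT))

theorem sizeProb_nonneg : 0 ≤ sizeProb p n := levelSum_nonneg fun _ _ => zero_le_one

theorem abs_levelSum_le : |levelSum p g n| ≤ levelSum p (fun T => |g T|) n := by
  refine (Finset.abs_sum_le_sum_abs _ _).trans (le_of_eq ?_)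
  exact Finset.sum_congr rfl fun T _ => by rw [abs_mul, abs_of_nonneg (wordProb_nonneg _ _)]

/-- Cauchy–Schwarz. -/
theorem levelSum_mul_le :
    levelSum p (fun T => g T * h T) n ≤
      √(levelSum p (fun T => g T ^ 2) n) * √(levelSum p (fun T => h T ^ 2) n) := by
  have := Real.sum_mul_le_sqrt_mul_sqrt (trees n)
    (fun T => √(wordProb p (code T)) * g T) (fun T => √(wordProb p (code T)) * h T)
  simp only [mul_pow, Real.sq_sqrt (wordProb_nonneg _ _)] at this
  refine le_trans (le_of_eq ?_) this
  refine Finset.sum_congr rfl fun T _ => ?_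
  rw [mul_mul_mul_comm, Real.mul_self_sqrt (wordProb_nonneg _ _)]

theorem levelSum_abs_mul_le :
    levelSum p (fun T => |g T * h T|) n ≤
      √(levelSum p (fun T => g T ^ 2) n) * √(levelSum p (fun T => h T ^ 2) n) := by
  have := levelSum_mul_le (p := p) (n := n) (g := fun T => |g T|) (h := fun T => |h T|)
  simpa only [abs_mul, sq_abs] using this

theorem levelSum_eq_zero (h0 : sizeProb p n = 0) : levelSum p g n = 0 := by
  rw [sizeProb_eq_sum, Finset.sum_eq_zero_iff_of_nonneg fun _ _ => wordProb_nonneg _ _] at h0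
  exact Finset.sum_eq_zero fun T hT => by rw [h0 T hT, zero_mul]

end levelSum

theorem setOf_size_eq (n : ℕ) : {T : PlaneTree | T.size = n} = trees n := by ext T; simp

theorem setIntegral_gw (p : PMF ℕ) (g : PlaneTree → ℝ) (n : ℕ) :
    ∫ T in {T | T.size = n}, g T ∂gw p = levelSum p g n := by
  rw [setOf_size_eq, setIntegral_finset]
  · simp [levelSum, gw_real_singleton]
  · exact IntegrableOn.finset

theorem gw_real_size (p : PMF ℕ) (n : ℕ) : (gw p).real {T | T.size = n} = sizeProb p n := by
  rw [sizeProb, ← setIntegral_gw]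
  simp

theorem admissible_iff {p : PMF ℕ} {n : ℕ} : gw p {T | T.size = n} ≠ 0 ↔ 0 < sizeProb p n := by
  rw [← gw_real_size, measureReal_def, ENNReal.toReal_pos_iff]
  simp [pos_iff_ne_zero, measure_lt_top]

theorem integral_gwCond (p : PMF ℕ) (g : PlaneTree → ℝ) (n : ℕ) :
    ∫ T, g T ∂gwCond p n = levelSum p g n / sizeProb p n := by
  rw [gwCond, ProbabilityTheory.cond, integral_smul_measure, setIntegral_gw, ← gw_real_size, measureReal_def,
    ENNReal.toReal_inv, smul_eq_mul, inv_mul_eq_div]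

theorem integrable_gwCond {E : Type*} [NormedAddCommGroup E] (p : PMF ℕ) (g : PlaneTree → E)
    (n : AdmissibleSize p) : Integrable g (gwCond p n) := by
  rw [gwCond, ProbabilityTheory.cond]
  refine Integrable.smul_measure ?_ (by simpa using n.2)
  rw [setOf_size_eq]
  exact IntegrableOn.finset

theorem iUnion_size : ⋃ n : ℕ, {T : PlaneTree | T.size = n} = Set.univ := by
  ext T; simp

theorem pairwise_disjoint_size :
    Pairwise (Function.onFun Disjoint fun n : ℕ => {T : PlaneTree | T.size = n}) := by
  intro m n hmn
  rw [Function.onFun, Set.disjoint_left]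
  rintro T rfl h
  exact hmn h

theorem hasSum_levelSum {p : PMF ℕ} {g : PlaneTree → ℝ} (hg : Integrable g (gw p)) :
    HasSum (levelSum p g) (∫ T, g T ∂gw p) := by
  have := hasSum_integral_iUnion (μ := gw p) (f := g) (s := fun n : ℕ => {T : PlaneTree | T.size = n})
    (fun _ => trivial) pairwise_disjoint_size hg.integrableOn
  simpa only [setIntegral_gw, iUnion_size, setIntegral_univ] using this

theorem integrable_gw_iff {p : PMF ℕ} {g : PlaneTree → ℝ} :
    Integrable g (gw p) ↔ Summable (levelSum p fun T => |g T|) := by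
  refine ⟨fun h => (hasSum_levelSum h.abs).summable, fun h => ?_⟩
  rw [← integrableOn_univ, ← iUnion_size]
  refine integrableOn_iUnion_of_summable_integral_norm (fun n => ?_) ?_
  · rw [setOf_size_eq]; exact IntegrableOn.finset
  · simpa only [Real.norm_eq_abs, setIntegral_gw] using h

/-! ### Sequences of independent offspring variables -/

/-- The law of a sequence of independent offspring variables. -/
noncomputable def seqLaw (p : PMF ℕ) : Measure (ℕ → ℕ) := Measure.infinitePi fun _ => p.toMeasure

instance (p : PMF ℕ) : IsProbabilityMeasure (seqLaw p) := by unfold seqLaw; infer_instance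

/-- The sequence which agrees with `ω` on `S` and with `ω'` off `S`. -/
noncomputable def mix (S : Set ℕ) (ω ω' : ℕ → ℕ) (i : ℕ) : ℕ := open Classical in
  if i ∈ S then ω i else ω' i

/-- The sequence which starts with the first `m` terms of `ω` and goes on with `ω'`. -/
def splice (m : ℕ) (ω ω' : ℕ → ℕ) (i : ℕ) : ℕ := if i < m then ω i else ω' (i - m)

/-- The first `n` terms of a sequence. -/
def word (ω : ℕ → ℕ) (n : ℕ) : List ℕ := List.ofFn fun i : Fin n => ω i

@[simp] theorem length_word (ω : ℕ → ℕ) (n : ℕ) : (word ω n).length = n := by simp [word]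

theorem word_succ (ω : ℕ → ℕ) (n : ℕ) : word ω (n + 1) = ω 0 :: word (fun i => ω (i + 1)) n := by
  simp [word, List.ofFn_succ]

theorem word_add (ω : ℕ → ℕ) (m n : ℕ) :
    word ω (m + n) = word ω m ++ word (fun i => ω (m + i)) n := by
  simp [word, List.ofFn_add]

theorem word_congr {ω ω' : ℕ → ℕ} {n : ℕ} (h : ∀ i < n, ω i = ω' i) : word ω n = word ω' n := by
  simp only [word]
  congr 1
  ext i
  exact h i i.2

theorem word_splice (m n : ℕ) (ω ω' : ℕ → ℕ) :
    word (splice m ω ω') (m + n) = word ω m ++ word ω' n := by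
  rw [word_add]
  congr 1
  · exact word_congr fun i hi => by simp [splice, hi]
  · exact word_congr fun i hi => by simp [splice]

theorem measurable_word {β : Type*} [MeasurableSpace β] (G : List ℕ → β) (n : ℕ) :
    Measurable fun ω => G (word ω n) := by
  have h1 : Measurable fun ω : ℕ → ℕ => fun i : Fin n => ω i := by fun_prop
  exact (Measurable.of_discrete (f := fun x : Fin n → ℕ => G (List.ofFn x))).comp h1

theorem stronglyMeasurable_word {β : Type*} [TopologicalSpace β] (G : List ℕ → β) (n : ℕ) :
    StronglyMeasurable fun ω => G (word ω n) := by
  have h1 : Measurable fun ω : ℕ → ℕ => fun i : Fin n => ω i := by fun_prop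
  exact (StronglyMeasurable.of_discrete (f := fun x : Fin n → ℕ => G (List.ofFn x))).comp_measurable h1

theorem measurable_eval (i : ℕ) : Measurable fun ω : ℕ → ℕ => ω i := measurable_pi_apply i

/-- Choosing each coordinate from one of two independent sequences yields again a sequence of
independent offspring variables. -/
theorem measurePreserving_mix (p : PMF ℕ) (S : Set ℕ) :
    MeasurePreserving (fun z : (ℕ → ℕ) × (ℕ → ℕ) => mix S z.1 z.2)
      ((seqLaw p).prod (seqLaw p)) (seqLaw p) := by
  classical
  have hm : Measurable fun z : (ℕ → ℕ) × (ℕ → ℕ) => mix S z.1 z.2 := by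
    refine measurable_pi_iff.2 fun i => ?_
    by_cases hi : i ∈ S
    · simp only [mix, hi, if_true]; fun_prop
    · simp only [mix, hi, if_false]; fun_prop
  refine ⟨hm, Measure.eq_infinitePi _ fun s t ht => ?_⟩
  rw [Measure.map_apply hm (MeasurableSet.pi s.countable_toSet fun i _ => ht i)]
  have : (fun z : (ℕ → ℕ) × (ℕ → ℕ) => mix S z.1 z.2) ⁻¹' ((s : Set ℕ).pi t) =
      (((s.filter (· ∈ S) : Finset ℕ) : Set ℕ).pi t) ×ˢ
        (((s.filter (¬ · ∈ S) : Finset ℕ) : Set ℕ).pi t) := by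
    ext z
    simp only [Set.mem_preimage, Set.mem_pi, Set.mem_prod, Finset.mem_coe, Finset.mem_filter, mix]
    constructor
    · intro h
      exact ⟨fun i hi => by simpa [hi.2] using h i hi.1, fun i hi => by simpa [hi.2] using h i hi.1⟩
    · rintro ⟨h1, h2⟩ i hi
      by_cases hS : i ∈ S
      · simpa [hS] using h1 i ⟨hi, hS⟩
      · simpa [hS] using h2 i ⟨hi, hS⟩
  rw [this, Measure.prod_prod, seqLaw, Measure.infinitePi_pi _ (fun i _ => ht i),
    Measure.infinitePi_pi _ (fun i _ => ht i), Finset.prod_filter_mul_prod_filter_not]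

theorem measurePreserving_comp_injective (p : PMF ℕ) {g : ℕ → ℕ} (hg : Function.Injective g) :
    MeasurePreserving (fun (ω : ℕ → ℕ) i => ω (g i)) (seqLaw p) (seqLaw p) :=
  ⟨by fun_prop, Measure.map_infinitePi_infinitePi_of_inj hg⟩

theorem measurePreserving_shift (p : PMF ℕ) (m : ℕ) :
    MeasurePreserving (fun (ω : ℕ → ℕ) i => ω (m + i)) (seqLaw p) (seqLaw p) :=
  measurePreserving_comp_injective p (add_right_injective m)

/-- Continuing the first `m` terms of a sequence by an independent sequence preserves the law. -/
theorem measurePreserving_splice (p : PMF ℕ) (m : ℕ) :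
    MeasurePreserving (fun z : (ℕ → ℕ) × (ℕ → ℕ) => splice m z.1 z.2)
      ((seqLaw p).prod (seqLaw p)) (seqLaw p) := by
  have hm : Measurable fun z : (ℕ → ℕ) × (ℕ → ℕ) => splice m z.1 z.2 := by
    refine measurable_pi_iff.2 fun i => ?_
    by_cases hi : i < m
    · simp only [splice, hi, if_true]; fun_prop
    · simp only [splice, hi, if_false]; fun_prop
  refine ⟨hm, Measure.eq_infinitePi _ fun s t ht => ?_⟩
  rw [Measure.map_apply hm (MeasurableSet.pi s.countable_toSet fun i _ => ht i)]
  have : (fun z : (ℕ → ℕ) × (ℕ → ℕ) => splice m z.1 z.2) ⁻¹' ((s : Set ℕ).pi t) =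
      (((s.filter (· < m) : Finset ℕ) : Set ℕ).pi t) ×ˢ
        ((((s.filter (¬ · < m)).image (· - m) : Finset ℕ) : Set ℕ).pi fun i => t (i + m)) := by
    ext z
    simp only [Set.mem_preimage, Set.mem_pi, Set.mem_prod, Finset.mem_coe, Finset.mem_filter,
      splice, Finset.mem_image, forall_exists_index, and_imp]
    constructor
    · intro h
      refine ⟨fun i hi him => by simpa [him] using h i hi, ?_⟩
      rintro j i hi him rfl
      simpa [him, Nat.sub_add_cancel (not_lt.1 him)] using h i hi
    · rintro ⟨h1, h2⟩ i hi
      by_cases hS : i < m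
      · simpa [hS] using h1 i hi hS
      · simpa [hS, Nat.sub_add_cancel (not_lt.1 hS)] using h2 _ i hi hS rfl
  rw [this, Measure.prod_prod, seqLaw, Measure.infinitePi_pi _ (fun i _ => ht i),
    Measure.infinitePi_pi _ (fun i _ => ht _), Finset.prod_image,
    ← Finset.prod_filter_mul_prod_filter_not s (· < m)]
  · congr 1
    refine Finset.prod_congr rfl fun i hi => ?_
    rw [Nat.sub_add_cancel (not_lt.1 (Finset.mem_filter.1 hi).2)]
  · intro i hi j hj hij
    simp at hi hj hij
    omega

section integrals
variable {E : Type*} [NormedAddCommGroup E] [NormedSpace ℝ E] {p : PMF ℕ}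

theorem integral_mix {H : (ℕ → ℕ) → E} (hH : Integrable H (seqLaw p)) (S : Set ℕ) :
    ∫ ω, H ω ∂seqLaw p = ∫ ω, ∫ ω', H (mix S ω ω') ∂seqLaw p ∂seqLaw p := by
  have h := measurePreserving_mix p S
  rw [← h.map_eq] at hH
  rw [← integral_prod (fun z : (ℕ → ℕ) × (ℕ → ℕ) => H (mix S z.1 z.2))
    (hH.comp_measurable h.measurable), ← integral_map h.measurable.aemeasurable hH.1, h.map_eq]

theorem integral_splice {H : (ℕ → ℕ) → E} (hH : Integrable H (seqLaw p)) (m : ℕ) :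
    ∫ ω, H ω ∂seqLaw p = ∫ ω, ∫ ω', H (splice m ω ω') ∂seqLaw p ∂seqLaw p := by
  have h := measurePreserving_splice p m
  rw [← h.map_eq] at hH
  rw [← integral_prod (fun z : (ℕ → ℕ) × (ℕ → ℕ) => H (splice m z.1 z.2))
    (hH.comp_measurable h.measurable), ← integral_map h.measurable.aemeasurable hH.1, h.map_eq]

theorem integral_shift {H : (ℕ → ℕ) → E} (hH : StronglyMeasurable H) (m : ℕ) :
    ∫ ω, H (fun i => ω (m + i)) ∂seqLaw p = ∫ ω, H ω ∂seqLaw p := by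
  have h := measurePreserving_shift p m
  conv_rhs => rw [← h.map_eq]
  rw [integral_map h.measurable.aemeasurable hH.aestronglyMeasurable]

theorem seqLaw_real_word_eq (u : List ℕ) :
    (seqLaw p).real {ω | word ω u.length = u} = wordProb p u := by
  have : {ω | word ω u.length = u} =
      ((Finset.range u.length : Finset ℕ) : Set ℕ).pi fun i => {u.getD i 0} := by
    ext ω
    simp only [Set.mem_ofPred_eq, Set.mem_pi, Finset.mem_coe, Finset.mem_range, word,
      Set.mem_singleton_iff]
    constructor
    · intro h i hi
      have h1 : (List.ofFn fun i : Fin u.length => ω i).getD i 0 = u.getD i 0 := by rw [h]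
      rw [← h1]
      simp [hi]
    · intro h
      refine List.ext_getElem (by simp) fun i h1 h2 => ?_
      simp [h i h2, h2]
  rw [this, measureReal_def, seqLaw, Measure.infinitePi_pi _ (fun _ _ => MeasurableSet.singleton _),
    ENNReal.toReal_prod, wordProb, ← Fin.prod_univ_eq_prod_range
      (fun i => (p.toMeasure {u.getD i 0}).toReal)]
  rw [← List.prod_ofFn]
  congr 1
  refine List.ext_getElem (by simp) fun i h1 h2 => ?_
  simp only [List.length_ofFn] at h1
  simp [p.toMeasure_apply_singleton _ (MeasurableSet.singleton _)]

/-- Integration over the event that the sequence starts with a given word. -/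
theorem integral_ite_prefix (u : List ℕ) (n : ℕ) (G : List ℕ → E) :
    ∫ ω, (open Classical in if u <+: word ω (u.length + n) then G (word ω (u.length + n)) else 0)
      ∂seqLaw p = wordProb p u • ∫ ω, G (u ++ word ω n) ∂seqLaw p := by
  classical
  have h := measurePreserving_splice p u.length
  conv_lhs => rw [← h.map_eq]
  rw [integral_map h.measurable.aemeasurable ((stronglyMeasurable_word (fun l =>
    if u <+: l then G l else 0) _).aestronglyMeasurable)]
  simp only [word_splice]
  have h1 : ∀ z : (ℕ → ℕ) × (ℕ → ℕ),
      (if u <+: word z.1 u.length ++ word z.2 n then G (word z.1 u.length ++ word z.2 n) else 0) =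
      ({ω | word ω u.length = u}.indicator (fun _ => (1 : ℝ)) z.1) • G (u ++ word z.2 n) := by
    intro z
    have h2 : u <+: word z.1 u.length ++ word z.2 n ↔ word z.1 u.length = u := by
      constructor
      · intro h
        exact ((List.prefix_of_prefix_length_le h (List.prefix_append _ _)
          (by simp)).eq_of_length (by simp)).symm
      · intro h; rw [h]; exact List.prefix_append _ _
    by_cases h3 : word z.1 u.length = u
    · rw [if_pos (h2.2 h3), Set.indicator_of_mem (by exact h3), one_smul, h3]
    · rw [if_neg (fun h => h3 (h2.1 h)), Set.indicator_of_notMem (by exact h3), zero_smul]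
  simp only [h1]
  rw [integral_prod_smul (fun ω => {ω | word ω u.length = u}.indicator (fun _ => (1 : ℝ)) ω)
    (fun ω => G (u ++ word ω n))]
  congr 1
  rw [← seqLaw_real_word_eq]
  refine integral_indicator_one ?_
  exact measurableSet_setOfPred.2 (measurable_word (fun l => l = u) _)

theorem excess_word_eq (ω : ℕ → ℕ) (n : ℕ) :
    excess (word ω n) = ∑ i ∈ Finset.range n, ((ω i : ℤ) - 1) := by
  rw [excess, word, List.map_ofFn, List.sum_ofFn, ← Fin.sum_univ_eq_sum_range
    (fun i => (ω i : ℤ) - 1)]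
  rfl

theorem mem_words_iff_excess {l : List ℕ} {n : ℕ} (hn : 0 < n) (hl : l.length = n) :
    l ∈ words n (n - 1) ↔ excess l = -1 := by
  rw [mem_words, excess_eq, hl]
  constructor
  · rintro ⟨-, h⟩
    omega
  · intro h
    exact ⟨rfl, by omega⟩

/-- Integration over the event that the walk is at `-1` at time `n`: by the cycle lemma each word
in this event is, in exactly one way, a rotation of the word of a tree with `n` vertices. -/
theorem integral_ite_excess [CompleteSpace E] {n : ℕ} (G : List ℕ → E) :
    ∫ ω, (if excess (word ω n) = -1 then G (word ω n) else 0) ∂seqLaw p =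
      ∑ T ∈ trees n, wordProb p (code T) • ∑ j ∈ Finset.range n, G ((code T).rotate j) := by
  classical
  rcases Nat.eq_zero_or_pos n with rfl | hn
  · simp [trees_zero, word]
  -- The integrand is split according to the word formed by the first `n` terms.
  have h1 : ∀ ω, (if excess (word ω n) = -1 then G (word ω n) else 0) =
      ∑ l ∈ words n (n - 1), {ω | word ω l.length = l}.indicator (fun _ => (1 : ℝ)) ω • G l := by
    intro ω
    have hterm : ∀ l ∈ words n (n - 1),
        {ω | word ω l.length = l}.indicator (fun _ => (1 : ℝ)) ω • G l =
        if word ω n = l then G l else 0 := by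
      intro l hl
      simp only [Set.indicator_apply, Set.mem_ofPred_eq, (mem_words.1 hl).1]
      split_ifs <;> simp
    rw [Finset.sum_congr rfl hterm, Finset.sum_ite_eq]
    simp only [mem_words_iff_excess hn (length_word ω n)]
  simp only [h1]
  rw [integral_finsetSum]
  swap
  · intro l _
    refine Integrable.smul_const ?_ _
    exact (integrable_const _).indicator
      (measurableSet_setOfPred.2 (measurable_word (fun l' => l' = l) _))
  have h2 : ∀ l ∈ words n (n - 1),
      ∫ ω, {ω | word ω l.length = l}.indicator (fun _ => (1 : ℝ)) ω • G l ∂seqLaw p =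
      wordProb p l • G l := by
    intro l _
    rw [integral_smul_const]
    congr 1
    rw [← seqLaw_real_word_eq]
    exact integral_indicator_one (measurableSet_setOfPred.2 (measurable_word (fun l' => l' = l) _))
  rw [Finset.sum_congr rfl h2]
  simp only [Finset.smul_sum]
  rw [← Finset.sum_product']
  symm
  -- The cycle lemma: `(T, j)` is sent to the `j`-th rotation of the word of `T`, a bijection onto
  -- the words of excess `-1`, which preserves the weights.
  refine Finset.sum_bij (fun z _ => (code z.1).rotate z.2) ?_ ?_ ?_ ?_
  · rintro ⟨T, j⟩ hz
    simp only [Finset.mem_product, mem_trees, Finset.mem_range] at hz ⊢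
    rw [mem_words_iff_excess hn (by rw [List.length_rotate, length_code, hz.1]), excess,
      ((List.rotate_perm (code T) j).map _).sum_eq]
    exact excess_code T
  · rintro ⟨T, j⟩ hz ⟨T', j'⟩ hz' h
    simp only [Finset.mem_product, mem_trees, Finset.mem_range] at hz hz' h
    obtain ⟨rfl, rfl⟩ := rotate_code_inj (by omega) (by omega) h
    rfl
  · intro l hl
    have hlen := (mem_words.1 hl).1
    obtain ⟨T, j, hj, rfl⟩ := exists_rotate_code ((mem_words_iff_excess hn hlen).1 hl)
    rw [List.length_rotate, length_code] at hlen
    rw [List.length_rotate, length_code] at hj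
    exact ⟨(T, j), by simp [hlen, hlen ▸ hj], rfl⟩
  · rintro ⟨T, j⟩ hz
    rw [wordProb_rotate]

/-- The probability that the walk with steps `ξ - 1` is at `c` at time `n`. -/
noncomputable def walkProb (p : PMF ℕ) (n : ℕ) (c : ℤ) : ℝ :=
  (seqLaw p).real {ω | excess (word ω n) = c}

theorem measurableSet_excess (n : ℕ) (c : ℤ) : MeasurableSet {ω | excess (word ω n) = c} :=
  measurableSet_setOfPred.2 (measurable_word (fun l => excess l = c) _)

theorem walkProb_eq_integral (n : ℕ) (c : ℤ) :
    walkProb p n c = ∫ ω, (if excess (word ω n) = c then (1 : ℝ) else 0) ∂seqLaw p := by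
  rw [walkProb, ← integral_indicator_one (measurableSet_excess n c)]
  simp [Set.indicator_apply]

theorem walkProb_nonneg (n : ℕ) (c : ℤ) : 0 ≤ walkProb p n c := measureReal_nonneg

theorem walkProb_zero : walkProb p 0 0 = 1 := by
  simp [walkProb, word]

/-- The Otter–Dwass formula. -/
theorem mul_sizeProb (n : ℕ) : n * sizeProb p n = walkProb p n (-1) := by
  rw [walkProb_eq_integral, integral_ite_excess (fun _ => (1 : ℝ)), sizeProb_eq_sum,
    Finset.mul_sum]
  exact Finset.sum_congr rfl fun T _ => by simp [mul_comm]

theorem levelSum_additive_eq_integral (f : PlaneTree → ℝ) (n : ℕ) :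
    levelSum p (additive f) n =
      ∫ ω, (if excess (word ω n) = -1 then headToll f (word ω n) else 0) ∂seqLaw p := by
  rw [integral_ite_excess (headToll f), levelSum]
  refine Finset.sum_congr rfl fun T hT => ?_
  rw [← mem_trees.1 hT, sum_headToll_rotate, smul_eq_mul]

theorem headToll_eq_sum (f : PlaneTree → ℝ) {l : List ℕ} {n : ℕ} (hl : l.length = n) :
    headToll f l = ∑ k ∈ Finset.range (n + 1), ∑ T ∈ trees k,
      (open Classical in if code T <+: l then f T else 0) := by
  classical
  by_cases h : ∃ T, code T <+: l
  · obtain ⟨T, hT⟩ := h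
    have hlen := hT.length_le
    rw [length_code] at hlen
    rw [headToll_of_prefix f hT, Finset.sum_eq_single T.size, Finset.sum_eq_single T]
    · rw [if_pos hT]
    · intro T' _ hne
      exact if_neg fun h => hne (eq_of_code_prefix h hT)
    · intro h; simp at h
    · intro k _ hne
      refine Finset.sum_eq_zero fun T' hT' => if_neg fun h => hne ?_
      rw [← mem_trees.1 hT', eq_of_code_prefix h hT]
    · intro h; simp at h; omega
  · rw [headToll_eq_zero f h]
    symm
    refine Finset.sum_eq_zero fun k _ => Finset.sum_eq_zero fun T _ => if_neg fun hT => h ⟨T, hT⟩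

/-- Integrals in which the toll of the tree at the start of the sequence is a factor. -/
theorem integral_headToll_mul {n : ℕ} (f : PlaneTree → ℝ) (G : List ℕ → ℝ)
    (hG : ∀ k ≤ n, ∀ T ∈ trees k, Integrable (fun ω => G (code T ++ word ω (n - k))) (seqLaw p)) :
    ∫ ω, headToll f (word ω n) * G (word ω n) ∂seqLaw p =
      ∑ k ∈ Finset.range (n + 1), ∑ T ∈ trees k,
        wordProb p (code T) * (f T * ∫ ω, G (code T ++ word ω (n - k)) ∂seqLaw p) := by
  classical
  have h1 : ∀ ω, headToll f (word ω n) * G (word ω n) = ∑ k ∈ Finset.range (n + 1),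
      ∑ T ∈ trees k, (if code T <+: word ω n then f T * G (word ω n) else 0) := by
    intro ω
    rw [headToll_eq_sum f (length_word ω n), Finset.sum_mul]
    refine Finset.sum_congr rfl fun k _ => ?_
    rw [Finset.sum_mul]
    exact Finset.sum_congr rfl fun T _ => by split_ifs <;> simp
  have hterm : ∀ k ∈ Finset.range (n + 1), ∀ T ∈ trees k,
      ∫ ω, (if code T <+: word ω n then f T * G (word ω n) else 0) ∂seqLaw p =
        wordProb p (code T) * (f T * ∫ ω, G (code T ++ word ω (n - k)) ∂seqLaw p) := by
    intro k hk T hT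
    have hlen : (code T).length + (n - k) = n := by
      rw [length_code, mem_trees.1 hT]; simp at hk; omega
    have := integral_ite_prefix (p := p) (code T) (n - k) (fun l => f T * G l)
    rw [hlen] at this
    rw [this, smul_eq_mul, integral_const_mul]
  -- On the event that `code T` is a prefix, the remaining letters are independent of it, so
  -- integrability may be checked after resampling the sequence from the end of the prefix.
  have hint : ∀ k ∈ Finset.range (n + 1), ∀ T ∈ trees k,
      Integrable (fun ω => if code T <+: word ω n then f T * G (word ω n) else 0) (seqLaw p) := by
    intro k hk T hT
    have hlen : n = (code T).length + (n - k) := by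
      rw [length_code, mem_trees.1 hT]; simp at hk; omega
    have h2 : Integrable (fun ω => ‖f T * G (code T ++ word ω (n - k))‖) (seqLaw p) :=
      ((hG k (by simp at hk; omega) T hT).const_mul _).norm
    have hsm : StronglyMeasurable
        fun ω => if code T <+: word ω n then f T * G (word ω n) else 0 :=
      stronglyMeasurable_word (fun l => if code T <+: l then f T * G l else 0) n
    have h := measurePreserving_splice p (code T).length
    rw [← h.map_eq, integrable_map_measure hsm.aestronglyMeasurable h.measurable.aemeasurable]
    refine Integrable.mono' (h2.comp_snd (seqLaw p))
      (hsm.comp_measurable h.measurable).aestronglyMeasurable (ae_of_all _ fun z => ?_)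
    simp only [Function.comp_apply]
    conv_lhs => rw [hlen, word_splice]
    split_ifs with h3
    · have : word z.1 (code T).length = code T :=
        ((List.prefix_of_prefix_length_le h3 (List.prefix_append _ _)
          (by simp)).eq_of_length (by simp)).symm
      rw [this]
    · rw [norm_zero]; exact norm_nonneg _
  simp only [h1]
  rw [integral_finsetSum _ fun k hk => integrable_finsetSum _ fun T hT => hint k hk T hT]
  refine Finset.sum_congr rfl fun k hk => ?_
  rw [integral_finsetSum _ fun T hT => hint k hk T hT]
  exact Finset.sum_congr rfl fun T hT => hterm k hk T hT

/-- The first moment formula for additive functionals. -/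
theorem levelSum_additive (f : PlaneTree → ℝ) (n : ℕ) :
    levelSum p (additive f) n =
      ∑ k ∈ Finset.range (n + 1), levelSum p f k * walkProb p (n - k) 0 := by
  rw [levelSum_additive_eq_integral]
  have h1 : ∀ ω, (if excess (word ω n) = -1 then headToll f (word ω n) else 0) =
      headToll f (word ω n) * (fun l => if excess l = -1 then (1 : ℝ) else 0) (word ω n) := by
    intro ω
    simp only [mul_ite, mul_one, mul_zero]
  have h2 : ∀ k, ∀ T ∈ trees k, ∀ ω, (if excess (code T ++ word ω (n - k)) = -1 then (1 : ℝ) else 0)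
      = if excess (word ω (n - k)) = 0 then (1 : ℝ) else 0 := by
    intro k T _ ω
    rw [excess_append, excess_code]
    congr 1
    simp
  simp only [h1]
  rw [integral_headToll_mul f (fun l => if excess l = -1 then (1 : ℝ) else 0)]
  · refine Finset.sum_congr rfl fun k _ => ?_
    rw [levelSum, Finset.sum_mul]
    refine Finset.sum_congr rfl fun T hT => ?_
    simp only [h2 k T hT]
    rw [← walkProb_eq_integral, mul_assoc]
  · intro k _ T _
    refine Integrable.of_bound (C := 1) (stronglyMeasurable_word (fun l =>
      if excess (code T ++ l) = -1 then (1 : ℝ) else 0) _).aestronglyMeasurable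
      (ae_of_all _ fun ω => ?_)
    split_ifs <;> simp

/-- Conditioning the walk on its value at time `m + k` multiplies expectations of nonnegative
functions of the first `m` steps by at most a factor. -/
theorem integral_ite_excess_le {m k : ℕ} {B : ℝ} (hB : ∀ c, walkProb p k c ≤ B)
    {G : List ℕ → ℝ} (hG : ∀ l, 0 ≤ G l) (hint : Integrable (fun ω => G (word ω m)) (seqLaw p))
    (c : ℤ) :
    ∫ ω, (if excess (word ω (m + k)) = c then G (word ω m) else 0) ∂seqLaw p ≤
      B * ∫ ω, G (word ω m) ∂seqLaw p := by
  have hi : Integrable (fun ω => if excess (word ω (m + k)) = c then G (word ω m) else 0)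
      (seqLaw p) := by
    have := hint.indicator (measurableSet_excess (m + k) c)
    refine this.congr (ae_of_all _ fun ω => ?_)
    simp [Set.indicator_apply]
  rw [integral_splice hi m, ← integral_const_mul]
  -- Given the first `m` steps, the remaining `k` steps have to make up the difference.
  have hin : ∀ ω, ∫ ω', (if excess (word (splice m ω ω') (m + k)) = c
      then G (word (splice m ω ω') m) else 0) ∂seqLaw p =
      walkProb p k (c - excess (word ω m)) * G (word ω m) := by
    intro ω
    rw [walkProb_eq_integral, ← integral_mul_const]
    refine integral_congr_ae (ae_of_all _ fun ω' => ?_)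
    have h1 : word (splice m ω ω') m = word ω m := by
      have := word_splice m 0 ω ω'
      simpa [word] using this
    simp only [word_splice, h1, excess_append]
    have h2 : excess (word ω m) + excess (word ω' k) = c ↔
        excess (word ω' k) = c - excess (word ω m) := by constructor <;> intro h <;> omega
    simp [h2]
  simp only [hin]
  refine integral_mono_of_nonneg (ae_of_all _ fun ω => mul_nonneg (walkProb_nonneg _ _) (hG _))
    (hint.const_mul B) (ae_of_all _ fun ω => mul_le_mul_of_nonneg_right (hB _) (hG _))

end integrals

/-! ### Moments of factor sums over independent words -/

section window
variable {p : PMF ℕ} {f : PlaneTree → ℝ}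

theorem abs_headToll_le (f : PlaneTree → ℝ) {l : List ℕ} {n : ℕ} (hl : l.length = n) :
    |headToll f l| ≤ ∑ k ∈ Finset.range (n + 1), ∑ T ∈ trees k, |f T| := by
  rw [headToll_eq_sum f hl]
  refine (Finset.abs_sum_le_sum_abs _ _).trans (Finset.sum_le_sum fun k _ => ?_)
  refine (Finset.abs_sum_le_sum_abs _ _).trans (Finset.sum_le_sum fun T _ => ?_)
  split_ifs <;> simp

theorem exists_abs_factorSum_le (f : PlaneTree → ℝ) (n : ℕ) :
    ∃ C, ∀ l : List ℕ, l.length = n → |factorSum f l| ≤ C := by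
  induction n with
  | zero =>
    refine ⟨0, fun l hl => ?_⟩
    rw [List.eq_nil_of_length_eq_zero hl]
    simp [factorSum]
  | succ n ih =>
    obtain ⟨C, hC⟩ := ih
    refine ⟨∑ k ∈ Finset.range (n + 1 + 1), ∑ T ∈ trees k, |f T| + C, fun l hl => ?_⟩
    obtain ⟨k, l, rfl⟩ := List.exists_cons_of_length_eq_add_one hl
    rw [factorSum]
    exact (abs_add_le _ _).trans (add_le_add (abs_headToll_le f hl) (hC l (by simpa using hl)))

theorem integrable_word_of_bound {G : List ℕ → ℝ} {n : ℕ} {C : ℝ}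
    (h : ∀ l : List ℕ, l.length = n → |G l| ≤ C) :
    Integrable (fun ω => G (word ω n)) (seqLaw p) :=
  Integrable.of_bound (stronglyMeasurable_word G n).aestronglyMeasurable C
    (ae_of_all _ fun ω => h _ (length_word ω n))

theorem integrable_factorSum (n : ℕ) :
    Integrable (fun ω => factorSum f (word ω n)) (seqLaw p) :=
  integrable_word_of_bound (exists_abs_factorSum_le f n).choose_spec

theorem integrable_factorSum_sub_sq (n : ℕ) (c : ℝ) :
    Integrable (fun ω => (factorSum f (word ω n) - c) ^ 2) (seqLaw p) := by
  obtain ⟨C, hC⟩ := exists_abs_factorSum_le f n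
  refine integrable_word_of_bound (G := fun l => (factorSum f l - c) ^ 2)
    (C := (C + |c|) ^ 2) fun l hl => ?_
  rw [abs_pow]
  exact pow_le_pow_left₀ (abs_nonneg _) ((abs_sub _ _).trans (by gcongr; exact hC l hl)) 2

theorem integrable_factorSum_sq (n : ℕ) :
    Integrable (fun ω => factorSum f (word ω n) ^ 2) (seqLaw p) := by
  simpa using integrable_factorSum_sub_sq (p := p) (f := f) n 0

theorem factorSum_word_succ (ω : ℕ → ℕ) (n : ℕ) :
    factorSum f (word ω (n + 1)) =
      headToll f (word ω (n + 1)) + factorSum f (word (fun i => ω (1 + i)) n) := by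
  rw [word_succ, factorSum]
  simp only [add_comm 1]

theorem integral_word_shift (G : List ℕ → ℝ) (n : ℕ) :
    ∫ ω, G (word (fun i => ω (1 + i)) n) ∂seqLaw p = ∫ ω, G (word ω n) ∂seqLaw p :=
  integral_shift (H := fun ω => G (word ω n)) (stronglyMeasurable_word G n) 1

theorem integrable_word_shift {G : List ℕ → ℝ} {n : ℕ}
    (h : Integrable (fun ω => G (word ω n)) (seqLaw p)) :
    Integrable (fun ω => G (word (fun i => ω (1 + i)) n)) (seqLaw p) :=
  (measurePreserving_shift p 1).integrable_comp_of_integrable h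

theorem integral_headToll (n : ℕ) :
    ∫ ω, headToll f (word ω n) ∂seqLaw p = ∑ k ∈ Finset.range (n + 1), levelSum p f k := by
  have := integral_headToll_mul (p := p) (n := n) f (fun _ => 1) (fun _ _ _ _ => integrable_const _)
  simpa [levelSum] using this

theorem headToll_sq (l : List ℕ) : headToll f l ^ 2 = headToll (fun T => f T ^ 2) l := by
  by_cases h : ∃ T, code T <+: l
  · obtain ⟨T, hT⟩ := h
    rw [headToll_of_prefix _ hT, headToll_of_prefix _ hT]
  · rw [headToll_eq_zero _ h, headToll_eq_zero _ h]; simp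

theorem integrable_headToll (n : ℕ) :
    Integrable (fun ω => headToll f (word ω n)) (seqLaw p) :=
  integrable_word_of_bound fun _ hl => abs_headToll_le f hl

/-- The mean of the factor sum; the weight `m + 1 - k` is the number of possible positions of a
factor of length `k`, and vanishes (as a truncated difference) if `k > m`. -/
theorem integral_factorSum {N : ℕ} (m : ℕ) (hm : m < N) :
    ∫ ω, factorSum f (word ω m) ∂seqLaw p =
      ∑ k ∈ Finset.range N, ((m + 1 - k : ℕ) : ℝ) * levelSum p f k := by
  induction m with
  | zero =>
    rw [Finset.sum_eq_single 0 (fun k _ hk => by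
      rw [Nat.sub_eq_zero_of_le (by omega)]; simp) (by simp; omega)]
    simp [word, factorSum, levelSum_zero_right]
  | succ m ih =>
    simp only [factorSum_word_succ]
    rw [integral_add (integrable_headToll _) (integrable_word_shift (integrable_factorSum m)),
      integral_headToll, integral_word_shift, ih (by omega)]
    have h1 : ∑ k ∈ Finset.range (m + 1 + 1), levelSum p f k =
        ∑ k ∈ Finset.range N, (if k < m + 2 then levelSum p f k else 0) := by
      rw [← Finset.sum_filter]
      congr 1
      ext k; simp; omega
    rw [h1, ← Finset.sum_add_distrib]
    refine Finset.sum_congr rfl fun k _ => ?_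
    split_ifs with hk
    · rw [show m + 1 + 1 - k = (m + 1 - k) + 1 by omega]; push_cast; ring
    · rw [Nat.sub_eq_zero_of_le (by omega), Nat.sub_eq_zero_of_le (by omega)]; simp

theorem factorSum_tail_code_append (T : PlaneTree) (l : List ℕ) :
    factorSum f (code T ++ l).tail = additive f T - f T + factorSum f l := by
  have h1 := factorSum_code_append f T l
  have h2 := headToll_append f T l
  obtain ⟨ts⟩ := T
  simp only [code, List.cons_append, factorSum, List.tail_cons] at h1 h2 ⊢
  rw [h2] at h1
  linarith

/-- Given the tree `T` at the start of the word, the factors strictly inside `code T` contribute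
`additive f T - f T`, and the factors to the right of it are independent of `T`. -/
theorem integral_headToll_mul_factorSum_tail (m : ℕ) :
    ∫ ω, headToll f (word ω (m + 1)) * factorSum f (word ω (m + 1)).tail ∂seqLaw p =
      ∑ k ∈ Finset.range (m + 1 + 1), (levelSum p (fun T => f T * (additive f T - f T)) k +
        levelSum p f k * ∫ ω, factorSum f (word ω (m + 1 - k)) ∂seqLaw p) := by
  have hint : ∀ (k : ℕ) (T : PlaneTree),
      Integrable (fun ω => factorSum f (code T ++ word ω (m + 1 - k)).tail) (seqLaw p) := by
    intro k T
    simp only [factorSum_tail_code_append]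
    exact (integrable_const _).add (integrable_factorSum _)
  rw [integral_headToll_mul f (fun l => factorSum f l.tail) fun k _ T _ => hint k T]
  refine Finset.sum_congr rfl fun k _ => ?_
  rw [levelSum, levelSum, Finset.sum_mul, ← Finset.sum_add_distrib]
  refine Finset.sum_congr rfl fun T _ => ?_
  simp only [factorSum_tail_code_append]
  rw [integral_add (integrable_const _) (integrable_factorSum _)]
  simp
  ring

/-- The second moment of the factor sum: nested pairs of factors contribute the first sum, disjoint
pairs the second one. -/
theorem integral_factorSum_sq {N : ℕ} (m : ℕ) (hm : m < N) :
    ∫ ω, factorSum f (word ω m) ^ 2 ∂seqLaw p =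
      ∑ k ∈ Finset.range N, ((m + 1 - k : ℕ) : ℝ) *
          levelSum p (fun T => f T * (2 * additive f T - f T)) k +
        ∑ k ∈ Finset.range N, ∑ l ∈ Finset.range N, levelSum p f k * levelSum p f l *
          (((m + 1 - (k + l) : ℕ) : ℝ) * (((m + 1 - (k + l) : ℕ) : ℝ) + 1)) := by
  induction m with
  | zero =>
    rw [Finset.sum_eq_single 0 (fun k _ hk => by
      rw [Nat.sub_eq_zero_of_le (by omega)]; simp) (by simp; omega)]
    rw [Finset.sum_eq_zero]
    · simp [word, factorSum, levelSum_zero_right]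
    · intro k _
      refine Finset.sum_eq_zero fun l _ => ?_
      rcases Nat.eq_zero_or_pos k with rfl | hk
      · simp [levelSum_zero_right]
      · rw [Nat.sub_eq_zero_of_le (by omega)]; simp
  | succ m ih =>
    -- Removing the first letter: the square of (toll at the head) + (sum over the tail) is
    -- expanded, the induction hypothesis covering the square of the last term.
    have hsq : ∀ ω, factorSum f (word ω (m + 1)) ^ 2 = headToll (fun T => f T ^ 2) (word ω (m + 1)) +
        2 * (headToll f (word ω (m + 1)) * factorSum f (word ω (m + 1)).tail) +
        factorSum f (word (fun i => ω (1 + i)) m) ^ 2 := by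
      intro ω
      have h1 : (word ω (m + 1)).tail = word (fun i => ω (1 + i)) m := by
        rw [word_succ, List.tail_cons]; simp only [add_comm 1]
      rw [h1, factorSum_word_succ, ← headToll_sq]
      ring
    have hi : Integrable (fun ω => headToll f (word ω (m + 1)) * factorSum f (word ω (m + 1)).tail)
        (seqLaw p) := by
      obtain ⟨C, hC⟩ := exists_abs_factorSum_le f m
      refine integrable_word_of_bound (G := fun l => headToll f l * factorSum f l.tail)
        (C := (∑ k ∈ Finset.range (m + 1 + 1), ∑ T ∈ trees k, |f T|) * C) fun l hl => ?_
      rw [abs_mul]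
      exact mul_le_mul (abs_headToll_le f hl) (hC _ (by simp [hl])) (abs_nonneg _)
        ((abs_nonneg _).trans (abs_headToll_le f hl))
    simp only [hsq]
    have hi' : Integrable (fun ω => headToll (fun T => f T ^ 2) (word ω (m + 1)) +
        2 * (headToll f (word ω (m + 1)) * factorSum f (word ω (m + 1)).tail)) (seqLaw p) :=
      (integrable_headToll _).add (hi.const_mul 2)
    rw [integral_add hi' (integrable_word_shift (G := fun l => factorSum f l ^ 2) (integrable_factorSum_sq m)),
      integral_add (integrable_headToll _) (hi.const_mul 2), integral_const_mul,
      integral_headToll_mul_factorSum_tail, integral_headToll,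
      integral_word_shift (fun l => factorSum f l ^ 2), ih (by omega), Finset.mul_sum,
      ← Finset.sum_add_distrib]
    -- The sums for the first two terms are extended by zero to the common range `N`.
    have hstep : ∑ k ∈ Finset.range (m + 1 + 1), (levelSum p (fun T => f T ^ 2) k +
        2 * (levelSum p (fun T => f T * (additive f T - f T)) k +
          levelSum p f k * ∫ ω, factorSum f (word ω (m + 1 - k)) ∂seqLaw p)) =
        ∑ k ∈ Finset.range N, (if k < m + 2 then
          levelSum p (fun T => f T * (2 * additive f T - f T)) k + ∑ l ∈ Finset.range N,
            levelSum p f k * levelSum p f l * (2 * ((m + 2 - (k + l) : ℕ) : ℝ)) else 0) := by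
      rw [← Finset.sum_filter]
      have : (Finset.range N).filter (· < m + 2) = Finset.range (m + 1 + 1) := by
        ext k; simp; omega
      rw [this]
      refine Finset.sum_congr rfl fun k hk => ?_
      have hk' : k < m + 2 := Finset.mem_range.1 hk
      have h1 : levelSum p (fun T => f T * (2 * additive f T - f T)) k =
          levelSum p (fun T => f T ^ 2) k +
            2 * levelSum p (fun T => f T * (additive f T - f T)) k := by
        rw [← levelSum_const_mul, ← levelSum_add]
        exact levelSum_congr fun T _ => by ring
      rw [h1, integral_factorSum (N := N) (m + 1 - k) (by omega), Finset.mul_sum]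
      have h2 : ∑ l ∈ Finset.range N,
          levelSum p f k * levelSum p f l * (2 * ((m + 2 - (k + l) : ℕ) : ℝ)) =
          2 * ∑ l ∈ Finset.range N,
            levelSum p f k * (((m + 1 - k + 1 - l : ℕ) : ℝ) * levelSum p f l) := by
        rw [Finset.mul_sum]
        refine Finset.sum_congr rfl fun l _ => ?_
        rw [show m + 1 - k + 1 - l = m + 2 - (k + l) by omega]
        ring
      rw [h2]; ring
    rw [hstep, ← Finset.sum_add_distrib, ← Finset.sum_add_distrib, ← Finset.sum_add_distrib]
    refine Finset.sum_congr rfl fun k _ => ?_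
    split_ifs with hk
    · rw [show m + 1 + 1 - k = (m + 1 - k) + 1 by omega, add_add_add_comm, ← Finset.sum_add_distrib]
      congr 1
      · push_cast; ring
      · refine Finset.sum_congr rfl fun l _ => ?_
        rcases le_or_gt (k + l) (m + 1) with h | h
        · rw [show m + 2 - (k + l) = (m + 1 - (k + l)) + 1 by omega]
          push_cast; ring
        · rw [show m + 2 - (k + l) = 0 by omega, show m + 1 - (k + l) = 0 by omega]
          simp
    · rw [show m + 1 + 1 - k = 0 by omega, show m + 1 - k = 0 by omega]
      have : ∀ l, m + 1 - (k + l) = 0 ∧ m + 1 + 1 - (k + l) = 0 := fun l => by omega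
      simp [this]

theorem integral_factorSum_sub_sq (m : ℕ) :
    ∫ ω, (factorSum f (word ω m) - ∫ ω', factorSum f (word ω' m) ∂seqLaw p) ^ 2 ∂seqLaw p =
      ∫ ω, factorSum f (word ω m) ^ 2 ∂seqLaw p -
        (∫ ω, factorSum f (word ω m) ∂seqLaw p) ^ 2 := by
  set e := ∫ ω', factorSum f (word ω' m) ∂seqLaw p with he
  have h1 : ∀ ω, (factorSum f (word ω m) - e) ^ 2 =
      factorSum f (word ω m) ^ 2 - 2 * e * factorSum f (word ω m) + e ^ 2 := fun ω => by ring
  simp only [h1]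
  have h2 : Integrable (fun ω => factorSum f (word ω m) ^ 2 - 2 * e * factorSum f (word ω m))
      (seqLaw p) := (integrable_factorSum_sq m).sub ((integrable_factorSum m).const_mul _)
  rw [integral_add h2 (integrable_const _), integral_sub (integrable_factorSum_sq m)
    ((integrable_factorSum m).const_mul _), integral_const_mul, ← he]
  simp
  ring

/-- The weight of the pair of sizes `(k, l)` in the variance of the factor sum over a word of length
`m`: the number of ordered placements of two disjoint factors, minus the product of the means, plus
the terms from centring. The first difference is truncated, as no disjoint placement exists for `k +
l > m`. -/
def pairWeight (m k l : ℕ) : ℝ :=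
  ((m + 1 - (k + l) : ℕ) : ℝ) * (((m + 1 - (k + l) : ℕ) : ℝ) + 1) -
    ((m : ℝ) + 1 - k) * ((m : ℝ) + 1 - l) + k * ((m : ℝ) + 1 - k) + l * ((m : ℝ) + 1 - l)

/-- The quadratic terms in `m` cancel, which makes the variance linear in `m`. -/
theorem pairWeight_of_le {m k l : ℕ} (h : k + l ≤ m + 1) :
    pairWeight m k l = m + 1 - k - l + k * l := by
  rw [pairWeight, Nat.cast_sub h]
  push_cast; ring

theorem pairWeight_nonneg {m k l : ℕ} (hk : k ≤ m) (hl : l ≤ m) : 0 ≤ pairWeight m k l := by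
  rcases le_or_gt (k + l) (m + 1) with h | h
  · rw [pairWeight_of_le h]
    have : ((k + l : ℕ) : ℝ) ≤ m + 1 := by exact_mod_cast h
    push_cast at this
    have : (0 : ℝ) ≤ k * l := by positivity
    linarith
  · rw [pairWeight, Nat.sub_eq_zero_of_le h.le]
    have h1 : (k : ℝ) ≤ m := by exact_mod_cast hk
    have h2 : (l : ℝ) ≤ m := by exact_mod_cast hl
    have h3 : (m : ℝ) + 1 < k + l := by exact_mod_cast h
    push_cast
    nlinarith [mul_nonneg (sub_nonneg.2 h1) (sub_nonneg.2 h2)]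

theorem pairWeight_le {m k l : ℕ} : pairWeight m k l ≤ m + 1 + k * l := by
  rcases le_or_gt (k + l) (m + 1) with h | h
  · rw [pairWeight_of_le h]
    have : (0 : ℝ) ≤ k := by positivity
    have : (0 : ℝ) ≤ l := by positivity
    linarith
  · rw [pairWeight, Nat.sub_eq_zero_of_le h.le]
    push_cast
    nlinarith [sq_nonneg ((m : ℝ) + 1 - k - l), (by positivity : (0 : ℝ) ≤ m)]

/-- The variance of the factor sum. Centering `additive f` at `k M` on trees of size `k` brings out
the cancellation between nested and disjoint pairs. -/
theorem variance_factorSum (m : ℕ) {M : ℝ}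
    (hM : M = ∑ k ∈ Finset.range (m + 1), levelSum p f k) :
    ∫ ω, (factorSum f (word ω m) - ∫ ω', factorSum f (word ω' m) ∂seqLaw p) ^ 2 ∂seqLaw p =
      ∑ k ∈ Finset.range (m + 1), ((m : ℝ) + 1 - k) *
        levelSum p (fun T => f T * (2 * (additive f T - k * M) - f T)) k +
      ∑ k ∈ Finset.range (m + 1), ∑ l ∈ Finset.range (m + 1),
        levelSum p f k * levelSum p f l * pairWeight m k l := by
  rw [integral_factorSum_sub_sq, integral_factorSum_sq (N := m + 1) m (by omega),
    integral_factorSum (N := m + 1) m (by omega)]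
  have hc : ∀ k ∈ Finset.range (m + 1), ((m + 1 - k : ℕ) : ℝ) = (m : ℝ) + 1 - k := by
    intro k hk
    rw [Nat.cast_sub (by simp at hk; omega)]; push_cast; rfl
  have h1 : ∀ k : ℕ, levelSum p (fun T => f T * (2 * (additive f T - k * M) - f T)) k =
      levelSum p (fun T => f T * (2 * additive f T - f T)) k - 2 * k * M * levelSum p f k := by
    intro k
    rw [← levelSum_const_mul, ← levelSum_sub]
    exact levelSum_congr fun T _ => by ring
  -- Since `M` is the sum of the `levelSum p f l`, the centring terms become a double sum, made
  -- symmetric in `k` and `l`.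
  have h2 : ∑ k ∈ Finset.range (m + 1), ((m : ℝ) + 1 - k) * (2 * k * M * levelSum p f k) =
      ∑ k ∈ Finset.range (m + 1), ∑ l ∈ Finset.range (m + 1), levelSum p f k * levelSum p f l *
        (k * ((m : ℝ) + 1 - k) + l * ((m : ℝ) + 1 - l)) := by
    have h3 : ∑ k ∈ Finset.range (m + 1), ∑ l ∈ Finset.range (m + 1),
        levelSum p f k * levelSum p f l * (l * ((m : ℝ) + 1 - l)) =
        ∑ k ∈ Finset.range (m + 1), ∑ l ∈ Finset.range (m + 1),
        levelSum p f k * levelSum p f l * (k * ((m : ℝ) + 1 - k)) := by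
      rw [Finset.sum_comm]
      exact Finset.sum_congr rfl fun k _ => Finset.sum_congr rfl fun l _ => by ring
    simp only [mul_add (_ * _), Finset.sum_add_distrib, h3]
    rw [← Finset.sum_add_distrib]
    refine Finset.sum_congr rfl fun k _ => ?_
    rw [← two_mul, Finset.mul_sum, hM, Finset.mul_sum, Finset.sum_mul, Finset.mul_sum]
    exact Finset.sum_congr rfl fun l _ => by ring
  have h4 : ∑ k ∈ Finset.range (m + 1), ∑ l ∈ Finset.range (m + 1),
      levelSum p f k * levelSum p f l * pairWeight m k l =
      ∑ k ∈ Finset.range (m + 1), ∑ l ∈ Finset.range (m + 1), levelSum p f k * levelSum p f l *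
          (((m + 1 - (k + l) : ℕ) : ℝ) * (((m + 1 - (k + l) : ℕ) : ℝ) + 1)) -
      (∑ k ∈ Finset.range (m + 1), ((m : ℝ) + 1 - k) * levelSum p f k) ^ 2 +
      ∑ k ∈ Finset.range (m + 1), ∑ l ∈ Finset.range (m + 1), levelSum p f k * levelSum p f l *
        (k * ((m : ℝ) + 1 - k) + l * ((m : ℝ) + 1 - l)) := by
    rw [sq, Finset.sum_mul_sum, ← Finset.sum_sub_distrib, ← Finset.sum_add_distrib]
    refine Finset.sum_congr rfl fun k _ => ?_
    rw [← Finset.sum_sub_distrib, ← Finset.sum_add_distrib]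
    refine Finset.sum_congr rfl fun l _ => ?_
    rw [pairWeight]; ring
  have h5 : ∑ k ∈ Finset.range (m + 1), ((m : ℝ) + 1 - k) *
        levelSum p (fun T => f T * (2 * (additive f T - k * M) - f T)) k =
      ∑ k ∈ Finset.range (m + 1), ((m : ℝ) + 1 - k) *
        levelSum p (fun T => f T * (2 * additive f T - f T)) k -
      ∑ k ∈ Finset.range (m + 1), ((m : ℝ) + 1 - k) * (2 * k * M * levelSum p f k) := by
    rw [← Finset.sum_sub_distrib]
    exact Finset.sum_congr rfl fun k _ => by rw [h1 k]; ring
  have h6 : ∀ b : ℕ → ℝ, ∑ k ∈ Finset.range (m + 1), ((m + 1 - k : ℕ) : ℝ) * b k =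
      ∑ k ∈ Finset.range (m + 1), ((m : ℝ) + 1 - k) * b k :=
    fun b => Finset.sum_congr rfl fun k hk => by rw [hc k hk]
  rw [h6, h6, h4, h5, h2]
  ring

/-- An upper bound for the variance of the factor sum. -/
theorem variance_factorSum_le (m : ℕ) {M : ℝ}
    (hM : M = ∑ k ∈ Finset.range (m + 1), levelSum p f k) :
    ∫ ω, (factorSum f (word ω m) - ∫ ω', factorSum f (word ω' m) ∂seqLaw p) ^ 2 ∂seqLaw p ≤
      ((m : ℝ) + 1) * (∑ k ∈ Finset.range (m + 1),
        2 * levelSum p (fun T => |f T * (additive f T - k * M)|) k) +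
      ((m : ℝ) + 1) * (∑ k ∈ Finset.range (m + 1), |levelSum p f k|) ^ 2 +
      (∑ k ∈ Finset.range (m + 1), (k : ℝ) * |levelSum p f k|) ^ 2 := by
  rw [variance_factorSum m hM, add_assoc]
  refine add_le_add ?_ ?_
  · rw [Finset.mul_sum]
    refine Finset.sum_le_sum fun k hk => ?_
    have hk' : (k : ℝ) ≤ m := by exact_mod_cast Nat.lt_succ_iff.1 (Finset.mem_range.1 hk)
    have h1 : levelSum p (fun T => f T * (2 * (additive f T - k * M) - f T)) k ≤
        2 * levelSum p (fun T => |f T * (additive f T - k * M)|) k := by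
      rw [← levelSum_const_mul]
      refine levelSum_mono fun T _ => ?_
      nlinarith [le_abs_self (f T * (additive f T - k * M)), sq_nonneg (f T)]
    have h0 : 0 ≤ 2 * levelSum p (fun T => |f T * (additive f T - k * M)|) k :=
      mul_nonneg zero_le_two (levelSum_nonneg fun T _ => abs_nonneg _)
    have hk0 : (0 : ℝ) ≤ k := by positivity
    calc ((m : ℝ) + 1 - k) * levelSum p (fun T => f T * (2 * (additive f T - k * M) - f T)) k
        ≤ ((m : ℝ) + 1 - k) * (2 * levelSum p (fun T => |f T * (additive f T - k * M)|) k) :=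
          mul_le_mul_of_nonneg_left h1 (by linarith)
      _ ≤ _ := mul_le_mul_of_nonneg_right (by linarith) h0
  · rw [sq, sq, Finset.sum_mul_sum, Finset.sum_mul_sum, Finset.mul_sum, ← Finset.sum_add_distrib]
    refine Finset.sum_le_sum fun k hk => ?_
    rw [Finset.mul_sum, ← Finset.sum_add_distrib]
    refine Finset.sum_le_sum fun l hl => ?_
    have h1 := pairWeight_nonneg (Nat.lt_succ_iff.1 (Finset.mem_range.1 hk))
      (Nat.lt_succ_iff.1 (Finset.mem_range.1 hl))
    calc levelSum p f k * levelSum p f l * pairWeight m k l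
        ≤ |levelSum p f k| * |levelSum p f l| * pairWeight m k l := by
          rw [← abs_mul]
          exact mul_le_mul_of_nonneg_right (le_abs_self _) h1
      _ ≤ |levelSum p f k| * |levelSum p f l| * (m + 1 + k * l) :=
          mul_le_mul_of_nonneg_left pairWeight_le (by positivity)
      _ = _ := by ring

end window

/-! ### The walk -/

/-- The standing assumptions on the offspring distribution: mean `1` and finite variance
`σsq > 0`. -/
structure IsCritical (p : PMF ℕ) (σsq : ℝ) : Prop where
  memLp : MemLp (fun k : ℕ => (k : ℝ)) 2 p.toMeasure
  mean : ∫ k : ℕ, (k : ℝ) ∂p.toMeasure = 1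
  var : σsq = Var[fun k : ℕ => (k : ℝ); p.toMeasure]
  pos : 0 < σsq

namespace IsCritical
variable {p : PMF ℕ} {σsq : ℝ} (hp : IsCritical p σsq)
include hp

theorem memLp_step : MemLp (fun k : ℕ => (k : ℝ) - 1) 2 p.toMeasure :=
  hp.memLp.sub (memLp_const 1)

theorem integrable_step : Integrable (fun k : ℕ => (k : ℝ) - 1) p.toMeasure :=
  hp.memLp_step.integrable one_le_two

theorem integral_step : ∫ k : ℕ, ((k : ℝ) - 1) ∂p.toMeasure = 0 := by
  rw [integral_sub (hp.memLp.integrable one_le_two) (integrable_const _), hp.mean]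
  simp

theorem integral_step_sq : ∫ k : ℕ, ((k : ℝ) - 1) ^ 2 ∂p.toMeasure = σsq := by
  rw [hp.var, variance_eq_integral hp.memLp.1.aemeasurable, hp.mean]

end IsCritical

/-! ### Characteristic functions of a single step -/

theorem integrable_of_norm_le_pmf {E : Type*} [NormedAddCommGroup E] (p : PMF ℕ) {g : ℕ → E} (C : ℝ)
    (h : ∀ k, ‖g k‖ ≤ C) : Integrable g p.toMeasure :=
  Integrable.of_bound StronglyMeasurable.of_discrete.aestronglyMeasurable C (ae_of_all _ h)

theorem toMeasure_real_singleton (p : PMF ℕ) (k : ℕ) : p.toMeasure.real {k} = (p k).toReal := by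
  rw [measureReal_def, p.toMeasure_apply_singleton _ (MeasurableSet.singleton k)]

theorem toReal_pos_of_ne_zero (p : PMF ℕ) {k : ℕ} (h : p k ≠ 0) : 0 < (p k).toReal :=
  ENNReal.toReal_pos h (p.apply_ne_top k)

/-- A single atom bounds the integral of a nonnegative function from below. -/
theorem mul_le_integral_pmf (p : PMF ℕ) {g : ℕ → ℝ} (hg : Integrable g p.toMeasure)
    (h0 : ∀ k, 0 ≤ g k) (k : ℕ) : (p k).toReal * g k ≤ ∫ j, g j ∂p.toMeasure := by
  calc (p k).toReal * g k = ∫ j in {k}, g j ∂p.toMeasure := by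
        rw [integral_singleton, toMeasure_real_singleton, smul_eq_mul]
    _ ≤ _ := setIntegral_le_integral hg (ae_of_all _ h0)

theorem ae_pmf_iff (p : PMF ℕ) {P : ℕ → Prop} :
    (∀ᵐ k ∂p.toMeasure, P k) ↔ ∀ k, p k ≠ 0 → P k := by
  rw [ae_iff_of_countable]
  simp only [p.toMeasure_apply_singleton _ (MeasurableSet.singleton _)]

namespace IsCritical
variable {p : PMF ℕ} {σsq : ℝ} (hp : IsCritical p σsq)
include hp

theorem exists_ne_one : ∃ k, p k ≠ 0 ∧ k ≠ 1 := by
  by_contra! h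
  have h1 : ∫ k : ℕ, ((k : ℝ) - 1) ^ 2 ∂p.toMeasure = 0 := by
    refine integral_eq_zero_of_ae ((ae_pmf_iff p).2 fun k hk => ?_)
    simp [h k hk]
  rw [hp.integral_step_sq] at h1
  exact hp.pos.ne' h1

theorem zero_ne_zero : p 0 ≠ 0 := by
  intro h0
  obtain ⟨k, hk, hk1⟩ := hp.exists_ne_one
  have hnn : 0 ≤ᵐ[p.toMeasure] fun k : ℕ => (k : ℝ) - 1 := by
    refine (ae_pmf_iff p).2 fun j hj => ?_
    have : j ≠ 0 := fun h => hj (h ▸ h0)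
    have : (1 : ℝ) ≤ j := by exact_mod_cast Nat.one_le_iff_ne_zero.2 this
    simpa using this
  have := (integral_eq_zero_iff_of_nonneg_ae hnn hp.integrable_step).1 hp.integral_step
  have h2 := (ae_pmf_iff p).1 this k hk
  simp only [Pi.zero_apply, sub_eq_zero, Nat.cast_eq_one] at h2
  exact hk1 h2

theorem exists_pos : ∃ k, p k ≠ 0 ∧ 0 < k := by
  by_contra! h
  have : ∫ k : ℕ, (k : ℝ) ∂p.toMeasure = 0 := by
    refine integral_eq_zero_of_ae ((ae_pmf_iff p).2 fun k hk => ?_)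
    simpa using h k hk
  rw [hp.mean] at this
  exact one_ne_zero this

omit hp in
theorem exists_zmultiples (p : PMF ℕ) : ∃ d : ℕ,
    AddSubgroup.closure {z : ℤ | ∃ k : ℕ, p k ≠ 0 ∧ z = k} = AddSubgroup.zmultiples (d : ℤ) := by
  obtain ⟨a, ha⟩ := Int.subgroup_cyclic (AddSubgroup.closure {z : ℤ | ∃ k : ℕ, p k ≠ 0 ∧ z = k})
  refine ⟨a.natAbs, ?_⟩
  rw [ha, Int.zmultiples_natAbs]
  exact (AddSubgroup.zmultiples_eq_closure a).symm

omit hp in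
variable (p) in
/-- The span of the offspring distribution: the nonnegative generator of the subgroup of `ℤ`
generated by the support. -/
noncomputable def _root_.PlaneTree.span : ℕ := (exists_zmultiples p).choose

omit hp in
theorem _root_.PlaneTree.closure_support (p : PMF ℕ) :
    AddSubgroup.closure {z : ℤ | ∃ k : ℕ, p k ≠ 0 ∧ z = k} =
      AddSubgroup.zmultiples (span p : ℤ) := (exists_zmultiples p).choose_spec

omit hp in
theorem _root_.PlaneTree.span_dvd {k : ℕ} (hk : p k ≠ 0) : (span p : ℤ) ∣ k := by
  rw [← Int.mem_zmultiples_iff, ← closure_support p]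
  exact AddSubgroup.subset_closure ⟨k, hk, rfl⟩

theorem span_pos : 0 < span p := by
  obtain ⟨k, hk, hk0⟩ := hp.exists_pos
  exact Nat.pos_of_dvd_of_pos (by exact_mod_cast span_dvd hk) hk0

omit hp in
/-- If `θ k` is a multiple of `2 π` for all `k` in the support, then so is `θ` times the span. -/
theorem _root_.PlaneTree.exists_span_mul_eq {θ : ℝ}
    (h : ∀ k : ℕ, p k ≠ 0 → ∃ z : ℤ, (z : ℝ) * (2 * Real.pi) = θ * k) :
    ∃ z : ℤ, (z : ℝ) * (2 * Real.pi) = θ * span p := by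
  have hmem : (span p : ℤ) ∈ AddSubgroup.closure {z : ℤ | ∃ k : ℕ, p k ≠ 0 ∧ z = k} := by
    rw [closure_support]; exact AddSubgroup.mem_zmultiples _
  have := AddSubgroup.closure_induction (p := fun (y : ℤ) _ =>
    ∃ z : ℤ, (z : ℝ) * (2 * Real.pi) = θ * y) ?_ ⟨0, by simp⟩ ?_ ?_ hmem
  · simpa using this
  · rintro y ⟨k, hk, rfl⟩
    simpa using h k hk
  · rintro x y _ _ ⟨z, hz⟩ ⟨z', hz'⟩
    exact ⟨z + z', by push_cast; linarith⟩
  · rintro x _ ⟨z, hz⟩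
    exact ⟨-z, by push_cast; linarith⟩

omit hp in
theorem _root_.PlaneTree.continuous_integral_one_sub_cos (p : PMF ℕ) :
    Continuous fun θ : ℝ => ∫ k : ℕ, (1 - Real.cos (θ * k)) ∂p.toMeasure := by
  refine continuous_of_dominated (bound := fun _ => 2)
    (fun θ => StronglyMeasurable.of_discrete.aestronglyMeasurable)
    (fun θ => ae_of_all _ fun k => ?_) (integrable_const _) (ae_of_all _ fun k => by fun_prop)
  rw [Real.norm_eq_abs, abs_le]
  constructor <;> linarith [Real.cos_le_one (θ * k), Real.neg_one_le_cos (θ * k)]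

/-- On a period of the characteristic function, `1 - Re 𝔼 e^{iθξ}` is at least of order `θ²`. -/
theorem exists_mul_sq_le_integral : ∃ c > 0, ∀ θ : ℝ, |θ| ≤ Real.pi / span p →
    c * θ ^ 2 ≤ ∫ k : ℕ, (1 - Real.cos (θ * k)) ∂p.toMeasure := by
  set ρ : ℝ → ℝ := fun θ => ∫ k : ℕ, (1 - Real.cos (θ * k)) ∂p.toMeasure with hρ
  have hint : ∀ θ : ℝ, Integrable (fun k : ℕ => 1 - Real.cos (θ * k)) p.toMeasure := fun θ =>
    integrable_of_norm_le_pmf p 2 fun k => by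
      rw [Real.norm_eq_abs, abs_le]
      constructor <;> linarith [Real.cos_le_one (θ * k), Real.neg_one_le_cos (θ * k)]
  have hnn : ∀ (θ : ℝ) (k : ℕ), 0 ≤ 1 - Real.cos (θ * k) := fun θ k => by
    linarith [Real.cos_le_one (θ * k)]
  have hd : (0 : ℝ) < span p := by exact_mod_cast hp.span_pos
  obtain ⟨k₀, hk₀, hk₀'⟩ := hp.exists_pos
  have hk₀r : (1 : ℝ) ≤ k₀ := by exact_mod_cast hk₀'
  have hpk := toReal_pos_of_ne_zero p hk₀
  have hpi := Real.pi_pos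
  -- Near zero a single point `k₀` of the support suffices, as `1 - cos x ≥ 2 x² / π²` for `|x| ≤
  -- π`.
  have hsmall : ∀ θ : ℝ, |θ| ≤ Real.pi / k₀ →
      (p k₀).toReal * (2 / Real.pi ^ 2) * θ ^ 2 ≤ ρ θ := by
    intro θ hθ
    have h1 : |θ * k₀| ≤ Real.pi := by
      rw [abs_mul, Nat.abs_cast]
      rwa [le_div_iff₀ (by linarith)] at hθ
    have h2 := Real.cos_le_one_sub_mul_cos_sq h1
    have h3 := mul_le_integral_pmf p (hint θ) (hnn θ) k₀
    refine le_trans ?_ h3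
    rw [mul_assoc]
    refine mul_le_mul_of_nonneg_left ?_ hpk.le
    have h4 : θ ^ 2 ≤ (θ * k₀) ^ 2 := by
      rw [mul_pow]; exact le_mul_of_one_le_right (sq_nonneg θ) (one_le_pow₀ hk₀r)
    have h5 : 2 / Real.pi ^ 2 * θ ^ 2 ≤ 2 / Real.pi ^ 2 * (θ * k₀) ^ 2 :=
      mul_le_mul_of_nonneg_left h4 (by positivity)
    linarith
  -- Away from zero the integral is positive, since it vanishes only if `θ k` is a multiple of `2 π`
  -- for all `k` in the support, that is, only if `θ` times the span is one. By compactness it is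
  -- bounded below.
  have hpos : ∀ θ : ℝ, |θ| ≤ Real.pi / span p → θ ≠ 0 → 0 < ρ θ := by
    intro θ hθ h0
    refine lt_of_le_of_ne (integral_nonneg (hnn θ)) fun h => h0 ?_
    have h1 := (integral_eq_zero_iff_of_nonneg (hnn θ) (hint θ)).1 h.symm
    obtain ⟨z, hz⟩ := exists_span_mul_eq (p := p) (θ := θ) fun k hk => by
      have := (ae_pmf_iff p).1 h1 k hk
      simp only [Pi.zero_apply] at this
      exact (Real.cos_eq_one_iff _).1 (by linarith)
    rw [le_div_iff₀ hd] at hθ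
    have h2 : |(z : ℝ)| * (2 * Real.pi) ≤ Real.pi := by
      rw [← abs_of_pos hd, ← abs_mul, ← hz, abs_mul, abs_of_pos (by positivity : 0 < 2 * Real.pi)]
        at hθ
      exact hθ
    have h3 : |(z : ℝ)| < 1 := by
      by_contra! h3
      nlinarith
    have h4 : z = 0 := by
      rw [← Int.cast_abs] at h3
      exact Int.abs_lt_one_iff.1 (by exact_mod_cast h3)
    rw [h4] at hz
    simp only [Int.cast_zero, zero_mul] at hz
    rcases mul_eq_zero.1 hz.symm with h | h
    · exact h
    · exact absurd h hd.ne'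
  set S : Set ℝ := Set.Icc (-(Real.pi / span p)) (Real.pi / span p) ∩
    {θ | Real.pi / k₀ ≤ |θ|} with hS
  have hScomp : IsCompact S :=
    isCompact_Icc.inter_right (isClosed_le continuous_const continuous_abs)
  have hlow : ∃ c > 0, ∀ θ ∈ S, c ≤ ρ θ := by
    rcases S.eq_empty_or_nonempty with h | h
    · exact ⟨1, one_pos, by simp [h]⟩
    · obtain ⟨θ₀, hθ₀, hmin⟩ := hScomp.exists_isMinOn h
        (continuous_integral_one_sub_cos p).continuousOn
      refine ⟨ρ θ₀, hpos θ₀ (abs_le.2 hθ₀.1) ?_, fun θ hθ => hmin hθ⟩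
      rintro rfl
      have : Real.pi / k₀ ≤ 0 := by simpa using hθ₀.2
      have : 0 < Real.pi / k₀ := by positivity
      linarith
  obtain ⟨c, hc, hcS⟩ := hlow
  refine ⟨min ((p k₀).toReal * (2 / Real.pi ^ 2)) (c / (Real.pi / span p) ^ 2), by positivity,
    fun θ hθ => ?_⟩
  rcases le_total |θ| (Real.pi / k₀) with h | h
  · exact (mul_le_mul_of_nonneg_right (min_le_left _ _) (sq_nonneg _)).trans (hsmall θ h)
  · refine (mul_le_mul_of_nonneg_right (min_le_right _ _) (sq_nonneg _)).trans ?_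
    have h1 : θ ^ 2 ≤ (Real.pi / span p) ^ 2 := sq_le_sq' (abs_le.1 hθ).1 (abs_le.1 hθ).2
    calc c / (Real.pi / span p) ^ 2 * θ ^ 2 ≤ c / (Real.pi / span p) ^ 2 * (Real.pi / span p) ^ 2 :=
          mul_le_mul_of_nonneg_left h1 (by positivity)
      _ = c := by field_simp
      _ ≤ ρ θ := hcS θ ⟨abs_le.1 hθ, h⟩

/-- A Gaussian bound for the characteristic function of a step, uniform under bounded
perturbations of the exponent. -/
theorem exists_norm_integral_exp_le : ∃ c > 0, ∀ (y : ℕ → ℝ) (b θ : ℝ), |θ| ≤ Real.pi / span p →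
    (∀ k, |y k - y 0| ≤ b) →
    ‖∫ k : ℕ, Complex.exp ((y k + θ * k : ℝ) * Complex.I) ∂p.toMeasure‖ ≤
      Real.exp (b ^ 2 - c * θ ^ 2) := by
  obtain ⟨c, hc, hcos⟩ := hp.exists_mul_sq_le_integral
  have hp0 := toReal_pos_of_ne_zero p hp.zero_ne_zero
  have hp1 : (p 0).toReal ≤ 1 := by
    rw [← toMeasure_real_singleton]; exact measureReal_le_one
  refine ⟨(p 0).toReal * c / 4, by positivity, fun y b θ hθ hy => ?_⟩
  set Z : ℕ → ℝ := fun k => y k + θ * k with hZ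
  set M := ∫ k : ℕ, Complex.exp ((Z k : ℝ) * Complex.I) ∂p.toMeasure with hM
  have hb : 0 ≤ b := (abs_nonneg _).trans (hy 0)
  have hexp : Integrable (fun k : ℕ => Complex.exp ((Z k : ℝ) * Complex.I)) p.toMeasure :=
    integrable_of_norm_le_pmf p 1 fun k => by rw [Complex.norm_exp_ofReal_mul_I]
  have hcosint : ∀ l, Integrable (fun k => Real.cos (Z k - Z l)) p.toMeasure := fun l =>
    integrable_of_norm_le_pmf p 1 fun k => by
      rw [Real.norm_eq_abs]; exact Real.abs_cos_le_one _
  -- `|M|² = 𝔼 cos(Z - Z')` for an independent copy `Z'` of `Z`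
  have hre : ∀ l, (M * (starRingEnd ℂ) (Complex.exp ((Z l : ℝ) * Complex.I))).re =
      ∫ k, Real.cos (Z k - Z l) ∂p.toMeasure := by
    intro l
    rw [hM, ← integral_mul_const, ← RCLike.re_eq_complex_re,
      ← integral_re (hexp.mul_const _)]
    refine integral_congr_ae (ae_of_all _ fun k => ?_)
    simp only [RCLike.re_eq_complex_re]
    rw [← Complex.exp_conj, ← Complex.exp_add]
    have : (Z k : ℂ) * Complex.I + (starRingEnd ℂ) ((Z l : ℂ) * Complex.I) =
        ((Z k - Z l : ℝ) : ℂ) * Complex.I := by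
      simp; ring
    rw [this, Complex.exp_ofReal_mul_I_re]
  have hnorm : ‖M‖ ^ 2 = ∫ l, ∫ k, Real.cos (Z k - Z l) ∂p.toMeasure ∂p.toMeasure := by
    simp only [← hre]
    have h1 : Integrable (fun l => M * (starRingEnd ℂ) (Complex.exp ((Z l : ℝ) * Complex.I)))
        p.toMeasure := integrable_of_norm_le_pmf p ‖M‖ fun k => by
      rw [norm_mul, RCLike.norm_conj, Complex.norm_exp_ofReal_mul_I, mul_one]
    have h2 := integral_re h1
    simp only [RCLike.re_eq_complex_re] at h2
    rw [h2, integral_const_mul, integral_conj, ← hM, Complex.mul_conj, Complex.ofReal_re,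
      Complex.normSq_eq_norm_sq]
  have hnn : ∀ l, 0 ≤ 1 - ∫ k, Real.cos (Z k - Z l) ∂p.toMeasure := by
    intro l
    have : ∫ k, Real.cos (Z k - Z l) ∂p.toMeasure ≤ ∫ k : ℕ, (1 : ℝ) ∂p.toMeasure :=
      integral_mono (hcosint l) (integrable_const _) fun k => Real.cos_le_one _
    simp at this
    linarith
  have hbd : ∀ l, |∫ k, Real.cos (Z k - Z l) ∂p.toMeasure| ≤ 1 := by
    intro l
    refine (abs_integral_le_integral_abs).trans ?_
    have : ∫ k, |Real.cos (Z k - Z l)| ∂p.toMeasure ≤ ∫ k : ℕ, (1 : ℝ) ∂p.toMeasure :=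
      integral_mono (hcosint l).abs (integrable_const _) fun k => Real.abs_cos_le_one _
    simpa using this
  have hint2 : Integrable (fun l => ∫ k, Real.cos (Z k - Z l) ∂p.toMeasure) p.toMeasure :=
    integrable_of_norm_le_pmf p 1 hbd
  -- Only the atom of `Z'` at the offspring number `0` is kept.
  have h3 : (p 0).toReal * (1 - ∫ k, Real.cos (Z k - Z 0) ∂p.toMeasure) ≤ 1 - ‖M‖ ^ 2 := by
    refine (mul_le_integral_pmf p ((integrable_const 1).sub hint2) hnn 0).trans (le_of_eq ?_)
    simp only [Pi.sub_apply]
    rw [integral_sub (integrable_const _) hint2, hnorm]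
    simp
  have h4 : c * θ ^ 2 / 2 - b ^ 2 / 2 ≤ 1 - ∫ k, Real.cos (Z k - Z 0) ∂p.toMeasure := by
    have h5 : ∀ k : ℕ, (1 - Real.cos (θ * k)) / 2 - b ^ 2 / 2 ≤ 1 - Real.cos (Z k - Z 0) := by
      intro k
      have h6 : Z k - Z 0 = θ * k + (y k - y 0) := by simp [hZ]; ring
      have h7 : 1 - (y k - y 0) ^ 2 / 2 ≤ Real.cos (y k - y 0) := Real.one_sub_sq_div_two_le_cos
      have h8 : (y k - y 0) ^ 2 ≤ b ^ 2 := sq_le_sq' (abs_le.1 (hy k)).1 (abs_le.1 (hy k)).2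
      -- `|e^{i(x+y)} - 1| ≥ |e^{ix} - 1| - |e^{iy} - 1|`, squared
      have h9 : (1 - Real.cos (θ * k)) / 2 - (1 - Real.cos (y k - y 0)) ≤
          1 - Real.cos (θ * k + (y k - y 0)) := by
        have e1 := Real.cos_sub (θ * k + (y k - y 0)) (θ * k)
        rw [add_sub_cancel_left] at e1
        have e2 := Real.sin_sq_add_cos_sq (θ * k)
        have e3 := Real.sin_sq_add_cos_sq (θ * k + (y k - y 0))
        nlinarith [sq_nonneg (2 * Real.cos (θ * k + (y k - y 0)) - 1 - Real.cos (θ * k)),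
          sq_nonneg (2 * Real.sin (θ * k + (y k - y 0)) - Real.sin (θ * k))]
      rw [h6]; linarith
    have hi0 : Integrable (fun k : ℕ => (1 - Real.cos (θ * k)) / 2) p.toMeasure := by
      refine Integrable.div_const ((integrable_const _).sub ?_) _
      exact integrable_of_norm_le_pmf p 1 fun k => by
        rw [Real.norm_eq_abs]; exact Real.abs_cos_le_one _
    have hi1 : Integrable (fun k : ℕ => (1 - Real.cos (θ * k)) / 2 - b ^ 2 / 2) p.toMeasure :=
      hi0.sub (integrable_const _)
    have h10 := integral_mono hi1 ((integrable_const 1).sub (hcosint 0)) h5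
    rw [integral_sub hi0 (integrable_const _),
      integral_div] at h10
    simp only [Pi.sub_apply] at h10
    rw [integral_sub (integrable_const _) (hcosint 0)] at h10
    simp only [integral_const, probReal_univ, smul_eq_mul, one_mul] at h10
    have := hcos θ hθ
    linarith
  -- `p 0 ≤ 1` and `1 + x ≤ e ^ x`.
  have h11 : ‖M‖ ^ 2 ≤ Real.exp (b ^ 2 - (p 0).toReal * c / 4 * θ ^ 2) ^ 2 := by
    have h12 : (p 0).toReal * (c * θ ^ 2 / 2 - b ^ 2 / 2) ≤ 1 - ‖M‖ ^ 2 :=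
      (mul_le_mul_of_nonneg_left h4 hp0.le).trans h3
    rw [← Real.exp_nat_mul]
    have h13 := Real.add_one_le_exp (((2 : ℕ) : ℝ) * (b ^ 2 - (p 0).toReal * c / 4 * θ ^ 2))
    refine le_trans ?_ h13
    push_cast
    nlinarith [sq_nonneg b]
  exact (sq_le_sq₀ (norm_nonneg _) (Real.exp_pos _).le).1 h11

end IsCritical

/-! ### Fourier inversion on the lattice of the walk -/

/-- The central limit theorem for characteristic functions, degenerate case included. -/
theorem tendsto_integral_exp_pow {Ω : Type*} {mΩ : MeasurableSpace Ω} {P : Measure Ω}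
    [IsProbabilityMeasure P] {Y : Ω → ℝ} {v : ℝ} (hY : MemLp Y 2 P) (h0 : ∫ ω, Y ω ∂P = 0)
    (hv : ∫ ω, Y ω ^ 2 ∂P = v) (t : ℝ) :
    Tendsto (fun n : ℕ => (∫ ω, Complex.exp ((t / √n * Y ω : ℝ) * Complex.I) ∂P) ^ n) atTop
      (𝓝 (Complex.exp (-(v * t ^ 2 / 2) : ℝ))) := by
  have hv0 : 0 ≤ v := hv ▸ integral_nonneg fun ω => sq_nonneg _
  -- If the variance vanishes, so does the variable, almost surely; otherwise it is normalized.
  rcases hv0.eq_or_lt with h | h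
  · have hYsq : Integrable (fun ω => Y ω ^ 2) P := hY.integrable_sq
    have h1 : ∀ᵐ ω ∂P, Y ω = 0 := by
      have := (integral_eq_zero_iff_of_nonneg (fun ω => sq_nonneg (Y ω)) hYsq).1 (hv.trans h.symm)
      filter_upwards [this] with ω hω
      simpa using hω
    have h2 : ∀ n : ℕ, ∫ ω, Complex.exp ((t / √n * Y ω : ℝ) * Complex.I) ∂P = 1 := by
      intro n
      rw [integral_congr_ae (g := fun _ => (1 : ℂ))]
      · simp
      · filter_upwards [h1] with ω hω
        simp [hω]
    simp only [h2, one_pow]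
    rw [← h]
    simp
  · set σ := √v with hσ
    have hσ0 : 0 < σ := Real.sqrt_pos.2 h
    have hX : AEMeasurable (fun ω => Y ω / σ) P := hY.1.aemeasurable.div_const _
    have := tendsto_charFun_inv_sqrt_mul_pow (P := P) (X := fun ω => Y ω / σ) hX
      (by rw [integral_div, h0, zero_div])
      (by
        simp only [Pi.pow_apply, div_pow]
        rw [integral_div, hv, hσ, Real.sq_sqrt hv0, div_self h.ne']) (σ * t)
    convert this using 2 with n
    · congr 1
      rw [charFun_apply_real, integral_map hX (by fun_prop)]
      refine integral_congr_ae (ae_of_all _ fun ω => ?_)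
      simp only
      congr 2
      push_cast
      have : (σ : ℂ) ≠ 0 := by exact_mod_cast hσ0.ne'
      field_simp
    · congr 1
      push_cast
      have h3 : ((√v : ℝ) : ℂ) ^ 2 = v := by exact_mod_cast Real.sq_sqrt hv0
      rw [mul_pow, hσ, h3]
      ring

/-- The characteristic function of a step of the walk. -/
noncomputable def stepChar (p : PMF ℕ) (θ : ℝ) : ℂ :=
  ∫ k : ℕ, Complex.exp ((θ * ((k : ℝ) - 1) : ℝ) * Complex.I) ∂p.toMeasure

theorem continuous_stepChar (p : PMF ℕ) : Continuous (stepChar p) := by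
  refine continuous_of_dominated (bound := fun _ => 1)
    (fun θ => StronglyMeasurable.of_discrete.aestronglyMeasurable)
    (fun θ => ae_of_all _ fun k => ?_) (integrable_const _) (ae_of_all _ fun k => by fun_prop)
  rw [Complex.norm_exp_ofReal_mul_I]

theorem norm_stepChar_le_one (p : PMF ℕ) (θ : ℝ) : ‖stepChar p θ‖ ≤ 1 := by
  refine (norm_integral_le_of_norm_le_const (C := 1) (ae_of_all _ fun k => ?_)).trans (by simp)
  rw [Complex.norm_exp_ofReal_mul_I]

theorem integral_exp_excess (p : PMF ℕ) (θ : ℝ) (n : ℕ) :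
    ∫ ω, Complex.exp ((θ * excess (word ω n) : ℝ) * Complex.I) ∂seqLaw p = stepChar p θ ^ n := by
  induction n with
  | zero => simp [word]
  | succ n ih =>
    have hint : Integrable (fun ω => Complex.exp ((θ * excess (word ω (1 + n)) : ℝ) * Complex.I))
        (seqLaw p) :=
      Integrable.of_bound (stronglyMeasurable_word
        (fun l => Complex.exp ((θ * excess l : ℝ) * Complex.I)) _).aestronglyMeasurable 1
        (ae_of_all _ fun ω => by rw [Complex.norm_exp_ofReal_mul_I])
    rw [add_comm n 1, integral_splice hint 1]
    have h1 : ∀ ω, ∫ ω', Complex.exp ((θ * excess (word (splice 1 ω ω') (1 + n)) : ℝ) * Complex.I)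
        ∂seqLaw p = Complex.exp ((θ * ((ω 0 : ℝ) - 1) : ℝ) * Complex.I) * stepChar p θ ^ n := by
      intro ω
      rw [← ih, ← integral_const_mul]
      refine integral_congr_ae (ae_of_all _ fun ω' => ?_)
      simp only [word_splice, excess_append]
      rw [← Complex.exp_add]
      congr 1
      simp [word]
      ring
    simp only [h1]
    rw [integral_mul_const, add_comm 1 n, pow_succ, mul_comm]
    congr 1
    have := (measurePreserving_eval_infinitePi (fun _ : ℕ => p.toMeasure) 0)
    rw [stepChar, ← this.map_eq, integral_map this.measurable.aemeasurable
      StronglyMeasurable.of_discrete.aestronglyMeasurable]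
    rfl

theorem ae_seqLaw_span_dvd (p : PMF ℕ) : ∀ᵐ ω ∂seqLaw p, ∀ i, (span p : ℤ) ∣ ω i := by
  refine ae_all_iff.2 fun i => ?_
  have h := measurePreserving_eval_infinitePi (fun _ : ℕ => p.toMeasure) i
  have h1 : ∀ᵐ k ∂p.toMeasure, (span p : ℤ) ∣ (k : ℕ) := (ae_pmf_iff p).2 fun k hk => span_dvd hk
  exact h.quasiMeasurePreserving.ae h1

theorem ae_seqLaw_dvd_excess (p : PMF ℕ) (n : ℕ) :
    ∀ᵐ ω ∂seqLaw p, (span p : ℤ) ∣ excess (word ω n) + n := by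
  filter_upwards [ae_seqLaw_span_dvd p] with ω hω
  rw [excess_word_eq, Finset.sum_sub_distrib]
  simp only [Finset.sum_const, Finset.card_range, nsmul_eq_mul, mul_one, sub_add_cancel]
  exact Finset.dvd_sum fun i _ => hω i

theorem integral_exp_lattice {d : ℕ} (hd : 0 < d) {y : ℤ} (hy : (d : ℤ) ∣ y) :
    ∫ θ in -(Real.pi / d)..Real.pi / d, Complex.exp ((θ * y : ℝ) * Complex.I) =
      if y = 0 then ((2 * Real.pi / d : ℝ) : ℂ) else 0 := by
  have hd' : (d : ℝ) ≠ 0 := by exact_mod_cast hd.ne'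
  split_ifs with h
  · subst h
    simp
    ring
  · obtain ⟨m, rfl⟩ := hy
    have hm : (((d : ℤ) * m : ℤ) : ℂ) * Complex.I ≠ 0 := by
      simp only [ne_eq, mul_eq_zero, Complex.I_ne_zero, or_false]
      exact_mod_cast h
    have h1 : ∀ θ : ℝ, Complex.exp ((θ * ((d : ℤ) * m : ℤ) : ℝ) * Complex.I) =
        Complex.exp ((((d : ℤ) * m : ℤ) : ℂ) * Complex.I * θ) := fun θ => by
      congr 1; push_cast; ring
    simp only [h1]
    rw [integral_exp_mul_complex hm, div_eq_zero_iff]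
    left
    have hdc : (d : ℂ) ≠ 0 := by exact_mod_cast hd.ne'
    have h2 : (((d : ℤ) * m : ℤ) : ℂ) * Complex.I * ((Real.pi / d : ℝ) : ℂ) =
        (((d : ℤ) * m : ℤ) : ℂ) * Complex.I * ((-(Real.pi / d) : ℝ) : ℂ) +
          m * (2 * Real.pi * Complex.I) := by
      push_cast
      field_simp
      ring
    rw [h2, Complex.exp_add, Complex.exp_int_mul_two_pi_mul_I, mul_one, sub_self]

/-- Fourier inversion: the indicator of the event that the walk is at `c` is the mean of `e^{iθ(S_n
- c)}` over one period, since `S_n - c` is a multiple of the span. -/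
theorem integral_ite_excess_eq_fourier {p : PMF ℕ} (hd : 0 < span p) {n : ℕ} {c : ℤ}
    (hc : (span p : ℤ) ∣ n + c) {Z : (ℕ → ℕ) → ℂ} (hZ : StronglyMeasurable Z)
    (hZ1 : ∀ ω, ‖Z ω‖ ≤ 1) :
    ∫ ω, (if excess (word ω n) = c then Z ω else 0) ∂seqLaw p =
      ((span p / (2 * Real.pi) : ℝ) : ℂ) * ∫ θ in -(Real.pi / span p)..Real.pi / span p,
        ∫ ω, Z ω * Complex.exp ((θ * (excess (word ω n) - c) : ℝ) * Complex.I) ∂seqLaw p := by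
  have hpi := Real.pi_pos
  have hexc : StronglyMeasurable fun ω => ((excess (word ω n) : ℤ) : ℝ) :=
    stronglyMeasurable_word (fun l => ((excess l : ℤ) : ℝ)) n
  rw [intervalIntegral_integral_swap]
  · rw [← integral_const_mul]
    refine integral_congr_ae ?_
    filter_upwards [ae_seqLaw_dvd_excess p n] with ω hω
    rw [intervalIntegral.integral_const_mul]
    have h1 : ∀ θ : ℝ, Complex.exp ((θ * (excess (word ω n) - c) : ℝ) * Complex.I) =
        Complex.exp ((θ * ((excess (word ω n) - c : ℤ) : ℝ) : ℝ) * Complex.I) := by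
      intro θ; push_cast; rfl
    simp only [h1]
    rw [integral_exp_lattice hd (by
      have := dvd_sub hω hc
      rwa [show excess (word ω n) + n - (n + c) = excess (word ω n) - c by ring] at this)]
    simp only [sub_eq_zero]
    split_ifs with h
    · have hdc : (span p : ℂ) ≠ 0 := by exact_mod_cast hd.ne'
      have : (Real.pi : ℂ) ≠ 0 := by exact_mod_cast hpi.ne'
      push_cast
      field_simp
    · simp
  · have : IsFiniteMeasure (volume.restrict (Set.uIoc (-(Real.pi / span p)) (Real.pi / span p))) :=
      by rw [Set.uIoc]; infer_instance
    refine Integrable.of_bound (C := 1) ?_ (ae_of_all _ fun z => ?_)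
    · refine StronglyMeasurable.aestronglyMeasurable ?_
      refine (hZ.comp_measurable measurable_snd).mul ?_
      refine Complex.continuous_exp.comp_stronglyMeasurable ?_
      refine StronglyMeasurable.mul_const ?_ _
      refine Complex.continuous_ofReal.comp_stronglyMeasurable ?_
      exact measurable_fst.stronglyMeasurable.mul
        ((hexc.comp_measurable measurable_snd).sub stronglyMeasurable_const)
    · simp only [Function.uncurry]
      rw [norm_mul, Complex.norm_exp_ofReal_mul_I, mul_one]
      exact hZ1 _

theorem walkProb_eq_fourier {p : PMF ℕ} (hd : 0 < span p) {n : ℕ} {c : ℤ}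
    (hc : (span p : ℤ) ∣ n + c) :
    (walkProb p n c : ℂ) =
      ((span p / (2 * Real.pi) : ℝ) : ℂ) * ∫ θ in -(Real.pi / span p)..Real.pi / span p,
        stepChar p θ ^ n * Complex.exp ((-(θ * c) : ℝ) * Complex.I) := by
  have := integral_ite_excess_eq_fourier hd hc (Z := fun _ => 1) stronglyMeasurable_const (by simp)
  rw [walkProb_eq_integral, ← integral_complex_ofReal]
  have h1 : ∀ ω, (((if excess (word ω n) = c then (1 : ℝ) else 0 : ℝ)) : ℂ) =
      if excess (word ω n) = c then (1 : ℂ) else 0 := fun ω => by split_ifs <;> simp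
  simp only [h1]
  rw [this]
  congr 1
  refine intervalIntegral.integral_congr fun θ _ => ?_
  simp only [one_mul]
  rw [← integral_exp_excess, ← integral_mul_const]
  refine integral_congr_ae (ae_of_all _ fun ω => ?_)
  simp only
  rw [← Complex.exp_add]
  congr 1
  push_cast
  ring

theorem dvd_of_walkProb_ne_zero {p : PMF ℕ} {n : ℕ} {c : ℤ} (h : walkProb p n c ≠ 0) :
    (span p : ℤ) ∣ n + c := by
  by_contra hc
  refine h ?_
  rw [walkProb, measureReal_eq_zero_iff]
  rw [measure_eq_zero_iff_ae_notMem]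
  filter_upwards [ae_seqLaw_dvd_excess p n] with ω hω hω'
  have hω'' : excess (word ω n) = c := hω'
  rw [hω'', add_comm] at hω
  exact hc hω

/-- Rescaling of Fourier integrals by the square root of the length. -/
theorem tendsto_sqrt_mul_intervalIntegral {a : ℝ} (ha : 0 < a) {Ψ : ℕ → ℝ → ℂ} {h : ℝ → ℂ}
    {G : ℝ → ℝ} (hΨ : ∀ n, Continuous (Ψ n)) (hG : Integrable G)
    (hbd : ∀ n : ℕ, 0 < n → ∀ u : ℝ, |u / √n| ≤ a → ‖Ψ n (u / √n)‖ ≤ G u)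
    (hlim : ∀ u : ℝ, Tendsto (fun n : ℕ => Ψ n (u / √n)) atTop (𝓝 (h u))) :
    Tendsto (fun n : ℕ => ((√n : ℝ) : ℂ) * ∫ θ in -a..a, Ψ n θ) atTop (𝓝 (∫ u, h u)) := by
  have key : Tendsto (fun n : ℕ => ∫ u, (Set.Ioc (-(a * √n)) (a * √n)).indicator
      (fun u => Ψ n (u / √n)) u) atTop (𝓝 (∫ u, h u)) := by
    refine tendsto_integral_filter_of_dominated_convergence (fun u => |G u|) ?_ ?_ hG.abs ?_
    · exact Eventually.of_forall fun n => ((hΨ n).comp (continuous_id.div_const _)).aestronglyMeasurable.indicator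
        measurableSet_Ioc
    · filter_upwards [eventually_gt_atTop 0] with n hn
      refine ae_of_all _ fun u => ?_
      rw [Set.indicator_apply]
      split_ifs with hu
      · have hs : 0 < √(n : ℝ) := Real.sqrt_pos.2 (by exact_mod_cast hn)
        refine (hbd n hn u ?_).trans (le_abs_self _)
        rw [abs_div, abs_of_pos hs, div_le_iff₀ hs, abs_le]
        exact ⟨hu.1.le, hu.2⟩
      · simp
    · refine ae_of_all _ fun u => ?_
      refine (hlim u).congr' ?_
      have h1 : Tendsto (fun n : ℕ => a * √(n : ℝ)) atTop atTop :=
        Tendsto.const_mul_atTop ha (Real.tendsto_sqrt_atTop.comp tendsto_natCast_atTop_atTop)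
      filter_upwards [h1.eventually_gt_atTop |u|] with n hn
      rw [Set.indicator_of_mem]
      exact ⟨by linarith [neg_abs_le u], (le_abs_self u).trans hn.le⟩
  refine key.congr' ?_
  filter_upwards [eventually_gt_atTop 0] with n hn
  have hs : 0 < √(n : ℝ) := Real.sqrt_pos.2 (by exact_mod_cast hn)
  rw [integral_indicator measurableSet_Ioc, ← intervalIntegral.integral_of_le (by nlinarith),
    intervalIntegral.integral_comp_div _ hs.ne', neg_div, mul_div_cancel_right₀ _ hs.ne',
    Complex.real_smul]

/-! ### Local limit estimates for the walk -/

theorem norm_exp_sub_one_le (x : ℝ) : ‖Complex.exp (x * Complex.I) - 1‖ ≤ |x| := by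
  have := Real.norm_exp_I_mul_ofReal_sub_one_le (x := x)
  rwa [mul_comm] at this

theorem norm_exp_sub_one_sub_le (x : ℝ) :
    ‖Complex.exp (x * Complex.I) - 1 - x * Complex.I‖ ≤ 2 * x ^ 2 := by
  rcases le_or_gt |x| 1 with h | h
  · have h1 : ‖(x : ℂ) * Complex.I‖ = |x| := by simp
    have := Complex.norm_exp_sub_one_sub_id_le (x := (x : ℂ) * Complex.I) (by rw [h1]; exact h)
    rw [h1, sq_abs] at this
    nlinarith [sq_nonneg x]
  · calc _ ≤ ‖Complex.exp (x * Complex.I) - 1‖ + ‖(x : ℂ) * Complex.I‖ := norm_sub_le _ _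
      _ ≤ |x| + |x| := add_le_add (norm_exp_sub_one_le x) (by simp)
      _ ≤ 2 * x ^ 2 := by rw [← sq_abs x]; nlinarith

theorem mul_exp_neg_le {b : ℝ} (hb : 0 < b) (t : ℝ) :
    t ^ 2 * Real.exp (-b * t ^ 2) ≤ 2 / b * Real.exp (-(b / 2) * t ^ 2) := by
  have h1 : b / 2 * t ^ 2 ≤ Real.exp (b / 2 * t ^ 2) := by
    linarith [Real.add_one_le_exp (b / 2 * t ^ 2)]
  have h2 : Real.exp (-b * t ^ 2) = Real.exp (-(b / 2) * t ^ 2) * Real.exp (-(b / 2) * t ^ 2) := by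
    rw [← Real.exp_add]; congr 1; ring
  have h3 : Real.exp (b / 2 * t ^ 2) * Real.exp (-(b / 2) * t ^ 2) = 1 := by
    rw [← Real.exp_add, neg_mul, add_neg_cancel, Real.exp_zero]
  have h4 := Real.exp_pos (-(b / 2) * t ^ 2)
  have h5 : b / 2 * t ^ 2 * Real.exp (-(b / 2) * t ^ 2) ≤ 1 :=
    (mul_le_mul_of_nonneg_right h1 h4.le).trans h3.le
  rw [h2]
  calc _ = 2 / b * (b / 2 * t ^ 2 * Real.exp (-(b / 2) * t ^ 2)) *
        Real.exp (-(b / 2) * t ^ 2) := by field_simp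
    _ ≤ 2 / b * 1 * Real.exp (-(b / 2) * t ^ 2) := by gcongr
    _ = _ := by ring

/-- A Gaussian bound for the integrand bounds an integral over any interval. -/
theorem norm_intervalIntegral_le_of_gaussian {a b A : ℝ} (ha : 0 ≤ a) (hb : 0 < b) {Ψ : ℝ → ℂ}
    (h : ∀ θ, |θ| ≤ a → ‖Ψ θ‖ ≤ A * Real.exp (-b * θ ^ 2)) :
    ‖∫ θ in -a..a, Ψ θ‖ ≤ A * √(Real.pi / b) := by
  have hA : 0 ≤ A := by simpa using (norm_nonneg _).trans (h 0 (by simpa using ha))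
  have hint : Integrable fun θ : ℝ => A * Real.exp (-b * θ ^ 2) :=
    (integrable_exp_neg_mul_sq hb).const_mul A
  calc ‖∫ θ in -a..a, Ψ θ‖ ≤ ∫ θ in -a..a, A * Real.exp (-b * θ ^ 2) := by
        refine intervalIntegral.norm_integral_le_of_norm_le (by linarith)
          (ae_of_all _ fun θ hθ => h θ (abs_le.2 ⟨hθ.1.le, hθ.2⟩)) hint.intervalIntegrable
    _ ≤ ∫ θ, A * Real.exp (-b * θ ^ 2) := by
        rw [intervalIntegral.integral_of_le (by linarith)]
        exact setIntegral_le_integral hint (ae_of_all _ fun θ => by positivity)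
    _ = _ := by rw [integral_const_mul, integral_gaussian]

namespace IsCritical
variable {p : PMF ℕ} {σsq : ℝ} (hp : IsCritical p σsq)
include hp

theorem norm_one_sub_stepChar_le (θ : ℝ) : ‖1 - stepChar p θ‖ ≤ 2 * σsq * θ ^ 2 := by
  have hi : Integrable (fun k : ℕ => (((θ * ((k : ℝ) - 1) : ℝ) : ℂ) * Complex.I)) p.toMeasure :=
    (hp.integrable_step.const_mul θ).ofReal.mul_const _
  have he : Integrable (fun k : ℕ => Complex.exp ((θ * ((k : ℝ) - 1) : ℝ) * Complex.I))
      p.toMeasure := integrable_of_norm_le_pmf p 1 fun k => by rw [Complex.norm_exp_ofReal_mul_I]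
  have he1 : Integrable (fun k : ℕ => Complex.exp ((θ * ((k : ℝ) - 1) : ℝ) * Complex.I) - 1)
      p.toMeasure := he.sub (integrable_const _)
  have h1 : ∫ k : ℕ, (Complex.exp ((θ * ((k : ℝ) - 1) : ℝ) * Complex.I) - 1 -
      ((θ * ((k : ℝ) - 1) : ℝ) : ℂ) * Complex.I) ∂p.toMeasure = stepChar p θ - 1 := by
    rw [integral_sub he1 hi, integral_sub he (integrable_const _), integral_mul_const,
      integral_complex_ofReal, integral_const_mul, hp.integral_step, stepChar]
    simp
  rw [norm_sub_rev, ← h1, ← hp.integral_step_sq, mul_assoc, mul_comm _ (θ ^ 2), ← mul_assoc,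
    ← integral_const_mul]
  refine norm_integral_le_of_norm_le (hp.memLp_step.integrable_sq.const_mul _)
    (ae_of_all _ fun k => ?_)
  refine (norm_exp_sub_one_sub_le _).trans_eq ?_
  ring

theorem exists_norm_stepChar_le : ∃ c > 0, ∀ θ : ℝ, |θ| ≤ Real.pi / span p → ∀ n : ℕ,
    ‖stepChar p θ ^ n‖ ≤ Real.exp (-(c * n) * θ ^ 2) := by
  obtain ⟨c, hc, h⟩ := hp.exists_norm_integral_exp_le
  refine ⟨c, hc, fun θ hθ n => ?_⟩
  have := h (fun _ => -θ) 0 θ hθ (by simp)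
  have h1 : stepChar p θ = ∫ k : ℕ, Complex.exp (((-θ) + θ * k : ℝ) * Complex.I) ∂p.toMeasure := by
    rw [stepChar]
    refine integral_congr_ae (ae_of_all _ fun k => ?_)
    simp only
    congr 3
    ring
  rw [← h1] at this
  rw [norm_pow]
  refine (pow_le_pow_left₀ (norm_nonneg _) this n).trans_eq ?_
  rw [← Real.exp_nat_mul]
  congr 1
  ring

theorem tendsto_stepChar_pow (u : ℝ) :
    Tendsto (fun n : ℕ => stepChar p (u / √n) ^ n) atTop
      (𝓝 (Complex.exp (-(σsq * u ^ 2 / 2) : ℝ))) :=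
  tendsto_integral_exp_pow hp.memLp_step hp.integral_step hp.integral_step_sq u

theorem abs_walkProb_le_of_fourier {a : ℝ} {Ψ : ℝ → ℂ} {x : ℝ}
    (h : (x : ℂ) = ((span p / (2 * Real.pi) : ℝ) : ℂ) *
      ∫ θ in -(Real.pi / span p)..Real.pi / span p, Ψ θ)
    (ha : ‖∫ θ in -(Real.pi / span p)..Real.pi / span p, Ψ θ‖ ≤ a) : |x| ≤ span p * a := by
  have hd : (0 : ℝ) < span p := by exact_mod_cast hp.span_pos
  have h1 : |x| = ‖(x : ℂ)‖ := by simp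
  rw [h1, h, norm_mul, Complex.norm_real, Real.norm_of_nonneg (by positivity)]
  refine mul_le_mul ?_ ha (norm_nonneg _) hd.le
  exact div_le_self hd.le (by linarith [Real.pi_gt_three])

/-- The point probabilities of the walk are of order at most the inverse square root. -/
theorem exists_walkProb_le : ∃ C > 0, ∀ n : ℕ, 0 < n → ∀ c : ℤ, walkProb p n c ≤ C / √n := by
  obtain ⟨b, hb, h⟩ := hp.exists_norm_stepChar_le
  have hd : (0 : ℝ) < span p := by exact_mod_cast hp.span_pos
  have hpi := Real.pi_pos
  refine ⟨span p * √(Real.pi / b), by positivity, fun n hn c => ?_⟩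
  have hn' : (0 : ℝ) < n := by exact_mod_cast hn
  by_cases hc : walkProb p n c = 0
  · rw [hc]; positivity
  have := norm_intervalIntegral_le_of_gaussian (a := Real.pi / span p) (b := b * n) (A := 1)
    (by positivity) (by positivity) (Ψ := fun θ => stepChar p θ ^ n *
      Complex.exp ((-(θ * c) : ℝ) * Complex.I)) (fun θ hθ => by
        rw [norm_mul, Complex.norm_exp_ofReal_mul_I, mul_one, one_mul]
        exact h θ hθ n)
  refine (le_abs_self _).trans ((hp.abs_walkProb_le_of_fourier
    (walkProb_eq_fourier hp.span_pos (dvd_of_walkProb_ne_zero hc)) this).trans_eq ?_)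
  rw [one_mul, ← div_div, Real.sqrt_div (by positivity), mul_div_assoc]

/-- The local limit theorem at `-1`, for the Fourier integral which represents the probability. The
integral converges along all `n`, whereas the probability vanishes off a residue class. -/
theorem tendsto_sqrt_mul_fourier :
    Tendsto (fun n : ℕ => ((√n : ℝ) : ℂ) * ∫ θ in -(Real.pi / span p)..Real.pi / span p,
      stepChar p θ ^ n * Complex.exp ((θ : ℝ) * Complex.I)) atTop
      (𝓝 ((√(2 * Real.pi / σsq) : ℝ) : ℂ)) := by
  obtain ⟨b, hb, h⟩ := hp.exists_norm_stepChar_le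
  have hd : (0 : ℝ) < span p := by exact_mod_cast hp.span_pos
  have hpi := Real.pi_pos
  have hlim : ∫ u : ℝ, Complex.exp (-(σsq * u ^ 2 / 2) : ℝ) = ((√(2 * Real.pi / σsq) : ℝ) : ℂ) := by
    simp only [← Complex.ofReal_exp]
    rw [integral_complex_ofReal]
    congr 1
    have := integral_gaussian (σsq / 2)
    rw [show Real.pi / (σsq / 2) = 2 * Real.pi / σsq by field_simp] at this
    rw [← this]
    congr 1
    ext u
    congr 1
    ring
  rw [← hlim]
  refine tendsto_sqrt_mul_intervalIntegral (G := fun u => Real.exp (-b * u ^ 2))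
    (by positivity) (fun n => ?_) (integrable_exp_neg_mul_sq hb) (fun n hn u hu => ?_) (fun u => ?_)
  · exact ((continuous_stepChar p).pow n).mul (by fun_prop)
  · rw [norm_mul, Complex.norm_exp_ofReal_mul_I, mul_one]
    refine (h _ hu n).trans_eq ?_
    have : (n : ℝ) ≠ 0 := by exact_mod_cast hn.ne'
    rw [div_pow, Real.sq_sqrt (Nat.cast_nonneg n)]
    congr 1
    field_simp
  · have h1 : Tendsto (fun n : ℕ => u / √(n : ℝ)) atTop (𝓝 0) :=
      tendsto_const_nhds.div_atTop (Real.tendsto_sqrt_atTop.comp tendsto_natCast_atTop_atTop)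
    have h2 : Tendsto (fun n : ℕ => Complex.exp ((u / √(n : ℝ) : ℝ) * Complex.I)) atTop (𝓝 1) := by
      have : Continuous fun x : ℝ => Complex.exp ((x : ℝ) * Complex.I) := by fun_prop
      have := (this.tendsto 0).comp h1
      simpa [Function.comp_def] using this
    simpa using (hp.tendsto_stepChar_pow u).mul h2

/-- A lower bound of the right order for the point probabilities at `-1`, along the admissible
residue class. -/
theorem exists_eventually_le_sqrt_mul_walkProb : ∃ c > 0, ∃ N : ℕ, ∀ n ≥ N,
    (span p : ℤ) ∣ n - 1 → c ≤ √n * walkProb p n (-1) := by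
  have hd : (0 : ℝ) < span p := by exact_mod_cast hp.span_pos
  have hpi := Real.pi_pos
  have hσ := hp.pos
  have h1 := ((Complex.continuous_re.tendsto _).comp
    (hp.tendsto_sqrt_mul_fourier.const_mul ((span p / (2 * Real.pi) : ℝ) : ℂ)))
  set L := (((span p / (2 * Real.pi) : ℝ) : ℂ) * ((√(2 * Real.pi / σsq) : ℝ) : ℂ)).re with hL
  have hL0 : 0 < L := by
    rw [hL, ← Complex.ofReal_mul, Complex.ofReal_re]; positivity
  obtain ⟨N, hN⟩ := eventually_atTop.1 (h1.eventually (lt_mem_nhds (half_lt_self hL0)))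
  refine ⟨L / 2, by positivity, N, fun n hn h0 => ?_⟩
  have h3 := walkProb_eq_fourier (p := p) hp.span_pos (n := n) (c := -1) (by
    rw [← sub_eq_add_neg]; exact h0)
  have h4 := hN n hn
  have h5 : √(n : ℝ) * walkProb p n (-1) = (((span p / (2 * Real.pi) : ℝ) : ℂ) *
    (((√n : ℝ) : ℂ) * ∫ θ in -(Real.pi / span p)..Real.pi / span p,
    stepChar p θ ^ n * Complex.exp ((θ : ℝ) * Complex.I))).re := by
    rw [mul_left_comm]
    have h6 : ∀ θ : ℝ, ((-(θ * (-1 : ℤ)) : ℝ) : ℂ) = (θ : ℂ) := fun θ => by simp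
    simp only [h6] at h3
    rw [← h3, ← Complex.ofReal_mul, Complex.ofReal_re]
  rw [h5]
  exact h4.le

theorem exists_le_sqrt_mul_walkProb :
    ∃ c > 0, ∀ n : ℕ, 0 < walkProb p n (-1) → c ≤ √n * walkProb p n (-1) := by
  obtain ⟨L, hL0, N, h2⟩ := hp.exists_eventually_le_sqrt_mul_walkProb
  -- The finitely many small indices are absorbed into the constant.
  have h3 : ∀ N : ℕ, ∃ c > 0, ∀ n < N, 0 < walkProb p n (-1) → c ≤ √n * walkProb p n (-1) := by
    intro N
    induction N with
    | zero => exact ⟨1, one_pos, by simp⟩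
    | succ N ih =>
      obtain ⟨c, hc, h⟩ := ih
      by_cases h0 : 0 < √N * walkProb p N (-1)
      · refine ⟨min c (√N * walkProb p N (-1)), lt_min hc h0, fun n hn hn0 => ?_⟩
        rcases Nat.lt_succ_iff_lt_or_eq.1 hn with h' | rfl
        · exact (min_le_left _ _).trans (h n h' hn0)
        · exact min_le_right _ _
      · refine ⟨c, hc, fun n hn hn0 => ?_⟩
        rcases Nat.lt_succ_iff_lt_or_eq.1 hn with h' | rfl
        · exact h n h' hn0
        · exfalso
          refine h0 (mul_pos (Real.sqrt_pos.2 ?_) hn0)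
          have : n ≠ 0 := by
            rintro rfl
            simp [walkProb, word] at hn0
          exact_mod_cast Nat.pos_of_ne_zero this
  obtain ⟨c, hc, h4⟩ := h3 N
  refine ⟨min c L, lt_min hc hL0, fun n hn => ?_⟩
  rcases lt_or_ge n N with h | h
  · exact (min_le_left _ _).trans (h4 n h hn)
  · exact (min_le_right _ _).trans (h2 n h (by
      have := dvd_of_walkProb_ne_zero hn.ne'
      rwa [← sub_eq_add_neg] at this))

/-- The Fourier integral for `ℙ(S_n = 0) - ℙ(S_n = -1)` is `o(1 / n)`: after rescaling the integrand
tends to a multiple of `u exp (-σ² u² / 2)`. -/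
theorem tendsto_mul_fourier_sub :
    Tendsto (fun n : ℕ => ((√n : ℝ) : ℂ) * ∫ θ in -(Real.pi / span p)..Real.pi / span p,
      ((√n : ℝ) : ℂ) * (stepChar p θ ^ n * (1 - Complex.exp ((θ : ℝ) * Complex.I)))) atTop
      (𝓝 0) := by
  obtain ⟨b, hb, h⟩ := hp.exists_norm_stepChar_le
  have hd : (0 : ℝ) < span p := by exact_mod_cast hp.span_pos
  have hpi := Real.pi_pos
  -- The limiting integrand is odd.
  have hlim : ∫ u : ℝ, Complex.exp (-(σsq * u ^ 2 / 2) : ℝ) * (-(u * Complex.I)) = 0 := by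
    have h1 := integral_neg_eq_self
      (fun u : ℝ => Complex.exp (-(σsq * u ^ 2 / 2) : ℝ) * (-(u * Complex.I))) volume
    have h2 : ∀ u : ℝ, Complex.exp (-(σsq * (-u) ^ 2 / 2) : ℝ) * (-(((-u : ℝ) : ℂ) * Complex.I)) =
        -(Complex.exp (-(σsq * u ^ 2 / 2) : ℝ) * (-(u * Complex.I))) := fun u => by
      push_cast; rw [neg_sq]; ring
    simp only [h2] at h1
    rw [integral_neg] at h1
    exact self_eq_neg.1 h1.symm
  rw [← hlim]
  refine tendsto_sqrt_mul_intervalIntegral (G := fun u => |u| * Real.exp (-b * u ^ 2))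
    (by positivity) (fun n => ?_) ?_ (fun n hn u hu => ?_) (fun u => ?_)
  · exact ((((continuous_stepChar p).pow n).mul (by fun_prop)).const_mul _)
  · have := (integrable_mul_exp_neg_mul_sq hb).norm
    refine this.congr (ae_of_all _ fun u => ?_)
    simp
  · have hs : 0 < √(n : ℝ) := Real.sqrt_pos.2 (by exact_mod_cast hn)
    have : (n : ℝ) ≠ 0 := by exact_mod_cast hn.ne'
    have h1 := h _ hu n
    rw [div_pow, Real.sq_sqrt (Nat.cast_nonneg n),
      show -(b * n) * (u ^ 2 / n) = -b * u ^ 2 by field_simp] at h1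
    have h2 := norm_exp_sub_one_le (u / √n)
    rw [norm_sub_rev, abs_div, abs_of_pos hs, le_div_iff₀ hs] at h2
    rw [norm_mul, norm_mul, Complex.norm_real, Real.norm_of_nonneg hs.le]
    calc _ = ‖1 - Complex.exp ((u / √(n : ℝ) : ℝ) * Complex.I)‖ * √n *
          ‖stepChar p (u / √n) ^ n‖ := by ring
      _ ≤ _ := mul_le_mul h2 h1 (norm_nonneg _) (abs_nonneg _)
  · have h1 : Tendsto (fun n : ℕ => √(n : ℝ)) atTop atTop :=
      Real.tendsto_sqrt_atTop.comp tendsto_natCast_atTop_atTop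
    have h2 : Tendsto (fun n : ℕ => ((√(n : ℝ) : ℝ) : ℂ) *
        (1 - Complex.exp ((u / √(n : ℝ) : ℝ) * Complex.I))) atTop (𝓝 (-(u * Complex.I))) := by
      rw [tendsto_iff_norm_sub_tendsto_zero]
      have h3 : Tendsto (fun n : ℕ => 2 * u ^ 2 / √(n : ℝ)) atTop (𝓝 0) :=
        tendsto_const_nhds.div_atTop h1
      refine squeeze_zero' (Eventually.of_forall fun n => norm_nonneg _) ?_ h3
      filter_upwards [eventually_gt_atTop 0] with n hn
      have hs : 0 < √(n : ℝ) := Real.sqrt_pos.2 (by exact_mod_cast hn)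
      have hsc : ((√(n : ℝ) : ℝ) : ℂ) ≠ 0 := by exact_mod_cast hs.ne'
      have h4 := norm_exp_sub_one_sub_le (u / √n)
      have h5 : ((√(n : ℝ) : ℝ) : ℂ) * (1 - Complex.exp ((u / √(n : ℝ) : ℝ) * Complex.I)) -
          -(u * Complex.I) = -((√(n : ℝ) : ℝ) : ℂ) * (Complex.exp ((u / √(n : ℝ) : ℝ) * Complex.I)
            - 1 - (u / √(n : ℝ) : ℝ) * Complex.I) := by
        push_cast
        field_simp
        ring
      rw [h5, norm_mul, norm_neg, Complex.norm_real, Real.norm_of_nonneg hs.le]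
      refine (mul_le_mul_of_nonneg_left h4 hs.le).trans_eq ?_
      rw [div_pow]
      field_simp
    refine ((hp.tendsto_stepChar_pow u).mul h2).congr fun n => ?_
    ring

/-- Comparison of the return probabilities of the walk with the probability of hitting `-1`. -/
theorem exists_abs_walkProb_sub_le : ∃ C > 0, ∃ ε : ℕ → ℝ, (∀ n, 0 ≤ ε n) ∧
    Tendsto ε atTop (𝓝 0) ∧ ∀ n k : ℕ, 0 < n → 2 * k ≤ n → (span p : ℤ) ∣ n - 1 →
      (span p : ℤ) ∣ k - 1 →
      |walkProb p (n - k) 0 - walkProb p n (-1)| ≤ C * k / (n * √n) + ε n / n := by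
  obtain ⟨b, hb, h⟩ := hp.exists_norm_stepChar_le
  have hd : (0 : ℝ) < span p := by exact_mod_cast hp.span_pos
  have hpi := Real.pi_pos
  have hσ := hp.pos
  set J : ℕ → ℂ := fun n => ∫ θ in -(Real.pi / span p)..Real.pi / span p,
      (stepChar p θ ^ n * (1 - Complex.exp ((θ : ℝ) * Complex.I))) with hJ
  have hε := hp.tendsto_mul_fourier_sub.norm.const_mul (span p : ℝ)
  rw [norm_zero, mul_zero] at hε
  refine ⟨span p * (2 * σsq * (4 / b) * √(Real.pi / (b / 4))), by positivity,
    _, fun n => by positivity, hε, fun n k hn hk hdn hdk => ?_⟩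
  have hn' : (0 : ℝ) < n := by exact_mod_cast hn
  have hs : 0 < √(n : ℝ) := Real.sqrt_pos.2 hn'
  have hss : √(n : ℝ) * √n = n := Real.mul_self_sqrt hn'.le
  have e1 := walkProb_eq_fourier (p := p) hp.span_pos (n := n - k) (c := 0) (by
    rw [Nat.cast_sub (by omega), add_zero]
    have := dvd_sub hdn hdk
    rwa [sub_sub_sub_cancel_right] at this)
  have e2 := walkProb_eq_fourier (p := p) hp.span_pos (n := n) (c := -1) (by
    rw [← sub_eq_add_neg]; exact hdn)
  have hcont := continuous_stepChar p
  -- The integrand is `Φ ^ n (1 - e^{iθ})`, which gives the term `ε n / n`, plus `Φ ^ (n - k) (1 - Φ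
  -- ^ k)`, which is of order `k θ² exp (-c n θ²)`.
  have e3 : ((walkProb p (n - k) 0 - walkProb p n (-1) : ℝ) : ℂ) =
      ((span p / (2 * Real.pi) : ℝ) : ℂ) * ∫ θ in -(Real.pi / span p)..Real.pi / span p,
        (stepChar p θ ^ (n - k) * (1 - stepChar p θ ^ k) +
          stepChar p θ ^ n * (1 - Complex.exp ((θ : ℝ) * Complex.I))) := by
    rw [Complex.ofReal_sub, e1, e2, ← mul_sub, ← intervalIntegral.integral_sub]
    · congr 1
      refine intervalIntegral.integral_congr fun θ _ => ?_
      rw [show n = n - k + k by omega, Nat.add_sub_cancel, pow_add]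
      simp
      ring
    · exact ((hcont.pow _).mul (by fun_prop)).intervalIntegrable _ _
    · exact ((hcont.pow _).mul (by fun_prop)).intervalIntegrable _ _
  have hk' : (k : ℝ) ≤ n / 2 := by
    have : (2 * k : ℝ) ≤ n := by exact_mod_cast hk
    linarith
  have hpow : ∀ (z : ℂ), ‖z‖ ≤ 1 → ∀ k : ℕ, ‖1 - z ^ k‖ ≤ k * ‖1 - z‖ := by
    intro z hz k
    rw [← mul_neg_geom_sum, norm_mul, mul_comm]
    refine mul_le_mul_of_nonneg_right ((norm_sum_le _ _).trans ?_) (norm_nonneg _)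
    refine (Finset.sum_le_card_nsmul _ _ 1 fun i _ => ?_).trans (by simp)
    rw [norm_pow]
    exact pow_le_one₀ (norm_nonneg _) hz
  -- As `k ≤ n / 2`, the power `Φ ^ (n - k)` still decays at the rate of `n / 2`; the factor `θ²` is
  -- absorbed by halving this rate once more.
  have b1 : ‖∫ θ in -(Real.pi / span p)..Real.pi / span p,
      stepChar p θ ^ (n - k) * (1 - stepChar p θ ^ k)‖ ≤
      (k * (2 * σsq) * (4 / (b * n))) * √(Real.pi / (b * n / 4)) := by
    refine norm_intervalIntegral_le_of_gaussian (by positivity) (by positivity) fun θ hθ => ?_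
    have h1 := h θ hθ (n - k)
    have h2 : Real.exp (-(b * (n - k : ℕ)) * θ ^ 2) ≤ Real.exp (-(b * n / 2) * θ ^ 2) := by
      refine Real.exp_le_exp.2 (mul_le_mul_of_nonneg_right ?_ (sq_nonneg _))
      rw [Nat.cast_sub (by omega)]
      nlinarith
    have h3 := hpow _ (norm_stepChar_le_one p θ) k
    have h4 := hp.norm_one_sub_stepChar_le θ
    have h5 := mul_exp_neg_le (b := b * n / 2) (by positivity) θ
    rw [norm_mul]
    calc _ ≤ Real.exp (-(b * n / 2) * θ ^ 2) * (k * (2 * σsq * θ ^ 2)) := by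
          refine mul_le_mul (h1.trans h2) (h3.trans ?_) (norm_nonneg _) (Real.exp_pos _).le
          gcongr
      _ = k * (2 * σsq) * (θ ^ 2 * Real.exp (-(b * n / 2) * θ ^ 2)) := by ring
      _ ≤ k * (2 * σsq) * (2 / (b * n / 2) * Real.exp (-(b * n / 2 / 2) * θ ^ 2)) := by gcongr
      _ = _ := by
        rw [show b * n / 2 / 2 = b * n / 4 by ring, show 2 / (b * n / 2) = 4 / (b * n) by
          field_simp; norm_num]
        ring
  refine (hp.abs_walkProb_le_of_fourier e3 (a := (k * (2 * σsq) * (4 / (b * n))) *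
    √(Real.pi / (b * n / 4)) + ‖J n‖) ?_).trans_eq ?_
  · rw [intervalIntegral.integral_add]
    · exact (norm_add_le _ _).trans (add_le_add b1 le_rfl)
    · exact ((hcont.pow _).mul (by fun_prop)).intervalIntegrable _ _
    · exact ((hcont.pow _).mul (by fun_prop)).intervalIntegrable _ _
  · have h6 : √(Real.pi / (b * n / 4)) = √(Real.pi / (b / 4)) / √n := by
      rw [← Real.sqrt_div (by positivity)]
      congr 1
      field_simp
    simp only [hJ]
    rw [h6, intervalIntegral.integral_const_mul, norm_mul, norm_mul, Complex.norm_real,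
      Real.norm_of_nonneg hs.le, ← mul_assoc (√(n : ℝ)), hss]
    generalize ‖∫ θ in -(Real.pi / span p)..Real.pi / span p,
      (stepChar p θ ^ n * (1 - Complex.exp ((θ : ℝ) * Complex.I)))‖ = X
    field_simp

end IsCritical

/-! ### The mean of an additive functional -/

theorem sum_inv_sqrt_le (n : ℕ) : ∑ k ∈ Finset.range (n + 1), 1 / √(k : ℝ) ≤ 2 * √n := by
  induction n with
  | zero => simp
  | succ n ih =>
    rw [Finset.sum_range_succ]
    have h0 : 0 < √((n + 1 : ℕ) : ℝ) := Real.sqrt_pos.2 (by positivity)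
    have h1 : √((n + 1 : ℕ) : ℝ) * √((n + 1 : ℕ) : ℝ) = n + 1 := by
      rw [Real.mul_self_sqrt (by positivity)]; push_cast; rfl
    have h2 : √(n : ℝ) * √(n : ℝ) = n := Real.mul_self_sqrt (by positivity)
    have h3 : 1 / √((n + 1 : ℕ) : ℝ) ≤ 2 * √((n + 1 : ℕ) : ℝ) - 2 * √(n : ℝ) := by
      rw [div_le_iff₀ h0]
      nlinarith [sq_nonneg (√((n + 1 : ℕ) : ℝ) - √(n : ℝ))]
    linarith

theorem inv_mul_sqrt_le {n : ℕ} (hn : 0 < n) :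
    1 / (((n + 1 : ℕ) : ℝ) * √((n + 1 : ℕ) : ℝ)) ≤ 2 / √(n : ℝ) - 2 / √((n + 1 : ℕ) : ℝ) := by
  have h0 : 0 < √((n + 1 : ℕ) : ℝ) := Real.sqrt_pos.2 (by positivity)
  have hn0 : 0 < √(n : ℝ) := Real.sqrt_pos.2 (by exact_mod_cast hn)
  set a := √(n : ℝ) with ha
  set b := √((n + 1 : ℕ) : ℝ) with hb
  have h1 : b * b = ((n + 1 : ℕ) : ℝ) := Real.mul_self_sqrt (by positivity)
  have h2 : a * a = n := Real.mul_self_sqrt (by positivity)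
  have h3 : b * b = a * a + 1 := by rw [h1, h2]; push_cast; rfl
  have hab : a ≤ b := Real.sqrt_le_sqrt (by push_cast; linarith)
  rw [← h1, div_sub_div _ _ hn0.ne' h0.ne', div_le_div_iff₀ (by positivity) (by positivity)]
  have h4 : (b - a) * (b + a) = 1 := by nlinarith
  have h5 : a ≤ 2 * (b - a) * (b * b) := by
    have : (b - a) * (2 * b) ≥ 1 := by nlinarith
    nlinarith
  nlinarith

/-- Tails of series dominated by `k ^ (-3/2)`. -/
theorem abs_sub_sum_le_of_hasSum {α : ℕ → ℝ} {μ η : ℝ} (hα : HasSum α μ) {n : ℕ} (hn : 0 < n)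
    (h : ∀ k, n < k → |α k| * (k * √k) ≤ η) :
    |μ - ∑ k ∈ Finset.range (n + 1), α k| ≤ 2 * η / √n := by
  have hη : 0 ≤ η := (by positivity : (0 : ℝ) ≤ _).trans (h (n + 1) (by omega))
  have hpart : ∀ m ≥ n, |∑ k ∈ Finset.range (m + 1), α k - ∑ k ∈ Finset.range (n + 1), α k| ≤
      2 * η / √n - 2 * η / √m := by
    intro m hm
    induction m, hm using Nat.le_induction with
    | base => simp
    | succ m hm ih =>
      rw [Finset.sum_range_succ, add_sub_right_comm]
      refine (abs_add_le _ _).trans ?_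
      have h1 := h (m + 1) (by omega)
      have h0 : 0 < ((m + 1 : ℕ) : ℝ) * √((m + 1 : ℕ) : ℝ) := by positivity
      rw [← le_div_iff₀ h0] at h1
      have h2 := mul_le_mul_of_nonneg_left (inv_mul_sqrt_le (n := m) (by omega)) hη
      have h3 : η * (1 / (((m + 1 : ℕ) : ℝ) * √((m + 1 : ℕ) : ℝ))) =
        η / (((m + 1 : ℕ) : ℝ) * √((m + 1 : ℕ) : ℝ)) := by ring
      have h4 : η * (2 / √(m : ℝ) - 2 / √((m + 1 : ℕ) : ℝ)) =
        2 * η / √m - 2 * η / √((m + 1 : ℕ) : ℝ) := by ring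
      linarith
  have hlim : Tendsto (fun m : ℕ => |∑ k ∈ Finset.range (m + 1), α k -
      ∑ k ∈ Finset.range (n + 1), α k|) atTop (𝓝 |μ - ∑ k ∈ Finset.range (n + 1), α k|) :=
    (((hα.tendsto_sum_nat.comp (tendsto_add_atTop_nat 1)).sub_const _).abs)
  refine le_of_tendsto hlim ?_
  filter_upwards [eventually_ge_atTop n] with m hm
  refine (hpart m hm).trans ?_
  have : 0 ≤ 2 * η / √(m : ℝ) := by positivity
  linarith

/-- A form of Kronecker's lemma: a bounded range of `k` contributes `O(1)` to the sum, and the other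
terms are `o(k ^ (-1/2))`. -/
theorem tendsto_sum_mul_div_sqrt {α : ℕ → ℝ} (hα : Summable fun k => |α k|)
    (h : Tendsto (fun k : ℕ => |α k| * (k * √k)) atTop (𝓝 0)) :
    Tendsto (fun n : ℕ => (∑ k ∈ Finset.range (n + 1), |α k| * k) / √n) atTop (𝓝 0) := by
  rw [Metric.tendsto_atTop]
  intro η hη
  obtain ⟨N, hN⟩ := eventually_atTop.1 (h.eventually (gt_mem_nhds (by positivity : 0 < η / 4)))
  have h1 : Tendsto (fun n : ℕ => N * (∑' k, |α k|) / √(n : ℝ)) atTop (𝓝 0) :=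
    tendsto_const_nhds.div_atTop (Real.tendsto_sqrt_atTop.comp tendsto_natCast_atTop_atTop)
  obtain ⟨M, hM⟩ := eventually_atTop.1 (h1.eventually (gt_mem_nhds (by positivity : 0 < η / 2)))
  refine ⟨max M 1, fun n hn => ?_⟩
  have hn1 : 0 < n := by have := le_max_right M 1; omega
  have hs : 0 < √(n : ℝ) := Real.sqrt_pos.2 (by exact_mod_cast hn1)
  have h2 := hM n ((le_max_left _ _).trans hn)
  rw [Real.dist_eq, sub_zero, abs_of_nonneg (by positivity), div_lt_iff₀ hs]
  rw [div_lt_iff₀ hs] at h2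
  calc ∑ k ∈ Finset.range (n + 1), |α k| * k
      ≤ ∑ k ∈ Finset.range (n + 1), (N * |α k| + η / 4 * (1 / √k)) := by
        refine Finset.sum_le_sum fun k _ => ?_
        rcases lt_or_ge k N with hk | hk
        · have : (k : ℝ) ≤ N := by exact_mod_cast hk.le
          have h3 : 0 ≤ η / 4 * (1 / √(k : ℝ)) := by positivity
          nlinarith [abs_nonneg (α k)]
        · have h3 : 0 ≤ N * |α k| := by positivity
          rcases Nat.eq_zero_or_pos k with rfl | hk0
          · simp; positivity
          have hk0 : 0 < √(k : ℝ) := Real.sqrt_pos.2 (by exact_mod_cast hk0)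
          have h4 : |α k| * k ≤ η / 4 * (1 / √k) := by
            rw [mul_one_div, le_div_iff₀ hk0, mul_assoc]
            exact (hN k hk).le
          linarith
    _ = N * ∑ k ∈ Finset.range (n + 1), |α k| + η / 4 * ∑ k ∈ Finset.range (n + 1), 1 / √(k : ℝ) := by
        rw [Finset.sum_add_distrib, Finset.mul_sum, Finset.mul_sum]
    _ ≤ N * (∑' k, |α k|) + η / 4 * (2 * √n) := by
        gcongr
        · exact hα.sum_le_tsum _ fun k _ => abs_nonneg _
        · exact sum_inv_sqrt_le n
    _ < η * √n := by linarith

/-- The expected number of returns to the origin, from a bound on the point probabilities. -/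
theorem sum_walkProb_zero_le {p : PMF ℕ} {C : ℝ} (hC : 0 ≤ C)
    (h : ∀ n : ℕ, 0 < n → ∀ c : ℤ, walkProb p n c ≤ C / √n) (n : ℕ) :
    ∑ k ∈ Finset.range (n + 1), walkProb p (n - k) 0 ≤ 1 + 2 * C * √n := by
  have h3 : ∑ k ∈ Finset.range (n + 1), walkProb p (n - k) 0 =
      ∑ k ∈ Finset.range (n + 1), walkProb p k 0 := by
    rw [← Finset.sum_range_reflect]
    refine Finset.sum_congr rfl fun k hk => ?_
    congr 1
    have := Finset.mem_range.1 hk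
    omega
  have h4 : ∀ k ∈ Finset.range (n + 1), walkProb p k 0 ≤
      (if k = 0 then 1 else 0) + C * (1 / √k) := by
    intro k _
    split_ifs with hk
    · subst hk; simp [walkProb_zero]
    · rw [zero_add, mul_one_div]; exact h k (Nat.pos_of_ne_zero hk) 0
  rw [h3]
  refine (Finset.sum_le_sum h4).trans ?_
  rw [Finset.sum_add_distrib, ← Finset.mul_sum]
  have := mul_le_mul_of_nonneg_left (sum_inv_sqrt_le n) hC
  simp only [Finset.sum_ite_eq', Finset.mem_range, Nat.succ_pos, if_true]
  linarith

theorem dvd_of_sizeProb_ne_zero {p : PMF ℕ} {n : ℕ} (h : sizeProb p n ≠ 0) : (span p : ℤ) ∣ n - 1 := by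
  have hn : n ≠ 0 := by
    rintro rfl
    exact h levelSum_zero_right
  have h1 : walkProb p n (-1) ≠ 0 := by
    rw [← mul_sizeProb]
    exact mul_ne_zero (by exact_mod_cast hn) h
  have := dvd_of_walkProb_ne_zero h1
  rwa [← sub_eq_add_neg] at this

namespace IsCritical
variable {p : PMF ℕ} {σsq : ℝ} (hp : IsCritical p σsq)
include hp

theorem exists_sizeProb_le : ∃ C > 0, ∀ n : ℕ, sizeProb p n * (n * √n) ≤ C := by
  obtain ⟨C, hC, h⟩ := hp.exists_walkProb_le
  refine ⟨C, hC, fun n => ?_⟩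
  rcases Nat.eq_zero_or_pos n with rfl | hn
  · simpa using hC.le
  have hs : 0 < √(n : ℝ) := Real.sqrt_pos.2 (by exact_mod_cast hn)
  have := h n hn (-1)
  rw [← mul_sizeProb, le_div_iff₀ hs] at this
  linarith

theorem exists_le_sizeProb : ∃ c > 0, ∀ n : ℕ, 0 < sizeProb p n → c ≤ sizeProb p n * (n * √n) := by
  obtain ⟨c, hc, h⟩ := hp.exists_le_sqrt_mul_walkProb
  refine ⟨c, hc, fun n hn => ?_⟩
  have hn0 : n ≠ 0 := by
    rintro rfl
    exact hn.ne' levelSum_zero_right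
  have hn1 : (0 : ℝ) < n := by exact_mod_cast Nat.pos_of_ne_zero hn0
  have := h n (by rw [← mul_sizeProb]; positivity)
  rw [← mul_sizeProb] at this
  linarith

theorem exists_sizeProb_pos (N : ℕ) : ∃ n ≥ N, 0 < sizeProb p n := by
  obtain ⟨c, hc, M, h⟩ := hp.exists_eventually_le_sqrt_mul_walkProb
  have hd := hp.span_pos
  refine ⟨span p * (M + N) + 1, by nlinarith, ?_⟩
  have h1 := h (span p * (M + N) + 1) (by nlinarith) (by simp)
  have h2 : 0 < walkProb p (span p * (M + N) + 1) (-1) := by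
    by_contra h3
    have := walkProb_nonneg (p := p) (span p * (M + N) + 1) (-1)
    rw [le_antisymm (not_lt.1 h3) this, mul_zero] at h1
    linarith
  rw [← mul_sizeProb] at h2
  exact pos_of_mul_pos_right h2 (Nat.cast_nonneg _)

theorem tendsto_coe_admissibleSize :
    Tendsto (fun n : AdmissibleSize p => (n : ℕ)) atTop atTop := by
  refine tendsto_atTop.2 fun b => ?_
  obtain ⟨n, hn, h⟩ := hp.exists_sizeProb_pos b
  filter_upwards [eventually_ge_atTop (⟨n, admissible_iff.2 h⟩ : AdmissibleSize p)] with m hm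
  exact hn.trans hm

/-- Limits along the admissible sizes, for sequences vanishing at the other sizes. -/
theorem tendsto_nat_of_tendsto_admissibleSize {g : ℕ → ℝ} (h0 : ∀ n, sizeProb p n = 0 → g n = 0)
    (h : Tendsto (fun n : AdmissibleSize p => g n) atTop (𝓝 0)) : Tendsto g atTop (𝓝 0) := by
  rw [Metric.tendsto_atTop]
  intro η hη
  obtain ⟨n, -, hn⟩ := hp.exists_sizeProb_pos 0
  have : Nonempty (AdmissibleSize p) := ⟨⟨n, admissible_iff.2 hn⟩⟩
  obtain ⟨N, hN⟩ := eventually_atTop.1 (Metric.tendsto_nhds.1 h η hη)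
  refine ⟨N, fun m hm => ?_⟩
  rcases (sizeProb_nonneg (p := p) (n := m)).eq_or_lt with h1 | h1
  · rw [h0 m h1.symm]; simpa using hη
  · exact hN ⟨m, admissible_iff.2 h1⟩ hm

theorem tendsto_abs_levelSum_mul {f : PlaneTree → ℝ}
    (h : Tendsto (fun n : ℕ => levelSum p f n / sizeProb p n) atTop (𝓝 0)) :
    Tendsto (fun n : ℕ => |levelSum p f n| * (n * √n)) atTop (𝓝 0) := by
  obtain ⟨C, hC, hle⟩ := hp.exists_sizeProb_le
  have h1 := h.abs.mul_const C
  simp only [abs_zero, zero_mul] at h1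
  refine squeeze_zero (fun n => by positivity) (fun n => ?_) h1
  rcases (sizeProb_nonneg (p := p) (n := n)).eq_or_lt with h2 | h2
  · rw [levelSum_eq_zero h2.symm]; simp
  · rw [abs_div, abs_of_pos h2]
    calc |levelSum p f n| * (n * √n) =
        |levelSum p f n| / sizeProb p n * (sizeProb p n * (n * √n)) := by field_simp
      _ ≤ _ := mul_le_mul_of_nonneg_left (hle n) (by positivity)

/-- The mean of the additive functional of the conditioned tree, from the first moment formula and
the local limit theorem. -/
theorem eventually_abs_levelSum_additive_le {f : PlaneTree → ℝ} (hf : Integrable f (gw p))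
    (h : Tendsto (fun n : ℕ => levelSum p f n / sizeProb p n) atTop (𝓝 0)) {η : ℝ} (hη : 0 < η) :
    ∀ᶠ n : ℕ in atTop, 0 < sizeProb p n →
      |levelSum p (additive f) n / sizeProb p n - n * ∫ T, f T ∂gw p| ≤ η * √n := by
  obtain ⟨c, hc, hlow⟩ := hp.exists_le_sizeProb
  obtain ⟨C1, hC1, hup⟩ := hp.exists_walkProb_le
  obtain ⟨C, hC, ε, hε0, hε, hcmp⟩ := hp.exists_abs_walkProb_sub_le
  set α := levelSum p f with hα
  set μ := ∫ T, f T ∂gw p with hμ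
  have hsum : HasSum α μ := hasSum_levelSum hf
  have habs : Summable fun k => |α k| :=
    Summable.of_nonneg_of_le (fun _ => abs_nonneg _) (fun k => abs_levelSum_le)
      (integrable_gw_iff.1 hf)
  set A := ∑' k, |α k| with hA
  have hA0 : 0 ≤ A := tsum_nonneg fun k => abs_nonneg _
  have hδ := hp.tendsto_abs_levelSum_mul h
  have hS := tendsto_sum_mul_div_sqrt habs hδ
  -- `ν` bounds `|α k| k ^ (3/2)` for large `k`. It enters the errors for `k > n / 2` with the
  -- factor `4 + 16 C1` and the tail of `μ` with the factor `2 C1`.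
  set ν := η * c / (3 * (4 + 18 * C1)) with hν
  have hν0 : 0 < ν := by positivity
  obtain ⟨N, hN⟩ := eventually_atTop.1 (hδ.eventually (gt_mem_nhds hν0))
  have e1 := (hS.const_mul C).eventually (gt_mem_nhds (show _ < η * c / 3 by
    rw [mul_zero]; positivity))
  have e2 := (hε.const_mul A).eventually (gt_mem_nhds (show _ < η * c / 3 by
    rw [mul_zero]; positivity))
  filter_upwards [e1, e2, eventually_ge_atTop (2 * N + 1)] with n he1 he2 hn hπ
  have hn0 : 0 < n := by omega
  have hnR : (0 : ℝ) < n := by exact_mod_cast hn0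
  have hs : 0 < √(n : ℝ) := Real.sqrt_pos.2 hnR
  have hss : √(n : ℝ) * √n = n := Real.mul_self_sqrt hnR.le
  have hw := mul_sizeProb (p := p) n
  have hw1 := hup n hn0 (-1)
  have hw0 := walkProb_nonneg (p := p) n (-1)
  set w := walkProb p n (-1) with hwdef
  have hwlow : c ≤ w * √n := by
    have := hlow n hπ
    rw [← hw]; linarith
  have hwpos : 0 < w := by rw [← hw]; positivity
  -- Sizes `k ≤ n / 2` are handled by comparing the two probabilities, sizes `k > n / 2` by the
  -- smallness of `α k`; the latter leaves return probabilities whose sum is `O(√n)`.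
  have hterm : ∀ k ∈ Finset.range (n + 1), |α k * (walkProb p (n - k) 0 - w)| ≤
      C / (n * √n) * (|α k| * k) + ε n / n * |α k| +
        4 * ν / (n * √n) * (walkProb p (n - k) 0 + w) := by
    intro k hk
    have hkn : k ≤ n := Nat.lt_succ_iff.1 (Finset.mem_range.1 hk)
    have hu0 := walkProb_nonneg (p := p) (n - k) 0
    rw [abs_mul]
    by_cases hk2 : 2 * k ≤ n
    · have h3 : 0 ≤ 4 * ν / (n * √n) * (walkProb p (n - k) 0 + w) := by positivity
      by_cases hk0 : sizeProb p k = 0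
      · rw [hα, levelSum_eq_zero hk0]
        simpa using h3
      have h4 := hcmp n k hn0 hk2 (dvd_of_sizeProb_ne_zero hπ.ne')
        (dvd_of_sizeProb_ne_zero hk0)
      have h5 := mul_le_mul_of_nonneg_left h4 (abs_nonneg (α k))
      have h6 : |α k| * (C * k / (n * √n) + ε n / n) =
        C / (n * √n) * (|α k| * k) + ε n / n * |α k| := by ring
      linarith
    · have h3 : 0 ≤ C / (n * √n) * (|α k| * k) + ε n / n * |α k| := by
        have := hε0 n
        positivity
      have h4 := (hN k (by omega)).le
      have hkR : (n : ℝ) ≤ 2 * k := by exact_mod_cast (by omega : n ≤ 2 * k)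
      have h5 : √(n : ℝ) ≤ 2 * √k := by
        rw [show (2 : ℝ) * √k = √(4 * k) by
          rw [Real.sqrt_mul (by norm_num), show (4 : ℝ) = 2 ^ 2 by norm_num,
            Real.sqrt_sq (by norm_num)]]
        exact Real.sqrt_le_sqrt (by linarith)
      have h6 : |α k| ≤ 4 * ν / (n * √n) := by
        rw [le_div_iff₀ (by positivity)]
        have : (n : ℝ) * √n ≤ 2 * k * (2 * √k) := by gcongr
        nlinarith [abs_nonneg (α k)]
      have h7 : |walkProb p (n - k) 0 - w| ≤ walkProb p (n - k) 0 + w := by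
        rw [abs_le]; constructor <;> linarith
      have := mul_le_mul h6 h7 (abs_nonneg _) (by positivity)
      linarith
  have hsumu := sum_walkProb_zero_le hC1.le hup n
  have hD : n * |∑ k ∈ Finset.range (n + 1), α k * (walkProb p (n - k) 0 - w)| ≤
      C * ((∑ k ∈ Finset.range (n + 1), |α k| * k) / √n) + A * ε n + ν * (4 + 16 * C1) := by
    have h3 := (Finset.abs_sum_le_sum_abs _ _).trans (Finset.sum_le_sum hterm)
    rw [Finset.sum_add_distrib, Finset.sum_add_distrib, ← Finset.mul_sum, ← Finset.mul_sum,
      ← Finset.mul_sum, Finset.sum_add_distrib, Finset.sum_const, Finset.card_range,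
      nsmul_eq_mul] at h3
    have h4 := habs.sum_le_tsum (Finset.range (n + 1)) fun k _ => abs_nonneg (α k)
    have h5 : ((n + 1 : ℕ) : ℝ) * w ≤ 2 * C1 * √n := by
      rw [le_div_iff₀ hs] at hw1
      have : ((n + 1 : ℕ) : ℝ) ≤ 2 * n := by
        push_cast
        have : (1 : ℝ) ≤ n := by exact_mod_cast hn0
        linarith
      calc ((n + 1 : ℕ) : ℝ) * w ≤ 2 * n * w := by gcongr
        _ = 2 * (w * √n) * √n := by rw [mul_assoc, mul_assoc, mul_assoc, hss]; ring
        _ ≤ 2 * C1 * √n := by gcongr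
    have h1s : 1 ≤ √(n : ℝ) := Real.one_le_sqrt.2 (by exact_mod_cast hn0)
    calc _ ≤ (n : ℝ) * (C / (n * √n) * ∑ k ∈ Finset.range (n + 1), |α k| * k + ε n / n * A +
          4 * ν / (n * √n) * (√n + 2 * C1 * √n + 2 * C1 * √n)) := by
          refine mul_le_mul_of_nonneg_left (h3.trans ?_) hnR.le
          have := hε0 n
          gcongr
          linarith
      _ = _ := by field_simp; ring
  have htail := abs_sub_sum_le_of_hasSum hsum hn0 (fun k hk => (hN k (by omega)).le)
  have hkey : n * |levelSum p (additive f) n - μ * w| ≤ η * c := by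
    have h3 : levelSum p (additive f) n - μ * w =
        ∑ k ∈ Finset.range (n + 1), α k * (walkProb p (n - k) 0 - w) -
          w * (μ - ∑ k ∈ Finset.range (n + 1), α k) := by
      rw [levelSum_additive]
      simp only [mul_sub, Finset.sum_sub_distrib, ← Finset.sum_mul]
      rw [hα]
      ring
    have h4 : n * |w * (μ - ∑ k ∈ Finset.range (n + 1), α k)| ≤ 2 * C1 * ν := by
      rw [abs_mul, abs_of_pos hwpos]
      calc _ ≤ n * (C1 / √n * (2 * ν / √n)) := by gcongr
        _ = 2 * C1 * ν := by
          rw [div_mul_div_comm, hss]; field_simp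
    rw [h3]
    calc _ ≤ (n : ℝ) * (|∑ k ∈ Finset.range (n + 1), α k * (walkProb p (n - k) 0 - w)| +
          |w * (μ - ∑ k ∈ Finset.range (n + 1), α k)|) := by
          gcongr
          exact abs_sub _ _
      _ ≤ η * c / 3 + η * c / 3 + ν * (4 + 16 * C1) + 2 * C1 * ν := by
          rw [mul_add]
          linarith
      _ = η * c := by
          have : ν * (4 + 18 * C1) = η * c / 3 := by rw [hν]; field_simp
          linarith
  -- `w = n π_n`, and `w √n` is bounded below by `c`.
  have h5 : levelSum p (additive f) n / sizeProb p n - n * μ =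
      n * (levelSum p (additive f) n - μ * w) / w := by
    rw [← hw]; field_simp
  rw [h5, abs_div, abs_mul, Nat.abs_cast, abs_of_pos hwpos, div_le_iff₀ hwpos]
  refine hkey.trans ?_
  have := mul_le_mul_of_nonneg_left hwlow hη.le
  linarith

end IsCritical

/-! ### Rotations and windows -/

theorem additive_congr {f g : PlaneTree → ℝ} (T : PlaneTree) :
    (∀ t, t.size ≤ T.size → f t = g t) → additive f T = additive g T := by
  induction T using induction_node with
  | h ts ih =>
    intro h
    rw [additive_node, additive_node, h _ le_rfl]
    congr 2
    refine List.map_congr_left fun t ht => ih t ht fun t' ht' => h t' (ht'.trans ?_)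
    rw [← length_code, ← length_code, code, List.length_cons, List.length_flatten, List.map_map]
    exact (List.le_sum_of_mem (List.mem_map_of_mem (f := List.length ∘ code) ht)).trans
      (Nat.le_succ _)

theorem additive_add (f g : PlaneTree → ℝ) (T : PlaneTree) :
    additive (fun t => f t + g t) T = additive f T + additive g T :=
  List.sum_map_add

theorem additive_const_mul (c : ℝ) (f : PlaneTree → ℝ) (T : PlaneTree) :
    additive (fun t => c * f t) T = c * additive f T :=
  List.sum_map_mul_left _ _ _

theorem abs_additive_le (f : PlaneTree → ℝ) (T : PlaneTree) :
    |additive f T| ≤ additive (fun t => |f t|) T := by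
  unfold additive
  induction fringe T with
  | nil => simp
  | cons t l ih =>
    simp only [List.map_cons, List.sum_cons]
    exact (abs_add_le _ _).trans (by gcongr)

theorem additive_one (T : PlaneTree) : additive (fun _ => 1) T = T.size := by
  simp [additive, size]

theorem additive_nonneg {f : PlaneTree → ℝ} (h : ∀ t, 0 ≤ f t) (T : PlaneTree) :
    0 ≤ additive f T := List.sum_nonneg (by simpa using fun t _ => h t)

theorem additive_sq_le (f : PlaneTree → ℝ) (T : PlaneTree) :
    additive f T ^ 2 ≤ T.size * additive (fun t => f t ^ 2) T := by
  rw [← sum_headToll_rotate, ← sum_headToll_rotate]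
  simp only [← headToll_sq]
  have := sq_sum_le_card_mul_sum_sq (s := Finset.range T.size)
    (f := fun i => headToll f ((code T).rotate i))
  rwa [Finset.card_range] at this

theorem headToll_eq_of_prefix {f : PlaneTree → ℝ} {K : ℕ} (hf : ∀ T, K < T.size → f T = 0)
    {l l' : List ℕ} (h : l <+: l') (hl : K ≤ l.length) : headToll f l = headToll f l' := by
  by_cases h1 : ∃ T, code T <+: l'
  · obtain ⟨T, hT⟩ := h1
    rw [headToll_of_prefix f hT]
    by_cases h2 : ∃ T, code T <+: l
    · obtain ⟨T', hT'⟩ := h2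
      rw [headToll_of_prefix f hT', eq_of_code_prefix hT (hT'.trans h)]
    · rw [headToll_eq_zero f h2, hf]
      by_contra h3
      refine h2 ⟨T, List.prefix_of_prefix_length_le hT h ?_⟩
      rw [length_code]
      omega
  · rw [headToll_eq_zero f h1, headToll_eq_zero]
    rintro ⟨T, hT⟩
    exact h1 ⟨T, hT.trans h⟩

/-- Two windows which differ by `a` letters: the difference of the factor sums collects the tolls at
the first `a` positions. -/
theorem factorSum_take_sub {f : PlaneTree → ℝ} {K : ℕ} (hf : ∀ T, K < T.size → f T = 0)
    {l : List ℕ} {a m : ℕ} (hK : K ≤ m) (hl : a + m ≤ l.length) :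
    factorSum f (l.take (a + m)) - factorSum f ((l.rotate a).take m) =
      ∑ i ∈ Finset.range a, headToll f (l.rotate i) := by
  have h1 : (l.rotate a).take m = (l.take (a + m)).drop a := by
    rw [List.rotate_eq_drop_append_take (by omega), List.take_append_of_le_length
      (by rw [List.length_drop]; omega), List.drop_take, Nat.add_sub_cancel_left]
  rw [h1, factorSum_eq_sum, factorSum_eq_sum, List.length_drop, List.length_take,
    min_eq_left hl, Nat.add_sub_cancel_left, Finset.sum_range_add]
  simp only [List.drop_drop]
  rw [add_sub_assoc, sub_self, add_zero]
  refine Finset.sum_congr rfl fun i hi => ?_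
  have hi' := Finset.mem_range.1 hi
  refine headToll_eq_of_prefix hf ?_ ?_
  · rw [List.rotate_eq_drop_append_take (by omega), List.drop_take]
    exact (List.take_prefix _ _).trans (List.prefix_append _ _)
  · rw [List.length_drop, List.length_take, min_eq_left hl]
    omega

/-- A sum over all rotations is invariant under a further rotation. -/
theorem sum_rotate_add (h : List ℕ → ℝ) (l : List ℕ) (a : ℕ) :
    ∑ j ∈ Finset.range l.length, h (l.rotate (j + a)) =
      ∑ j ∈ Finset.range l.length, h (l.rotate j) := by
  induction a with
  | zero => simp
  | succ a ih =>
    rw [← ih]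
    have h1 := Finset.sum_range_succ' (fun j => h (l.rotate (j + a))) l.length
    have h2 := Finset.sum_range_succ (fun j => h (l.rotate (j + a))) l.length
    have h3 : l.rotate (l.length + a) = l.rotate (0 + a) := by
      rw [← List.rotate_rotate, List.rotate_length, zero_add]
    rw [h2, h3] at h1
    simp only [add_right_comm _ a 1, ← add_assoc] at h1 ⊢
    linarith

/-- The additive functional as a sum, over all rotations, of differences of window sums. -/
theorem mul_additive_eq {f : PlaneTree → ℝ} {K : ℕ} (hf : ∀ T, K < T.size → f T = 0)
    {a m : ℕ} (hK : K ≤ m) (T : PlaneTree) (hT : a + m ≤ T.size) :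
    a * additive f T = ∑ j ∈ Finset.range T.size,
      (factorSum f (((code T).rotate j).take (a + m)) -
        factorSum f (((code T).rotate j).take m)) := by
  have h1 := sum_rotate_add (fun l => factorSum f (l.take m)) (code T) a
  simp only [length_code] at h1
  rw [Finset.sum_sub_distrib, ← h1, ← Finset.sum_sub_distrib]
  simp only [← List.rotate_rotate]
  rw [Finset.sum_congr rfl fun j _ => factorSum_take_sub hf hK (by
    rw [List.length_rotate, length_code]; exact hT), Finset.sum_comm]
  simp only [List.rotate_rotate]
  have h2 := fun i => sum_rotate_add (headToll f) (code T) i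
  simp only [length_code] at h2
  simp only [h2, sum_headToll_rotate]
  simp

/-- Moments of the additive functional of the conditioned tree are controlled by moments of window
sums in independent sequences. -/
theorem mul_levelSum_sub_pow_le {p : PMF ℕ} {f : PlaneTree → ℝ} {K : ℕ}
    (hf : ∀ T, K < T.size → f T = 0) {a m n q : ℕ} (hK : K ≤ m) (hn : a + m ≤ n) (hq : Even q)
    (hq0 : q ≠ 0) {B M : ℝ} (hM : M = ∑ k ∈ Finset.range (K + 1), levelSum p f k)
    (hB : ∀ c, walkProb p (n - (a + m)) c ≤ B) (hB' : ∀ c, walkProb p (n - m) c ≤ B) :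
    (a : ℝ) ^ q * levelSum p (fun T => (additive f T - n * M) ^ q) n ≤
      (2 * n : ℝ) ^ (q - 1) * (B *
        ∫ ω, (factorSum f (word ω (a + m)) - ∫ ω', factorSum f (word ω' (a + m)) ∂seqLaw p) ^ q
          ∂seqLaw p + B *
        ∫ ω, (factorSum f (word ω m) - ∫ ω', factorSum f (word ω' m) ∂seqLaw p) ^ q
          ∂seqLaw p) := by
  set e : ℕ → ℝ := fun m => ∫ ω', factorSum f (word ω' m) ∂seqLaw p with he
  have hlev : ∀ k, K < k → levelSum p f k = 0 := fun k hk => by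
    rw [levelSum_congr (h := fun _ => 0) fun T hT => hf T (by omega), levelSum_const, zero_mul]
  have hmean : ∀ m, K ≤ m → e m = ∑ k ∈ Finset.range (K + 1), ((m : ℝ) + 1 - k) *
      levelSum p f k := by
    intro m hm
    rw [he]
    simp only
    rw [integral_factorSum (N := m + 1) m (Nat.lt_succ_self m)]
    have : Finset.range (K + 1) ⊆ Finset.range (m + 1) := Finset.range_subset_range.2 (by omega)
    rw [← Finset.sum_subset this fun k _ hk => by
      rw [hlev k (by simpa using hk), mul_zero]]
    refine Finset.sum_congr rfl fun k hk => ?_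
    have := Finset.mem_range.1 hk
    rw [Nat.cast_sub (by omega)]
    push_cast; ring
  -- The means of the two windows differ by exactly `a M`, so centring the windows centres the
  -- additive functional.
  have hdiff : e (a + m) - e m = a * M := by
    rw [hmean _ (by omega), hmean _ hK, hM, ← Finset.sum_sub_distrib, Finset.mul_sum]
    refine Finset.sum_congr rfl fun k _ => ?_
    push_cast; ring
  have hpos : ∀ x : ℝ, 0 ≤ x ^ q := fun x => hq.pow_nonneg x
  set G : ℕ → List ℕ → ℝ := fun m l => (factorSum f (l.take m) - e m) ^ q with hG
  -- Convexity of `x ^ q`, for the average over rotations and for the difference of the two windows.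
  have hpt : ∀ T : PlaneTree, T.size = n → (a : ℝ) ^ q * (additive f T - n * M) ^ q ≤
      (2 * n : ℝ) ^ (q - 1) * (∑ j ∈ Finset.range n, G (a + m) ((code T).rotate j) +
        ∑ j ∈ Finset.range n, G m ((code T).rotate j)) := by
    intro T hT
    have h1 : (a : ℝ) * (additive f T - n * M) = ∑ j ∈ Finset.range n,
        ((factorSum f (((code T).rotate j).take (a + m)) - e (a + m)) -
          (factorSum f (((code T).rotate j).take m) - e m)) := by
      rw [mul_sub, mul_additive_eq hf hK T (by omega), hT, mul_left_comm, ← hdiff]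
      simp only [Finset.sum_sub_distrib, Finset.sum_const, Finset.card_range, nsmul_eq_mul]
      ring
    rw [← mul_pow, h1, ← hq.pow_abs]
    obtain ⟨r, rfl⟩ := Nat.exists_eq_succ_of_ne_zero hq0
    simp only [Nat.succ_eq_add_one, Nat.add_sub_cancel] at *
    set z : ℕ → ℝ := fun j => (factorSum f (((code T).rotate j).take (a + m)) - e (a + m)) with hz
    set y : ℕ → ℝ := fun j => (factorSum f (((code T).rotate j).take m) - e m) with hy
    calc |∑ j ∈ Finset.range n, (z j - y j)| ^ (r + 1)
        ≤ (∑ j ∈ Finset.range n, (|z j| + |y j|)) ^ (r + 1) := by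
          refine pow_le_pow_left₀ (abs_nonneg _) ((Finset.abs_sum_le_sum_abs _ _).trans
            (Finset.sum_le_sum fun j _ => abs_sub _ _)) _
      _ ≤ (n : ℝ) ^ r * ∑ j ∈ Finset.range n, (|z j| + |y j|) ^ (r + 1) := by
          have h2 := pow_sum_le_card_mul_sum_pow (s := Finset.range n) (f := fun j => |z j| + |y j|)
            (fun j _ => by positivity) r
          rwa [Finset.card_range] at h2
      _ ≤ (n : ℝ) ^ r * ∑ j ∈ Finset.range n, 2 ^ r * (z j ^ (r + 1) + y j ^ (r + 1)) := by
          gcongr with j _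
          refine (add_pow_le (abs_nonneg _) (abs_nonneg _) (r + 1)).trans_eq ?_
          rw [hq.pow_abs, hq.pow_abs, Nat.add_sub_cancel]
      _ = _ := by
          rw [← Finset.mul_sum, Finset.sum_add_distrib, mul_pow]
          ring
  have hint : ∀ m, Integrable (fun ω => (factorSum f (word ω m) - e m) ^ q) (seqLaw p) := by
    intro m
    obtain ⟨C, hC⟩ := exists_abs_factorSum_le f m
    refine integrable_word_of_bound (G := fun l => (factorSum f l - e m) ^ q)
      (C := (C + |e m|) ^ q) fun l hl => ?_
    rw [abs_pow]
    exact pow_le_pow_left₀ (abs_nonneg _) ((abs_sub _ _).trans (by gcongr; exact hC l hl)) q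
  -- The rotated words form a bridge of length `n`, whose first `m` steps have a law with density at
  -- most `B` up to normalization.
  have htrans : ∀ m ≤ n, (∀ c, walkProb p (n - m) c ≤ B) →
      ∑ T ∈ trees n, wordProb p (code T) * ∑ j ∈ Finset.range n, G m ((code T).rotate j) ≤
        B * ∫ ω, (factorSum f (word ω m) - e m) ^ q ∂seqLaw p := by
    intro m hm hB
    have h1 := integral_ite_excess (p := p) (n := n) (G m)
    simp only [smul_eq_mul] at h1
    rw [← h1]
    have h2 := integral_ite_excess_le hB (G := fun l => (factorSum f l - e m) ^ q)
      (fun l => hpos _) (hint m) (-1)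
    rw [Nat.add_sub_cancel' hm] at h2
    refine le_of_eq_of_le (integral_congr_ae (ae_of_all _ fun ω => ?_)) h2
    simp only [hG]
    have : (word ω n).take m = word ω m := by
      obtain ⟨k, rfl⟩ := Nat.exists_eq_add_of_le hm
      rw [word_add, List.take_append_of_le_length (by simp), List.take_of_length_le (by simp)]
    rw [this]
  calc (a : ℝ) ^ q * levelSum p (fun T => (additive f T - n * M) ^ q) n
      = ∑ T ∈ trees n, wordProb p (code T) * ((a : ℝ) ^ q * (additive f T - n * M) ^ q) := by
        rw [levelSum, Finset.mul_sum]
        exact Finset.sum_congr rfl fun T _ => by ring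
    _ ≤ ∑ T ∈ trees n, wordProb p (code T) * ((2 * n : ℝ) ^ (q - 1) *
        (∑ j ∈ Finset.range n, G (a + m) ((code T).rotate j) +
        ∑ j ∈ Finset.range n, G m ((code T).rotate j))) :=
        Finset.sum_le_sum fun T hT =>
          mul_le_mul_of_nonneg_left (hpt T (mem_trees.1 hT)) (wordProb_nonneg _ _)
    _ = (2 * n : ℝ) ^ (q - 1) *
        (∑ T ∈ trees n, wordProb p (code T) * ∑ j ∈ Finset.range n, G (a + m) ((code T).rotate j) +
        ∑ T ∈ trees n, wordProb p (code T) * ∑ j ∈ Finset.range n, G m ((code T).rotate j)) := by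
        rw [← Finset.sum_add_distrib, Finset.mul_sum]
        exact Finset.sum_congr rfl fun T _ => by ring
    _ ≤ _ := by
        gcongr
        · exact htrans _ hn hB
        · exact htrans _ (by omega) hB'

/-! ### Large fringe subtrees -/

theorem size_node (ts : List PlaneTree) : (node ts).size = 1 + (ts.map size).sum := by
  rw [← length_code, code, List.length_cons, List.length_flatten, List.map_map, add_comm]
  congr 3
  ext t
  exact length_code t

theorem additive_eq_zero_of_size_le {g : PlaneTree → ℝ} {m : ℕ} (hg : ∀ T, T.size ≤ m → g T = 0)
    {T : PlaneTree} (hT : T.size ≤ m) : additive g T = 0 := by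
  rw [additive_congr (g := fun _ => 0 * (0 : ℝ)) T fun t ht => by rw [hg t (ht.trans hT), zero_mul],
    additive_const_mul, zero_mul]

/-- Among disjoint trees with fewer than `2 m + 2` vertices in total, at most one has more than `m`
vertices. -/
theorem sum_additive_sq {g : PlaneTree → ℝ} {m : ℕ} (hg : ∀ T, T.size ≤ m → g T = 0)
    (ts : List PlaneTree) (h : (ts.map size).sum ≤ 2 * m + 1) :
    (ts.map (additive g)).sum ^ 2 = (ts.map fun t => additive g t ^ 2).sum := by
  induction ts with
  | nil => simp
  | cons t ts ih =>
    simp only [List.map_cons, List.sum_cons] at h ⊢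
    rw [← ih (by omega)]
    by_cases ht : t.size ≤ m
    · rw [additive_eq_zero_of_size_le hg ht]; ring
    · have : (ts.map (additive g)).sum = 0 := by
        refine List.sum_eq_zero fun x hx => ?_
        obtain ⟨t', ht', rfl⟩ := List.mem_map.1 hx
        have := List.le_sum_of_mem (List.mem_map_of_mem (f := size) ht')
        exact additive_eq_zero_of_size_le hg (by omega)
      rw [this]; ring

/-- Fringe subtrees with more than half of the vertices form a chain, so that the square of a sum
over such subtrees is again an additive functional. -/
theorem additive_sq_eq {g : PlaneTree → ℝ} {m : ℕ} (hg : ∀ T, T.size ≤ m → g T = 0)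
    (T : PlaneTree) (hT : T.size ≤ 2 * m + 2) :
    additive g T ^ 2 = additive (fun t => g t * (2 * additive g t - g t)) T := by
  induction T using induction_node with
  | h ts ih =>
    rw [size_node] at hT
    have h1 := sum_additive_sq hg ts (by omega)
    have h2 : (ts.map (additive fun t => g t * (2 * additive g t - g t))) =
        ts.map fun t => additive g t ^ 2 := by
      refine List.map_congr_left fun t ht => (ih t ht ?_).symm
      have := List.le_sum_of_mem (List.mem_map_of_mem (f := size) ht)
      omega
    rw [additive_node _ ts, additive_node (fun t => g t * (2 * additive g t - g t)), h2, ← h1,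
      additive_node g ts]
    ring

/-! ### A variance bound in terms of the toll -/

theorem sqrt_le_two_mul_sqrt {n k : ℕ} (h : n ≤ 4 * k) : √(n : ℝ) ≤ 2 * √(k : ℝ) := by
  rw [show (2 : ℝ) * √k = √(4 * k) by
    rw [Real.sqrt_mul (by norm_num), show (4 : ℝ) = 2 ^ 2 by norm_num,
      Real.sqrt_sq (by norm_num)]]
  exact Real.sqrt_le_sqrt (by exact_mod_cast h)

theorem add_add_sq_le (x y z : ℝ) : (x + y + z) ^ 2 ≤ 3 * (x ^ 2 + y ^ 2 + z ^ 2) := by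
  nlinarith [sq_nonneg (x - y), sq_nonneg (y - z), sq_nonneg (x - z)]

/-- A bound `s` for the toll function `f`, where `a k` bounds the `L²` norm of `f` under the law of
the tree conditioned to have `k` vertices. -/
structure TollBound (p : PMF ℕ) (f : PlaneTree → ℝ) (a : ℕ → ℝ) (s : ℝ) : Prop where
  nonneg : ∀ k, 0 ≤ a k
  levelSum_sq_le : ∀ k, levelSum p (fun T => f T ^ 2) k ≤ sizeProb p k * a k ^ 2
  le : ∀ k, a k ≤ s
  summable : Summable fun k => a k / k
  tsum_le : ∑' k, a k / k ≤ s

namespace TollBound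
variable {p : PMF ℕ} {f : PlaneTree → ℝ} {a : ℕ → ℝ} {s : ℝ} (hb : TollBound p f a s)
include hb

theorem bound_nonneg : 0 ≤ s := (hb.nonneg 0).trans (hb.le 0)

theorem sum_le (S : Finset ℕ) : ∑ k ∈ S, a k / k ≤ s :=
  (hb.summable.sum_le_tsum S fun k _ => div_nonneg (hb.nonneg k) (Nat.cast_nonneg k)).trans
    hb.tsum_le

/-- Cauchy–Schwarz at a given size. -/
theorem levelSum_abs_mul_le {h : PlaneTree → ℝ} {k : ℕ} {y : ℝ} (hy : 0 ≤ y)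
    (hh : levelSum p (fun T => h T ^ 2) k ≤ sizeProb p k * y ^ 2) :
    levelSum p (fun T => |f T * h T|) k ≤ sizeProb p k * (a k * y) := by
  have hπ : 0 ≤ sizeProb p k := sizeProb_nonneg
  have ha := hb.nonneg k
  calc _ ≤ √(levelSum p (fun T => f T ^ 2) k) * √(levelSum p (fun T => h T ^ 2) k) :=
        PlaneTree.levelSum_abs_mul_le
    _ ≤ √(sizeProb p k * a k ^ 2) * √(sizeProb p k * y ^ 2) := by
        gcongr
        exact hb.levelSum_sq_le k
    _ = _ := by
        rw [Real.sqrt_mul hπ, Real.sqrt_mul hπ, Real.sqrt_sq ha, Real.sqrt_sq hy, mul_mul_mul_comm,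
          Real.mul_self_sqrt hπ]

theorem levelSum_abs_le (k : ℕ) : levelSum p (fun T => |f T|) k ≤ sizeProb p k * a k := by
  have := hb.levelSum_abs_mul_le (h := fun _ => 1) (k := k) zero_le_one (by
    simp [sizeProb])
  simpa using this

theorem restrict (P : PlaneTree → Prop) [DecidablePred P] :
    TollBound p (fun T => if P T then f T else 0) a s :=
  { hb with
    levelSum_sq_le := fun k => (levelSum_mono fun T _ => by
      split_ifs
      · exact le_rfl
      · simpa using sq_nonneg (f T)).trans (hb.levelSum_sq_le k) }

section
variable {C : ℝ} (hC : ∀ n : ℕ, sizeProb p n * (n * √n) ≤ C)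
include hC

theorem levelSum_abs_le_div (k : ℕ) :
    levelSum p (fun T => |f T|) k ≤ C * (a k / k) * (1 / √k) := by
  rcases Nat.eq_zero_or_pos k with rfl | hk
  · simp [levelSum_zero_right]
  · have hk' : (0 : ℝ) < k := by exact_mod_cast hk
    have hs : 0 < √(k : ℝ) := Real.sqrt_pos.2 hk'
    refine (hb.levelSum_abs_le k).trans ?_
    have := mul_le_mul_of_nonneg_right (hC k) (hb.nonneg k)
    have h2 : C * (a k / k) * (1 / √k) = C * a k / (k * √k) := by field_simp
    rw [h2, le_div_iff₀ (by positivity)]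
    linarith

theorem levelSum_abs_le_div' (k : ℕ) : levelSum p (fun T => |f T|) k ≤ C * (a k / k) := by
  have hC0 : 0 ≤ C := by simpa using hC 0
  have ha := hb.nonneg k
  refine (hb.levelSum_abs_le_div hC k).trans (mul_le_of_le_one_right (by positivity) ?_)
  rcases Nat.eq_zero_or_pos k with rfl | hk
  · simp
  · rw [div_le_one (Real.sqrt_pos.2 (by exact_mod_cast hk))]
    exact Real.one_le_sqrt.2 (by exact_mod_cast hk)

theorem integrable : Integrable f (gw p) :=
  integrable_gw_iff.2 (Summable.of_nonneg_of_le (fun _ => levelSum_nonneg fun _ _ => abs_nonneg _)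
    (hb.levelSum_abs_le_div' hC) (hb.summable.mul_left C))

theorem sum_abs_le (S : Finset ℕ) : ∑ k ∈ S, |levelSum p f k| ≤ C * s := by
  have hC0 : 0 ≤ C := by simpa using hC 0
  refine (Finset.sum_le_sum fun k _ => abs_levelSum_le.trans (hb.levelSum_abs_le_div' hC k)).trans ?_
  rw [← Finset.mul_sum]
  exact mul_le_mul_of_nonneg_left (hb.sum_le S) hC0

theorem sum_mul_abs_le (m : ℕ) :
    ∑ k ∈ Finset.range (m + 1), (k : ℝ) * |levelSum p f k| ≤ C * s * (2 * √m) := by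
  have hC0 : 0 ≤ C := by simpa using hC 0
  have hs := hb.bound_nonneg
  have h1 : ∀ k : ℕ, (k : ℝ) * |levelSum p f k| ≤ C * s * (1 / √k) := by
    intro k
    have h2 := abs_levelSum_le.trans (hb.levelSum_abs_le_div hC k)
    rcases Nat.eq_zero_or_pos k with rfl | hk
    · simp
    have hk' : (0 : ℝ) < k := by exact_mod_cast hk
    calc (k : ℝ) * |levelSum p f k| ≤ k * (C * (a k / k) * (1 / √k)) := by gcongr
      _ = C * a k * (1 / √k) := by field_simp
      _ ≤ C * s * (1 / √k) := by gcongr; exact hb.le k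
  refine (Finset.sum_le_sum fun k _ => h1 k).trans ?_
  rw [← Finset.mul_sum]
  exact mul_le_mul_of_nonneg_left (sum_inv_sqrt_le m) (by positivity)

theorem abs_integral_sub_le {m : ℕ} (hm : 0 < m) :
    |∫ T, f T ∂gw p - ∑ k ∈ Finset.range (m + 1), levelSum p f k| ≤ 2 * (C * s) / √m := by
  have hC0 : 0 ≤ C := by simpa using hC 0
  refine abs_sub_sum_le_of_hasSum (hasSum_levelSum (hb.integrable hC)) hm fun k hk => ?_
  have hk' : (0 : ℝ) < k := by exact_mod_cast hm.trans hk
  have h2 := abs_levelSum_le.trans (hb.levelSum_abs_le_div hC k)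
  have hs : 0 < √(k : ℝ) := Real.sqrt_pos.2 hk'
  calc |levelSum p f k| * (k * √k) ≤ C * (a k / k) * (1 / √k) * (k * √k) := by gcongr
    _ = C * a k := by field_simp
    _ ≤ C * s := by gcongr; exact hb.le k

theorem abs_integral_le : |∫ T, f T ∂gw p| ≤ C * s := by
  have h := ((hasSum_levelSum (hb.integrable hC)).tendsto_sum_nat).abs
  refine le_of_tendsto h (Eventually.of_forall fun n => ?_)
  exact (Finset.abs_sum_le_sum_abs _ _).trans (hb.sum_abs_le hC _)

end

/-- Crude second moment bound. -/
theorem levelSum_additive_sq_le (n : ℕ) :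
    levelSum p (fun T => additive f T ^ 2) n ≤ s ^ 2 * n ^ 2 * sizeProb p n := by
  have hs := hb.bound_nonneg
  calc levelSum p (fun T => additive f T ^ 2) n
      ≤ levelSum p (fun T => n * additive (fun t => f t ^ 2) T) n :=
        levelSum_mono fun T hT => by rw [← hT]; exact additive_sq_le f T
    _ = n * ∑ k ∈ Finset.range (n + 1), levelSum p (fun T => f T ^ 2) k * walkProb p (n - k) 0 := by
        rw [levelSum_const_mul, levelSum_additive]
    _ ≤ n * ∑ k ∈ Finset.range (n + 1), s ^ 2 * (levelSum p (fun _ => 1) k *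
        walkProb p (n - k) 0) := by
        refine mul_le_mul_of_nonneg_left (Finset.sum_le_sum fun k _ => ?_) (Nat.cast_nonneg n)
        rw [← mul_assoc]
        refine mul_le_mul_of_nonneg_right ?_ (walkProb_nonneg _ _)
        refine (hb.levelSum_sq_le k).trans ?_
        rw [mul_comm]
        exact mul_le_mul_of_nonneg_right (pow_le_pow_left₀ (hb.nonneg k) (hb.le k) 2)
          sizeProb_nonneg
    _ = _ := by
        rw [← Finset.mul_sum, ← levelSum_additive]
        rw [levelSum_congr (h := fun _ => (n : ℝ)) fun T hT => by rw [additive_one, hT],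
          levelSum_const]
        ring

/-- The contribution of fringe subtrees with more than half of the vertices. -/
theorem levelSum_large_sq_le {C c C1 : ℝ} (hC : ∀ n : ℕ, sizeProb p n * (n * √n) ≤ C)
    (hc : 0 < c) (hlow : ∀ n : ℕ, 0 < sizeProb p n → c ≤ sizeProb p n * (n * √n))
    (hC1 : 0 ≤ C1) (hup : ∀ n : ℕ, 0 < n → ∀ j : ℤ, walkProb p n j ≤ C1 / √n)
    {m : ℕ} (hf : ∀ T, T.size ≤ m → f T = 0) {n : ℕ} (hmn : m < n) (hnm : n ≤ 2 * m + 2) :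
    levelSum p (fun T => additive (fun t => |f t|) T ^ 2) n ≤
      (8 * C / c * (1 + 2 * C1) * s * √n) ^ 2 * sizeProb p n := by
  have hC0 : 0 ≤ C := by simpa using hC 0
  have hs := hb.bound_nonneg
  set b := additive fun t => |f t| with hbdef
  have hb0 : ∀ T, 0 ≤ b T := additive_nonneg fun _ => abs_nonneg _
  set y : ℕ → ℝ := fun k => √(levelSum p (fun T => b T ^ 2) k / sizeProb p k) with hy
  have hysq : ∀ k, levelSum p (fun T => b T ^ 2) k = sizeProb p k * y k ^ 2 := by
    intro k
    have h0 : 0 ≤ sizeProb p k := sizeProb_nonneg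
    rcases h0.eq_or_lt with h | h
    · rw [← h, levelSum_eq_zero h.symm, zero_mul]
    · rw [hy]
      simp only
      rw [Real.sq_sqrt (div_nonneg (levelSum_nonneg fun _ _ => sq_nonneg _) h0)]
      field_simp
  have hne : (Finset.Ioc m n).Nonempty := ⟨n, Finset.mem_Ioc.2 ⟨hmn, le_rfl⟩⟩
  -- `y k` is the `L²` norm of the functional conditioned on the size `k`; it is bounded at a size
  -- `N` in `(m, n]` where it is largest.
  obtain ⟨N, hN, hmax⟩ := Finset.exists_max_image (Finset.Ioc m n) y hne
  obtain ⟨hN1, hN2⟩ := Finset.mem_Ioc.1 hN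
  have hyN : 0 ≤ y N := Real.sqrt_nonneg _
  have hN0 : (0 : ℝ) < N := by exact_mod_cast (by omega : 0 < N)
  set D := 8 * C / c * (1 + 2 * C1) * s * √n with hD
  have hD0 : 0 ≤ D := by positivity
  have key : y N ≤ D := by
    have hπ0 : 0 ≤ sizeProb p N := sizeProb_nonneg
    rcases hπ0.eq_or_lt with h | h
    · have : y N = 0 := by rw [hy]; simp [← h]
      rw [this]; exact hD0
    have hterm : ∀ k ∈ Finset.range (N + 1),
        levelSum p (fun t => |f t| * (2 * b t - |f t|)) k * walkProb p (N - k) 0 ≤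
          8 * C / c * sizeProb p N * s * y N * walkProb p (N - k) 0 := by
      intro k hk
      have hkN : k ≤ N := Nat.lt_succ_iff.1 (Finset.mem_range.1 hk)
      refine mul_le_mul_of_nonneg_right ?_ (walkProb_nonneg _ _)
      rcases le_or_gt k m with hkm | hkm
      · rw [levelSum_congr (h := fun _ => 0) fun T hT => by rw [hf T (by omega)]; simp,
          levelSum_const]
        rw [zero_mul]
        positivity
      have h1 : levelSum p (fun t => |f t| * (2 * b t - |f t|)) k ≤
          levelSum p (fun t => 2 * |f t * b t|) k :=
        levelSum_mono fun T _ => by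
          rw [abs_mul, abs_of_nonneg (hb0 T)]
          nlinarith [sq_nonneg |f T|]
      rw [levelSum_const_mul] at h1
      have h2 := hb.levelSum_abs_mul_le (k := k) (y := y k) (Real.sqrt_nonneg _) (hysq k).le
      have h3 : y k ≤ y N := hmax k (Finset.mem_Ioc.2 ⟨hkm, hkN.trans hN2⟩)
      have hk0 : (0 : ℝ) < k := by exact_mod_cast (by omega : 0 < k)
      -- Sizes in `(m, n]` differ by a factor of at most 2, so their probabilities are comparable.
      have h4 : sizeProb p k ≤ 4 * C / c * sizeProb p N := by
        have h5 : (N : ℝ) * √N ≤ 4 * (k * √k) := by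
          have hkR : (N : ℝ) ≤ 2 * k := by exact_mod_cast (by omega : N ≤ 2 * k)
          have h6 : √(N : ℝ) ≤ 2 * √k := sqrt_le_two_mul_sqrt (by omega)
          calc (N : ℝ) * √N ≤ 2 * k * (2 * √k) := by gcongr
            _ = _ := by ring
        have h6 : sizeProb p k ≤ C / (k * √k) := by
          rw [le_div_iff₀ (by positivity)]; exact hC k
        have h7 : c / (N * √N) ≤ sizeProb p N := by
          rw [div_le_iff₀ (by positivity)]; exact hlow N h
        calc sizeProb p k ≤ C / (k * √k) := h6
          _ ≤ C / (N * √N / 4) := by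
            gcongr
            linarith
          _ = 4 * C / c * (c / (N * √N)) := by field_simp
          _ ≤ _ := by gcongr
      calc _ ≤ 2 * (sizeProb p k * (a k * y k)) := h1.trans (by gcongr)
        _ ≤ 2 * (4 * C / c * sizeProb p N * (s * y N)) := by
          have h8 : a k * y k ≤ s * y N := mul_le_mul (hb.le k) h3 (Real.sqrt_nonneg _) hs
          have h9 : 0 ≤ a k * y k := mul_nonneg (hb.nonneg k) (Real.sqrt_nonneg _)
          gcongr
        _ = _ := by ring
    -- The square is an additive functional whose toll has mean at most of order `s * y N`, which
    -- leads to `y N ^ 2 ≤ D * y N`.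
    have h1 : sizeProb p N * y N ^ 2 ≤ 8 * C / c * sizeProb p N * s * y N *
        (1 + 2 * C1 * √N) := by
      rw [← hysq, levelSum_congr (h := additive fun t => |f t| * (2 * b t - |f t|)) fun T hT =>
        additive_sq_eq (g := fun t => |f t|) (m := m) (fun T hT => by rw [hf T hT, abs_zero]) T
          (by omega), levelSum_additive]
      refine (Finset.sum_le_sum hterm).trans ?_
      rw [← Finset.mul_sum]
      exact mul_le_mul_of_nonneg_left (sum_walkProb_zero_le hC1 hup N) (by positivity)
    have h2 : 1 + 2 * C1 * √(N : ℝ) ≤ (1 + 2 * C1) * √n := by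
      have h3 : √(N : ℝ) ≤ √n := Real.sqrt_le_sqrt (by exact_mod_cast hN2)
      have h4 : 1 ≤ √(n : ℝ) := Real.one_le_sqrt.2 (by exact_mod_cast (by omega : 1 ≤ n))
      nlinarith
    have h3 : y N ^ 2 ≤ D * y N := by
      refine le_of_mul_le_mul_left ?_ h
      refine h1.trans ((mul_le_mul_of_nonneg_left h2 (by positivity)).trans_eq ?_)
      rw [hD]; ring
    rcases hyN.eq_or_lt with h4 | h4
    · rw [← h4]; exact hD0
    · exact le_of_mul_le_mul_right (by rw [← sq]; exact h3) h4
  rw [hysq, mul_comm]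
  refine mul_le_mul_of_nonneg_right ?_ sizeProb_nonneg
  exact pow_le_pow_left₀ (Real.sqrt_nonneg _) ((hmax n (Finset.mem_Ioc.2 ⟨hmn, le_rfl⟩)).trans key) 2

/-- The variance of a window sum for the small fringe subtrees, given the bound at smaller sizes. -/
theorem variance_window_le {C A : ℝ} (hC : ∀ n : ℕ, sizeProb p n * (n * √n) ≤ C) (hA : 0 ≤ A)
    {m' : ℕ} (hm' : 0 < m')
    (ih : ∀ k ≤ m', levelSum p (fun T => (additive f T - k * ∫ t, f t ∂gw p) ^ 2) k ≤
      (A * s) ^ 2 * k * sizeProb p k) {m n : ℕ} (hm : m' ≤ m) (hmn : m + 1 ≤ n) :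
    ∫ ω, (factorSum (fun T => if T.size ≤ m' then f T else 0) (word ω m) -
      ∫ ω', factorSum (fun T => if T.size ≤ m' then f T else 0) (word ω' m) ∂seqLaw p) ^ 2
        ∂seqLaw p ≤ n * s ^ 2 * (2 * C * A + 9 * C ^ 2) := by
  have hC0 : 0 ≤ C := by simpa using hC 0
  have hs := hb.bound_nonneg
  set μ := ∫ t, f t ∂gw p with hμ
  set g : PlaneTree → ℝ := fun T => if T.size ≤ m' then f T else 0 with hg
  have hbg : TollBound p g a s := hb.restrict _
  have hlev : ∀ k, m' < k → levelSum p g k = 0 := fun k hk => by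
    rw [levelSum_congr (h := fun _ => 0) fun T hT => by simp [hg, hT, hk], levelSum_const, zero_mul]
  have hlev' : ∀ k ≤ m', levelSum p g k = levelSum p f k := fun k hk =>
    levelSum_congr fun T hT => by simp [hg, hT, hk]
  set M := ∑ k ∈ Finset.range (m + 1), levelSum p g k with hM
  have hM' : |μ - M| ≤ 2 * (C * s) / √m' := by
    have h1 : M = ∑ k ∈ Finset.range (m' + 1), levelSum p f k := by
      have : Finset.range (m' + 1) ⊆ Finset.range (m + 1) := Finset.range_subset_range.2 (by omega)
      rw [hM, ← Finset.sum_subset this fun k _ hk => hlev k (by simpa using hk)]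
      exact Finset.sum_congr rfl fun k hk => hlev' k (Nat.lt_succ_iff.1 (Finset.mem_range.1 hk))
    rw [h1]
    exact hb.abs_integral_sub_le hC hm'
  -- The induction hypothesis bounds the `L²` norm of `additive f - k μ` at the sizes `k ≤ m'`;
  -- replacing `μ` by `M` costs an error of the same order.
  have hterm : ∀ k : ℕ, levelSum p (fun T => |g T * (additive g T - k * M)|) k ≤
      C * s * (A + 2 * C) * (a k / k) := by
    intro k
    have ha := hb.nonneg k
    rcases le_or_gt k m' with hk | hk
    · rcases Nat.eq_zero_or_pos k with rfl | hk0
      · simp [levelSum_zero_right]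
      have hk' : (0 : ℝ) < k := by exact_mod_cast hk0
      have hsk : 0 < √(k : ℝ) := Real.sqrt_pos.2 hk'
      have h1 : levelSum p (fun T => |g T * (additive g T - k * M)|) k ≤
          levelSum p (fun T => |f T * (additive f T - k * μ)| + k * |μ - M| * |f T|) k := by
        refine levelSum_mono fun T hT => ?_
        have h2 : additive g T = additive f T := additive_congr T fun t ht => by
          simp [hg, ht.trans (hT.le.trans hk)]
        have h3 : g T = f T := by simp [hg, hT, hk]
        rw [h2, h3, show f T * (additive f T - k * M) =
          f T * (additive f T - k * μ) + k * (μ - M) * f T by ring]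
        refine (abs_add_le _ _).trans_eq ?_
        rw [abs_mul (k * (μ - M)), abs_mul (k : ℝ), Nat.abs_cast]
      rw [levelSum_add, levelSum_const_mul] at h1
      have h2 := hb.levelSum_abs_mul_le (k := k) (y := A * s * √k) (by positivity)
        (h := fun T => additive f T - k * μ) (by
          refine (ih k hk).trans_eq ?_
          rw [mul_pow _ (√(k : ℝ)), Real.sq_sqrt hk'.le]
          ring)
      have h3 := hb.levelSum_abs_le k
      have h4 : k * |μ - M| ≤ 2 * (C * s) * √k := by
        have hsm : √(k : ℝ) ≤ √m' := Real.sqrt_le_sqrt (by exact_mod_cast hk)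
        calc k * |μ - M| ≤ k * (2 * (C * s) / √k) := by
              refine mul_le_mul_of_nonneg_left (hM'.trans ?_) hk'.le
              gcongr
          _ = 2 * (C * s) * (k / √k) := by ring
          _ = _ := by rw [Real.div_sqrt]
      have h5 : sizeProb p k * √k ≤ C / k := by
        rw [le_div_iff₀ hk']
        linarith [hC k]
      have hπ : 0 ≤ sizeProb p k := sizeProb_nonneg
      calc _ ≤ sizeProb p k * (a k * (A * s * √k)) +
            2 * (C * s) * √k * (sizeProb p k * a k) := by
            refine h1.trans (add_le_add h2 ?_)
            exact mul_le_mul h4 h3 (levelSum_nonneg fun _ _ => abs_nonneg _) (by positivity)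
        _ = s * (A + 2 * C) * a k * (sizeProb p k * √k) := by ring
        _ ≤ s * (A + 2 * C) * a k * (C / k) := by gcongr
        _ = _ := by ring
    · rw [levelSum_congr (h := fun _ => 0) fun T hT => by simp [hg, hT, hk], levelSum_const,
        zero_mul]
      positivity
  refine (variance_factorSum_le m hM).trans ?_
  have h1 : ∑ k ∈ Finset.range (m + 1), 2 * levelSum p (fun T => |g T * (additive g T - k * M)|) k ≤
      2 * (C * s * (A + 2 * C) * s) := by
    rw [← Finset.mul_sum]
    refine mul_le_mul_of_nonneg_left ((Finset.sum_le_sum fun k _ => hterm k).trans ?_) zero_le_two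
    rw [← Finset.mul_sum]
    exact mul_le_mul_of_nonneg_left (hb.sum_le _) (by positivity)
  have h2 := hbg.sum_abs_le hC (Finset.range (m + 1))
  have h3 := hbg.sum_mul_abs_le hC m
  have hmn' : (m : ℝ) + 1 ≤ n := by exact_mod_cast hmn
  -- The sum of `k |levelSum p g k|` is of order `√m`, since the terms are at most of order `k ^
  -- (-1/2)`.
  have h4 : (C * s * (2 * √(m : ℝ))) ^ 2 ≤ n * (4 * C ^ 2 * s ^ 2) := by
    rw [mul_pow, mul_pow 2, Real.sq_sqrt (Nat.cast_nonneg m)]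
    calc _ = (m : ℝ) * (4 * C ^ 2 * s ^ 2) := by ring
      _ ≤ _ := by gcongr; linarith
  calc _ ≤ (n : ℝ) * (2 * (C * s * (A + 2 * C) * s)) + n * (C * s) ^ 2 +
        (C * s * (2 * √m)) ^ 2 := by
        gcongr
        exact Finset.sum_nonneg fun k _ =>
          mul_nonneg zero_le_two (levelSum_nonneg fun _ _ => abs_nonneg _)
    _ ≤ _ := by linarith

/-- The contribution of fringe subtrees with at most half of the vertices. -/
theorem levelSum_small_sq_le {C c C1 A : ℝ} (hC : ∀ n : ℕ, sizeProb p n * (n * √n) ≤ C)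
    (hc : 0 < c) (hlow : ∀ n : ℕ, 0 < sizeProb p n → c ≤ sizeProb p n * (n * √n))
    (hC1 : 0 < C1) (hup : ∀ n : ℕ, 0 < n → ∀ j : ℤ, walkProb p n j ≤ C1 / √n) (hA : 0 ≤ A)
    {n m' : ℕ} (hn : 4 ≤ n) (hm' : m' = n / 2) (hπ : 0 < sizeProb p n)
    (ih : ∀ k ≤ m', levelSum p (fun T => (additive f T - k * ∫ t, f t ∂gw p) ^ 2) k ≤
      (A * s) ^ 2 * k * sizeProb p k) {M : ℝ}
    (hM : M = ∑ k ∈ Finset.range (m' + 1),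
      levelSum p (fun T => if T.size ≤ m' then f T else 0) k) :
    levelSum p (fun T => (additive (fun T => if T.size ≤ m' then f T else 0) T - n * M) ^ 2) n ≤
      512 * C1 / c * (2 * C * A + 9 * C ^ 2) * (s ^ 2 * n * sizeProb p n) := by
  have hC0 : 0 ≤ C := by simpa using hC 0
  have hs := hb.bound_nonneg
  have hm'0 : 0 < m' := by omega
  have hnR : (1 : ℝ) ≤ n := by exact_mod_cast (by omega : 1 ≤ n)
  have hsn : 0 < √(n : ℝ) := Real.sqrt_pos.2 (by linarith)
  -- The windows have lengths `m' + n / 4` and `m'`; both leave at least `n / 4` steps of the bridge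
  -- free.
  obtain ⟨w, hw⟩ : ∃ w, w = n / 4 := ⟨_, rfl⟩
  set g : PlaneTree → ℝ := fun T => if T.size ≤ m' then f T else 0 with hg
  set V := (n : ℝ) * s ^ 2 * (2 * C * A + 9 * C ^ 2) with hV
  have hV0 : 0 ≤ V := by positivity
  set B := 2 * C1 / √n with hB
  have hB0 : 0 < B := by positivity
  have hBle : ∀ k : ℕ, n ≤ 4 * k → ∀ j, walkProb p k j ≤ B := fun k hk j => by
    have hk0 : 0 < k := by omega
    refine (hup k hk0 j).trans ?_
    have := sqrt_le_two_mul_sqrt hk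
    rw [hB, div_le_div_iff₀ (Real.sqrt_pos.2 (by exact_mod_cast hk0)) hsn]
    nlinarith
  have h1 := mul_levelSum_sub_pow_le (p := p) (f := g) (K := m') (fun T hT => by
    simp [hg, hT]) (a := w) (m := m') (n := n) (q := 2) le_rfl (by omega) even_two two_ne_zero hM
    (hBle _ (by omega)) (hBle _ (by omega))
  have h2 := hb.variance_window_le hC hA hm'0 ih (m := w + m') (n := n)
    (by omega) (by omega)
  have h3 := hb.variance_window_le hC hA hm'0 ih (m := m') (n := n)
    (by omega) (by omega)
  have h4 : (w : ℝ) ^ 2 * levelSum p (fun T => (additive g T - n * M) ^ 2) n ≤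
      2 * n * (B * V + B * V) := by
    refine h1.trans ?_
    rw [show 2 - 1 = 1 from rfl, pow_one]
    gcongr
  have h5 : (n : ℝ) ≤ 8 * w := by exact_mod_cast (by omega : n ≤ 8 * w)
  have h6 : c ≤ n * √n * sizeProb p n := by
    have := hlow n hπ
    linarith
  have hL0 : 0 ≤ levelSum p (fun T => (additive g T - n * M) ^ 2) n :=
    levelSum_nonneg fun _ _ => sq_nonneg _
  have hn2 : (0 : ℝ) < n ^ 2 := by positivity
  refine le_of_mul_le_mul_left ?_ hn2
  calc (n : ℝ) ^ 2 * levelSum p (fun T => (additive g T - n * M) ^ 2) n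
      ≤ (8 * w) ^ 2 * levelSum p (fun T => (additive g T - n * M) ^ 2) n := by gcongr
    _ = 64 * ((w : ℝ) ^ 2 * levelSum p (fun T => (additive g T - n * M) ^ 2) n) := by ring
    _ ≤ 64 * (2 * n * (B * V + B * V)) := by gcongr
    _ = 512 * C1 * n ^ 2 * s ^ 2 * (2 * C * A + 9 * C ^ 2) / √n := by
      rw [hB, hV]; ring
    _ ≤ 512 * C1 * n ^ 2 * s ^ 2 * (2 * C * A + 9 * C ^ 2) / √n *
        (n * √n * sizeProb p n / c) := by
      refine le_mul_of_one_le_right (by positivity) ?_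
      rwa [one_le_div hc]
    _ = _ := by field_simp

end TollBound

/-- The additive functional of the conditioned tree has variance of order at most its size,
uniformly over the toll functions with a given bound. -/
theorem IsCritical.exists_levelSum_sub_sq_le {p : PMF ℕ} {σsq : ℝ} (hp : IsCritical p σsq) :
    ∃ A > 0, ∀ (f : PlaneTree → ℝ) (a : ℕ → ℝ) (s : ℝ), TollBound p f a s → ∀ n : ℕ,
      levelSum p (fun T => (additive f T - n * ∫ t, f t ∂gw p) ^ 2) n ≤
        (A * s) ^ 2 * n * sizeProb p n := by
  obtain ⟨C, hC0, hC⟩ := hp.exists_sizeProb_le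
  obtain ⟨c, hc, hlow⟩ := hp.exists_le_sizeProb
  obtain ⟨C1, hC1, hup⟩ := hp.exists_walkProb_le
  set D := 8 * C / c * (1 + 2 * C1) with hD
  have hD0 : 0 < D := by positivity
  have hE0 : 0 < 512 * C1 / c := by positivity
  generalize hE : 512 * C1 / c = E at hE0
  -- The constant has to satisfy `hAsmall`, for `n < 4`, and `hAmain`, for the induction step. The
  -- latter is possible because the left-hand side is only linear in `A`.
  set A := 1 + 3 * (E * (2 * C)) + 3 * (E * (9 * C ^ 2) + D ^ 2 + 16 * C ^ 2) + 8 * (1 + C ^ 2)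
    with hA
  have hA1 : 1 ≤ A := by
    have : 0 < 3 * (E * (2 * C)) := by positivity
    have : 0 < 3 * (E * (9 * C ^ 2) + D ^ 2 + 16 * C ^ 2) := by positivity
    have : 0 < 8 * (1 + C ^ 2) := by positivity
    linarith
  have hAsmall : 8 * (1 + C ^ 2) ≤ A ^ 2 := by
    have : 0 < 3 * (E * (2 * C)) := by positivity
    have : 0 < 3 * (E * (9 * C ^ 2) + D ^ 2 + 16 * C ^ 2) := by positivity
    nlinarith
  have hAmain : 3 * (E * (2 * C * A + 9 * C ^ 2) + D ^ 2 + 16 * C ^ 2) ≤ A ^ 2 := by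
    have h1 : 0 < 3 * (E * (9 * C ^ 2) + D ^ 2 + 16 * C ^ 2) := by positivity
    have h2 : 0 < 8 * (1 + C ^ 2) := by positivity
    have h3 : A * (3 * (E * (2 * C)) + 3 * (E * (9 * C ^ 2) + D ^ 2 + 16 * C ^ 2)) ≤ A * A := by
      gcongr
      linarith
    nlinarith
  refine ⟨A, by linarith, fun f a s hb n => ?_⟩
  have hs := hb.bound_nonneg
  set μ := ∫ t, f t ∂gw p with hμ
  have hμle := hb.abs_integral_le hC
  induction n using Nat.strong_induction_on with
  | _ n ih =>
  have hπ0 : 0 ≤ sizeProb p n := sizeProb_nonneg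
  rcases hπ0.eq_or_lt with hπ | hπ
  · rw [levelSum_eq_zero hπ.symm, ← hπ, mul_zero]
  have hn0 : 0 < n := by
    rcases Nat.eq_zero_or_pos n with rfl | h
    · exact absurd hπ (by rw [sizeProb, levelSum_zero_right]; exact lt_irrefl 0)
    · exact h
  have hnR : (1 : ℝ) ≤ n := by exact_mod_cast hn0
  -- For small sizes the crude bound suffices.
  rcases lt_or_ge n 4 with hn | hn
  · have h1 : levelSum p (fun T => (additive f T - n * μ) ^ 2) n ≤
        levelSum p (fun T => 2 * additive f T ^ 2 + 2 * (n * μ) ^ 2) n :=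
      levelSum_mono fun T _ => by nlinarith [sq_nonneg (additive f T + n * μ)]
    rw [levelSum_add, levelSum_const_mul, levelSum_const] at h1
    have h2 := hb.levelSum_additive_sq_le n
    have h3 : μ ^ 2 ≤ (C * s) ^ 2 := sq_le_sq' (by linarith [abs_le.1 hμle]) (abs_le.1 hμle).2
    have h4 : (n : ℝ) ≤ 4 := by exact_mod_cast hn.le
    calc _ ≤ 2 * (s ^ 2 * n ^ 2 * sizeProb p n) + 2 * (n * μ) ^ 2 * sizeProb p n := by linarith
      _ = 2 * (s ^ 2 + μ ^ 2) * n * (n * sizeProb p n) := by ring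
      _ ≤ 2 * (s ^ 2 + (C * s) ^ 2) * 4 * (n * sizeProb p n) := by gcongr
      _ = 8 * (1 + C ^ 2) * (s ^ 2 * n * sizeProb p n) := by ring
      _ ≤ A ^ 2 * (s ^ 2 * n * sizeProb p n) := by gcongr
      _ = _ := by ring
  obtain ⟨m', hm'⟩ : ∃ m', m' = n / 2 := ⟨_, rfl⟩
  have hm'0 : 0 < m' := by omega
  -- The toll is split at the size `n / 2`, and the mean over the small sizes is recentred from `M`
  -- to `μ`.
  set g : PlaneTree → ℝ := fun T => if T.size ≤ m' then f T else 0 with hg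
  set h : PlaneTree → ℝ := fun T => if ¬ T.size ≤ m' then f T else 0 with hh
  have hsplit : ∀ T, additive f T = additive g T + additive h T := fun T => by
    rw [← additive_add]
    refine additive_congr T fun t _ => ?_
    by_cases ht : t.size ≤ m' <;> simp [hg, hh, ht]
  set M := ∑ k ∈ Finset.range (m' + 1), levelSum p g k with hM
  have hMμ : |μ - M| ≤ 2 * (C * s) / √m' := by
    have h1 : M = ∑ k ∈ Finset.range (m' + 1), levelSum p f k :=
      Finset.sum_congr rfl fun k hk => levelSum_congr fun T hT => by
        have := Finset.mem_range.1 hk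
        simp [hg, hT, Nat.lt_succ_iff.1 this]
    rw [h1]
    exact hb.abs_integral_sub_le hC hm'0
  have hsn : 0 < √(n : ℝ) := Real.sqrt_pos.2 (by linarith)
  have hdrift : (n * (M - μ)) ^ 2 ≤ 16 * C ^ 2 * (s ^ 2 * n) := by
    have h1 : |μ - M| ≤ 4 * (C * s) / √n := by
      refine hMμ.trans ?_
      have := sqrt_le_two_mul_sqrt (n := n) (k := m') (by omega)
      have hpos : 0 < √(m' : ℝ) := Real.sqrt_pos.2 (by exact_mod_cast hm'0)
      rw [div_le_div_iff₀ hpos hsn]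
      have h2 : 0 ≤ C * s := by positivity
      nlinarith
    have h2 : |n * (M - μ)| ≤ 4 * (C * s) * √n := by
      rw [abs_mul, Nat.abs_cast, abs_sub_comm]
      calc (n : ℝ) * |μ - M| ≤ n * (4 * (C * s) / √n) := by gcongr
        _ = 4 * (C * s) * (n / √n) := by ring
        _ = _ := by rw [Real.div_sqrt]
    calc (n * (M - μ)) ^ 2 = |n * (M - μ)| ^ 2 := (sq_abs _).symm
      _ ≤ (4 * (C * s) * √n) ^ 2 := by gcongr
      _ = _ := by rw [mul_pow, Real.sq_sqrt (by linarith)]; ring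
  have hlarge : levelSum p (fun T => additive h T ^ 2) n ≤ D ^ 2 * (s ^ 2 * n * sizeProb p n) := by
    have h1 := (hb.restrict fun T => ¬ T.size ≤ m').levelSum_large_sq_le hC hc hlow hC1.le hup
      (m := m') (fun T hT => by simp [hT]) (n := n) (by omega) (by omega)
    have h2 : levelSum p (fun T => additive h T ^ 2) n ≤
        levelSum p (fun T => additive (fun t => |h t|) T ^ 2) n :=
      levelSum_mono fun T _ => sq_le_sq' (by linarith [abs_le.1 (abs_additive_le h T)])
        (abs_le.1 (abs_additive_le h T)).2
    refine (h2.trans h1).trans_eq ?_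
    rw [mul_pow, Real.sq_sqrt (by linarith)]
    ring
  have hsmall := hb.levelSum_small_sq_le hC hc hlow hC1 hup (A := A) (by linarith) hn hm' hπ
    (fun k hk => ih k (by omega)) hM
  rw [hE] at hsmall
  have hfinal : levelSum p (fun T => (additive f T - n * μ) ^ 2) n ≤
      levelSum p (fun T => 3 * ((additive g T - n * M) ^ 2 + additive h T ^ 2 +
        (n * (M - μ)) ^ 2)) n := by
    refine levelSum_mono fun T _ => ?_
    rw [hsplit, show additive g T + additive h T - n * μ =
      (additive g T - n * M) + additive h T + n * (M - μ) by ring]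
    exact add_add_sq_le _ _ _
  rw [levelSum_const_mul, levelSum_add, levelSum_add, levelSum_const] at hfinal
  calc _ ≤ 3 * (E * (2 * C * A + 9 * C ^ 2) * (s ^ 2 * n * sizeProb p n) +
        D ^ 2 * (s ^ 2 * n * sizeProb p n) + 16 * C ^ 2 * (s ^ 2 * n) * sizeProb p n) := by
        refine hfinal.trans ?_
        gcongr
    _ = 3 * (E * (2 * C * A + 9 * C ^ 2) + D ^ 2 + 16 * C ^ 2) * (s ^ 2 * n * sizeProb p n) := by
        ring
    _ ≤ A ^ 2 * (s ^ 2 * n * sizeProb p n) := by gcongr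
    _ = _ := by ring

/-! ### The central limit theorem for almost additive functionals of words -/

section independence
variable {p : PMF ℕ}

theorem shift_splice (m : ℕ) (ω ω' : ℕ → ℕ) : (fun i => splice m ω ω' (m + i)) = ω' := by
  ext i
  simp [splice]

/-- A function of the first `m` terms is independent of a function of the other terms. -/
theorem integral_mul_shift {𝕜 : Type*} [RCLike 𝕜] {A B : (ℕ → ℕ) → 𝕜} (m : ℕ)
    (hA : ∀ ω ω', A (splice m ω ω') = A ω)
    (hAB : Integrable (fun ω => A ω * B (fun i => ω (m + i))) (seqLaw p)) :
    ∫ ω, A ω * B (fun i => ω (m + i)) ∂seqLaw p = (∫ ω, A ω ∂seqLaw p) * ∫ ω, B ω ∂seqLaw p := by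
  rw [integral_splice hAB m]
  simp only [hA, shift_splice, integral_const_mul, integral_mul_const]

end independence

/-- The sum of a function over the shifts of a sequence by the first `q` multiples of `L`. -/
noncomputable def blockSum (Z : (ℕ → ℕ) → ℝ) (L : ℕ) : ℕ → (ℕ → ℕ) → ℝ
  | 0, _ => 0
  | q + 1, ω => Z ω + blockSum Z L q fun i => ω (L + i)

section blockSum
variable {p : PMF ℕ} {Z : (ℕ → ℕ) → ℝ} {L : ℕ}

theorem blockSum_sub_const (Z : (ℕ → ℕ) → ℝ) (L : ℕ) (c : ℝ) (q : ℕ) (ω : ℕ → ℕ) :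
    blockSum (fun ω => Z ω - c) L q ω = blockSum Z L q ω - q * c := by
  induction q generalizing ω with
  | zero => simp [blockSum]
  | succ q ih => rw [blockSum, blockSum, ih]; push_cast; ring

theorem memLp_blockSum (hZ : MemLp Z 2 (seqLaw p)) (L q : ℕ) :
    MemLp (blockSum Z L q) 2 (seqLaw p) := by
  induction q with
  | zero => exact MemLp.zero'
  | succ q ih => exact hZ.add (ih.comp_measurePreserving (measurePreserving_shift p L))

theorem integral_blockSum_shift (hZ : MemLp Z 2 (seqLaw p)) (L q m : ℕ) :
    ∫ ω, blockSum Z L q (fun i => ω (m + i)) ∂seqLaw p = ∫ ω, blockSum Z L q ω ∂seqLaw p := by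
  have h := measurePreserving_shift p m
  conv_rhs => rw [← h.map_eq]
  rw [integral_map h.measurable.aemeasurable (by rw [h.map_eq]; exact (memLp_blockSum hZ L q).1)]

theorem integral_blockSum (hZ : MemLp Z 2 (seqLaw p)) (L q : ℕ) :
    ∫ ω, blockSum Z L q ω ∂seqLaw p = q * ∫ ω, Z ω ∂seqLaw p := by
  induction q with
  | zero => simp [blockSum]
  | succ q ih =>
    have h1 : Integrable (fun ω : ℕ → ℕ => blockSum Z L q fun i => ω (L + i)) (seqLaw p) :=
      ((memLp_blockSum hZ L q).comp_measurePreserving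
        (measurePreserving_shift p L)).integrable one_le_two
    simp only [blockSum]
    rw [integral_add (hZ.integrable one_le_two) h1, integral_blockSum_shift hZ, ih]
    push_cast; ring

theorem integral_blockSum_sq (hZ : MemLp Z 2 (seqLaw p)) (h0 : ∫ ω, Z ω ∂seqLaw p = 0)
    (hloc : ∀ ω ω', Z (splice L ω ω') = Z ω) (q : ℕ) :
    ∫ ω, blockSum Z L q ω ^ 2 ∂seqLaw p = q * ∫ ω, Z ω ^ 2 ∂seqLaw p := by
  induction q with
  | zero => simp [blockSum]
  | succ q ih =>
    have h := measurePreserving_shift p L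
    have hB := memLp_blockSum hZ L q
    have hB' := hB.comp_measurePreserving h
    have h1 : ∀ ω, blockSum Z L (q + 1) ω ^ 2 = Z ω ^ 2 +
        (2 * (Z ω * blockSum Z L q fun i => ω (L + i)) +
          (blockSum Z L q fun i => ω (L + i)) ^ 2) := fun ω => by
      rw [blockSum]; ring
    have i1 : Integrable (fun ω => Z ω * blockSum Z L q fun i => ω (L + i)) (seqLaw p) :=
      hZ.integrable_mul hB'
    have i2 : Integrable (fun ω : ℕ → ℕ => (blockSum Z L q fun i => ω (L + i)) ^ 2) (seqLaw p) :=
      hB'.integrable_sq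
    have i3 : Integrable (fun ω => 2 * (Z ω * blockSum Z L q fun i => ω (L + i)) +
          (blockSum Z L q fun i => ω (L + i)) ^ 2) (seqLaw p) := (i1.const_mul 2).add i2
    simp only [h1]
    rw [integral_add hZ.integrable_sq i3, integral_add (i1.const_mul 2) i2, integral_const_mul,
      integral_mul_shift L hloc i1, h0]
    have h2 : ∫ ω, (blockSum Z L q fun i => ω (L + i)) ^ 2 ∂seqLaw p =
        ∫ ω, blockSum Z L q ω ^ 2 ∂seqLaw p := by
      conv_rhs => rw [← h.map_eq]
      rw [integral_map h.measurable.aemeasurable (by rw [h.map_eq]; exact (hB.1.pow 2))]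
    rw [h2, ih]
    push_cast; ring

theorem integral_exp_blockSum (hZ : MemLp Z 2 (seqLaw p))
    (hloc : ∀ ω ω', Z (splice L ω ω') = Z ω) (t : ℝ) (q : ℕ) :
    ∫ ω, Complex.exp ((t * blockSum Z L q ω : ℝ) * Complex.I) ∂seqLaw p =
      (∫ ω, Complex.exp ((t * Z ω : ℝ) * Complex.I) ∂seqLaw p) ^ q := by
  have hmeas : ∀ X : (ℕ → ℕ) → ℝ, AEStronglyMeasurable X (seqLaw p) →
      AEStronglyMeasurable (fun ω => Complex.exp ((t * X ω : ℝ) * Complex.I)) (seqLaw p) := by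
    intro X hX
    have : Continuous fun x : ℝ => Complex.exp ((t * x : ℝ) * Complex.I) := by fun_prop
    exact this.comp_aestronglyMeasurable hX
  induction q with
  | zero => simp [blockSum]
  | succ q ih =>
    have h := measurePreserving_shift p L
    have hB := memLp_blockSum hZ L q
    have hB' := hB.comp_measurePreserving h
    have h1 : ∀ ω, Complex.exp ((t * blockSum Z L (q + 1) ω : ℝ) * Complex.I) =
        Complex.exp ((t * Z ω : ℝ) * Complex.I) *
          (fun ω => Complex.exp ((t * blockSum Z L q ω : ℝ) * Complex.I)) fun i => ω (L + i) := by
      intro ω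
      simp only
      rw [← Complex.exp_add, blockSum]
      congr 1
      push_cast; ring
    simp only [h1]
    rw [integral_mul_shift (A := fun ω => Complex.exp ((t * Z ω : ℝ) * Complex.I))
      (B := fun ω => Complex.exp ((t * blockSum Z L q ω : ℝ) * Complex.I)) L
      (fun ω ω' => by simp only [hloc]), ih, pow_succ, mul_comm]
    refine Integrable.of_bound ((hmeas _ hZ.1).mul (hmeas _ hB'.1)) 1 (ae_of_all _ fun ω => ?_)
    rw [Complex.norm_mul, Complex.norm_exp_ofReal_mul_I, Complex.norm_exp_ofReal_mul_I, one_mul]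

end blockSum

theorem sq_integral_abs_le {Ω : Type*} {mΩ : MeasurableSpace Ω} {P : Measure Ω}
    [IsProbabilityMeasure P] {X : Ω → ℝ} (hX : MemLp X 2 P) :
    (∫ ω, |X ω| ∂P) ^ 2 ≤ ∫ ω, X ω ^ 2 ∂P := by
  have h := variance_nonneg (fun ω => |X ω|) P
  have h' := variance_eq_sub (X := fun ω => |X ω|) hX.abs
  simp only [Pi.pow_apply, sq_abs] at h'
  linarith

theorem integral_abs_le_sqrt {Ω : Type*} {mΩ : MeasurableSpace Ω} {P : Measure Ω}
    [IsProbabilityMeasure P] {X : Ω → ℝ} (hX : MemLp X 2 P) :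
    ∫ ω, |X ω| ∂P ≤ √(∫ ω, X ω ^ 2 ∂P) :=
  Real.le_sqrt_of_sq_le (sq_integral_abs_le hX)

theorem norm_exp_sub_exp_le (x y : ℝ) :
    ‖Complex.exp (x * Complex.I) - Complex.exp (y * Complex.I)‖ ≤ |x - y| := by
  have h : Complex.exp (x * Complex.I) - Complex.exp (y * Complex.I) =
      Complex.exp (y * Complex.I) * (Complex.exp ((x - y : ℝ) * Complex.I) - 1) := by
    rw [mul_sub, ← Complex.exp_add, mul_one]
    congr 2
    push_cast; ring
  rw [h, norm_mul, Complex.norm_exp_ofReal_mul_I, one_mul]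
  exact norm_exp_sub_one_le _

theorem norm_integral_exp_sub_le {Ω : Type*} {mΩ : MeasurableSpace Ω} {P : Measure Ω}
    [IsProbabilityMeasure P] {X X' : Ω → ℝ} (hX : Integrable X P) (hX' : Integrable X' P) :
    ‖∫ ω, Complex.exp (X ω * Complex.I) ∂P - ∫ ω, Complex.exp (X' ω * Complex.I) ∂P‖ ≤
      ∫ ω, |X ω - X' ω| ∂P := by
  have hmeas : ∀ X : Ω → ℝ, Integrable X P →
      Integrable (fun ω => Complex.exp (X ω * Complex.I)) P := by
    intro X hX
    have : Continuous fun x : ℝ => Complex.exp (x * Complex.I) := by fun_prop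
    exact Integrable.of_bound (this.comp_aestronglyMeasurable hX.1) 1
      (ae_of_all _ fun ω => by rw [Complex.norm_exp_ofReal_mul_I])
  rw [← integral_sub (hmeas _ hX) (hmeas _ hX')]
  exact norm_integral_le_of_norm_le (hX.sub hX').abs (ae_of_all _ fun ω => norm_exp_sub_exp_le _ _)

section almostAdditive
variable {p : PMF ℕ} {Y : List ℕ → ℝ} {K : ℕ} {c₀ : ℝ}

/-- Cutting a word into blocks of length `L`: the value of the functional is the sum of the values
of the blocks and of the defects at the junctions, which depend on disjoint windows. -/
theorem word_mul_eq_blockSum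
    (hloc : ∀ l₁ l₂ l₃ l₄ : List ℕ, l₂.length = K → l₃.length = K →
      Y (l₁ ++ l₂ ++ (l₃ ++ l₄)) - Y (l₁ ++ l₂) - Y (l₃ ++ l₄) = Y (l₂ ++ l₃) - Y l₂ - Y l₃)
    {L : ℕ} (hL : K ≤ L) (q : ℕ) (ω : ℕ → ℕ) :
    Y (word ω ((q + 1) * L)) = blockSum (fun ω => Y (word ω L)) L (q + 1) ω +
      blockSum (fun ω => Y (word ω (K + K)) - Y (word ω K) - Y (word (fun i => ω (K + i)) K)) L q
        fun i => ω (L - K + i) := by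
  induction q generalizing ω with
  | zero => simp [blockSum]
  | succ q ih =>
    obtain ⟨M, rfl⟩ := Nat.exists_eq_add_of_le' hL
    have h1 : word ω ((q + 1 + 1) * (M + K)) =
        word ω (M + K) ++ word (fun i => ω (M + K + i)) ((q + 1) * (M + K)) := by
      rw [← word_add]; congr 1; ring
    have h2 : word ω (M + K) = word ω M ++ word (fun i => ω (M + i)) K := word_add _ _ _
    have h3 : word (fun i => ω (M + K + i)) ((q + 1) * (M + K)) =
        word (fun i => ω (M + K + i)) K ++
          word (fun i => ω (M + K + (K + i))) ((q + 1) * (M + K) - K) := by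
      rw [← word_add (fun i => ω (M + K + i))]
      congr 1
      have : K ≤ (q + 1) * (M + K) := by nlinarith
      omega
    -- The first block is split off. The defect of the cut only involves the `K` letters on either
    -- side of it.
    have h4 := hloc (word ω M) (word (fun i => ω (M + i)) K) (word (fun i => ω (M + K + i)) K)
      (word (fun i => ω (M + K + (K + i))) ((q + 1) * (M + K) - K)) (length_word _ _)
      (length_word _ _)
    rw [← h2, ← h3, ← h1] at h4
    have h5 : word (fun i => ω (M + i)) (K + K) =
        word (fun i => ω (M + i)) K ++ word (fun i => ω (M + K + i)) K := by
      rw [word_add]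
      simp only [add_assoc]
    rw [← h5] at h4
    have h6 := ih fun i => ω (M + K + i)
    simp only [blockSum, Nat.add_sub_cancel] at h6 ⊢
    have h7 : (fun i => ω (M + (K + i))) = fun i => ω (M + K + i) := by
      ext i; rw [add_assoc]
    have h8 : (fun i => ω (M + (M + K + i))) = fun i => ω (M + K + (M + i)) := by
      ext i; congr 1; ring
    rw [h7, h8]
    linarith

/-- The distance between a centred almost additive functional and a sum of independent blocks. -/
theorem integral_abs_word_sub_blockSum_le
    (hY : ∀ m, MemLp (fun ω => Y (word ω m)) 2 (seqLaw p))
    (hbd : ∀ l l', |Y (l ++ l') - Y l - Y l'| ≤ c₀)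
    (hloc : ∀ l₁ l₂ l₃ l₄ : List ℕ, l₂.length = K → l₃.length = K →
      Y (l₁ ++ l₂ ++ (l₃ ++ l₄)) - Y (l₁ ++ l₂) - Y (l₃ ++ l₄) = Y (l₂ ++ l₃) - Y l₂ - Y l₃)
    {L : ℕ} (hL : 2 * K ≤ L) (q r : ℕ) :
    ∫ ω, |(Y (word ω ((q + 1) * L + r)) - ∫ ω', Y (word ω' ((q + 1) * L + r)) ∂seqLaw p) -
      blockSum (fun ω => Y (word ω L) - ∫ ω', Y (word ω' L) ∂seqLaw p) L (q + 1) ω| ∂seqLaw p ≤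
      √(q * c₀ ^ 2) + 2 * (c₀ + ∫ ω, |Y (word ω r)| ∂seqLaw p) := by
  set δ : (ℕ → ℕ) → ℝ := fun ω =>
    Y (word ω (K + K)) - Y (word ω K) - Y (word (fun i => ω (K + i)) K) with hδ
  have hδbd : ∀ ω, |δ ω| ≤ c₀ := fun ω => by
    rw [hδ]; simp only
    rw [word_add]
    exact hbd _ _
  have hδ2 : MemLp δ 2 (seqLaw p) :=
    ((hY _).sub (hY _)).sub ((hY K).comp_measurePreserving (measurePreserving_shift p K))
  have hint : ∀ m, Integrable (fun ω => Y (word ω m)) (seqLaw p) := fun m =>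
    (hY m).integrable one_le_two
  set N := (q + 1) * L with hN
  set e : ℕ → ℝ := fun m => ∫ ω', Y (word ω' m) ∂seqLaw p with he
  set δ' : (ℕ → ℕ) → ℝ := fun ω => δ ω - ∫ ω', δ ω' ∂seqLaw p with hδ'
  have hδ'2 : MemLp δ' 2 (seqLaw p) := hδ2.sub (memLp_const _)
  have hshift := measurePreserving_shift p (L - K)
  have hY' : MemLp (fun ω => Y (word ω L) - e L) 2 (seqLaw p) := (hY L).sub (memLp_const _)
  have hmean : e N = (q + 1 : ℕ) * e L + q * ∫ ω', δ ω' ∂seqLaw p := by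
    rw [he]
    simp only
    have i0 : Integrable (fun ω : ℕ → ℕ => blockSum δ L q fun i => ω (L - K + i)) (seqLaw p) :=
      ((memLp_blockSum hδ2 L _).comp_measurePreserving hshift).integrable one_le_two
    rw [← integral_blockSum (hY L) L, ← integral_blockSum hδ2 L,
      ← integral_blockSum_shift hδ2 L q (L - K), ← integral_add
      ((memLp_blockSum (hY L) L _).integrable one_le_two) i0]
    exact integral_congr_ae (ae_of_all _ fun ω => word_mul_eq_blockSum hloc (by omega) q ω)
  -- Up to the remainder of length `r`, the error is a centred sum of `q` defects. They are
  -- independent, since `2 * K ≤ L` makes their windows disjoint.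
  have hjunc : ∀ ω, Y (word ω N) - e N -
      blockSum (fun ω => Y (word ω L) - e L) L (q + 1) ω =
      blockSum δ' L q fun i => ω (L - K + i) := by
    intro ω
    rw [hδ', blockSum_sub_const, blockSum_sub_const, hmean, word_mul_eq_blockSum hloc (by omega)]
    ring
  have hδ0 : ∫ ω, δ' ω ∂seqLaw p = 0 := by
    rw [hδ', integral_sub (hδ2.integrable one_le_two) (integrable_const _)]
    simp
  have hδloc : ∀ ω ω', δ' (splice L ω ω') = δ' ω := by
    intro ω ω'
    simp only [hδ', hδ]
    rw [word_congr (ω' := ω) (n := K + K) fun i hi => by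
        simp only [splice]; rw [if_pos (by omega)],
      word_congr (ω' := ω) (n := K) fun i hi => by simp only [splice]; rw [if_pos (by omega)],
      word_congr (ω := fun i => splice L ω ω' (K + i)) (ω' := fun i => ω (K + i)) (n := K)
        fun i hi => by simp only [splice]; rw [if_pos (by omega)]]
  have hδsq : ∫ ω, δ' ω ^ 2 ∂seqLaw p ≤ c₀ ^ 2 := by
    have h1 := variance_eq_integral hδ2.1.aemeasurable
    have h2 := variance_le_expectation_sq hδ2.1
    rw [h1] at h2
    refine h2.trans ((integral_mono hδ2.integrable_sq (integrable_const (c₀ ^ 2)) fun ω => ?_).trans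
      (by simp))
    simp only
    rw [← sq_abs]
    exact pow_le_pow_left₀ (abs_nonneg _) (hδbd ω) 2
  have hR : ∫ ω : ℕ → ℕ, |blockSum δ' L q fun i => ω (L - K + i)| ∂seqLaw p ≤ √(q * c₀ ^ 2) := by
    refine (integral_abs_le_sqrt ((memLp_blockSum hδ'2 L q).comp_measurePreserving hshift)).trans
      (Real.sqrt_le_sqrt ?_)
    have h2 : ∫ ω : ℕ → ℕ, (blockSum δ' L q fun i => ω (L - K + i)) ^ 2 ∂seqLaw p =
        ∫ ω, blockSum δ' L q ω ^ 2 ∂seqLaw p := by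
      conv_rhs => rw [← hshift.map_eq]
      rw [integral_map hshift.measurable.aemeasurable (by
        rw [hshift.map_eq]; exact ((memLp_blockSum hδ'2 L q).1.pow 2))]
    refine (h2.trans (integral_blockSum_sq hδ'2 hδ0 hδloc q)).trans_le ?_
    gcongr
  -- The last `r` letters change the functional by at most `c₀` and their own value.
  have hrem : ∀ ω, |Y (word ω (N + r)) - Y (word ω N)| ≤ c₀ + |Y (word (fun i => ω (N + i)) r)| := by
    intro ω
    have := hbd (word ω N) (word (fun i => ω (N + i)) r)
    rw [← word_add] at this
    rw [show Y (word ω (N + r)) - Y (word ω N) = (Y (word ω (N + r)) - Y (word ω N) -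
      Y (word (fun i => ω (N + i)) r)) + Y (word (fun i => ω (N + i)) r) by ring]
    exact (abs_add_le _ _).trans (by gcongr)
  have hsh : Integrable (fun ω : ℕ → ℕ => Y (word (fun i => ω (N + i)) r)) (seqLaw p) :=
    ((hY r).comp_measurePreserving (measurePreserving_shift p N)).integrable one_le_two
  have hI : ∫ ω, |Y (word ω (N + r)) - Y (word ω N)| ∂seqLaw p ≤
      c₀ + ∫ ω, |Y (word ω r)| ∂seqLaw p := by
    have h1 := integral_mono (((hint (N + r)).sub (hint N)).abs)
      ((integrable_const c₀).add hsh.abs) hrem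
    refine h1.trans_eq ?_
    simp only [Pi.add_apply]
    rw [integral_add (integrable_const _) hsh.abs, integral_const]
    simp only [probReal_univ, one_smul]
    congr 1
    exact integral_shift (H := fun ω => |Y (word ω r)|)
      (stronglyMeasurable_word (fun l => |Y l|) r) N
  have hE : |e (N + r) - e N| ≤ c₀ + ∫ ω, |Y (word ω r)| ∂seqLaw p := by
    rw [he]
    simp only
    rw [← integral_sub (hint _) (hint _)]
    exact (abs_integral_le_integral_abs).trans hI
  have hall : ∀ ω, |(Y (word ω (N + r)) - e (N + r)) -
      blockSum (fun ω => Y (word ω L) - e L) L (q + 1) ω| ≤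
      |blockSum δ' L q fun i => ω (L - K + i)| + (|Y (word ω (N + r)) - Y (word ω N)| +
        |e (N + r) - e N|) := by
    intro ω
    rw [← hjunc, show (Y (word ω (N + r)) - e (N + r)) -
      blockSum (fun ω => Y (word ω L) - e L) L (q + 1) ω =
      (Y (word ω N) - e N - blockSum (fun ω => Y (word ω L) - e L) L (q + 1) ω) +
      ((Y (word ω (N + r)) - Y (word ω N)) - (e (N + r) - e N)) by ring]
    exact (abs_add_le _ _).trans (add_le_add le_rfl (abs_sub _ _))
  have i1 : Integrable (fun ω : ℕ → ℕ => |blockSum δ' L q fun i => ω (L - K + i)|) (seqLaw p) :=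
    (((memLp_blockSum hδ'2 L q).comp_measurePreserving hshift).integrable one_le_two).abs
  have i2 : Integrable (fun ω => |Y (word ω (N + r)) - Y (word ω N)| + |e (N + r) - e N|)
      (seqLaw p) := (((hint (N + r)).sub (hint N)).abs).add (integrable_const _)
  have i3 : Integrable (fun ω => |blockSum δ' L q fun i => ω (L - K + i)| +
      (|Y (word ω (N + r)) - Y (word ω N)| + |e (N + r) - e N|)) (seqLaw p) := i1.add i2
  refine (integral_mono (((hint (N + r)).sub (integrable_const _)).sub
    ((memLp_blockSum hY' L (q + 1)).integrable one_le_two)).abs i3 hall).trans ?_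
  have i4 : Integrable (fun ω => |Y (word ω (N + r)) - Y (word ω N)|) (seqLaw p) :=
    ((hint (N + r)).sub (hint N)).abs
  rw [integral_add i1 i2, integral_add i4 (integrable_const _)]
  simp only [integral_const, probReal_univ, one_smul]
  linarith

end almostAdditive

theorem tendsto_natCast_div_div {L : ℕ} (hL : 0 < L) :
    Tendsto (fun n : ℕ => ((n / L : ℕ) : ℝ) / n) atTop (𝓝 (1 / L)) := by
  have hL' : (0 : ℝ) < L := by exact_mod_cast hL
  have h1 : Tendsto (fun n : ℕ => (1 : ℝ) / L - 1 / n) atTop (𝓝 (1 / L)) := by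
    simpa using (tendsto_const_nhds (x := (1 : ℝ) / L)).sub tendsto_one_div_atTop_nhds_zero_nat
  refine tendsto_of_tendsto_of_tendsto_of_le_of_le' h1 tendsto_const_nhds ?_ ?_
  · filter_upwards [eventually_gt_atTop 0] with n hn
    have hn' : (0 : ℝ) < n := by exact_mod_cast hn
    rw [div_sub_div _ _ hL'.ne' hn'.ne', div_le_div_iff₀ (by positivity) hn']
    have h2 : n ≤ L * (n / L) + L := by
      have := Nat.div_add_mod n L
      have := Nat.mod_lt n hL
      omega
    have h3 : (n : ℝ) ≤ L * (n / L : ℕ) + L := by exact_mod_cast h2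
    nlinarith
  · filter_upwards [eventually_gt_atTop 0] with n hn
    have hn' : (0 : ℝ) < n := by exact_mod_cast hn
    rw [div_le_div_iff₀ hn' hL', one_mul]
    exact_mod_cast Nat.div_mul_le_self n L

section almostAdditive
variable {p : PMF ℕ} {Y : List ℕ → ℝ} {K : ℕ} {c₀ : ℝ}

/-- With blocks of a fixed length `L`, the normalized functional is close to a sum of independent
blocks: the junctions contribute the error `c₀ / √L`, everything else vanishes in the limit. -/
theorem eventually_norm_integral_exp_word_sub_le
    (hY : ∀ m, MemLp (fun ω => Y (word ω m)) 2 (seqLaw p))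
    (hbd : ∀ l l', |Y (l ++ l') - Y l - Y l'| ≤ c₀)
    (hloc : ∀ l₁ l₂ l₃ l₄ : List ℕ, l₂.length = K → l₃.length = K →
      Y (l₁ ++ l₂ ++ (l₃ ++ l₄)) - Y (l₁ ++ l₂) - Y (l₃ ++ l₄) = Y (l₂ ++ l₃) - Y l₂ - Y l₃)
    {L : ℕ} (hL : 2 * K ≤ L) (hL0 : 0 < L) {v : ℝ}
    (hv : ∫ ω, (Y (word ω L) - ∫ ω', Y (word ω' L) ∂seqLaw p) ^ 2 ∂seqLaw p = v) {η : ℝ}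
    (hη : 0 < η) :
    ∀ᶠ n : ℕ in atTop, ‖∫ ω, Complex.exp
      (((Y (word ω n) - ∫ ω', Y (word ω' n) ∂seqLaw p) / √n : ℝ) * Complex.I) ∂seqLaw p -
        Complex.exp (-(v / L / 2) : ℝ)‖ ≤ c₀ / √L + η := by
  have hc₀ : 0 ≤ c₀ := (abs_nonneg _).trans (hbd [] [])
  have hL' : (0 : ℝ) < L := by exact_mod_cast hL0
  set e : ℕ → ℝ := fun m => ∫ ω', Y (word ω' m) ∂seqLaw p with he
  set Z : (ℕ → ℕ) → ℝ := fun ω => Y (word ω L) - e L with hZ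
  have hZ2 : MemLp Z 2 (seqLaw p) := (hY L).sub (memLp_const _)
  have hZ0 : ∫ ω, Z ω ∂seqLaw p = 0 := by
    rw [hZ, integral_sub ((hY L).integrable one_le_two) (integrable_const _)]
    simp [he]
  have hZloc : ∀ ω ω', Z (splice L ω ω') = Z ω := by
    intro ω ω'
    simp only [hZ]
    rw [word_congr (ω' := ω) (n := L) fun i hi => by simp only [splice]; rw [if_pos hi]]
  have hv0 : 0 ≤ v := hv ▸ integral_nonneg fun _ => sq_nonneg _
  set R := ∑ r ∈ Finset.range L, ∫ ω, |Y (word ω r)| ∂seqLaw p with hR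
  have hRle : ∀ r < L, ∫ ω, |Y (word ω r)| ∂seqLaw p ≤ R := fun r hr =>
    Finset.single_le_sum (f := fun r => ∫ ω, |Y (word ω r)| ∂seqLaw p)
      (fun r _ => integral_nonneg fun _ => abs_nonneg _) (Finset.mem_range.2 hr)
  have hS2 : ∀ q, ∫ ω, |blockSum Z L q ω| ∂seqLaw p ≤ √(q * v) := fun q => by
    refine (integral_abs_le_sqrt (memLp_blockSum hZ2 L q)).trans_eq ?_
    rw [integral_blockSum_sq hZ2 hZ0 hZloc, hv]
  have hsq : Tendsto (fun n : ℕ => √(n : ℝ)) atTop atTop :=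
    Real.tendsto_sqrt_atTop.comp tendsto_natCast_atTop_atTop
  -- `t1` controls the incomplete last block, `t2` the replacement of `√n` by `√(L * (n / L))`, and
  -- `t3` is the central limit theorem for the blocks.
  have t1 : Tendsto (fun n : ℕ => 2 * (c₀ + R) / √(n : ℝ)) atTop (𝓝 0) :=
    tendsto_const_nhds.div_atTop hsq
  have t2 : Tendsto (fun n : ℕ => |√(((n / L : ℕ) : ℝ) / n) - √(1 / L)| * √v) atTop (𝓝 0) := by
    have := (((Real.continuous_sqrt.tendsto _).comp (tendsto_natCast_div_div hL0)).sub_const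
      (√(1 / L))).abs.mul_const (√v)
    simpa using this
  have t3 : Tendsto (fun n : ℕ => ‖(∫ ω, Complex.exp ((1 / √L / √((n / L : ℕ) : ℝ) * Z ω : ℝ) *
      Complex.I) ∂seqLaw p) ^ (n / L) - Complex.exp (-(v * (1 / √L) ^ 2 / 2) : ℝ)‖) atTop (𝓝 0) := by
    have hdiv : Tendsto (fun n : ℕ => n / L) atTop atTop :=
      Filter.tendsto_atTop_atTop.2 fun b => ⟨b * L, fun a ha => (Nat.le_div_iff_mul_le hL0).2 ha⟩
    exact tendsto_iff_norm_sub_tendsto_zero.1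
      ((tendsto_integral_exp_pow hZ2 hZ0 hv (1 / √L)).comp hdiv)
  have hη3 : 0 < η / 3 := by positivity
  filter_upwards [t1.eventually (gt_mem_nhds hη3), t2.eventually (gt_mem_nhds hη3),
    t3.eventually (gt_mem_nhds hη3), eventually_ge_atTop L] with n h1 h2 h3 hn
  obtain ⟨q, hq⟩ : ∃ q, n / L = q + 1 :=
    ⟨n / L - 1, (Nat.succ_pred_eq_of_pos (Nat.div_pos hn hL0)).symm⟩
  have hnq : n = (q + 1) * L + n % L := by
    rw [← hq, mul_comm]; exact (Nat.div_add_mod n L).symm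
  have hn0 : (0 : ℝ) < n := by exact_mod_cast hL0.trans_le hn
  have hsn : 0 < √(n : ℝ) := Real.sqrt_pos.2 hn0
  have hr := Nat.mod_lt n hL0
  rw [hq] at h2 h3
  have hq0 : (0 : ℝ) < ((q + 1 : ℕ) : ℝ) := by positivity
  have hsq0 : 0 < √((q + 1 : ℕ) : ℝ) := Real.sqrt_pos.2 hq0
  have hsL0 : 0 < √(L : ℝ) := Real.sqrt_pos.2 hL'
  have hYint : Integrable (fun ω => (Y (word ω n) - e n) / √n) (seqLaw p) :=
    (((hY n).integrable one_le_two).sub (integrable_const _)).div_const _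
  have hSint : Integrable (blockSum Z L (q + 1)) (seqLaw p) :=
    (memLp_blockSum hZ2 L _).integrable one_le_two
  have b1 : ‖∫ ω, Complex.exp (((Y (word ω n) - e n) / √n : ℝ) * Complex.I) ∂seqLaw p -
      ∫ ω, Complex.exp ((blockSum Z L (q + 1) ω / √n : ℝ) * Complex.I) ∂seqLaw p‖ ≤
      c₀ / √L + 2 * (c₀ + R) / √n := by
    refine (norm_integral_exp_sub_le hYint (hSint.div_const _)).trans ?_
    have h4 := integral_abs_word_sub_blockSum_le hY hbd hloc hL q (n % L)
    rw [← hnq] at h4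
    have h5 : ∀ ω, |(Y (word ω n) - e n) / √n - blockSum Z L (q + 1) ω / √n| =
        |(Y (word ω n) - e n) - blockSum Z L (q + 1) ω| / √n := fun ω => by
      rw [← sub_div, abs_div, abs_of_pos hsn]
    simp only [h5]
    rw [integral_div]
    have h6 : √(q * c₀ ^ 2) ≤ c₀ * √n / √L := by
      rw [Real.sqrt_mul (Nat.cast_nonneg q), Real.sqrt_sq hc₀, le_div_iff₀ hsL0]
      have h7 : √(q : ℝ) * √L ≤ √n := by
        rw [← Real.sqrt_mul (Nat.cast_nonneg q)]
        refine Real.sqrt_le_sqrt ?_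
        have : q * L ≤ n := (Nat.mul_le_mul_right L (Nat.le_succ q)).trans
          ((Nat.le_add_right _ (n % L)).trans_eq hnq.symm)
        exact_mod_cast this
      nlinarith
    calc _ ≤ (c₀ * √n / √L + 2 * (c₀ + R)) / √n := by
          refine div_le_div_of_nonneg_right (h4.trans (add_le_add h6 ?_)) hsn.le
          have := hRle _ hr
          linarith
      _ = _ := by field_simp
  have b2 : ‖∫ ω, Complex.exp ((blockSum Z L (q + 1) ω / √n : ℝ) * Complex.I) ∂seqLaw p -
      ∫ ω, Complex.exp ((1 / √L / √((q + 1 : ℕ) : ℝ) * blockSum Z L (q + 1) ω : ℝ) * Complex.I)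
        ∂seqLaw p‖ ≤ |√(((q + 1 : ℕ) : ℝ) / n) - √(1 / L)| * √v := by
    refine (norm_integral_exp_sub_le (hSint.div_const _) (hSint.const_mul _)).trans ?_
    have h5 : ∀ ω, |blockSum Z L (q + 1) ω / √n - 1 / √L / √((q + 1 : ℕ) : ℝ) *
        blockSum Z L (q + 1) ω| = |√(((q + 1 : ℕ) : ℝ) / n) - √(1 / L)| / √((q + 1 : ℕ) : ℝ) *
          |blockSum Z L (q + 1) ω| := fun ω => by
      rw [← abs_of_pos hsq0, ← abs_div, ← abs_mul, abs_of_pos hsq0]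
      congr 1
      rw [Real.sqrt_div hq0.le, Real.sqrt_div zero_le_one, Real.sqrt_one]
      field_simp
    simp only [h5]
    rw [integral_const_mul]
    refine (mul_le_mul_of_nonneg_left (hS2 (q + 1)) (by positivity)).trans_eq ?_
    rw [Real.sqrt_mul hq0.le]
    field_simp
  have b3 := h3
  rw [← integral_exp_blockSum hZ2 hZloc] at b3
  have h8 : v / L / 2 = v * (1 / √(L : ℝ)) ^ 2 / 2 := by
    rw [div_pow, Real.sq_sqrt hL'.le]; ring
  rw [h8]
  refine (norm_sub_le_norm_sub_add_norm_sub _ _ _).trans ((add_le_add b1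
    ((norm_sub_le_norm_sub_add_norm_sub _ _ _).trans (add_le_add b2 b3.le))).trans ?_)
  linarith

/-- The central limit theorem for almost additive functionals of words in independent letters. -/
theorem tendsto_integral_exp_word
    (hY : ∀ m, MemLp (fun ω => Y (word ω m)) 2 (seqLaw p))
    (hbd : ∀ l l', |Y (l ++ l') - Y l - Y l'| ≤ c₀)
    (hloc : ∀ l₁ l₂ l₃ l₄ : List ℕ, l₂.length = K → l₃.length = K →
      Y (l₁ ++ l₂ ++ (l₃ ++ l₄)) - Y (l₁ ++ l₂) - Y (l₃ ++ l₄) = Y (l₂ ++ l₃) - Y l₂ - Y l₃)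
    {Q : ℝ} (hvar : Tendsto (fun m : ℕ => (∫ ω, (Y (word ω m) -
      ∫ ω', Y (word ω' m) ∂seqLaw p) ^ 2 ∂seqLaw p) / m) atTop (𝓝 Q)) :
    Tendsto (fun n : ℕ => ∫ ω, Complex.exp
      (((Y (word ω n) - ∫ ω', Y (word ω' n) ∂seqLaw p) / √n : ℝ) * Complex.I) ∂seqLaw p) atTop
      (𝓝 (Complex.exp (-(Q / 2) : ℝ))) := by
  rw [Metric.tendsto_atTop]
  intro ε hε
  have t1 : Tendsto (fun L : ℕ => c₀ / √(L : ℝ)) atTop (𝓝 0) :=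
    tendsto_const_nhds.div_atTop (Real.tendsto_sqrt_atTop.comp tendsto_natCast_atTop_atTop)
  have hcont : Continuous fun x : ℝ => Complex.exp (-(x / 2) : ℝ) := by fun_prop
  have t2 := Metric.tendsto_nhds.1 ((hcont.tendsto Q).comp hvar) (ε / 3) (by positivity)
  -- The block length `L` is fixed so large that the junctions are negligible and the variance of a
  -- block, divided by `L`, is close to `Q`.
  obtain ⟨L, h1, h2, hL, hL0⟩ := ((t1.eventually (gt_mem_nhds (by positivity : 0 < ε / 3))).and
    (t2.and ((eventually_ge_atTop (2 * K)).and (eventually_gt_atTop 0)))).exists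
  have h3 := eventually_norm_integral_exp_word_sub_le hY hbd hloc hL hL0 rfl
    (by positivity : 0 < ε / 3)
  obtain ⟨N, hN⟩ := eventually_atTop.1 h3
  refine ⟨N, fun n hn => ?_⟩
  have h4 := hN n hn
  rw [dist_eq_norm]
  simp only [Function.comp_apply, dist_eq_norm] at h2
  refine (norm_sub_le_norm_sub_add_norm_sub _ _ _).trans_lt ((add_lt_add_of_le_of_lt h4 h2).trans_le ?_)
  linarith

end almostAdditive

/-! ### Factor sums of tolls of bounded size -/

section bounded
variable {f : PlaneTree → ℝ} {K : ℕ} {b : ℝ}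

theorem abs_headToll_le_of_bound (hb : ∀ T, |f T| ≤ b) (l : List ℕ) : |headToll f l| ≤ b := by
  by_cases h : ∃ T, code T <+: l
  · obtain ⟨T, hT⟩ := h
    rw [headToll_of_prefix f hT]; exact hb T
  · rw [headToll_eq_zero f h, abs_zero]
    exact (abs_nonneg _).trans (hb (node []))

theorem factorSum_cons_append (k : ℕ) (l l' : List ℕ) :
    factorSum f (k :: l ++ l') = headToll f (k :: l ++ l') + factorSum f (l ++ l') := rfl

/-- Only the factors which reach across the cut are affected; they start at one of the last `K`
positions before it. -/
theorem abs_factorSum_append_sub_le (hf : ∀ T, K < T.size → f T = 0) (hb : ∀ T, |f T| ≤ b)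
    (l l' : List ℕ) :
    |factorSum f (l ++ l') - factorSum f l - factorSum f l'| ≤ 2 * b * (min l.length K : ℕ) := by
  induction l with
  | nil => simp [factorSum]
  | cons k l ih =>
    have hb0 : 0 ≤ b := (abs_nonneg _).trans (hb (node []))
    rw [factorSum_cons_append, factorSum]
    have h2 : headToll f (k :: l ++ l') + factorSum f (l ++ l') -
        (headToll f (k :: l) + factorSum f l) - factorSum f l' =
        (headToll f (k :: l ++ l') - headToll f (k :: l)) +
          (factorSum f (l ++ l') - factorSum f l - factorSum f l') := by ring
    rw [h2]
    rcases le_or_gt K (k :: l).length with h | h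
    · rw [headToll_eq_of_prefix hf (List.prefix_append (k :: l) l') h, sub_self, zero_add]
      refine ih.trans ?_
      have : min l.length K ≤ min (k :: l).length K := by
        simp only [List.length_cons]; omega
      gcongr
    · have h3 := abs_sub (headToll f (k :: l ++ l')) (headToll f (k :: l))
      have h4 := abs_headToll_le_of_bound hb (k :: l ++ l')
      have h5 := abs_headToll_le_of_bound hb (k :: l)
      have h6 : min (k :: l).length K = min l.length K + 1 := by
        simp only [List.length_cons] at h ⊢; omega
      rw [h6]
      rw [Nat.cast_add, Nat.cast_one]
      refine (abs_add_le _ _).trans ?_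
      linarith

/-- The defect of the factor sum at a cut depends only on the `K` letters on each side of it, as no
factor carrying a toll is longer than `K`. -/
theorem factorSum_append_append (hf : ∀ T, K < T.size → f T = 0) (l₁ l₂ l₃ l₄ : List ℕ)
    (h2 : l₂.length = K) (h3 : l₃.length = K) :
    factorSum f (l₁ ++ l₂ ++ (l₃ ++ l₄)) - factorSum f (l₁ ++ l₂) - factorSum f (l₃ ++ l₄) =
      factorSum f (l₂ ++ l₃) - factorSum f l₂ - factorSum f l₃ := by
  have h4 : ∀ l₁ l' : List ℕ, factorSum f (l₁ ++ l₂ ++ l') - factorSum f (l₁ ++ l₂) =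
      factorSum f (l₂ ++ l') - factorSum f l₂ := by
    intro l₁ l'
    induction l₁ with
    | nil => rfl
    | cons k l ih =>
      have h5 := headToll_eq_of_prefix hf (List.prefix_append (k :: (l ++ l₂)) l')
        (by simp; omega)
      simp only [List.cons_append, factorSum] at ih h5 ⊢
      rw [h5]
      linarith
  have h5 : ∀ l : List ℕ, factorSum f (l ++ (l₃ ++ l₄)) - factorSum f (l₃ ++ l₄) =
      factorSum f (l ++ l₃) - factorSum f l₃ := by
    intro l
    induction l with
    | nil => simp
    | cons k l ih =>
      have h6 := headToll_eq_of_prefix hf (List.prefix_append (k :: l ++ l₃) l₄)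
        (by simp; omega)
      simp only [List.cons_append, List.append_assoc, factorSum] at ih h6 ⊢
      rw [h6]
      linarith
  have h6 := h4 l₁ (l₃ ++ l₄)
  have h7 := h5 l₂
  linarith

end bounded

section
variable {p : PMF ℕ}

theorem excess_word_eq_blockSum (ω : ℕ → ℕ) (m : ℕ) :
    ((excess (word ω m) : ℤ) : ℝ) = blockSum (fun ω => (ω 0 : ℝ) - 1) 1 m ω := by
  induction m generalizing ω with
  | zero => simp [word, blockSum]
  | succ m ih =>
    rw [word_succ, excess_cons, blockSum, ← ih]
    simp only [add_comm 1]
    push_cast; ring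

theorem integral_eval (g : ℕ → ℝ) (i : ℕ) :
    ∫ ω, g (ω i) ∂seqLaw p = ∫ k, g k ∂p.toMeasure := by
  have := (measurePreserving_eval_infinitePi (fun _ : ℕ => p.toMeasure) i)
  rw [← this.map_eq, integral_map this.measurable.aemeasurable
    StronglyMeasurable.of_discrete.aestronglyMeasurable]
  rfl

end

namespace IsCritical
variable {p : PMF ℕ} {σsq : ℝ} (hp : IsCritical p σsq)
include hp

theorem memLp_eval : MemLp (fun ω : ℕ → ℕ => (ω 0 : ℝ) - 1) 2 (seqLaw p) :=
  hp.memLp_step.comp_measurePreserving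
    (measurePreserving_eval_infinitePi (fun _ : ℕ => p.toMeasure) 0)

theorem memLp_excess (m : ℕ) :
    MemLp (fun ω => ((excess (word ω m) : ℤ) : ℝ)) 2 (seqLaw p) := by
  simp only [excess_word_eq_blockSum]
  exact memLp_blockSum hp.memLp_eval 1 m

theorem integral_excess (m : ℕ) : ∫ ω, ((excess (word ω m) : ℤ) : ℝ) ∂seqLaw p = 0 := by
  simp only [excess_word_eq_blockSum]
  rw [integral_blockSum hp.memLp_eval, integral_eval (fun k => (k : ℝ) - 1), hp.integral_step,
    mul_zero]

theorem integral_excess_sq (m : ℕ) :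
    ∫ ω, ((excess (word ω m) : ℤ) : ℝ) ^ 2 ∂seqLaw p = m * σsq := by
  simp only [excess_word_eq_blockSum]
  rw [integral_blockSum_sq hp.memLp_eval, integral_eval (fun k => ((k : ℝ) - 1) ^ 2),
    hp.integral_step_sq]
  · rw [integral_eval (fun k => (k : ℝ) - 1), hp.integral_step]
  · intro ω ω'
    simp [splice]

theorem integrable_mul_excess {G : List ℕ → ℝ} {m : ℕ} {C : ℝ}
    (hG : ∀ l : List ℕ, l.length = m → |G l| ≤ C) :
    Integrable (fun ω => G (word ω m) * ((excess (word ω m) : ℤ) : ℝ)) (seqLaw p) :=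
  ((hp.memLp_excess m).integrable one_le_two).bdd_mul (c := C)
    (stronglyMeasurable_word G m).aestronglyMeasurable
    (ae_of_all _ fun ω => hG _ (length_word ω m))

/-- A tree moves the walk by `-1`, and the steps after it are centred. -/
theorem integral_headToll_mul_excess (f : PlaneTree → ℝ) (m : ℕ) :
    ∫ ω, headToll f (word ω m) * ((excess (word ω m) : ℤ) : ℝ) ∂seqLaw p =
      -∫ ω, headToll f (word ω m) ∂seqLaw p := by
  have hi : ∀ (T : PlaneTree) (j : ℕ),
      Integrable (fun ω => ((excess (code T ++ word ω j) : ℤ) : ℝ)) (seqLaw p) := by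
    intro T j
    simp only [excess_append, Int.cast_add]
    exact (integrable_const _).add ((hp.memLp_excess j).integrable one_le_two)
  rw [integral_headToll_mul f (fun l => ((excess l : ℤ) : ℝ)) fun k _ T _ => hi T _,
    integral_headToll, ← Finset.sum_neg_distrib]
  refine Finset.sum_congr rfl fun k _ => ?_
  rw [levelSum, ← Finset.sum_neg_distrib]
  refine Finset.sum_congr rfl fun T _ => ?_
  have : ∫ ω, ((excess (code T ++ word ω (m - k)) : ℤ) : ℝ) ∂seqLaw p = -1 := by
    simp only [excess_append, Int.cast_add, excess_code]
    rw [integral_add (integrable_const _) ((hp.memLp_excess _).integrable one_le_two),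
      hp.integral_excess]
    simp
  rw [this]
  ring

/-- The covariance of a factor sum with the endpoint of the walk. -/
theorem integral_factorSum_mul_excess (f : PlaneTree → ℝ) (m : ℕ) :
    ∫ ω, factorSum f (word ω m) * ((excess (word ω m) : ℤ) : ℝ) ∂seqLaw p =
      -∫ ω, factorSum f (word ω m) ∂seqLaw p := by
  induction m with
  | zero => simp [word, factorSum]
  | succ m ih =>
    obtain ⟨C, hC⟩ := exists_abs_factorSum_le f m
    have hsh := measurePreserving_shift p 1
    have hexc : ∀ ω, ((excess (word ω (m + 1)) : ℤ) : ℝ) =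
        ((ω 0 : ℝ) - 1) + ((excess (word (fun i => ω (1 + i)) m) : ℤ) : ℝ) := by
      intro ω
      rw [word_succ, excess_cons]
      simp only [add_comm 1]
      push_cast; ring
    -- The first step is independent of the factors in the tail, and centred, so it only interacts
    -- with the head toll.
    have h1 : ∀ ω, factorSum f (word ω (m + 1)) * ((excess (word ω (m + 1)) : ℤ) : ℝ) =
        headToll f (word ω (m + 1)) * ((excess (word ω (m + 1)) : ℤ) : ℝ) +
        (((ω 0 : ℝ) - 1) * (fun ω => factorSum f (word ω m)) (fun i => ω (1 + i)) +
        (fun ω => factorSum f (word ω m) * ((excess (word ω m) : ℤ) : ℝ)) fun i => ω (1 + i)) := by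
      intro ω
      rw [factorSum_word_succ, add_mul]
      congr 1
      rw [hexc]
      ring
    have i1 : Integrable (fun ω => headToll f (word ω (m + 1)) *
        ((excess (word ω (m + 1)) : ℤ) : ℝ)) (seqLaw p) :=
      hp.integrable_mul_excess fun _ hl => abs_headToll_le f hl
    have i2 : Integrable (fun ω : ℕ → ℕ => ((ω 0 : ℝ) - 1) *
        (fun ω => factorSum f (word ω m)) (fun i => ω (1 + i))) (seqLaw p) :=
      (hp.memLp_eval.integrable one_le_two).mul_bdd (c := C)
        ((stronglyMeasurable_word (factorSum f) m).aestronglyMeasurable.comp_measurePreserving hsh)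
        (ae_of_all _ fun ω => hC _ (length_word _ m))
    have i3' : Integrable (fun ω => factorSum f (word ω m) * ((excess (word ω m) : ℤ) : ℝ))
        (seqLaw p) := hp.integrable_mul_excess hC
    have i3 : Integrable (fun ω : ℕ → ℕ => (fun ω => factorSum f (word ω m) *
        ((excess (word ω m) : ℤ) : ℝ)) fun i => ω (1 + i)) (seqLaw p) :=
      hsh.integrable_comp_of_integrable i3'
    have i4 : Integrable (fun ω : ℕ → ℕ => ((ω 0 : ℝ) - 1) *
        (fun ω => factorSum f (word ω m)) (fun i => ω (1 + i)) + (fun ω => factorSum f (word ω m) *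
        ((excess (word ω m) : ℤ) : ℝ)) fun i => ω (1 + i)) (seqLaw p) := i2.add i3
    rw [integral_congr_ae (ae_of_all _ h1), integral_add i1 i4, integral_add i2 i3,
      hp.integral_headToll_mul_excess,
      integral_mul_shift (A := fun ω : ℕ → ℕ => (ω 0 : ℝ) - 1)
        (B := fun ω => factorSum f (word ω m)) 1 (fun ω ω' => by simp [splice]) i2,
      integral_eval (fun k => (k : ℝ) - 1), hp.integral_step, zero_mul, zero_add]
    have h2 := integral_shift (p := p) (H := fun ω => factorSum f (word ω m) *
        ((excess (word ω m) : ℤ) : ℝ)) (stronglyMeasurable_word (fun l => factorSum f l *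
        ((excess l : ℤ) : ℝ)) m) 1
    rw [h2, ih]
    simp only [factorSum_word_succ]
    rw [integral_add (integrable_headToll _) (integrable_word_shift (integrable_factorSum m)),
      integral_word_shift (factorSum f)]
    ring

/-- The variance of a linear combination of a factor sum and the endpoint of the walk. -/
theorem integral_linear_sub_sq (f : PlaneTree → ℝ) (s u : ℝ) (m : ℕ) :
    ∫ ω, ((s * factorSum f (word ω m) + u * ((excess (word ω m) : ℤ) : ℝ)) -
      ∫ ω', (s * factorSum f (word ω' m) + u * ((excess (word ω' m) : ℤ) : ℝ)) ∂seqLaw p) ^ 2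
        ∂seqLaw p =
      s ^ 2 * ∫ ω, (factorSum f (word ω m) - ∫ ω', factorSum f (word ω' m) ∂seqLaw p) ^ 2
        ∂seqLaw p - 2 * s * u * (∫ ω, factorSum f (word ω m) ∂seqLaw p) + u ^ 2 * (m * σsq) := by
  have hE : ∫ ω', (s * factorSum f (word ω' m) + u * ((excess (word ω' m) : ℤ) : ℝ)) ∂seqLaw p =
      s * ∫ ω, factorSum f (word ω m) ∂seqLaw p := by
    rw [integral_add ((integrable_factorSum m).const_mul s)
      (((hp.memLp_excess m).integrable one_le_two).const_mul u), integral_const_mul,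
      integral_const_mul, hp.integral_excess, mul_zero, add_zero]
  rw [hE]
  obtain ⟨C, hC⟩ := exists_abs_factorSum_le f m
  have hcov := hp.integral_factorSum_mul_excess f m
  set e := ∫ ω, factorSum f (word ω m) ∂seqLaw p with he
  have i1 : Integrable (fun ω => s ^ 2 * (factorSum f (word ω m) - e) ^ 2) (seqLaw p) :=
    (integrable_factorSum_sub_sq m e).const_mul _
  have i2 : Integrable (fun ω => 2 * s * u * (factorSum f (word ω m) *
      ((excess (word ω m) : ℤ) : ℝ))) (seqLaw p) := (hp.integrable_mul_excess hC).const_mul _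
  have i3 : Integrable (fun ω => -(2 * s * u * e) * ((excess (word ω m) : ℤ) : ℝ)) (seqLaw p) :=
    ((hp.memLp_excess m).integrable one_le_two).const_mul _
  have i4 : Integrable (fun ω => u ^ 2 * ((excess (word ω m) : ℤ) : ℝ) ^ 2) (seqLaw p) :=
    (hp.memLp_excess m).integrable_sq.const_mul _
  have i34 : Integrable (fun ω => -(2 * s * u * e) * ((excess (word ω m) : ℤ) : ℝ) +
    u ^ 2 * ((excess (word ω m) : ℤ) : ℝ) ^ 2) (seqLaw p) := i3.add i4
  have i234 : Integrable (fun ω => 2 * s * u * (factorSum f (word ω m) *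
      ((excess (word ω m) : ℤ) : ℝ)) + (-(2 * s * u * e) * ((excess (word ω m) : ℤ) : ℝ) +
    u ^ 2 * ((excess (word ω m) : ℤ) : ℝ) ^ 2)) (seqLaw p) := i2.add i34
  have h1 : ∀ ω, (s * factorSum f (word ω m) + u * ((excess (word ω m) : ℤ) : ℝ) - s * e) ^ 2 =
      s ^ 2 * (factorSum f (word ω m) - e) ^ 2 + (2 * s * u * (factorSum f (word ω m) *
      ((excess (word ω m) : ℤ) : ℝ)) + (-(2 * s * u * e) * ((excess (word ω m) : ℤ) : ℝ) +
    u ^ 2 * ((excess (word ω m) : ℤ) : ℝ) ^ 2)) := fun ω => by ring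
  simp only [h1]
  rw [integral_add i1 i234, integral_add i2 i34, integral_add i3 i4, integral_const_mul,
    integral_const_mul, integral_const_mul, integral_const_mul, hcov, hp.integral_excess,
    hp.integral_excess_sq]
  ring

end IsCritical

section bounded
variable {p : PMF ℕ} {f : PlaneTree → ℝ} {K : ℕ}

theorem levelSum_eq_zero_of_lt (hf : ∀ T, K < T.size → f T = 0) (g : PlaneTree → ℝ) {k : ℕ}
    (hk : K < k) : levelSum p (fun T => f T * g T) k = 0 := by
  rw [levelSum_congr (h := fun _ => 0) fun T hT => by rw [hf T (by omega), zero_mul],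
    levelSum_const, zero_mul]

theorem sum_range_eq_of_size_le {g : ℕ → ℝ} (hg : ∀ k, K < k → g k = 0) {m : ℕ} (hm : K ≤ m) :
    ∑ k ∈ Finset.range (m + 1), g k = ∑ k ∈ Finset.range (K + 1), g k :=
  (Finset.sum_subset (Finset.range_subset_range.2 (by omega)) fun k _ hk =>
    hg k (by simpa using hk)).symm

theorem integral_factorSum_of_size_le (hf : ∀ T, K < T.size → f T = 0) {m : ℕ} (hm : K ≤ m) :
    ∫ ω, factorSum f (word ω m) ∂seqLaw p =
      ∑ k ∈ Finset.range (K + 1), ((m : ℝ) + 1 - k) * levelSum p f k := by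
  have hlev : ∀ k, K < k → levelSum p f k = 0 := fun k hk => by
    simpa using levelSum_eq_zero_of_lt (p := p) hf (fun _ => 1) hk
  rw [integral_factorSum m (Nat.lt_succ_self m),
    sum_range_eq_of_size_le (fun k hk => by rw [hlev k hk, mul_zero]) hm]
  refine Finset.sum_congr rfl fun k hk => ?_
  have := Finset.mem_range.1 hk
  rw [Nat.cast_sub (by omega)]
  push_cast; ring

/-- The mean of a factor sum grows linearly with the length of the word. -/
theorem exists_integral_factorSum_eq (hf : ∀ T, K < T.size → f T = 0) :
    ∃ c, ∀ m ≥ K, ∫ ω, factorSum f (word ω m) ∂seqLaw p =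
      m * (∑ k ∈ Finset.range (K + 1), levelSum p f k) + c := by
  refine ⟨∑ k ∈ Finset.range (K + 1), (1 - k) * levelSum p f k, fun m hm => ?_⟩
  rw [integral_factorSum_of_size_le hf hm, Finset.mul_sum, ← Finset.sum_add_distrib]
  exact Finset.sum_congr rfl fun k _ => by ring

/-- The variance of a factor sum grows linearly with the length of the word. -/
theorem exists_variance_factorSum_eq (hf : ∀ T, K < T.size → f T = 0) :
    ∃ c, ∀ m ≥ 2 * K, ∫ ω, (factorSum f (word ω m) -
      ∫ ω', factorSum f (word ω' m) ∂seqLaw p) ^ 2 ∂seqLaw p =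
      m * (∑ k ∈ Finset.range (K + 1), levelSum p (fun T => f T * (2 * (additive f T -
        k * ∑ j ∈ Finset.range (K + 1), levelSum p f j) - f T)) k +
        (∑ k ∈ Finset.range (K + 1), levelSum p f k) ^ 2) + c := by
  set M := ∑ j ∈ Finset.range (K + 1), levelSum p f j with hM
  set β : ℕ → ℝ := fun k => levelSum p (fun T => f T * (2 * (additive f T - k * M) - f T)) k
    with hβ
  have hlev : ∀ k, K < k → levelSum p f k = 0 := fun k hk => by
    simpa using levelSum_eq_zero_of_lt (p := p) hf (fun _ => 1) hk
  refine ⟨∑ k ∈ Finset.range (K + 1), (1 - k) * β k + ∑ k ∈ Finset.range (K + 1),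
    ∑ l ∈ Finset.range (K + 1), levelSum p f k * levelSum p f l * (1 - k - l + k * l),
    fun m hm => ?_⟩
  have hm' : K ≤ m := by omega
  rw [variance_factorSum m (sum_range_eq_of_size_le hlev hm').symm]
  rw [sum_range_eq_of_size_le (K := K) (fun k hk => by
      rw [levelSum_eq_zero_of_lt hf _ hk, mul_zero]) hm',
    sum_range_eq_of_size_le (K := K) (fun k hk => by
      simp [hlev k hk]) hm']
  have h1 : ∑ k ∈ Finset.range (K + 1), ∑ l ∈ Finset.range (m + 1),
      levelSum p f k * levelSum p f l * pairWeight m k l =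
      m * M ^ 2 + ∑ k ∈ Finset.range (K + 1),
        ∑ l ∈ Finset.range (K + 1), levelSum p f k * levelSum p f l * (1 - k - l + k * l) := by
    rw [hM, sq, Finset.sum_mul_sum, Finset.mul_sum, ← Finset.sum_add_distrib]
    refine Finset.sum_congr rfl fun k hk => ?_
    rw [sum_range_eq_of_size_le (K := K) (fun l hl => by simp [hlev l hl]) hm', Finset.mul_sum,
      ← Finset.sum_add_distrib]
    refine Finset.sum_congr rfl fun l hl => ?_
    have := Finset.mem_range.1 hk
    have := Finset.mem_range.1 hl
    rw [pairWeight_of_le (by omega)]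
    ring
  rw [h1, mul_add, Finset.mul_sum]
  have h2 : ∑ k ∈ Finset.range (K + 1), ((m : ℝ) + 1 - k) * β k =
      ∑ k ∈ Finset.range (K + 1), (m : ℝ) * β k + ∑ k ∈ Finset.range (K + 1), (1 - k) * β k := by
    rw [← Finset.sum_add_distrib]
    exact Finset.sum_congr rfl fun k _ => by ring
  simp only [hβ] at h2 ⊢
  rw [h2]
  ring

theorem tendsto_affine_div {g : ℕ → ℝ} {a c : ℝ} {N : ℕ} (h : ∀ m ≥ N, g m = m * a + c) :
    Tendsto (fun m : ℕ => g m / m) atTop (𝓝 a) := by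
  have h1 : Tendsto (fun m : ℕ => a + c / m) atTop (𝓝 a) := by
    simpa using tendsto_const_nhds.add (tendsto_const_div_atTop_nhds_zero_nat c)
  refine h1.congr' ?_
  filter_upwards [eventually_ge_atTop N, eventually_gt_atTop 0] with m hm hm0
  have : (m : ℝ) ≠ 0 := by exact_mod_cast hm0.ne'
  rw [h m hm]
  field_simp

/-- The joint central limit theorem for a factor sum and the endpoint of the walk. -/
theorem IsCritical.tendsto_integral_exp_linear {σsq : ℝ} (hp : IsCritical p σsq) {b : ℝ}
    (hf : ∀ T, K < T.size → f T = 0) (hb : ∀ T, |f T| ≤ b) {M v : ℝ}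
    (hM : M = ∑ k ∈ Finset.range (K + 1), levelSum p f k)
    (hv : v = ∑ k ∈ Finset.range (K + 1), levelSum p (fun T => f T * (2 * (additive f T -
        k * M) - f T)) k + M ^ 2) (s u : ℝ) :
    Tendsto (fun n : ℕ => ∫ ω, Complex.exp ((s / √n * (factorSum f (word ω n) - n * M) +
      u / √n * (((excess (word ω n) : ℤ) : ℝ) + 1) : ℝ) * Complex.I) ∂seqLaw p) atTop
      (𝓝 (Complex.exp (-((s ^ 2 * v - 2 * s * u * M + u ^ 2 * σsq) / 2) : ℝ))) := by
  set Y : List ℕ → ℝ := fun l => s * factorSum f l + u * ((excess l : ℤ) : ℝ) with hY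
  obtain ⟨c, hc⟩ := exists_integral_factorSum_eq (p := p) hf
  obtain ⟨c', hc'⟩ := exists_variance_factorSum_eq (p := p) hf
  rw [← hM] at hc
  simp only [← hM] at hc'
  rw [← hv] at hc'
  have hb0 : 0 ≤ b := (abs_nonneg _).trans (hb (node []))
  have hY2 : ∀ m, MemLp (fun ω => Y (word ω m)) 2 (seqLaw p) := fun m => by
    obtain ⟨C, hC⟩ := exists_abs_factorSum_le f m
    have h1 : MemLp (fun ω => factorSum f (word ω m)) 2 (seqLaw p) :=
      MemLp.of_bound (stronglyMeasurable_word (factorSum f) m).aestronglyMeasurable C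
        (ae_of_all _ fun ω => hC _ (length_word ω m))
    exact (h1.const_mul s).add ((hp.memLp_excess m).const_mul u)
  have hclt := tendsto_integral_exp_word (p := p) (Y := Y) (K := K) (c₀ := |s| * (2 * b * K))
    (Q := s ^ 2 * v - 2 * s * u * M + u ^ 2 * σsq) hY2 ?_ ?_ ?_
  · have hEY : ∀ n ≥ K, ∫ ω', Y (word ω' n) ∂seqLaw p = s * (n * M + c) := fun n hn => by
      simp only [hY]
      rw [integral_add ((integrable_factorSum n).const_mul s)
        (((hp.memLp_excess n).integrable one_le_two).const_mul u), integral_const_mul,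
        integral_const_mul, hp.integral_excess, mul_zero, add_zero, hc n hn]
    have hsq : Tendsto (fun n : ℕ => √(n : ℝ)) atTop atTop :=
      Real.tendsto_sqrt_atTop.comp tendsto_natCast_atTop_atTop
    -- The mean of `Y` over a word of length `n` is `s * (n * M + c)`; the bounded difference to the
    -- centring in the statement yields a phase which tends to `1`.
    have hph : Tendsto (fun n : ℕ => Complex.exp (((s * c + u) / √n : ℝ) * Complex.I)) atTop
        (𝓝 1) := by
      have h1 : Tendsto (fun n : ℕ => (s * c + u) / √(n : ℝ)) atTop (𝓝 0) :=
        tendsto_const_nhds.div_atTop hsq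
      have : Continuous fun x : ℝ => Complex.exp ((x : ℝ) * Complex.I) := by fun_prop
      simpa [Function.comp_def] using (this.tendsto 0).comp h1
    have h2 := hclt.mul hph
    rw [mul_one] at h2
    refine h2.congr' ?_
    filter_upwards [eventually_ge_atTop K] with n hn
    rw [hEY n hn, ← integral_mul_const]
    refine integral_congr_ae (ae_of_all _ fun ω => ?_)
    simp only [hY]
    rw [← Complex.exp_add]
    congr 1
    push_cast
    ring
  · intro l l'
    have h1 : Y (l ++ l') - Y l - Y l' =
        s * (factorSum f (l ++ l') - factorSum f l - factorSum f l') := by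
      simp only [hY, excess_append]
      push_cast; ring
    rw [h1, abs_mul]
    refine mul_le_mul_of_nonneg_left ((abs_factorSum_append_sub_le hf hb l l').trans ?_)
      (abs_nonneg s)
    gcongr
    exact min_le_right _ _
  · intro l₁ l₂ l₃ l₄ h2 h3
    have h1 := factorSum_append_append hf l₁ l₂ l₃ l₄ h2 h3
    simp only [hY, excess_append]
    push_cast
    linear_combination s * h1
  · refine tendsto_affine_div (N := 2 * K) (c := s ^ 2 * c' - 2 * s * u * c) fun m hm => ?_
    simp only [hY]
    rw [hp.integral_linear_sub_sq, hc' m hm, hc m (by omega)]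
    ring

end bounded

/-! ### A Gaussian bound for the characteristic function of a sum of local terms -/

section
variable {p : PMF ℕ}

/-- Functions of distinct letters are independent. -/
theorem integral_prod_comp {R : ℕ} {j : Fin R → ℕ} (hj : Function.Injective j)
    (g : Fin R → ℕ → ℂ) :
    ∫ ω, ∏ r, g r (ω (j r)) ∂seqLaw p = ∏ r, ∫ k, g r k ∂p.toMeasure := by
  have h1 : (seqLaw p).map (fun ω r => ω (j r)) = Measure.pi fun _ : Fin R => p.toMeasure := by
    rw [seqLaw, Measure.map_infinitePi_infinitePi_of_inj hj, Measure.infinitePi_eq_pi]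
  rw [← integral_fintype_prod_eq_prod, ← h1, integral_map
    (measurable_pi_lambda _ fun r => measurable_pi_apply (j r)).aemeasurable]
  exact StronglyMeasurable.aestronglyMeasurable (by
    refine Measurable.stronglyMeasurable ?_
    exact Finset.measurable_prod _ fun r _ =>
      (measurable_of_countable (g r)).comp (measurable_pi_apply r))

theorem sum_range_mul_add {M : Type*} [AddCommMonoid M] (z : ℕ → M) (R K t : ℕ) :
    ∑ i ∈ Finset.range (R * K + t), z i =
      (∑ r : Fin R, ∑ a ∈ Finset.range K, z (r * K + a)) +
        ∑ i ∈ Finset.range t, z (R * K + i) := by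
  rw [Finset.sum_range_add, Fin.sum_univ_eq_sum_range fun r => ∑ a ∈ Finset.range K, z (r * K + a)]
  congr 1
  induction R with
  | zero => simp
  | succ R ih => rw [Nat.succ_mul, Finset.sum_range_add, ih, Finset.sum_range_succ]

/-- The last coordinates of the blocks of length `K` are integrated out, all others being frozen:
each window of length `K` contains at most one of them, so that the integrand factorizes. -/
theorem IsCritical.exists_norm_integral_exp_window_le {σsq : ℝ} (hp : IsCritical p σsq) :
    ∃ c > 0, ∀ (K : ℕ) (B : ℝ) (x : ℕ → (ℕ → ℕ) → ℝ), 0 < K → (∀ i, Measurable (x i)) →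
      (∀ i ω, |x i ω| ≤ B) →
      (∀ i ω ω', (∀ a < K, ω (i + a) = ω' (i + a)) → x i ω = x i ω') →
      ∀ (n : ℕ) (θ : ℝ), |θ| ≤ Real.pi / span p →
        ‖∫ ω, Complex.exp ((∑ i ∈ Finset.range n, (x i ω + θ * ω i) : ℝ) * Complex.I) ∂seqLaw p‖ ≤
          Real.exp ((n / K : ℕ) * ((K * (2 * B)) ^ 2 - c * θ ^ 2)) := by
  obtain ⟨c, hc, hstep⟩ := hp.exists_norm_integral_exp_le
  refine ⟨c, hc, fun K B x hK hx hB hloc n θ hθ => ?_⟩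
  set R := n / K with hR
  obtain ⟨t, ht, hn⟩ : ∃ t < K, n = R * K + t :=
    ⟨n % K, Nat.mod_lt _ hK, by rw [hR, mul_comm, Nat.div_add_mod]⟩
  set j : Fin R → ℕ := fun r => r * K + (K - 1) with hj
  have hjinj : Function.Injective j := by
    intro r r' h
    have h' : (r : ℕ) * K = r' * K := by simp only [hj] at h; omega
    exact Fin.ext (Nat.eq_of_mul_eq_mul_right hK h')
  set z : ℕ → (ℕ → ℕ) → ℝ := fun i ω => x i ω + θ * ω i with hz
  have hzm : ∀ i, Measurable (z i) := fun i =>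
    (hx i).add (((measurable_of_countable fun k : ℕ => (k : ℝ)).comp (measurable_eval i)).const_mul θ)
  have hint : Integrable (fun ω => Complex.exp ((∑ i ∈ Finset.range n, z i ω : ℝ) * Complex.I))
      (seqLaw p) := by
    refine Integrable.of_bound (C := 1) ?_ (ae_of_all _ fun ω => by
      rw [Complex.norm_exp_ofReal_mul_I])
    have h1 : Continuous fun x : ℝ => Complex.exp (x * Complex.I) := by fun_prop
    exact (h1.measurable.comp (Finset.measurable_sum _ fun i _ => hzm i)).aestronglyMeasurable
  rw [integral_mix hint (Set.range j)ᶜ]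
  refine (norm_integral_le_of_norm_le_const (C := Real.exp (R * ((K * (2 * B)) ^ 2 - c * θ ^ 2)))
    (ae_of_all _ fun η => ?_)).trans (by simp)
  -- A window starting in the block `r` ends before the last letter of the block `r + 1`, so it
  -- contains the last letter of no block other than `r`.
  have hblock : ∀ (r r' : Fin R) (a : ℕ), a < 2 * K - 1 → (r : ℕ) * K + a = j r' → r = r' := by
    intro r r' a ha h
    simp only [hj] at h
    refine Fin.ext (le_antisymm ?_ ?_)
    · by_contra hlt
      have := Nat.mul_le_mul_right K (Nat.succ_le_of_lt (not_le.1 hlt))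
      rw [Nat.succ_mul] at this
      omega
    · by_contra hlt
      have := Nat.mul_le_mul_right K (Nat.succ_le_of_lt (not_le.1 hlt))
      rw [Nat.succ_mul] at this
      omega
  set u : Fin R → ℕ → ℕ → ℕ := fun r k => Function.update η (j r) k with hu
  have hmix : ∀ (ω : ℕ → ℕ) (r : Fin R) (a : ℕ), a < 2 * K - 1 →
      mix (Set.range j)ᶜ η ω (r * K + a) = u r (ω (j r)) (r * K + a) := by
    intro ω r a ha
    by_cases h : (r : ℕ) * K + a ∈ Set.range j
    · obtain ⟨r', hr'⟩ := h
      have := hblock r r' a ha hr'.symm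
      subst this
      simp [mix, hu, ← hr']
    · have h' : (r : ℕ) * K + a ≠ j r := fun h'' => h ⟨r, h''.symm⟩
      simp [mix, hu, h, Function.update_of_ne h']
  have hzmix : ∀ (ω : ℕ → ℕ) (r : Fin R) (a : ℕ), a < K →
      z (r * K + a) (mix (Set.range j)ᶜ η ω) = z (r * K + a) (u r (ω (j r))) := by
    intro ω r a ha
    simp only [hz]
    rw [hmix ω r a (by omega), hloc _ _ (u r (ω (j r))) fun a' ha' => by
      rw [add_assoc]; exact hmix ω r (a + a') (by omega)]
  -- The windows in the incomplete last block see frozen letters only.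
  have hzlast : ∀ (ω : ℕ → ℕ) (i : ℕ), z (R * K + i) (mix (Set.range j)ᶜ η ω) =
      z (R * K + i) η := by
    intro ω i
    have h1 : ∀ i, mix (Set.range j)ᶜ η ω (R * K + i) = η (R * K + i) := by
      intro i
      have : R * K + i ∉ Set.range j := by
        rintro ⟨r, hr⟩
        have := Nat.mul_le_mul_right K (Nat.succ_le_of_lt r.2)
        rw [Nat.succ_mul] at this
        simp only [hj] at hr
        omega
      simp [mix, this]
    simp only [hz]
    rw [h1, hloc _ _ η fun a _ => by rw [add_assoc]; exact h1 _]
  set Z : Fin R → ℕ → ℝ := fun r k => ∑ a ∈ Finset.range K, z (r * K + a) (u r k) with hZ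
  have hfac : ∀ ω : ℕ → ℕ, Complex.exp ((∑ i ∈ Finset.range n,
      z i (mix (Set.range j)ᶜ η ω) : ℝ) * Complex.I) =
      (∏ r, Complex.exp ((Z r (ω (j r)) : ℝ) * Complex.I)) *
        Complex.exp ((∑ i ∈ Finset.range t, z (R * K + i) η : ℝ) * Complex.I) := by
    intro ω
    rw [hn, sum_range_mul_add, ← Complex.exp_sum, ← Complex.exp_add, ← Finset.sum_mul, ← add_mul,
      ← Complex.ofReal_sum, ← Complex.ofReal_add]
    congr 4
    · refine Finset.sum_congr rfl fun r _ => Finset.sum_congr rfl fun a ha => ?_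
      exact hzmix ω r a (Finset.mem_range.1 ha)
    · exact Finset.sum_congr rfl fun i _ => hzlast ω i
  simp only [hfac]
  rw [integral_mul_const, norm_mul, Complex.norm_exp_ofReal_mul_I, mul_one,
    integral_prod_comp hjinj fun r k => Complex.exp ((Z r k : ℝ) * Complex.I), norm_prod,
    Real.exp_nat_mul]
  refine (Finset.prod_le_prod (g := fun _ => Real.exp ((K * (2 * B)) ^ 2 - c * θ ^ 2))
    (fun _ _ => norm_nonneg _) fun r _ => ?_).trans (by simp)
  -- The exponent of the block `r` is `θ k` plus a function of the resampled letter `k` which varies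
  -- by at most `2 * B * K`.
  set y : ℕ → ℝ := fun k => ∑ a ∈ Finset.range K, (x (r * K + a) (u r k) +
    θ * if a = K - 1 then 0 else (η (r * K + a) : ℝ)) with hy
  have hZy : ∀ k, Z r k = y k + θ * k := by
    intro k
    have h1 : ∀ a ∈ Finset.range K, z (r * K + a) (u r k) = (x (r * K + a) (u r k) +
        θ * if a = K - 1 then 0 else (η (r * K + a) : ℝ)) +
        (if a = K - 1 then θ * (k : ℝ) else 0) := by
      intro a ha
      simp only [hz, hu]
      by_cases h : a = K - 1
      · subst h
        simp [hj]
      · have h' : (r : ℕ) * K + a ≠ j r := by simp only [hj]; omega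
        simp [h, Function.update_of_ne h']
    rw [hZ, hy]
    simp only
    rw [Finset.sum_congr rfl h1, Finset.sum_add_distrib, Finset.sum_ite_eq',
      if_pos (Finset.mem_range.2 (by omega))]
  simp only [hZy]
  refine hstep y _ θ hθ fun k => ?_
  simp only [hy]
  rw [← Finset.sum_sub_distrib]
  refine (Finset.abs_sum_le_sum_abs _ _).trans
    ((Finset.sum_le_card_nsmul _ _ (2 * B) fun a _ => ?_).trans (by simp))
  rw [add_sub_add_right_eq_sub, two_mul]
  exact (abs_sub _ _).trans (add_le_add (hB _ _) (hB _ _))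

theorem headToll_take {f : PlaneTree → ℝ} {K : ℕ} (hf : ∀ T, K < T.size → f T = 0) (l : List ℕ) :
    headToll f (l.take K) = headToll f l := by
  rcases le_or_gt K l.length with h | h
  · exact headToll_eq_of_prefix hf (List.take_prefix _ _) (by simp [h])
  · rw [List.take_of_length_le h.le]

theorem headToll_drop_word_congr {f : PlaneTree → ℝ} {K : ℕ} (hf : ∀ T, K < T.size → f T = 0)
    {n i : ℕ} {ω ω' : ℕ → ℕ} (h : ∀ a < K, ω (i + a) = ω' (i + a)) :
    headToll f ((word ω n).drop i) = headToll f ((word ω' n).drop i) := by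
  rw [← headToll_take hf, ← headToll_take hf ((word ω' n).drop i)]
  congr 1
  refine List.ext_getElem (by simp) fun a h1 h2 => ?_
  simp only [List.length_take, List.length_drop, length_word] at h1
  simp only [List.getElem_take, List.getElem_drop, word, List.getElem_ofFn]
  exact h a (by omega)

/-- A Gaussian bound, on the central limit scale, for the joint characteristic function of a factor
sum and the endpoint of the walk. -/
theorem IsCritical.exists_norm_integral_exp_factorSum_le {σsq : ℝ} (hp : IsCritical p σsq)
    {f : PlaneTree → ℝ} {K : ℕ} {b : ℝ} (hf : ∀ T, K < T.size → f T = 0) (hb : ∀ T, |f T| ≤ b)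
    (s : ℝ) : ∃ A c : ℝ, 0 < c ∧ ∀ n : ℕ, 0 < n → ∀ θ : ℝ, |θ| ≤ Real.pi / span p →
      ‖∫ ω, Complex.exp ((s / √n * factorSum f (word ω n) +
        θ * ((excess (word ω n) : ℤ) : ℝ) : ℝ) * Complex.I) ∂seqLaw p‖ ≤
          A * Real.exp (-c * (n * θ ^ 2)) := by
  obtain ⟨c, hc, h⟩ := hp.exists_norm_integral_exp_window_le
  -- Windows of length `K + 1` are used to have a positive length.
  have hf' : ∀ T, K + 1 < T.size → f T = 0 := fun T hT => hf T (by omega)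
  have hk : (0 : ℝ) < K + 1 := by positivity
  refine ⟨Real.exp (4 * (K + 1) * (s ^ 2 * b ^ 2) + c * Real.pi ^ 2), c / (K + 1), by positivity,
    fun n hn θ hθ => ?_⟩
  have hn' : (0 : ℝ) < n := by exact_mod_cast hn
  have h1 : ∀ ω : ℕ → ℕ, Complex.exp ((s / √n * factorSum f (word ω n) +
        θ * ((excess (word ω n) : ℤ) : ℝ) : ℝ) * Complex.I) =
      Complex.exp ((∑ i ∈ Finset.range n, (s / √n * headToll f ((word ω n).drop i) + θ * ω i) : ℝ)
        * Complex.I) * Complex.exp ((-(θ * n) : ℝ) * Complex.I) := by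
    intro ω
    rw [← Complex.exp_add, ← add_mul, ← Complex.ofReal_add]
    congr 3
    rw [factorSum_eq_sum, length_word, Finset.sum_add_distrib, ← Finset.mul_sum, ← Finset.mul_sum,
      excess_word_eq]
    push_cast
    rw [Finset.sum_sub_distrib]
    simp
    ring
  simp only [h1]
  rw [integral_mul_const, norm_mul, Complex.norm_exp_ofReal_mul_I, mul_one]
  refine (h (K + 1) (|s / √n| * b) (fun i ω => s / √n * headToll f ((word ω n).drop i))
    (by omega) (fun i => (measurable_word (fun l => headToll f (l.drop i)) n).const_mul _)
    (fun i ω => ?_) (fun i ω ω' hω => by rw [headToll_drop_word_congr hf' hω]) n θ hθ).trans ?_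
  · rw [abs_mul]
    exact mul_le_mul_of_nonneg_left (abs_headToll_le_of_bound hb _) (abs_nonneg _)
  rw [← Real.exp_add]
  refine Real.exp_le_exp.2 ?_
  have h2 : (|s / √n| * b) ^ 2 = s ^ 2 * b ^ 2 / n := by
    rw [mul_pow, sq_abs, div_pow, Real.sq_sqrt hn'.le]; ring
  have h3 : ((n / (K + 1) : ℕ) : ℝ) ≤ n / (K + 1) := by exact_mod_cast Nat.cast_div_le
  have h4 : (n : ℝ) / (K + 1) - 1 ≤ ((n / (K + 1) : ℕ) : ℝ) := by
    have h5 := Nat.lt_div_mul_add (a := n) (b := K + 1) (by omega)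
    have h6 : (n : ℝ) < ((n / (K + 1) : ℕ) : ℝ) * (K + 1) + (K + 1) := by exact_mod_cast h5
    rw [sub_le_iff_le_add, div_le_iff₀ hk]
    linarith
  have h7 : θ ^ 2 ≤ Real.pi ^ 2 := by
    rw [← sq_abs]
    refine pow_le_pow_left₀ (abs_nonneg _) (hθ.trans (div_le_self Real.pi_pos.le ?_)) 2
    exact_mod_cast hp.span_pos
  generalize hR : ((n / (K + 1) : ℕ) : ℝ) = R at h3 h4 ⊢
  -- The perturbation is of order `n ^ (-1/2)` per letter, so its square summed over the blocks is
  -- bounded.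
  have h8 : R * (((K + 1 : ℕ) : ℝ) * (2 * (|s / √n| * b))) ^ 2 ≤
      4 * (K + 1) * (s ^ 2 * b ^ 2) := by
    rw [show (((K + 1 : ℕ) : ℝ) * (2 * (|s / √n| * b))) ^ 2 =
      4 * (K + 1) ^ 2 * (|s / √n| * b) ^ 2 by push_cast; ring, h2]
    calc R * (4 * ((K : ℝ) + 1) ^ 2 * (s ^ 2 * b ^ 2 / n)) ≤
        n / (K + 1) * (4 * ((K : ℝ) + 1) ^ 2 * (s ^ 2 * b ^ 2 / n)) := by gcongr
      _ = _ := by field_simp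
  have h9 : ((n : ℝ) / (K + 1) - 1) * (c * θ ^ 2) ≤ R * (c * θ ^ 2) := by gcongr
  have h10 : c * θ ^ 2 ≤ c * Real.pi ^ 2 := by gcongr
  have h11 : -(c / (K + 1)) * (n * θ ^ 2) = -((n : ℝ) / (K + 1) * (c * θ ^ 2)) := by ring
  rw [h11, mul_sub]
  linarith

end

/-! ### The central limit theorem for tolls carried by trees of bounded size -/

theorem integral_gwCond_eq_sum {E : Type*} [NormedAddCommGroup E] [NormedSpace ℝ E]
    [CompleteSpace E] (p : PMF ℕ) (g : PlaneTree → E) (n : ℕ) :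
    ∫ T, g T ∂gwCond p n = (sizeProb p n)⁻¹ • ∑ T ∈ trees n, wordProb p (code T) • g T := by
  have h1 : ∫ T in {T | T.size = n}, g T ∂gw p = ∑ T ∈ trees n, wordProb p (code T) • g T := by
    rw [setOf_size_eq, setIntegral_finset _ IntegrableOn.finset]
    simp only [gw_real_singleton]
  rw [gwCond, ProbabilityTheory.cond, integral_smul_measure, h1, ← gw_real_size, measureReal_def,
    ENNReal.toReal_inv]

/-- Completing the square: integrating out the variable dual to the endpoint removes from the
variance the part explained by the endpoint. -/
theorem integral_exp_quadratic {σsq : ℝ} (hσ : 0 < σsq) (s v M : ℝ) :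
    ∫ u : ℝ, Complex.exp (-((s ^ 2 * v - 2 * s * u * M + u ^ 2 * σsq) / 2) : ℝ) =
      Complex.exp (-(s ^ 2 * (v - M ^ 2 / σsq) / 2) : ℝ) * ((√(2 * Real.pi / σsq) : ℝ) : ℂ) := by
  simp only [← Complex.ofReal_exp]
  rw [integral_complex_ofReal, ← Complex.ofReal_mul]
  congr 1
  have h1 : ∀ u : ℝ, Real.exp (-((s ^ 2 * v - 2 * s * u * M + u ^ 2 * σsq) / 2)) =
      Real.exp (-(s ^ 2 * (v - M ^ 2 / σsq) / 2)) *
        (fun u => Real.exp (-(σsq / 2) * u ^ 2)) (u - s * M / σsq) := by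
    intro u
    simp only
    rw [← Real.exp_add]
    congr 1
    field_simp
    ring
  simp only [h1]
  rw [integral_const_mul, integral_sub_right_eq_self (fun u => Real.exp (-(σsq / 2) * u ^ 2)),
    integral_gaussian]
  congr 2
  field_simp

section
variable {p : PMF ℕ} {f : PlaneTree → ℝ} {K : ℕ} {b : ℝ}

/-- Rotating the word of a tree changes its factor sum only near the two cutting points. -/
theorem abs_factorSum_rotate_code_sub_le (hf : ∀ T, K < T.size → f T = 0) (hb : ∀ T, |f T| ≤ b)
    (T : PlaneTree) {j : ℕ} (hj : j ≤ T.size) :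
    |factorSum f ((code T).rotate j) - additive f T| ≤ 4 * b * K := by
  have hb0 : 0 ≤ b := (abs_nonneg _).trans (hb (node []))
  have hK : ∀ l l' : List ℕ, |factorSum f (l ++ l') - factorSum f l - factorSum f l'| ≤
      2 * b * K := fun l l' => (abs_factorSum_append_sub_le hf hb l l').trans
    (mul_le_mul_of_nonneg_left (by exact_mod_cast min_le_right _ _) (by positivity))
  have h1 := hK ((code T).drop j) ((code T).take j)
  have h2 := hK ((code T).take j) ((code T).drop j)
  rw [List.take_append_drop, factorSum_code] at h2
  rw [List.rotate_eq_drop_append_take (by rwa [length_code])]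
  rw [abs_le] at h1 h2 ⊢
  constructor <;> linarith [h1.1, h1.2, h2.1, h2.2]

/-- The cycle lemma turns a factor sum of a bridge into the additive functional of the conditioned
tree, up to the influence of the cutting point. -/
theorem norm_integral_ite_excess_sub_le (hf : ∀ T, K < T.size → f T = 0) (hb : ∀ T, |f T| ≤ b)
    (t M : ℝ) {n : ℕ} (hn : 0 < sizeProb p n) :
    ‖(∫ ω, (if excess (word ω n) = -1 then
        Complex.exp ((t * (factorSum f (word ω n) - n * M) : ℝ) * Complex.I) else 0) ∂seqLaw p) -
      ((n * sizeProb p n : ℝ) : ℂ) *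
        ∫ T, Complex.exp ((t * (additive f T - n * M) : ℝ) * Complex.I) ∂gwCond p n‖ ≤
      |t| * (4 * b * K) * (n * sizeProb p n) := by
  have h2 : ((n * sizeProb p n : ℝ) : ℂ) *
        ∫ T, Complex.exp ((t * (additive f T - n * M) : ℝ) * Complex.I) ∂gwCond p n =
      ∑ T ∈ trees n, wordProb p (code T) • ∑ j ∈ Finset.range n,
        Complex.exp ((t * (additive f T - n * M) : ℝ) * Complex.I) := by
    rw [integral_gwCond_eq_sum, ← Complex.real_smul, smul_smul, mul_assoc,
      mul_inv_cancel₀ hn.ne', mul_one, Finset.smul_sum]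
    refine Finset.sum_congr rfl fun T _ => ?_
    rw [Finset.sum_const, Finset.card_range, smul_comm, Nat.cast_smul_eq_nsmul]
  rw [integral_ite_excess fun l => Complex.exp ((t * (factorSum f l - n * M) : ℝ) * Complex.I), h2,
    ← Finset.sum_sub_distrib, sizeProb_eq_sum, Finset.mul_sum, Finset.mul_sum]
  refine norm_sum_le_of_le _ fun T hT => ?_
  rw [← smul_sub, norm_smul, Real.norm_of_nonneg (wordProb_nonneg _ _), ← Finset.sum_sub_distrib,
    ← mul_assoc, mul_comm]
  refine mul_le_mul_of_nonneg_right ?_ (wordProb_nonneg _ _)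
  refine (norm_sum_le_of_le _ (n := fun _ => |t| * (4 * b * K)) fun j hj => ?_).trans
    (by simp [mul_comm])
  refine (norm_exp_sub_exp_le _ _).trans ?_
  rw [← mul_sub, abs_mul, sub_sub_sub_cancel_right]
  refine mul_le_mul_of_nonneg_left (abs_factorSum_rotate_code_sub_le hf hb T ?_) (abs_nonneg t)
  rw [mem_trees.1 hT]
  exact (Finset.mem_range.1 hj).le

/-- The central limit theorem for a bounded toll carried by trees of bounded size. -/
theorem IsCritical.tendsto_integral_exp_additive {σsq : ℝ} (hp : IsCritical p σsq)
    (hf : ∀ T, K < T.size → f T = 0) (hb : ∀ T, |f T| ≤ b) {M v : ℝ}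
    (hM : M = ∑ k ∈ Finset.range (K + 1), levelSum p f k)
    (hv : v = ∑ k ∈ Finset.range (K + 1), levelSum p (fun T => f T * (2 * (additive f T -
        k * M) - f T)) k + M ^ 2) (s : ℝ) :
    Tendsto (fun n : AdmissibleSize p => ∫ T, Complex.exp ((s / √(n : ℝ) *
      (additive f T - (n : ℝ) * M) : ℝ) * Complex.I) ∂gwCond p n) atTop
      (𝓝 (Complex.exp (-(s ^ 2 * (v - M ^ 2 / σsq) / 2) : ℝ))) := by
  have hd : (0 : ℝ) < span p := by exact_mod_cast hp.span_pos
  have hpi := Real.pi_pos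
  set a := Real.pi / span p with ha
  have ha0 : 0 < a := by positivity
  set Ψ : ℕ → ℝ → ℂ := fun n θ => ∫ ω, Complex.exp ((s / √n * (factorSum f (word ω n) - n * M) +
      θ * (((excess (word ω n) : ℤ) : ℝ) + 1) : ℝ) * Complex.I) ∂seqLaw p with hΨ
  have hmeas : ∀ (n : ℕ) (θ : ℝ), AEStronglyMeasurable (fun ω => Complex.exp ((s / √n *
      (factorSum f (word ω n) - n * M) + θ * (((excess (word ω n) : ℤ) : ℝ) + 1) : ℝ) *
        Complex.I)) (seqLaw p) := fun n θ =>
    (stronglyMeasurable_word (fun l => Complex.exp ((s / √n * (factorSum f l - n * M) +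
      θ * (((excess l : ℤ) : ℝ) + 1) : ℝ) * Complex.I)) n).aestronglyMeasurable
  have hcont : ∀ n, Continuous (Ψ n) := fun n => by
    refine continuous_of_dominated (bound := fun _ => 1) (hmeas n)
      (fun θ => ae_of_all _ fun ω => by rw [Complex.norm_exp_ofReal_mul_I])
      (integrable_const _) (ae_of_all _ fun ω => by fun_prop)
  obtain ⟨A, c, hc, hgauss⟩ := hp.exists_norm_integral_exp_factorSum_le hf hb s
  -- The numerator: Fourier inversion for the characteristic function on the event that the walk is
  -- at `-1`, rescaled.
  have hnum : Tendsto (fun n : ℕ => ((√n : ℝ) : ℂ) * ∫ θ in -a..a, Ψ n θ) atTop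
      (𝓝 (Complex.exp (-(s ^ 2 * (v - M ^ 2 / σsq) / 2) : ℝ) *
        ((√(2 * Real.pi / σsq) : ℝ) : ℂ))) := by
    rw [← integral_exp_quadratic hp.pos]
    refine tendsto_sqrt_mul_intervalIntegral ha0 hcont
      ((integrable_exp_neg_mul_sq hc).const_mul A) (fun n hn u hu => ?_) fun u =>
      hp.tendsto_integral_exp_linear hf hb hM hv s u
    have hn' : (0 : ℝ) < n := by exact_mod_cast hn
    have h1 : Ψ n (u / √n) = (∫ ω, Complex.exp ((s / √n * factorSum f (word ω n) +
        u / √n * ((excess (word ω n) : ℤ) : ℝ) : ℝ) * Complex.I) ∂seqLaw p) *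
          Complex.exp ((u / √n - s / √n * (n * M) : ℝ) * Complex.I) := by
      rw [← integral_mul_const]
      refine integral_congr_ae (ae_of_all _ fun ω => ?_)
      simp only
      rw [← Complex.exp_add, ← add_mul, ← Complex.ofReal_add]
      congr 3
      ring
    rw [h1, norm_mul, Complex.norm_exp_ofReal_mul_I, mul_one]
    refine (hgauss n hn _ hu).trans_eq ?_
    rw [div_pow, Real.sq_sqrt hn'.le]
    congr 3
    field_simp
  -- The denominator: the probability of this event.
  have hden := hp.tendsto_sqrt_mul_fourier
  have hlim0 : ((√(2 * Real.pi / σsq) : ℝ) : ℂ) ≠ 0 := by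
    have := hp.pos
    exact_mod_cast (Real.sqrt_pos.2 (by positivity)).ne'
  have hquot := hnum.div hden hlim0
  rw [mul_div_cancel_right₀ _ hlim0] at hquot
  have hcoe := hp.tendsto_coe_admissibleSize
  have hsq : Tendsto (fun n : ℕ => |s| / √(n : ℝ) * (4 * b * K)) atTop (𝓝 0) := by
    have h1 : Tendsto (fun n : ℕ => |s| / √(n : ℝ)) atTop (𝓝 0) :=
      tendsto_const_nhds.div_atTop (Real.tendsto_sqrt_atTop.comp tendsto_natCast_atTop_atTop)
    simpa using h1.mul_const (4 * b * K)
  -- The quotient differs from the characteristic function for the conditioned tree by the effect of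
  -- the cutting point, which is `O(1 / √n)`.
  have hdiff := squeeze_zero_norm (a := fun n : AdmissibleSize p => |s| / √(n : ℝ) * (4 * b * K))
    (f := fun n : AdmissibleSize p => (((√(n : ℕ) : ℝ) : ℂ) * ∫ θ in -a..a, Ψ n θ) /
      (((√(n : ℕ) : ℝ) : ℂ) * ∫ θ in -a..a, stepChar p θ ^ (n : ℕ) * Complex.exp ((θ : ℝ) *
        Complex.I)) - ∫ T, Complex.exp ((s / √(n : ℝ) *
      (additive f T - (n : ℝ) * M) : ℝ) * Complex.I) ∂gwCond p n) ?_ (hsq.comp hcoe)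
  · have := (hquot.comp hcoe).sub hdiff
    rw [sub_zero] at this
    exact this.congr fun n => sub_sub_cancel _ _
  rintro ⟨n, hn⟩
  have hn1 : 0 < sizeProb p n := admissible_iff.1 hn
  have hn0 : n ≠ 0 := by
    rintro rfl
    exact hn1.ne' levelSum_zero_right
  have hn' : (0 : ℝ) < n := by exact_mod_cast Nat.pos_of_ne_zero hn0
  have hnp : 0 < n * sizeProb p n := by positivity
  have hdvd : (span p : ℤ) ∣ n + (-1) := dvd_of_sizeProb_ne_zero hn1.ne'
  have h1 := norm_integral_ite_excess_sub_le hf hb (s / √n) M hn1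
  have h2 := integral_ite_excess_eq_fourier hp.span_pos hdvd
    (stronglyMeasurable_word (fun l => Complex.exp ((s / √n * (factorSum f l - n * M) : ℝ) *
      Complex.I)) n) (fun ω => by rw [Complex.norm_exp_ofReal_mul_I])
  have h3 := walkProb_eq_fourier hp.span_pos hdvd
  rw [← mul_sizeProb] at h3
  have h4 : ∀ θ : ℝ, ∫ ω, Complex.exp ((s / √n * (factorSum f (word ω n) - n * M) : ℝ) *
      Complex.I) * Complex.exp ((θ * (excess (word ω n) - (-1 : ℤ)) : ℝ) * Complex.I) ∂seqLaw p =
      Ψ n θ := by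
    intro θ
    refine integral_congr_ae (ae_of_all _ fun ω => ?_)
    simp only
    rw [← Complex.exp_add, ← add_mul, ← Complex.ofReal_add]
    congr 3
    push_cast
    ring
  simp only [h4] at h2
  have h5 : ∀ θ : ℝ, (-(θ * ((-1 : ℤ) : ℝ)) : ℝ) = θ := fun θ => by push_cast; ring
  simp only [h5] at h3
  rw [h2] at h1
  have hs0 : ((√(n : ℝ) : ℝ) : ℂ) ≠ 0 := by exact_mod_cast (Real.sqrt_pos.2 hn').ne'
  simp only
  rw [mul_div_mul_left _ _ hs0]
  have hd0 : ((span p / (2 * Real.pi) : ℝ) : ℂ) ≠ 0 := by exact_mod_cast (by positivity)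
  rw [← mul_div_mul_left _ _ hd0, ← h3]
  have hc0 : ((n * sizeProb p n : ℝ) : ℂ) ≠ 0 := by exact_mod_cast hnp.ne'
  rw [div_sub' hc0, norm_div, Complex.norm_real, Real.norm_of_nonneg hnp.le, div_le_iff₀ hnp]
  refine h1.trans_eq ?_
  rw [abs_div, abs_of_nonneg (Real.sqrt_nonneg _)]

end

/-! ### Fourth moments and convergence of the variance for tolls carried by bounded sizes -/

section
variable {p : PMF ℕ}

theorem abs_blockSum_le {Z : (ℕ → ℕ) → ℝ} {D : ℝ} (hD : ∀ ω, |Z ω| ≤ D) (L q : ℕ) (ω : ℕ → ℕ) :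
    |blockSum Z L q ω| ≤ q * D := by
  induction q generalizing ω with
  | zero => simp [blockSum]
  | succ q ih =>
    rw [blockSum]
    refine (abs_add_le _ _).trans ((add_le_add (hD ω) (ih _)).trans_eq ?_)
    push_cast; ring

/-- The fourth moment of a sum of independent centred bounded variables, by induction on the number
of terms. -/
theorem integral_blockSum_pow_four_le {Z : (ℕ → ℕ) → ℝ} {L : ℕ} {D : ℝ}
    (hZ : AEStronglyMeasurable Z (seqLaw p)) (hD : ∀ ω, |Z ω| ≤ D)
    (h0 : ∫ ω, Z ω ∂seqLaw p = 0) (hloc : ∀ ω ω', Z (splice L ω ω') = Z ω) (q : ℕ) :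
    ∫ ω, blockSum Z L q ω ^ 4 ∂seqLaw p ≤ 3 * D ^ 4 * q ^ 2 := by
  have hD0 : 0 ≤ D := (abs_nonneg _).trans (hD 0)
  have hZ2 : MemLp Z 2 (seqLaw p) := MemLp.of_bound hZ D (ae_of_all _ hD)
  have hZsq : ∫ ω, Z ω ^ 2 ∂seqLaw p ≤ D ^ 2 := by
    refine (integral_mono hZ2.integrable_sq (integrable_const (D ^ 2)) fun ω => ?_).trans_eq
      (by simp)
    exact sq_le_sq' (neg_le_of_abs_le (hD ω)) (le_of_abs_le (hD ω))
  have hB2 : ∀ q, ∫ ω, blockSum Z L q ω ^ 2 ∂seqLaw p ≤ q * D ^ 2 := fun q => by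
    rw [integral_blockSum_sq hZ2 h0 hloc]
    gcongr
  induction q with
  | zero => simp [blockSum]
  | succ q ih =>
    have hBm := (memLp_blockSum hZ2 L q).1
    have hsh := measurePreserving_shift p L
    have hBs : AEStronglyMeasurable (fun ω : ℕ → ℕ => blockSum Z L q fun i => ω (L + i))
        (seqLaw p) := hBm.comp_measurePreserving hsh
    have hi : ∀ (j k : ℕ), Integrable (fun ω : ℕ → ℕ =>
        Z ω ^ j * (fun ω => blockSum Z L q ω ^ k) fun i => ω (L + i)) (seqLaw p) := by
      intro j k
      refine Integrable.of_bound ((hZ.pow j).mul (hBs.pow k)) (D ^ j * (q * D) ^ k)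
        (ae_of_all _ fun ω => ?_)
      rw [norm_mul, norm_pow, norm_pow, Real.norm_eq_abs, Real.norm_eq_abs]
      have h1 := hD ω
      have h2 := abs_blockSum_le hD L q fun i => ω (L + i)
      gcongr
    have hval : ∀ (j k : ℕ), ∫ ω : ℕ → ℕ,
        Z ω ^ j * (fun ω => blockSum Z L q ω ^ k) (fun i => ω (L + i)) ∂seqLaw p =
        (∫ ω, Z ω ^ j ∂seqLaw p) * ∫ ω, blockSum Z L q ω ^ k ∂seqLaw p := fun j k =>
      integral_mul_shift (A := fun ω => Z ω ^ j) (B := fun ω => blockSum Z L q ω ^ k) L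
        (fun ω ω' => by simp only [hloc]) (hi j k)
    have hexp : ∀ ω, blockSum Z L (q + 1) ω ^ 4 =
        ∑ j ∈ Finset.range 5, ((Nat.choose 4 j : ℕ) : ℝ) *
          (Z ω ^ j * (fun ω => blockSum Z L q ω ^ (4 - j)) fun i => ω (L + i)) := by
      intro ω
      rw [blockSum, add_pow]
      exact Finset.sum_congr rfl fun j _ => by ring
    simp only [hexp]
    rw [integral_finsetSum _ fun j _ => (hi j _).const_mul _]
    simp only [integral_const_mul, hval]
    have hmean : ∫ ω, blockSum Z L q ω ∂seqLaw p = 0 := by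
      rw [integral_blockSum hZ2, h0, mul_zero]
    have hZ4 : ∫ ω, Z ω ^ 4 ∂seqLaw p ≤ D ^ 4 := by
      refine (integral_mono ?_ (integrable_const (D ^ 4)) fun ω => ?_).trans_eq (by simp)
      · refine Integrable.of_bound (hZ.pow 4) (D ^ 4) (ae_of_all _ fun ω => ?_)
        rw [norm_pow, Real.norm_eq_abs]
        exact pow_le_pow_left₀ (abs_nonneg _) (hD ω) 4
      · simp only
        rw [← (show Even 4 by decide).pow_abs]
        exact pow_le_pow_left₀ (abs_nonneg _) (hD ω) 4
    have h22 : (∫ ω, Z ω ^ 2 ∂seqLaw p) * ∫ ω, blockSum Z L q ω ^ 2 ∂seqLaw p ≤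
        D ^ 2 * (q * D ^ 2) :=
      mul_le_mul hZsq (hB2 q) (integral_nonneg fun _ => sq_nonneg _) (sq_nonneg D)
    -- The terms with an odd power vanish, as one of the factors has mean zero.
    simp only [Finset.sum_range_succ, Finset.sum_range_zero, Nat.sub_self, Nat.sub_zero, pow_zero,
      pow_one, h0, hmean, integral_const, probReal_univ, one_smul, zero_mul, mul_zero, zero_add,
      add_zero, one_mul, mul_one, Nat.reduceSub]
    rw [show Nat.choose 4 0 = 1 by decide, show Nat.choose 4 2 = 6 by decide,
      show Nat.choose 4 4 = 1 by decide]
    push_cast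
    have h5 : 0 ≤ D ^ 4 := by positivity
    calc _ ≤ 1 * (3 * D ^ 4 * q ^ 2) + 6 * (D ^ 2 * (q * D ^ 2)) + 1 * D ^ 4 := by gcongr
      _ ≤ _ := by nlinarith

theorem add_add_pow_four_le (x y z : ℝ) :
    (x + y + z) ^ 4 ≤ 27 * (x ^ 4 + y ^ 4 + z ^ 4) := by
  have h1 := add_add_sq_le x y z
  have h2 := add_add_sq_le (x ^ 2) (y ^ 2) (z ^ 2)
  have h3 : ((x + y + z) ^ 2) ^ 2 ≤ (3 * (x ^ 2 + y ^ 2 + z ^ 2)) ^ 2 :=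
    pow_le_pow_left₀ (sq_nonneg _) h1 2
  calc (x + y + z) ^ 4 = ((x + y + z) ^ 2) ^ 2 := by ring
    _ ≤ 9 * (x ^ 2 + y ^ 2 + z ^ 2) ^ 2 := by rw [mul_pow] at h3; linarith
    _ ≤ 9 * (3 * ((x ^ 2) ^ 2 + (y ^ 2) ^ 2 + (z ^ 2) ^ 2)) := by gcongr
    _ = _ := by ring

/-- The fourth central moment of a sum of two centred bounded variables and a remainder. -/
theorem integral_sub_pow_four_le {Ω : Type*} {mΩ : MeasurableSpace Ω} {P : Measure Ω}
    [IsProbabilityMeasure P] {X U V : Ω → ℝ} {c R B : ℝ} (hX : AEStronglyMeasurable X P)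
    (hU : AEStronglyMeasurable U P) (hV : AEStronglyMeasurable V P)
    (hUb : ∀ ω, |U ω| ≤ B) (hVb : ∀ ω, |V ω| ≤ B) (hU0 : ∫ ω, U ω ∂P = 0) (hV0 : ∫ ω, V ω ∂P = 0)
    (hR : ∀ ω, |X ω - c - U ω - V ω| ≤ R) :
    ∫ ω, (X ω - ∫ ω', X ω' ∂P) ^ 4 ∂P ≤
      27 * ((∫ ω, U ω ^ 4 ∂P) + (∫ ω, V ω ^ 4 ∂P) + (2 * R) ^ 4) := by
  have hbd : ∀ {Y : Ω → ℝ} {C : ℝ}, AEStronglyMeasurable Y P → (∀ ω, |Y ω| ≤ C) → ∀ k : ℕ,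
      Integrable (fun ω => Y ω ^ k) P := fun {Y C} hY hC k =>
    Integrable.of_bound (hY.pow k) (C ^ k) (ae_of_all _ fun ω => by
      rw [norm_pow, Real.norm_eq_abs]; exact pow_le_pow_left₀ (abs_nonneg _) (hC ω) k)
  set W : Ω → ℝ := fun ω => X ω - c - U ω - V ω with hW
  have hWm : AEStronglyMeasurable W P := ((hX.sub aestronglyMeasurable_const).sub hU).sub hV
  have iU : Integrable U P := by simpa using hbd hU hUb 1
  have iV : Integrable V P := by simpa using hbd hV hVb 1
  have iW : Integrable W P := by simpa using hbd hWm hR 1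
  have hXe : ∀ ω, X ω = c + (U ω + (V ω + W ω)) := fun ω => by simp only [hW]; ring
  have iVW : Integrable (fun ω => V ω + W ω) P := iV.add iW
  have iUVW : Integrable (fun ω => U ω + (V ω + W ω)) P := iU.add iVW
  have hmean : ∫ ω, X ω ∂P = c + ∫ ω, W ω ∂P := by
    simp only [hXe]
    rw [integral_add (integrable_const _) iUVW, integral_add iU iVW, integral_add iV iW, hU0, hV0]
    simp
  have hW1 : |∫ ω, W ω ∂P| ≤ R := by
    have := norm_integral_le_of_norm_le_const (μ := P) (f := W) (C := R) (ae_of_all _ hR)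
    simpa using this
  have hpt : ∀ ω, (X ω - ∫ ω', X ω' ∂P) ^ 4 ≤ 27 * (U ω ^ 4 + V ω ^ 4 + (2 * R) ^ 4) := by
    intro ω
    have h1 : X ω - ∫ ω', X ω' ∂P = U ω + V ω + (W ω - ∫ ω', W ω' ∂P) := by
      rw [hmean, hXe]; ring
    rw [h1]
    refine (add_add_pow_four_le _ _ _).trans ?_
    refine mul_le_mul_of_nonneg_left (add_le_add le_rfl ?_) (by norm_num)
    rw [← (show Even 4 by decide).pow_abs]
    refine pow_le_pow_left₀ (abs_nonneg _) ?_ 4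
    rw [two_mul]
    exact (abs_sub _ _).trans (add_le_add (hR ω) hW1)
  have i1 : Integrable (fun ω => U ω ^ 4 + V ω ^ 4) P := (hbd hU hUb 4).add (hbd hV hVb 4)
  have i2 : Integrable (fun ω => U ω ^ 4 + V ω ^ 4 + (2 * R) ^ 4) P :=
    i1.add (integrable_const _)
  refine (integral_mono_of_nonneg (ae_of_all _ fun ω => (show Even 4 by decide).pow_nonneg _)
    (i2.const_mul 27) (ae_of_all _ hpt)).trans_eq ?_
  rw [integral_const_mul, integral_add i1 (integrable_const _),
    integral_add (hbd hU hUb 4) (hbd hV hVb 4)]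
  simp

variable {f : PlaneTree → ℝ} {K : ℕ} {b : ℝ}

theorem abs_factorSum_le_mul (hb : ∀ T, |f T| ≤ b) (l : List ℕ) :
    |factorSum f l| ≤ l.length * b := by
  induction l with
  | nil => simp [factorSum]
  | cons k l ih =>
    rw [factorSum, List.length_cons]
    refine (abs_add_le _ _).trans
      ((add_le_add (abs_headToll_le_of_bound hb (k :: l)) ih).trans_eq ?_)
    push_cast; ring

/-- The fourth central moment of a factor sum grows quadratically: the centred factor sum is a sum
over independent blocks, plus a sum over independent junctions, plus a bounded remainder. -/
theorem exists_integral_factorSum_pow_four_le (hf : ∀ T, K < T.size → f T = 0)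
    (hb : ∀ T, |f T| ≤ b) : ∃ C ≥ 0, ∃ N, ∀ m ≥ N,
      ∫ ω, (factorSum f (word ω m) - ∫ ω', factorSum f (word ω' m) ∂seqLaw p) ^ 4 ∂seqLaw p ≤
        C * m ^ 2 := by
  have hb0 : 0 ≤ b := (abs_nonneg _).trans (hb (node []))
  have hK : ∀ l l' : List ℕ, |factorSum f (l ++ l') - factorSum f l - factorSum f l'| ≤
      2 * b * K := fun l l' => (abs_factorSum_append_sub_le hf hb l l').trans
    (mul_le_mul_of_nonneg_left (by exact_mod_cast min_le_right _ _) (by positivity))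
  -- The block length is positive and leaves the junction windows of length `2 * K` disjoint.
  set L := 2 * K + 1 with hL
  set Y : List ℕ → ℝ := factorSum f with hY
  set δ : (ℕ → ℕ) → ℝ := fun ω =>
    Y (word ω (K + K)) - Y (word ω K) - Y (word (fun i => ω (K + i)) K) with hδ
  have hYm : ∀ m, AEStronglyMeasurable (fun ω => Y (word ω m)) (seqLaw p) := fun m =>
    (stronglyMeasurable_word Y m).aestronglyMeasurable
  have hδm : AEStronglyMeasurable δ (seqLaw p) := ((hYm _).sub (hYm _)).sub
    ((hYm K).comp_measurePreserving (measurePreserving_shift p K))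
  have hδb : ∀ ω, |δ ω| ≤ 2 * b * K := fun ω => by
    simp only [hδ]
    rw [word_add]
    exact hK _ _
  have hYb : ∀ m ω, |Y (word ω m)| ≤ m * b := fun m ω => by
    simpa using abs_factorSum_le_mul hb (word ω m)
  set D := 2 * (L * b) with hD
  have hKL : (K : ℝ) ≤ L := by exact_mod_cast (by omega : K ≤ L)
  have hL1 : (1 : ℝ) ≤ L := by exact_mod_cast (by omega : 1 ≤ L)
  have hcenter : ∀ {Z : (ℕ → ℕ) → ℝ} {B : ℝ}, AEStronglyMeasurable Z (seqLaw p) →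
      (∀ ω, |Z ω| ≤ B) → (∀ ω, |Z ω - ∫ ω', Z ω' ∂seqLaw p| ≤ 2 * B) ∧
        ∫ ω, (Z ω - ∫ ω', Z ω' ∂seqLaw p) ∂seqLaw p = 0 := by
    intro Z B hZ hB
    have hi : Integrable Z (seqLaw p) := Integrable.of_bound hZ B (ae_of_all _ hB)
    have h1 : |∫ ω', Z ω' ∂seqLaw p| ≤ B := by
      simpa using norm_integral_le_of_norm_le_const (μ := seqLaw p) (f := Z) (C := B)
        (ae_of_all _ hB)
    refine ⟨fun ω => ?_, ?_⟩
    · rw [two_mul]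
      exact (abs_sub _ _).trans (add_le_add (hB ω) h1)
    · rw [integral_sub hi (integrable_const _)]
      simp
  obtain ⟨hZb, hZ0⟩ := hcenter (hYm L) (hYb L)
  obtain ⟨hδb', hδ0⟩ := hcenter hδm hδb
  set e := ∫ ω', Y (word ω' L) ∂seqLaw p with he
  set d := ∫ ω', δ ω' ∂seqLaw p with hd
  set D' := 2 * (2 * b * K) with hD'
  set R := 2 * b * K + L * b with hR
  refine ⟨27 * (3 * D ^ 4 + 3 * D' ^ 4 + (2 * R) ^ 4), by positivity, L, fun m hm => ?_⟩
  obtain ⟨q, r, hr, rfl⟩ : ∃ q r, r < L ∧ m = (q + 1) * L + r := by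
    refine ⟨m / L - 1, m % L, Nat.mod_lt _ (by omega), ?_⟩
    rw [Nat.sub_add_cancel ((Nat.one_le_div_iff (by omega)).2 hm), mul_comm, Nat.div_add_mod]
  have hsh := measurePreserving_shift p (L - K)
  set U : (ℕ → ℕ) → ℝ := blockSum (fun ω => Y (word ω L) - e) L (q + 1) with hU
  set V : (ℕ → ℕ) → ℝ := fun ω => blockSum (fun ω => δ ω - d) L q fun i => ω (L - K + i) with hV
  have hZm : AEStronglyMeasurable (fun ω => Y (word ω L) - e) (seqLaw p) :=
    (hYm L).sub aestronglyMeasurable_const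
  have hδm' : AEStronglyMeasurable (fun ω => δ ω - d) (seqLaw p) :=
    hδm.sub aestronglyMeasurable_const
  have hZ2 : MemLp (fun ω => Y (word ω L) - e) 2 (seqLaw p) :=
    MemLp.of_bound hZm _ (ae_of_all _ hZb)
  have hδ2 : MemLp (fun ω => δ ω - d) 2 (seqLaw p) :=
    MemLp.of_bound hδm' _ (ae_of_all _ hδb')
  have hUm := (memLp_blockSum hZ2 L (q + 1)).1
  have hVm' := (memLp_blockSum hδ2 L q).1
  have hVm : AEStronglyMeasurable V (seqLaw p) := hVm'.comp_measurePreserving hsh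
  have hZloc : ∀ ω ω', (fun ω => Y (word ω L) - e) (splice L ω ω') =
      (fun ω => Y (word ω L) - e) ω := fun ω ω' => by
    simp only
    rw [word_congr (ω' := ω) fun i hi => by simp only [splice]; rw [if_pos hi]]
  have hδloc : ∀ ω ω', (fun ω => δ ω - d) (splice L ω ω') = (fun ω => δ ω - d) ω := by
    intro ω ω'
    simp only [hδ]
    rw [word_congr (ω' := ω) (n := K + K) fun i hi => by
        simp only [splice]; rw [if_pos (by omega)],
      word_congr (ω' := ω) (n := K) fun i hi => by simp only [splice]; rw [if_pos (by omega)],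
      word_congr (ω := fun i => splice L ω ω' (K + i)) (ω' := fun i => ω (K + i)) (n := K)
        fun i hi => by simp only [splice]; rw [if_pos (by omega)]]
  have hV4 : ∫ ω, V ω ^ 4 ∂seqLaw p = ∫ ω, blockSum (fun ω => δ ω - d) L q ω ^ 4 ∂seqLaw p := by
    conv_rhs => rw [← hsh.map_eq]
    rw [integral_map hsh.measurable.aemeasurable (by rw [hsh.map_eq]; exact hVm'.pow 4)]
  have hV0 : ∫ ω, V ω ∂seqLaw p = 0 := by
    rw [hV, integral_blockSum_shift hδ2, integral_blockSum hδ2, hδ0, mul_zero]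
  have hU0 : ∫ ω, U ω ∂seqLaw p = 0 := by
    rw [hU, integral_blockSum hZ2, hZ0, mul_zero]
  have hrem : ∀ ω, |Y (word ω ((q + 1) * L + r)) - ((q + 1 : ℕ) * e + q * d) - U ω - V ω| ≤ R := by
    intro ω
    have h1 := word_mul_eq_blockSum (Y := Y) (factorSum_append_append hf) (by omega : K ≤ L) q ω
    have h2 := hK (word ω ((q + 1) * L)) (word (fun i => ω ((q + 1) * L + i)) r)
    have h3 := hYb r fun i => ω ((q + 1) * L + i)
    rw [← word_add] at h2
    have h4 : (r : ℝ) * b ≤ L * b := by gcongr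
    simp only [hU, hV]
    rw [blockSum_sub_const, blockSum_sub_const]
    rw [show Y (word ω ((q + 1) * L + r)) - ((q + 1 : ℕ) * e + q * d) -
        (blockSum (fun ω => Y (word ω L)) L (q + 1) ω - (q + 1 : ℕ) * e) -
        (blockSum δ L q (fun i => ω (L - K + i)) - q * d) =
        (Y (word ω ((q + 1) * L + r)) - Y (word ω ((q + 1) * L)) -
          Y (word (fun i => ω ((q + 1) * L + i)) r)) +
          Y (word (fun i => ω ((q + 1) * L + i)) r) by rw [h1]; ring]
    exact (abs_add_le _ _).trans (add_le_add h2 (h3.trans h4))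
  have hUB : ∀ ω, |U ω| ≤ ((q + 1 : ℕ) : ℝ) * (D + D') := fun ω =>
    (abs_blockSum_le hZb L (q + 1) ω).trans (by gcongr; exact le_add_of_nonneg_right (by positivity))
  have hVB : ∀ ω, |V ω| ≤ ((q + 1 : ℕ) : ℝ) * (D + D') := fun ω =>
    (abs_blockSum_le hδb' L q _).trans (by
      gcongr
      · omega
      · exact le_add_of_nonneg_left (by positivity))
  refine (integral_sub_pow_four_le (hYm _) hUm hVm hUB hVB hU0 hV0 hrem).trans ?_
  have h4U := integral_blockSum_pow_four_le hZm hZb hZ0 hZloc (q + 1)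
  have h4V := integral_blockSum_pow_four_le hδm' hδb' hδ0 hδloc q
  rw [← hV4] at h4V
  have hq1 : ((q + 1 : ℕ) : ℝ) ≤ (((q + 1) * L + r : ℕ) : ℝ) := by
    exact_mod_cast (Nat.le_mul_of_pos_right _ (by omega)).trans (Nat.le_add_right _ _)
  have hq0 : (q : ℝ) ≤ (((q + 1) * L + r : ℕ) : ℝ) :=
    le_trans (by exact_mod_cast Nat.le_succ q) hq1
  have hone : (1 : ℝ) ≤ (((q + 1) * L + r : ℕ) : ℝ) :=
    le_trans (by exact_mod_cast Nat.le_add_left 1 q) hq1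
  generalize (((q + 1) * L + r : ℕ) : ℝ) = x at hq1 hq0 hone
  rw [mul_assoc, add_mul, add_mul]
  gcongr
  · exact h4U.trans (by gcongr)
  · exact h4V.trans (by gcongr)
  · exact le_mul_of_one_le_right (by positivity) (one_le_pow₀ hone)

/-- The fourth moment of the additive functional of the conditioned tree, in the case of a bounded
toll carried by trees of bounded size. -/
theorem IsCritical.exists_levelSum_sub_pow_four_le {σsq : ℝ} (hp : IsCritical p σsq)
    (hf : ∀ T, K < T.size → f T = 0) (hb : ∀ T, |f T| ≤ b) {M : ℝ}
    (hM : M = ∑ k ∈ Finset.range (K + 1), levelSum p f k) :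
    ∃ C ≥ 0, ∀ᶠ n : ℕ in atTop,
      levelSum p (fun T => (additive f T - n * M) ^ 4) n ≤ C * (n ^ 2 * sizeProb p n) := by
  obtain ⟨C, hC, N, hN⟩ := exists_integral_factorSum_pow_four_le (p := p) hf hb
  obtain ⟨c, hc, hlow⟩ := hp.exists_le_sizeProb
  obtain ⟨C₁, hC₁, hup⟩ := hp.exists_walkProb_le
  refine ⟨2560 * (C₁ * C) / c, by positivity, ?_⟩
  filter_upwards [eventually_ge_atTop (3 * (N + K + 2))] with n hn
  -- The windows have lengths `2 * m` and `m` with `m` about `n / 3`, so that at least `m` steps of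
  -- the bridge are free.
  obtain ⟨m, hm1, hm2, hm3⟩ : ∃ m, N + K + 2 ≤ m ∧ 3 * m ≤ n ∧ n ≤ 4 * m :=
    ⟨n / 3, by omega, by omega, by omega⟩
  have hm0 : (0 : ℝ) < m := by exact_mod_cast (by omega : 0 < m)
  have hs0 : 0 < √(m : ℝ) := Real.sqrt_pos.2 hm0
  rcases (sizeProb_nonneg (p := p) (n := n)).eq_or_lt' with h0 | hpos
  · rw [levelSum_eq_zero h0, h0]; simp
  have hB : ∀ k ≥ m, ∀ c, walkProb p k c ≤ C₁ / √m := fun k hk c =>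
    (hup k (by omega) c).trans (by gcongr)
  have h1 := mul_levelSum_sub_pow_le (p := p) hf (a := m) (m := m) (n := n) (q := 4) (by omega)
    (by omega) (by decide) (by norm_num) hM (hB _ (by omega)) (hB _ (by omega))
  have h2 := hN m (by omega)
  have h3 := hN (m + m) (by omega)
  have hn4 : (n : ℝ) ≤ 4 * m := by exact_mod_cast hm3
  have h4 : (m : ℝ) ^ 4 * levelSum p (fun T => (additive f T - n * M) ^ 4) n ≤
      (m : ℝ) ^ 4 * (2560 * (C₁ * C) * √m) := by
    refine h1.trans ?_
    calc (2 * n : ℝ) ^ (4 - 1) * (C₁ / √m * _ + C₁ / √m * _) ≤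
        (2 * (4 * m) : ℝ) ^ (4 - 1) * (C₁ / √m * (C * ((m + m : ℕ) : ℝ) ^ 2) +
          C₁ / √m * (C * (m : ℝ) ^ 2)) := by
          gcongr
      _ = 2560 * (C₁ * C) * (m : ℝ) ^ 4 * (m / √m) := by push_cast; ring
      _ = _ := by rw [Real.div_sqrt]; ring
  have h5 := le_of_mul_le_mul_left h4 (by positivity)
  refine h5.trans ?_
  have hn0 : (0 : ℝ) < n := by exact_mod_cast (by omega : 0 < n)
  have h6 : √(m : ℝ) ≤ √n := Real.sqrt_le_sqrt (by exact_mod_cast (by omega : m ≤ n))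
  have h7 : c * √n ≤ n ^ 2 * sizeProb p n := by
    have h8 := mul_le_mul_of_nonneg_right (hlow n hpos) (Real.sqrt_nonneg n)
    refine h8.trans_eq ?_
    rw [show sizeProb p n * (n * √n) * √n = sizeProb p n * n * (√n * √n) by ring,
      Real.mul_self_sqrt hn0.le]
    ring
  rw [div_mul_eq_mul_div, le_div_iff₀ hc]
  calc 2560 * (C₁ * C) * √m * c ≤ 2560 * (C₁ * C) * √n * c := by gcongr
    _ = 2560 * (C₁ * C) * (c * √n) := by ring
    _ ≤ _ := by gcongr

end

/-- A bound on the fourth moments turns convergence of the characteristic functions to a Gaussian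
one into convergence of the second moments, since `x ^ 2` agrees with `2 (1 - cos (s x)) / s ^ 2` up
to `s ^ 2 x ^ 4`. -/
theorem tendsto_integral_sq_of_tendsto_integral_exp {ι Ω : Type*} {mΩ : MeasurableSpace Ω}
    {l : Filter ι} {P : ι → Measure Ω} [∀ i, IsProbabilityMeasure (P i)] {X : ι → Ω → ℝ} {C g : ℝ}
    (hm : ∀ i, AEStronglyMeasurable (X i) (P i)) (h2 : ∀ i, Integrable (fun ω => X i ω ^ 2) (P i))
    (h4 : ∀ i, Integrable (fun ω => X i ω ^ 4) (P i))
    (hC : ∀ᶠ i in l, ∫ ω, X i ω ^ 4 ∂P i ≤ C)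
    (hexp : ∀ s : ℝ, Tendsto (fun i => ∫ ω, Complex.exp ((s * X i ω : ℝ) * Complex.I) ∂P i) l
      (𝓝 (Complex.exp (-(s ^ 2 * g / 2) : ℝ)))) :
    Tendsto (fun i => ∫ ω, X i ω ^ 2 ∂P i) l (𝓝 g) := by
  have hcos : ∀ x : ℝ, |Real.cos x - 1 + x ^ 2 / 2| ≤ x ^ 4 := by
    intro x
    have h1 := Real.one_sub_sq_div_two_le_cos (x := x)
    rw [abs_of_nonneg (by linarith)]
    rcases le_total |x| 1 with hx | hx
    · have h3 := le_of_abs_le (Real.cos_bound hx)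
      rw [(show Even 4 by decide).pow_abs] at h3
      have h5 : 0 ≤ x ^ 4 := by positivity
      linarith
    · have h3 := Real.cos_le_one x
      have h5 : 1 ≤ x ^ 2 := by rw [← sq_abs]; exact one_le_pow₀ hx
      have h6 : x ^ 2 ≤ x ^ 4 := by
        calc x ^ 2 = x ^ 2 * 1 := (mul_one _).symm
          _ ≤ x ^ 2 * x ^ 2 := by gcongr
          _ = _ := by ring
      linarith
  have hbound : ∀ s : ℝ, s ≠ 0 → ∀ i, |∫ ω, X i ω ^ 2 ∂P i -
      2 / s ^ 2 * (1 - (∫ ω, Complex.exp ((s * X i ω : ℝ) * Complex.I) ∂P i).re)| ≤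
      2 * s ^ 2 * ∫ ω, X i ω ^ 4 ∂P i := by
    intro s hs i
    have hi : Integrable (fun ω => Complex.exp ((s * X i ω : ℝ) * Complex.I)) (P i) := by
      have : Continuous fun x : ℝ => Complex.exp ((s * x : ℝ) * Complex.I) := by fun_prop
      exact Integrable.of_bound (this.comp_aestronglyMeasurable (hm i)) 1
        (ae_of_all _ fun ω => by rw [Complex.norm_exp_ofReal_mul_I])
    have hre : (∫ ω, Complex.exp ((s * X i ω : ℝ) * Complex.I) ∂P i).re =
        ∫ ω, Real.cos (s * X i ω) ∂P i := by
      have := integral_re hi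
      simp only [RCLike.re_to_complex, Complex.exp_ofReal_mul_I_re] at this
      exact this.symm
    have hic : Integrable (fun ω => Real.cos (s * X i ω)) (P i) := by
      have := hi.re
      simpa only [RCLike.re_to_complex, Complex.exp_ofReal_mul_I_re] using this
    have h1 : ∫ ω, X i ω ^ 2 ∂P i - 2 / s ^ 2 * (1 - ∫ ω, Real.cos (s * X i ω) ∂P i) =
        ∫ ω, 2 / s ^ 2 * (Real.cos (s * X i ω) - 1 + (s * X i ω) ^ 2 / 2) ∂P i := by
      have h3 : ∀ ω, 2 / s ^ 2 * (Real.cos (s * X i ω) - 1 + (s * X i ω) ^ 2 / 2) =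
          X i ω ^ 2 - 2 / s ^ 2 * (1 - Real.cos (s * X i ω)) := fun ω => by
        field_simp
        ring
      simp only [h3]
      have i1 : Integrable (fun ω => 1 - Real.cos (s * X i ω)) (P i) :=
        (integrable_const _).sub hic
      rw [integral_sub (h2 i) (i1.const_mul _), integral_const_mul,
        integral_sub (integrable_const _) hic]
      simp
    rw [hre, h1, ← integral_const_mul]
    refine abs_integral_le_integral_abs.trans (integral_mono_of_nonneg
      (ae_of_all _ fun ω => abs_nonneg _) ((h4 i).const_mul _) (ae_of_all _ fun ω => ?_))
    simp only
    rw [abs_mul, abs_of_nonneg (by positivity : 0 ≤ 2 / s ^ 2)]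
    calc 2 / s ^ 2 * _ ≤ 2 / s ^ 2 * (s * X i ω) ^ 4 := by gcongr; exact hcos _
      _ = _ := by field_simp
  rw [Metric.tendsto_nhds]
  intro ε hε
  -- A small `s` is fixed, depending on `ε` only.
  have hs : ∀ᶠ s : ℝ in 𝓝[>] 0, 2 * s ^ 2 * |C| + s ^ 2 * g ^ 2 < ε / 2 ∧ |s ^ 2 * g / 2| < 1 := by
    have c1 : Tendsto (fun s : ℝ => 2 * s ^ 2 * |C| + s ^ 2 * g ^ 2) (𝓝[>] 0) (𝓝 0) := by
      have : Continuous fun s : ℝ => 2 * s ^ 2 * |C| + s ^ 2 * g ^ 2 := by fun_prop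
      simpa using (this.tendsto 0).mono_left nhdsWithin_le_nhds
    have c2 : Tendsto (fun s : ℝ => |s ^ 2 * g / 2|) (𝓝[>] 0) (𝓝 0) := by
      have : Continuous fun s : ℝ => |s ^ 2 * g / 2| := by fun_prop
      simpa using (this.tendsto 0).mono_left nhdsWithin_le_nhds
    exact (c1.eventually (gt_mem_nhds (half_pos hε))).and
      (c2.eventually (gt_mem_nhds one_pos))
  obtain ⟨s, ⟨hs1, hs2⟩, hs0⟩ := (hs.and self_mem_nhdsWithin).exists
  have hs0' : (0 : ℝ) < s := hs0
  have hlim : Tendsto (fun i => 2 / s ^ 2 *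
      (1 - (∫ ω, Complex.exp ((s * X i ω : ℝ) * Complex.I) ∂P i).re)) l
      (𝓝 (2 / s ^ 2 * (1 - Real.exp (-(s ^ 2 * g / 2))))) := by
    have h1 := (Complex.continuous_re.tendsto _).comp (hexp s)
    rw [← Complex.ofReal_exp, Complex.ofReal_re] at h1
    exact (h1.const_sub 1).const_mul _
  have hg : |2 / s ^ 2 * (1 - Real.exp (-(s ^ 2 * g / 2))) - g| ≤ s ^ 2 * g ^ 2 := by
    have h1 := Real.norm_exp_sub_one_sub_id_le (x := -(s ^ 2 * g / 2))
      (by rw [Real.norm_eq_abs, abs_neg]; exact hs2.le)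
    rw [Real.norm_eq_abs, Real.norm_eq_abs, sq_abs] at h1
    rw [show 2 / s ^ 2 * (1 - Real.exp (-(s ^ 2 * g / 2))) - g =
      -(2 / s ^ 2 * (Real.exp (-(s ^ 2 * g / 2)) - 1 - -(s ^ 2 * g / 2))) by field_simp; ring,
      abs_neg, abs_mul, abs_of_nonneg (by positivity : 0 ≤ 2 / s ^ 2)]
    calc 2 / s ^ 2 * _ ≤ 2 / s ^ 2 * (-(s ^ 2 * g / 2)) ^ 2 := by gcongr
      _ = s ^ 2 * g ^ 2 / 2 := by field_simp
      _ ≤ _ := half_le_self (by positivity)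
  filter_upwards [hC, Metric.tendsto_nhds.1 hlim (ε / 2) (half_pos hε)] with i hi1 hi2
  rw [Real.dist_eq] at hi2 ⊢
  have h1 := hbound s hs0'.ne' i
  have h3 : 2 * s ^ 2 * ∫ ω, X i ω ^ 4 ∂P i ≤ 2 * s ^ 2 * |C| := by
    gcongr
    exact hi1.trans (le_abs_self C)
  rw [abs_le] at h1 hg
  rw [abs_lt] at hi2 ⊢
  constructor <;> linarith [h1.1, h1.2, hi2.1, hi2.2, hg.1, hg.2]

/-- Convergence of the normalized second moment, in the case of a bounded toll carried by trees of
bounded size. -/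
theorem IsCritical.tendsto_integral_sub_sq_div {p : PMF ℕ} {f : PlaneTree → ℝ} {K : ℕ} {b σsq : ℝ}
    (hp : IsCritical p σsq) (hf : ∀ T, K < T.size → f T = 0) (hb : ∀ T, |f T| ≤ b) {M v : ℝ}
    (hM : M = ∑ k ∈ Finset.range (K + 1), levelSum p f k)
    (hv : v = ∑ k ∈ Finset.range (K + 1), levelSum p (fun T => f T * (2 * (additive f T -
        k * M) - f T)) k + M ^ 2) :
    Tendsto (fun n : AdmissibleSize p => (∫ T, (additive f T - (n : ℝ) * M) ^ 2 ∂gwCond p n) /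
      (n : ℝ)) atTop (𝓝 (v - M ^ 2 / σsq)) := by
  obtain ⟨C, hC, hev⟩ := hp.exists_levelSum_sub_pow_four_le hf hb hM
  have hpos : ∀ n : AdmissibleSize p, (0 : ℝ) < (n : ℕ) := fun n => by
    refine Nat.cast_pos.2 (Nat.pos_of_ne_zero fun h0 => ?_)
    have := admissible_iff.1 n.2
    rw [h0] at this
    exact this.ne' levelSum_zero_right
  have h := tendsto_integral_sq_of_tendsto_integral_exp (C := C) (g := v - M ^ 2 / σsq)
    (P := fun n : AdmissibleSize p => gwCond p n)
    (X := fun (n : AdmissibleSize p) T => (additive f T - (n : ℝ) * M) / √(n : ℝ)) (l := atTop)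
    (fun n => (integrable_gwCond p _ n).1) (fun n => integrable_gwCond p _ n)
    (fun n => integrable_gwCond p _ n) ?_ fun s => ?_
  · refine h.congr fun n => ?_
    rw [← integral_div]
    refine integral_congr_ae (ae_of_all _ fun T => ?_)
    simp only
    rw [div_pow, Real.sq_sqrt (hpos n).le]
  · filter_upwards [hp.tendsto_coe_admissibleSize.eventually hev] with n hn
    have h1 : ∀ T, ((additive f T - (n : ℝ) * M) / √(n : ℝ)) ^ 4 =
        (additive f T - (n : ℝ) * M) ^ 4 / (n : ℝ) ^ 2 := fun T => by
      rw [div_pow, show √(n : ℝ) ^ 4 = (√(n : ℝ) ^ 2) ^ 2 by ring, Real.sq_sqrt (hpos n).le]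
    simp only [h1]
    rw [integral_div, integral_gwCond, div_div, div_le_iff₀
      (mul_pos (admissible_iff.1 n.2) (by have := hpos n; positivity))]
    refine hn.trans_eq ?_
    ring
  · refine (hp.tendsto_integral_exp_additive hf hb hM hv s).congr fun n => ?_
    refine integral_congr_ae (ae_of_all _ fun T => ?_)
    simp only
    congr 3
    ring

/-! ### The asymptotic variance and its continuity in the toll -/

/-- The additive functional minus the size times the mean toll. -/
noncomputable def centred (p : PMF ℕ) (f : PlaneTree → ℝ) (T : PlaneTree) : ℝ :=
  additive f T - (T.size : ℝ) * ∫ t, f t ∂gw p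

/-- The asymptotic variance `γ²`, in a form with `𝔼 f(𝒯)²` inside the first integral: the square of
the mean in the second term comes from `-Var f = -𝔼 f² + μ²`. -/
noncomputable def asympVar (p : PMF ℕ) (σsq : ℝ) (f : PlaneTree → ℝ) : ℝ :=
  (∫ T, f T * (2 * centred p f T - f T) ∂gw p) + (∫ T, f T ∂gw p) ^ 2 -
    (∫ T, f T ∂gw p) ^ 2 / σsq

theorem centred_add {p : PMF ℕ} {f g : PlaneTree → ℝ} (hf : Integrable f (gw p))
    (hg : Integrable g (gw p)) (T : PlaneTree) :
    centred p (fun t => f t + g t) T = centred p f T + centred p g T := by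
  rw [centred, additive_add, integral_add hf hg, centred, centred]
  ring

theorem levelSum_centred (p : PMF ℕ) (f : PlaneTree → ℝ) (φ : ℝ → PlaneTree → ℝ) (n : ℕ) :
    levelSum p (fun T => φ (centred p f T) T) n =
      levelSum p (fun T => φ (additive f T - n * ∫ t, f t ∂gw p) T) n :=
  levelSum_congr fun T hT => by rw [centred, hT]

section
variable {p : PMF ℕ} {f g r : PlaneTree → ℝ} {a a' a'' : ℕ → ℝ} {s ε A C : ℝ}

/-- The constant `A` bounds the variance of additive functionals in terms of their tolls. -/
def VarianceBound (p : PMF ℕ) (A : ℝ) : Prop :=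
  ∀ (f : PlaneTree → ℝ) (a : ℕ → ℝ) (s : ℝ), TollBound p f a s → ∀ n : ℕ,
    levelSum p (fun T => centred p f T ^ 2) n ≤ (A * s) ^ 2 * n * sizeProb p n

theorem IsCritical.exists_varianceBound {σsq : ℝ} (hp : IsCritical p σsq) :
    ∃ A > 0, VarianceBound p A := by
  obtain ⟨A, hA0, hA⟩ := hp.exists_levelSum_sub_sq_le
  refine ⟨A, hA0, fun f a s hb n => ?_⟩
  rw [levelSum_centred p f fun x _ => x ^ 2]
  exact hA f a s hb n

namespace TollBound

/-- Cauchy–Schwarz size by size: a toll may be integrated against functions which, given the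
size `k`, have an `L²` norm of order `√k`. -/
theorem integrable_mul_and_abs_integral_le (hb : TollBound p f a s)
    (hC : ∀ n : ℕ, sizeProb p n * (n * √n) ≤ C) {h : PlaneTree → ℝ} {S : ℝ} (hS : 0 ≤ S)
    (hh : ∀ k, levelSum p (fun T => h T ^ 2) k ≤ S ^ 2 * k * sizeProb p k) :
    Integrable (fun T => f T * h T) (gw p) ∧ |∫ T, f T * h T ∂gw p| ≤ C * S * s := by
  have hC0 : 0 ≤ C := by simpa using hC 0
  have h1 : ∀ k, levelSum p (fun T => |f T * h T|) k ≤ C * S * (a k / k) := by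
    intro k
    rcases Nat.eq_zero_or_pos k with rfl | hk
    · simp [levelSum_zero_right]
    have hk' : (0 : ℝ) < k := by exact_mod_cast hk
    have h2 := hb.levelSum_abs_mul_le (h := h) (k := k) (y := S * √k) (by positivity) (by
      rw [mul_pow, Real.sq_sqrt hk'.le, mul_comm]
      exact hh k)
    refine h2.trans ?_
    have h3 : 0 ≤ a k / k * S := mul_nonneg (div_nonneg (hb.nonneg k) hk'.le) hS
    calc sizeProb p k * (a k * (S * √k)) = sizeProb p k * (k * √k) * (a k / k * S) := by
          field_simp
      _ ≤ C * (a k / k * S) := mul_le_mul_of_nonneg_right (hC k) h3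
      _ = _ := by ring
  have hsum : Summable fun k : ℕ => C * S * (a k / k) := hb.summable.mul_left _
  have hint : Integrable (fun T => f T * h T) (gw p) :=
    integrable_gw_iff.2 (hsum.of_nonneg_of_le (fun k => levelSum_nonneg fun _ _ => abs_nonneg _) h1)
  refine ⟨hint, ?_⟩
  refine abs_integral_le_integral_abs.trans ?_
  rw [← (hasSum_levelSum hint.abs).tsum_eq]
  refine ((hasSum_levelSum hint.abs).summable.tsum_le_tsum h1 hsum).trans ?_
  rw [tsum_mul_left]
  exact mul_le_mul_of_nonneg_left hb.tsum_le (by positivity)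

theorem levelSum_sq_le_mul (hb : TollBound p f a s) (k : ℕ) :
    levelSum p (fun T => f T ^ 2) k ≤ s ^ 2 * k * sizeProb p k := by
  rcases Nat.eq_zero_or_pos k with rfl | hk
  · simp [levelSum_zero_right]
  have hk' : (1 : ℝ) ≤ k := by exact_mod_cast hk
  have hπ : 0 ≤ sizeProb p k := sizeProb_nonneg
  have h1 := hb.levelSum_sq_le k
  have h2 : a k ^ 2 ≤ s ^ 2 := pow_le_pow_left₀ (hb.nonneg k) (hb.le k) 2
  calc _ ≤ sizeProb p k * a k ^ 2 := h1
    _ ≤ sizeProb p k * s ^ 2 := by gcongr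
    _ = s ^ 2 * 1 * sizeProb p k := by ring
    _ ≤ _ := by gcongr

theorem levelSum_two_mul_centred_sub_sq_le (hb : TollBound p f a s) (hA : VarianceBound p A)
    (hA0 : 0 ≤ A) (k : ℕ) :
    levelSum p (fun T => (2 * centred p f T - f T) ^ 2) k ≤
      ((4 * A + 2) * s) ^ 2 * k * sizeProb p k := by
  have h1 := hA f a s hb k
  have h2 := hb.levelSum_sq_le_mul k
  have h3 : levelSum p (fun T => (2 * centred p f T - f T) ^ 2) k ≤
      levelSum p (fun T => 8 * centred p f T ^ 2 + 2 * f T ^ 2) k :=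
    levelSum_mono fun T _ => by nlinarith [sq_nonneg (2 * centred p f T + f T)]
  rw [levelSum_add, levelSum_const_mul, levelSum_const_mul] at h3
  have hx : 0 ≤ s ^ 2 * k * sizeProb p k :=
    mul_nonneg (by positivity) sizeProb_nonneg
  calc _ ≤ 8 * ((A * s) ^ 2 * k * sizeProb p k) + 2 * (s ^ 2 * k * sizeProb p k) := by linarith
    _ = (8 * A ^ 2 + 2) * (s ^ 2 * k * sizeProb p k) := by ring
    _ ≤ (4 * A + 2) ^ 2 * (s ^ 2 * k * sizeProb p k) := by
        gcongr
        nlinarith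
    _ = _ := by ring

theorem integrable_mul_centred (hb : TollBound p f a s) (hA : VarianceBound p A) (hA0 : 0 ≤ A)
    (hC : ∀ n : ℕ, sizeProb p n * (n * √n) ≤ C) :
    Integrable (fun T => f T * centred p f T) (gw p) :=
  (hb.integrable_mul_and_abs_integral_le hC (mul_nonneg hA0 hb.bound_nonneg) (hA f a s hb)).1

theorem memLp_two (hb : TollBound p f a s) (hC : ∀ n : ℕ, sizeProb p n * (n * √n) ≤ C) :
    MemLp f 2 (gw p) := by
  refine (memLp_two_iff_integrable_sq (hb.integrable hC).1).2 ?_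
  have := (hb.integrable_mul_and_abs_integral_le hC hb.bound_nonneg hb.levelSum_sq_le_mul).1
  exact this.congr (ae_of_all _ fun T => (sq (f T)).symm)

/-- The asymptotic variance is a continuous function of the toll. -/
theorem abs_asympVar_sub_le {σsq : ℝ} (hσ : 0 < σsq) (hb : TollBound p f a s)
    (hb' : TollBound p g a' s)
    (hr : TollBound p r a'' ε) (hfg : ∀ T, f T = g T + r T) (hA : VarianceBound p A)
    (hA0 : 0 ≤ A) (hC : ∀ n : ℕ, sizeProb p n * (n * √n) ≤ C) :
    |asympVar p σsq f - asympVar p σsq g| ≤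
      (2 * C * (4 * A + 2) + 2 * C ^ 2 * (1 + 1 / σsq)) * s * ε := by
  have hs := hb.bound_nonneg
  have hε := hr.bound_nonneg
  have hC0 : 0 ≤ C := by simpa using hC 0
  have ig := hb'.integrable hC
  have ir := hr.integrable hC
  have hfe : f = fun T => g T + r T := funext hfg
  have hcen : ∀ T, centred p f T = centred p g T + centred p r T := fun T => by
    rw [hfe]; exact centred_add ig ir T
  have hμ : ∫ T, f T ∂gw p = (∫ T, g T ∂gw p) + ∫ T, r T ∂gw p := by
    rw [hfe]; exact integral_add ig ir
  obtain ⟨i1, b1⟩ := hr.integrable_mul_and_abs_integral_le hC (S := (4 * A + 2) * s)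
    (by positivity) (hb.levelSum_two_mul_centred_sub_sq_le hA hA0)
  obtain ⟨i2, b2⟩ := hb'.integrable_mul_and_abs_integral_le hC (S := (4 * A + 2) * ε)
    (by positivity) (hr.levelSum_two_mul_centred_sub_sq_le hA hA0)
  obtain ⟨i3, -⟩ := hb'.integrable_mul_and_abs_integral_le hC (S := (4 * A + 2) * s)
    (by positivity) (hb'.levelSum_two_mul_centred_sub_sq_le hA hA0)
  have h1 : ∫ T, f T * (2 * centred p f T - f T) ∂gw p =
      (∫ T, g T * (2 * centred p g T - g T) ∂gw p) +
        ((∫ T, r T * (2 * centred p f T - f T) ∂gw p) +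
          ∫ T, g T * (2 * centred p r T - r T) ∂gw p) := by
    have i12 : Integrable (fun T => r T * (2 * centred p f T - f T) +
        g T * (2 * centred p r T - r T)) (gw p) := i1.add i2
    rw [← integral_add i1 i2, ← integral_add i3 i12]
    refine integral_congr_ae (ae_of_all _ fun T => ?_)
    simp only
    rw [hcen, hfg]
    ring
  have m1 := hb.abs_integral_le hC
  have m2 := hb'.abs_integral_le hC
  have m3 := hr.abs_integral_le hC
  have m4 : |(∫ T, r T ∂gw p) * ((∫ T, f T ∂gw p) + ∫ T, g T ∂gw p)| ≤ C * ε * (C * s + C * s) := by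
    rw [abs_mul]
    exact mul_le_mul m3 ((abs_add_le _ _).trans (add_le_add m1 m2)) (abs_nonneg _) (by positivity)
  have h2 : asympVar p σsq f - asympVar p σsq g =
      (∫ T, r T * (2 * centred p f T - f T) ∂gw p) +
        (∫ T, g T * (2 * centred p r T - r T) ∂gw p) +
      (1 - 1 / σsq) * ((∫ T, r T ∂gw p) * ((∫ T, f T ∂gw p) + ∫ T, g T ∂gw p)) := by
    rw [asympVar, asympVar, h1, hμ]
    ring
  have m5 : |1 - 1 / σsq| ≤ 1 + 1 / σsq := by
    refine (abs_sub _ _).trans_eq ?_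
    rw [abs_one, abs_of_pos (by positivity)]
  rw [h2]
  calc _ ≤ C * ((4 * A + 2) * s) * ε + C * ((4 * A + 2) * ε) * s +
        (1 + 1 / σsq) * (C * ε * (C * s + C * s)) := by
        refine (abs_add_le _ _).trans (add_le_add ((abs_add_le _ _).trans (add_le_add b1 b2)) ?_)
        rw [abs_mul]
        exact mul_le_mul m5 m4 (abs_nonneg _) (by positivity)
    _ = _ := by ring

/-- The normalized second moments depend continuously on the toll, uniformly in the size. -/
theorem abs_integral_centred_sq_sub_le (hb : TollBound p f a s) (hb' : TollBound p g a' s)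
    (hr : TollBound p r a'' ε) (hfg : ∀ T, f T = g T + r T) (hA : VarianceBound p A)
    (hC : ∀ n : ℕ, sizeProb p n * (n * √n) ≤ C) (n : AdmissibleSize p) :
    |(∫ T, centred p f T ^ 2 ∂gwCond p n) / n - (∫ T, centred p g T ^ 2 ∂gwCond p n) / n| ≤
      2 * A ^ 2 * s * ε := by
  have hs := hb.bound_nonneg
  have hε := hr.bound_nonneg
  have ig := hb'.integrable hC
  have ir := hr.integrable hC
  have hcen : ∀ T, centred p f T = centred p g T + centred p r T := fun T => by
    rw [show f = fun T => g T + r T from funext hfg]; exact centred_add ig ir T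
  obtain ⟨n, hn⟩ := n
  have hπ : 0 < sizeProb p n := admissible_iff.1 hn
  have hn0 : (0 : ℝ) < n := by
    refine Nat.cast_pos.2 (Nat.pos_of_ne_zero fun h0 => ?_)
    rw [h0] at hπ
    exact hπ.ne' levelSum_zero_right
  simp only [integral_gwCond]
  have h1 : levelSum p (fun T => centred p f T ^ 2) n - levelSum p (fun T => centred p g T ^ 2) n =
      levelSum p (fun T => centred p r T * (centred p f T + centred p g T)) n := by
    rw [← levelSum_sub]
    refine levelSum_congr fun T _ => ?_
    rw [hcen]; ring
  have h2 : levelSum p (fun T => (centred p f T + centred p g T) ^ 2) n ≤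
      (2 * A * s) ^ 2 * n * sizeProb p n := by
    have h3 : levelSum p (fun T => (centred p f T + centred p g T) ^ 2) n ≤
        levelSum p (fun T => 2 * centred p f T ^ 2 + 2 * centred p g T ^ 2) n :=
      levelSum_mono fun T _ => by nlinarith [sq_nonneg (centred p f T - centred p g T)]
    rw [levelSum_add, levelSum_const_mul, levelSum_const_mul] at h3
    have h4 := hA f a s hb n
    have h5 := hA g a' s hb' n
    linarith
  have h3 : |levelSum p (fun T => centred p r T * (centred p f T + centred p g T)) n| ≤
      2 * A ^ 2 * s * ε * (n * sizeProb p n) := by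
    refine abs_levelSum_le.trans (PlaneTree.levelSum_abs_mul_le.trans ?_)
    rw [← Real.sqrt_mul (levelSum_nonneg fun _ _ => sq_nonneg _)]
    refine Real.sqrt_le_iff.2 ⟨by positivity, ?_⟩
    calc _ ≤ (A * ε) ^ 2 * n * sizeProb p n * ((2 * A * s) ^ 2 * n * sizeProb p n) :=
          mul_le_mul (hA r a'' ε hr n) h2 (levelSum_nonneg fun _ _ => sq_nonneg _) (by positivity)
      _ = _ := by ring
  rw [← sub_div, ← sub_div, h1, abs_div, abs_div, abs_of_pos hπ, abs_of_pos hn0,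
    div_le_iff₀ hn0, div_le_iff₀ hπ, mul_assoc]
  exact h3

/-- The characteristic functions depend continuously on the toll, uniformly in the size. -/
theorem norm_integral_exp_centred_sub_le (hb' : TollBound p g a' s)
    (hr : TollBound p r a'' ε) (hfg : ∀ T, f T = g T + r T) (hA : VarianceBound p A)
    (hA0 : 0 ≤ A) (hC : ∀ n : ℕ, sizeProb p n * (n * √n) ≤ C) (t : ℝ) (n : AdmissibleSize p) :
    ‖∫ T, Complex.exp ((t / √(n : ℝ) * centred p f T : ℝ) * Complex.I) ∂gwCond p n -
      ∫ T, Complex.exp ((t / √(n : ℝ) * centred p g T : ℝ) * Complex.I) ∂gwCond p n‖ ≤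
      |t| * (A * ε) := by
  have hε := hr.bound_nonneg
  have ig := hb'.integrable hC
  have ir := hr.integrable hC
  have hcen : ∀ T, centred p f T = centred p g T + centred p r T := fun T => by
    rw [show f = fun T => g T + r T from funext hfg]; exact centred_add ig ir T
  refine (norm_integral_exp_sub_le (integrable_gwCond p _ n) (integrable_gwCond p _ n)).trans ?_
  have h1 : ∀ T, |t / √(n : ℝ) * centred p f T - t / √(n : ℝ) * centred p g T| =
      |t| / √(n : ℝ) * |centred p r T| := fun T => by
    rw [hcen, mul_add, add_sub_cancel_left, abs_mul, abs_div, abs_of_nonneg (Real.sqrt_nonneg _)]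
  simp only [h1]
  rw [integral_const_mul]
  have hm : MemLp (centred p r) 2 (gwCond p n) :=
    (memLp_two_iff_integrable_sq (integrable_gwCond p _ n).1).2 (integrable_gwCond p _ n)
  have h2 : ∫ T, |centred p r T| ∂gwCond p n ≤ A * ε * √(n : ℝ) := by
    refine (integral_abs_le_sqrt hm).trans (Real.sqrt_le_iff.2 ⟨by positivity, ?_⟩)
    rw [integral_gwCond, div_le_iff₀ (admissible_iff.1 n.2), mul_pow, Real.sq_sqrt (Nat.cast_nonneg _)]
    exact hA r a'' ε hr n
  calc |t| / √(n : ℝ) * ∫ T, |centred p r T| ∂gwCond p n ≤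
      |t| / √(n : ℝ) * (A * ε * √(n : ℝ)) := by gcongr
    _ = |t| * (A * ε) * (√(n : ℝ) / √(n : ℝ)) := by ring
    _ ≤ _ := mul_le_of_le_one_right (by positivity) (div_self_le_one _)

end TollBound

/-- Restricted to trees with more than `K` vertices, a toll has an arbitrarily small bound for large
`K`. -/
theorem TollBound.eventually_tail (hb : TollBound p f a s) (ha : Tendsto a atTop (𝓝 0))
    (hε : 0 < ε) : ∀ᶠ K : ℕ in atTop, TollBound p (fun T => if ¬ T.size ≤ K then f T else 0)
      (fun k => if k ≤ K then 0 else a k) ε := by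
  have h1 : Tendsto (fun K : ℕ => ∑' k : ℕ, (if k ≤ K then 0 else a k) / (k : ℝ)) atTop (𝓝 0) := by
    have := tendsto_tsum_of_dominated_convergence (𝓕 := atTop) (bound := fun k : ℕ => a k / k)
      (f := fun (K k : ℕ) => (if k ≤ K then 0 else a k) / (k : ℝ)) (g := fun _ => 0) hb.summable
      (fun k => tendsto_const_nhds.congr' (by
        filter_upwards [eventually_ge_atTop k] with K hK
        simp [hK])) (Eventually.of_forall fun K k => ?_)
    · simpa using this
    · have := hb.nonneg k
      rw [Real.norm_of_nonneg (by split_ifs <;> positivity)]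
      gcongr
      split_ifs
      · exact this
      · exact le_rfl
  have h2 := eventually_forall_ge_atTop.2 (ha.eventually (gt_mem_nhds hε))
  filter_upwards [h1.eventually (gt_mem_nhds hε), h2] with K hK1 hK2
  refine ⟨fun k => ?_, fun k => ?_, fun k => ?_, ?_, hK1.le⟩
  · split_ifs
    · exact le_rfl
    · exact hb.nonneg k
  · split_ifs with hk
    · rw [levelSum_congr (h := fun _ => 0) fun T hT => by simp [hT, hk], levelSum_const]
      simp
    · exact (hb.restrict fun T => ¬ T.size ≤ K).levelSum_sq_le k
  · split_ifs with hk
    · exact hε.le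
    · exact (hK2 k (not_le.1 hk).le).le
  · refine hb.summable.of_nonneg_of_le (fun k => ?_) fun k => ?_
    · have := hb.nonneg k
      split_ifs <;> positivity
    · gcongr
      split_ifs
      · exact hb.nonneg k
      · exact le_rfl

theorem sum_levelSum_eq_integral {h : PlaneTree → ℝ} {K : ℕ} (hh : ∀ T, K < T.size → h T = 0) :
    ∑ k ∈ Finset.range (K + 1), levelSum p h k = ∫ T, h T ∂gw p := by
  have hlev : ∀ (h : PlaneTree → ℝ), (∀ T, K < T.size → h T = 0) →
      ∀ k ∉ Finset.range (K + 1), levelSum p h k = 0 := fun h hh k hk => by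
    rw [levelSum_congr (h := fun _ => 0) fun T hT => hh T (by
      have := Finset.mem_range.not.1 hk
      omega), levelSum_const, zero_mul]
  have hint : Integrable h (gw p) := integrable_gw_iff.2
    (summable_of_ne_finset_zero (hlev _ fun T hT => by rw [hh T hT, abs_zero]))
  exact (hasSum_sum_of_ne_finset_zero (hlev h hh)).unique (hasSum_levelSum hint)

theorem exists_abs_le_of_size_le {h : PlaneTree → ℝ} {K : ℕ} (hh : ∀ T, K < T.size → h T = 0) :
    ∃ b, ∀ T, |h T| ≤ b := by
  refine ⟨∑ k ∈ Finset.range (K + 1), ∑ T ∈ trees k, |h T|, fun T => ?_⟩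
  have h0 : ∀ k ∈ Finset.range (K + 1), 0 ≤ ∑ T ∈ trees k, |h T| := fun k _ =>
    Finset.sum_nonneg fun _ _ => abs_nonneg _
  rcases le_or_gt T.size K with hT | hT
  · exact (Finset.single_le_sum (f := fun T => |h T|) (fun _ _ => abs_nonneg _)
      (mem_trees.2 rfl)).trans
      (Finset.single_le_sum h0 (Finset.mem_range.2 (Nat.lt_succ_of_le hT)))
  · rw [hh T hT, abs_zero]
    exact Finset.sum_nonneg h0

/-- For a toll carried by trees of bounded size, `asympVar` is the variance parameter of the central
limit theorem. -/
theorem sum_levelSum_add_sub_eq_asympVar {K : ℕ} (hf : ∀ T, K < T.size → f T = 0) {σsq M : ℝ}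
    (hM : M = ∑ k ∈ Finset.range (K + 1), levelSum p f k) :
    ∑ k ∈ Finset.range (K + 1), levelSum p (fun T => f T * (2 * (additive f T -
        k * M) - f T)) k + M ^ 2 - M ^ 2 / σsq = asympVar p σsq f := by
  rw [sum_levelSum_eq_integral hf] at hM
  rw [asympVar, ← hM, ← sum_levelSum_eq_integral (K := K) fun T hT => by rw [hf T hT, zero_mul]]
  congr 3
  exact funext fun k => levelSum_congr fun T hT => by rw [centred, hT, hM]

end

/-! ### Convergence to the normal law -/

section
variable {p : PMF ℕ} {σsq : ℝ} {f : PlaneTree → ℝ} {a : ℕ → ℝ} {s : ℝ}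

theorem IsCritical.tendsto_asympVar_truncation (hp : IsCritical p σsq) (hb : TollBound p f a s)
    (ha : Tendsto a atTop (𝓝 0)) :
    Tendsto (fun K : ℕ => asympVar p σsq fun T => if T.size ≤ K then f T else 0) atTop
      (𝓝 (asympVar p σsq f)) := by
  obtain ⟨A, hA0, hA⟩ := hp.exists_varianceBound
  obtain ⟨C, hC0, hC⟩ := hp.exists_sizeProb_le
  have hs := hb.bound_nonneg
  have hσ := hp.pos
  set D := (2 * C * (4 * A + 2) + 2 * C ^ 2 * (1 + 1 / σsq)) * s with hD
  have hD0 : 0 ≤ D := by positivity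
  rw [Metric.tendsto_nhds]
  intro ε hε
  filter_upwards [hb.eventually_tail ha (ε := ε / (D + 1)) (by positivity)] with K hK
  rw [dist_comm, Real.dist_eq]
  refine (TollBound.abs_asympVar_sub_le hp.pos hb (hb.restrict _) hK (fun T => ?_) hA hA0.le
    hC).trans_lt ?_
  · by_cases hT : T.size ≤ K <;> simp [hT]
  · rw [← hD, ← mul_div_assoc, div_lt_iff₀ (by positivity)]
    linarith

/-- The normalized second moment around `n μ` converges to the asymptotic variance. -/
theorem IsCritical.tendsto_integral_centred_sq_div (hp : IsCritical p σsq) (hb : TollBound p f a s)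
    (ha : Tendsto a atTop (𝓝 0)) :
    Tendsto (fun n : AdmissibleSize p => (∫ T, centred p f T ^ 2 ∂gwCond p n) / (n : ℝ)) atTop
      (𝓝 (asympVar p σsq f)) := by
  obtain ⟨A, hA0, hA⟩ := hp.exists_varianceBound
  obtain ⟨C, hC0, hC⟩ := hp.exists_sizeProb_le
  have hs := hb.bound_nonneg
  refine TendstoUniformly.tendsto_of_eventually_tendsto (p := atTop)
    (F := fun (K : ℕ) (n : AdmissibleSize p) =>
      (∫ T, centred p (fun T => if T.size ≤ K then f T else 0) T ^ 2 ∂gwCond p n) / (n : ℝ))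
    (Metric.tendstoUniformly_iff.2 fun ε hε => ?_) (Eventually.of_forall fun K => ?_)
    (hp.tendsto_asympVar_truncation hb ha)
  · filter_upwards [hb.eventually_tail ha (ε := ε / (2 * A ^ 2 * s + 1)) (by positivity)] with K hK n
    rw [Real.dist_eq]
    refine (TollBound.abs_integral_centred_sq_sub_le hb (hb.restrict _) hK (fun T => ?_) hA
      hC n).trans_lt ?_
    · by_cases hT : T.size ≤ K <;> simp [hT]
    · rw [← mul_div_assoc, div_lt_iff₀ (by positivity)]
      linarith
  · have hf : ∀ T, K < T.size → (if T.size ≤ K then f T else 0) = 0 := fun T hT =>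
      if_neg (not_le.2 hT)
    obtain ⟨b, hbd⟩ := exists_abs_le_of_size_le hf
    have h1 := hp.tendsto_integral_sub_sq_div hf hbd rfl rfl
    rw [sum_levelSum_add_sub_eq_asympVar hf rfl] at h1
    refine h1.congr fun n => ?_
    rw [integral_gwCond, integral_gwCond, levelSum_centred p _ fun x _ => x ^ 2,
      sum_levelSum_eq_integral hf]

/-- The characteristic functions converge to the one of the normal law. -/
theorem IsCritical.tendsto_integral_exp_centred (hp : IsCritical p σsq) (hb : TollBound p f a s)
    (ha : Tendsto a atTop (𝓝 0)) (t : ℝ) :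
    Tendsto (fun n : AdmissibleSize p =>
      ∫ T, Complex.exp ((t / √(n : ℝ) * centred p f T : ℝ) * Complex.I) ∂gwCond p n) atTop
      (𝓝 (Complex.exp (-(t ^ 2 * asympVar p σsq f / 2) : ℝ))) := by
  obtain ⟨A, hA0, hA⟩ := hp.exists_varianceBound
  obtain ⟨C, hC0, hC⟩ := hp.exists_sizeProb_le
  have hlim : Tendsto (fun K : ℕ => Complex.exp (-(t ^ 2 *
      (asympVar p σsq fun T => if T.size ≤ K then f T else 0) / 2) : ℝ)) atTop
      (𝓝 (Complex.exp (-(t ^ 2 * asympVar p σsq f / 2) : ℝ))) := by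
    have : Continuous fun x : ℝ => Complex.exp (-(t ^ 2 * x / 2) : ℝ) := by fun_prop
    exact (this.tendsto _).comp (hp.tendsto_asympVar_truncation hb ha)
  refine TendstoUniformly.tendsto_of_eventually_tendsto (p := atTop)
    (F := fun (K : ℕ) (n : AdmissibleSize p) => ∫ T, Complex.exp ((t / √(n : ℝ) *
      centred p (fun T => if T.size ≤ K then f T else 0) T : ℝ) * Complex.I) ∂gwCond p n)
    (Metric.tendstoUniformly_iff.2 fun ε hε => ?_) (Eventually.of_forall fun K => ?_) hlim
  · filter_upwards [hb.eventually_tail ha (ε := ε / (|t| * A + 1)) (by positivity)] with K hK n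
    rw [dist_eq_norm]
    refine (TollBound.norm_integral_exp_centred_sub_le (hb.restrict _) hK (fun T => ?_) hA hA0.le
      hC t n).trans_lt ?_
    · by_cases hT : T.size ≤ K <;> simp [hT]
    · rw [← mul_assoc, ← mul_div_assoc, div_lt_iff₀ (by positivity)]
      linarith
  · have hf : ∀ T, K < T.size → (if T.size ≤ K then f T else 0) = 0 := fun T hT =>
      if_neg (not_le.2 hT)
    obtain ⟨b, hbd⟩ := exists_abs_le_of_size_le hf
    have h1 := hp.tendsto_integral_exp_additive hf hbd rfl rfl t
    rw [sum_levelSum_add_sub_eq_asympVar hf rfl] at h1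
    refine h1.congr fun n => ?_
    rw [integral_gwCond_eq_sum, integral_gwCond_eq_sum, sum_levelSum_eq_integral hf]
    congr 1
    refine Finset.sum_congr rfl fun T hT => ?_
    rw [centred, mem_trees.1 hT]

end

section
variable {p : PMF ℕ} {σsq : ℝ} {f : PlaneTree → ℝ}

theorem cast_admissibleSize_pos (n : AdmissibleSize p) : (0 : ℝ) < (n : ℕ) := by
  refine Nat.cast_pos.2 (Nat.pos_of_ne_zero fun h0 => ?_)
  have := admissible_iff.1 n.2
  rw [h0] at this
  exact this.ne' levelSum_zero_right

/-- The hypotheses of the second part amount to a bound for the toll whose `L²` norms tend to zero.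
-/
theorem IsCritical.exists_tollBound (hp : IsCritical p σsq)
    (h0 : Tendsto (fun n : AdmissibleSize p => ∫ T, f T ^ 2 ∂gwCond p n) atTop (𝓝 0))
    (h1 : Summable fun n : AdmissibleSize p => √(∫ T, f T ^ 2 ∂gwCond p n) / (n : ℝ)) :
    ∃ a s, TollBound p f a s ∧ Tendsto a atTop (𝓝 0) := by
  set a : ℕ → ℝ := fun k => √(levelSum p (fun T => f T ^ 2) k / sizeProb p k) with ha
  -- At sizes of probability zero, dividing by zero gives `a k = 0`, so these sizes do not
  -- contribute to the sum.
  have hzero : ∀ k, sizeProb p k = 0 → a k = 0 := fun k hk => by simp [ha, hk]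
  have hlim : Tendsto a atTop (𝓝 0) := by
    refine hp.tendsto_nat_of_tendsto_admissibleSize hzero ?_
    have := (Real.continuous_sqrt.tendsto 0).comp h0
    rw [Real.sqrt_zero] at this
    refine this.congr fun n => ?_
    simp only [Function.comp_apply, integral_gwCond, ha]
  have hsum : Summable fun k => a k / k := by
    refine (Function.Injective.summable_iff (g := ((↑) : AdmissibleSize p → ℕ))
      Subtype.val_injective fun k hk => ?_).1 ?_
    · have : ¬ 0 < sizeProb p k := fun h => hk ⟨⟨k, admissible_iff.2 h⟩, rfl⟩
      rw [hzero k (le_antisymm (not_lt.1 this) sizeProb_nonneg), zero_div]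
    · refine h1.congr fun n => ?_
      simp only [Function.comp_apply, integral_gwCond, ha]
  obtain ⟨B, hB⟩ := hlim.bddAbove_range
  refine ⟨a, max B (∑' k, a k / k), ⟨fun k => Real.sqrt_nonneg _, fun k => ?_,
    fun k => (hB ⟨k, rfl⟩).trans (le_max_left _ _), hsum, le_max_right _ _⟩, hlim⟩
  rcases (sizeProb_nonneg (p := p) (n := k)).eq_or_lt' with h | h
  · rw [levelSum_eq_zero h, h, zero_mul]
  · rw [ha]
    simp only
    rw [Real.sq_sqrt (div_nonneg (levelSum_nonneg fun _ _ => sq_nonneg _) h.le),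
      mul_div_cancel₀ _ h.ne']

/-- The mean of the additive functional: a cancellation between the local limit theorem at nearby
sizes makes the error smaller than the fluctuations. -/
theorem IsCritical.isLittleO_integral_additive_sub (hp : IsCritical p σsq)
    (hf : Integrable f (gw p))
    (h : Tendsto (fun n : AdmissibleSize p => ∫ T, f T ∂gwCond p n) atTop (𝓝 0)) :
    (fun n : AdmissibleSize p => (∫ T, additive f T ∂gwCond p n) - (n : ℝ) * ∫ T, f T ∂gw p)
      =o[atTop] fun n : AdmissibleSize p => √(n : ℝ) := by
  have hnat : Tendsto (fun n : ℕ => levelSum p f n / sizeProb p n) atTop (𝓝 0) := by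
    refine hp.tendsto_nat_of_tendsto_admissibleSize (fun n hn => by simp [hn]) (h.congr fun n => ?_)
    rw [integral_gwCond]
  refine isLittleO_iff.2 fun η hη => ?_
  filter_upwards [hp.tendsto_coe_admissibleSize.eventually
    (hp.eventually_abs_levelSum_additive_le hf hnat hη)] with n hn
  rw [integral_gwCond, Real.norm_eq_abs, Real.norm_of_nonneg (Real.sqrt_nonneg _)]
  exact hn (admissible_iff.1 n.2)

theorem tendsto_integral_of_tendsto_integral_sq
    (h : Tendsto (fun n : AdmissibleSize p => ∫ T, f T ^ 2 ∂gwCond p n) atTop (𝓝 0)) :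
    Tendsto (fun n : AdmissibleSize p => ∫ T, f T ∂gwCond p n) atTop (𝓝 0) := by
  have h1 := (Real.continuous_sqrt.tendsto 0).comp h
  rw [Real.sqrt_zero] at h1
  refine squeeze_zero_norm (fun n => ?_) h1
  refine (norm_integral_le_integral_norm f).trans (integral_abs_le_sqrt ?_)
  exact (memLp_two_iff_integrable_sq (integrable_gwCond p _ n).1).2 (integrable_gwCond p _ n)

theorem integral_centred_eq (n : AdmissibleSize p) (φ : ℝ → ℂ) :
    ∫ T, φ (centred p f T) ∂gwCond p n =
      ∫ T, φ (additive f T - (n : ℝ) * ∫ t, f t ∂gw p) ∂gwCond p n := by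
  rw [integral_gwCond_eq_sum, integral_gwCond_eq_sum]
  congr 1
  refine Finset.sum_congr rfl fun T hT => ?_
  rw [centred, mem_trees.1 hT]

theorem IsCritical.nonempty_admissibleSize (hp : IsCritical p σsq) :
    Nonempty (AdmissibleSize p) := by
  obtain ⟨n, -, hn⟩ := hp.exists_sizeProb_pos 0
  exact ⟨⟨n, admissible_iff.2 hn⟩⟩

theorem IsCritical.asympVar_nonneg (hp : IsCritical p σsq) {a : ℕ → ℝ} {s : ℝ}
    (hb : TollBound p f a s) (ha : Tendsto a atTop (𝓝 0)) : 0 ≤ asympVar p σsq f := by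
  have := hp.nonempty_admissibleSize
  exact ge_of_tendsto (hp.tendsto_integral_centred_sq_div hb ha) (Eventually.of_forall fun n =>
    div_nonneg (integral_nonneg fun _ => sq_nonneg _) (Nat.cast_nonneg _))

/-- The second moment around `n μ` is the variance plus the squared bias, and the bias is `o(√n)` by
the statement on the mean. -/
theorem IsCritical.isLittleO_variance_additive_sub (hp : IsCritical p σsq) {a : ℕ → ℝ} {s : ℝ}
    (hf : Integrable f (gw p))
    (h : Tendsto (fun n : AdmissibleSize p => ∫ T, f T ∂gwCond p n) atTop (𝓝 0))
    (hb : TollBound p f a s) (ha : Tendsto a atTop (𝓝 0)) :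
    (fun n : AdmissibleSize p => Var[additive f; gwCond p n] - (n : ℝ) * asympVar p σsq f)
      =o[atTop] fun n : AdmissibleSize p => (n : ℝ) := by
  have hpos := cast_admissibleSize_pos (p := p)
  refine (isLittleO_iff_tendsto fun n hn => absurd hn (hpos n).ne').2 ?_
  have h1 := hp.tendsto_integral_centred_sq_div hb ha
  have h2 := ((isLittleO_iff_tendsto fun n hn => absurd hn (Real.sqrt_pos.2 (hpos n)).ne').1
    (hp.isLittleO_integral_additive_sub hf h)).pow 2
  have h3 := (h1.sub h2).sub_const (asympVar p σsq f)
  rw [zero_pow two_ne_zero, sub_zero, sub_self] at h3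
  refine h3.congr fun n => ?_
  have hn := (hpos n).ne'
  have hm : MemLp (additive f) 2 (gwCond p n) :=
    (memLp_two_iff_integrable_sq (integrable_gwCond p _ n).1).2 (integrable_gwCond p _ n)
  have h4 : ∫ T, centred p f T ^ 2 ∂gwCond p n = (∫ T, additive f T ^ 2 ∂gwCond p n) -
      2 * ((n : ℝ) * ∫ t, f t ∂gw p) * (∫ T, additive f T ∂gwCond p n) +
      ((n : ℝ) * ∫ t, f t ∂gw p) ^ 2 := by
    rw [integral_gwCond, levelSum_centred p f fun x _ => x ^ 2, ← integral_gwCond]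
    have h5 : ∀ T, (additive f T - (n : ℝ) * ∫ t, f t ∂gw p) ^ 2 =
        additive f T ^ 2 - 2 * ((n : ℝ) * ∫ t, f t ∂gw p) * additive f T +
          ((n : ℝ) * ∫ t, f t ∂gw p) ^ 2 := fun T => by ring
    simp only [h5]
    rw [integral_add (integrable_gwCond p _ n) (integrable_const _),
      integral_sub (integrable_gwCond p _ n) (integrable_gwCond p _ n), integral_const_mul]
    simp
  rw [variance_eq_sub hm, h4, div_pow, Real.sq_sqrt (hpos n).le]
  simp only [Pi.pow_apply]
  field_simp
  ring

/-- Convergence in distribution by Lévy's continuity theorem. The theorem being available for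
sequences, it is applied along sequences of admissible sizes tending to infinity. -/
theorem IsCritical.tendstoInDistribution_additive (hp : IsCritical p σsq) {a : ℕ → ℝ} {s : ℝ}
    (hb : TollBound p f a s) (ha : Tendsto a atTop (𝓝 0)) :
    TendstoInDistribution
      (fun (n : AdmissibleSize p) T => (additive f T - (n : ℝ) * ∫ t, f t ∂gw p) / √(n : ℝ)) atTop
      (id : ℝ → ℝ) (fun n : AdmissibleSize p => gwCond p n)
      (gaussianReal 0 (asympVar p σsq f).toNNReal) := by
  refine ⟨fun n => measurable_of_countable _ |>.aemeasurable, aemeasurable_id, ?_⟩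
  refine tendsto_of_seq_tendsto fun x hx => ?_
  refine ProbabilityMeasure.tendsto_iff_tendsto_charFun.2 fun t => ?_
  have h1 := (hp.tendsto_integral_exp_centred hb ha t).comp hx
  simp only [ProbabilityMeasure.coe_mk, Measure.map_id]
  rw [charFun_gaussianReal, Real.coe_toNNReal _ (hp.asympVar_nonneg hb ha)]
  have h2 : Complex.exp (-(t ^ 2 * asympVar p σsq f / 2) : ℝ) =
      Complex.exp (t * (0 : ℝ) * Complex.I - (asympVar p σsq f : ℂ) * t ^ 2 / 2) := by
    congr 1
    push_cast
    ring
  rw [← h2]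
  refine h1.congr fun k => ?_
  change _ = charFun ((gwCond p (x k)).map fun T =>
    (additive f T - ((x k : ℕ) : ℝ) * ∫ t, f t ∂gw p) / √((x k : ℕ) : ℝ)) t
  simp only [Function.comp_apply]
  rw [charFun_apply_real, integral_map (measurable_of_countable _).aemeasurable
    (by fun_prop), integral_centred_eq (x k) fun y => Complex.exp ((t / √(x k : ℝ) * y : ℝ) *
      Complex.I)]
  refine integral_congr_ae (ae_of_all _ fun T => ?_)
  simp only
  congr 2
  push_cast
  ring

end

end PlaneTree

open PlaneTree in
theorem theorem1p2 (p : PMF ℕ) (σsq : ℝ) (f : PlaneTree → ℝ) (μ : ℝ)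
    -- the offspring variable has mean 1 and finite variance `σsq > 0`
    (hξ : MemLp (fun k : ℕ => (k : ℝ)) 2 p.toMeasure)
    (hmean : ∫ k : ℕ, (k : ℝ) ∂p.toMeasure = 1)
    (hσ : σsq = Var[fun k : ℕ => (k : ℝ); p.toMeasure]) (hσ_pos : 0 < σsq)
    -- `𝔼 |f(𝒯)| < ∞` and `μ = 𝔼 f(𝒯)`
    (hf : Integrable f (gw p)) (hμ : μ = ∫ T, f T ∂gw p) :
    -- (i)
    (Tendsto (fun n : AdmissibleSize p => ∫ T, f T ∂gwCond p n) atTop (𝓝 0) →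
      (fun n : AdmissibleSize p => (∫ T, additive f T ∂gwCond p n) - (n : ℝ) * μ)
        =o[atTop] fun n : AdmissibleSize p => √(n : ℝ)) ∧
    -- (ii)
    (Tendsto (fun n : AdmissibleSize p => ∫ T, f T ^ 2 ∂gwCond p n) atTop (𝓝 0) →
      Summable (fun n : AdmissibleSize p => √(∫ T, f T ^ 2 ∂gwCond p n) / (n : ℝ)) →
      -- the expectations in the formula for `γ²` converge absolutely
      MemLp f 2 (gw p) ∧
      Integrable (fun T => f T * (additive f T - (T.size : ℝ) * μ)) (gw p) ∧
      ∃ γsq : ℝ,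
        γsq = 2 * (∫ T, f T * (additive f T - (T.size : ℝ) * μ) ∂gw p)
          - Var[f; gw p] - μ ^ 2 / σsq ∧
        0 ≤ γsq ∧
        ((fun n : AdmissibleSize p => Var[additive f; gwCond p n] - (n : ℝ) * γsq)
          =o[atTop] fun n : AdmissibleSize p => (n : ℝ)) ∧
        TendstoInDistribution
          (fun (n : AdmissibleSize p) T => (additive f T - (n : ℝ) * μ) / √(n : ℝ)) atTop
          (id : ℝ → ℝ) (fun n : AdmissibleSize p => gwCond p n) (gaussianReal 0 γsq.toNNReal)) := by
  have hp : IsCritical p σsq := ⟨hξ, hmean, hσ, hσ_pos⟩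
  have : IsProbabilityMeasure (gw p) := isProbabilityMeasure_gw p hmean (hσ ▸ hσ_pos)
  subst hμ
  refine ⟨hp.isLittleO_integral_additive_sub hf, fun h0 h1 => ?_⟩
  obtain ⟨a, s, hb, ha⟩ := hp.exists_tollBound h0 h1
  obtain ⟨A, hA0, hA⟩ := hp.exists_varianceBound
  obtain ⟨C, hC0, hC⟩ := hp.exists_sizeProb_le
  have hf2 : MemLp f 2 (gw p) := hb.memLp_two hC
  have hint := hb.integrable_mul_centred hA hA0.le hC
  refine ⟨hf2, hint, asympVar p σsq f, ?_, hp.asympVar_nonneg hb ha,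
    hp.isLittleO_variance_additive_sub hf (tendsto_integral_of_tendsto_integral_sq h0) hb ha,
    hp.tendstoInDistribution_additive hb ha⟩
  have h2 : ∫ T, f T * (2 * centred p f T - f T) ∂gw p =
      2 * (∫ T, f T * centred p f T ∂gw p) - ∫ T, f T ^ 2 ∂gw p := by
    rw [← integral_const_mul, ← integral_sub (hint.const_mul 2) hf2.integrable_sq]
    exact integral_congr_ae (ae_of_all _ fun T => by ring)
  rw [asympVar, h2, variance_eq_sub hf2]
  simp only [Pi.pow_apply, centred]
  ring
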